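/- **Setting.** For an operator $A=\sum_{\gamma}c_\gamma P_\gamma$ in the Pauli basis on $n$ qubits let $\|A\|_1=\sum_\gamma|c_\gamma|$; $A$ is $q$-sparse if at most $q$ of the $c_\gamma$ are nonzero, and $w$-local if every $P_\gamma$ with $c_\gamma\ne0$ acts nontrivially on at most $w$ qubits. Let $H$ be Hermitian and $D_1,\dots,D_m$ ($m\ge1$) be operators on $n$ qubits, all $q$-sparse and $w$-local. Put $\mathcal H(\rho)=-i[H,\rho]$, $\mathcal D_l(\rho)=D_l\rho D_l^\dagger-\frac12D_l^\dagger D_l\rho-\frac12\rho D_l^\dagger D_l$, $\mathcal L=\mathcal H+\sum_l\mathcal D_l$, and $\|\mathcal L\|_{\sf pauli}=2\big(\|H\|_1+\sum_l\|D_l\|_1^2\big)$. **LCS formulas.** An LCS formula is a finite sum $\sum_i c_i\mathcal V_i$ with $c_i\ge0$; its 1-norm is $\mu=\sum_ic_i$. Sampling it means applying $\mathcal V_i$ with probability $c_i/\mu$. A unitary-conjugate operation $\mathcal V(\rho)=\frac12(e^{i\phi}U\rho W^\dagger+e^{-i\phi}W\rho U^\dagger)$ is applied effectively with one control ancilla: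 reset it to $|+\rangle$, apply $U$ controlled on $1$ and $W$ controlled on $0$, apply $\mathrm{diag}(e^{-i\phi/2},e^{i\phi/2})$, measure $X$, and multiply the final measured value by the outcome $\pm1$. The formula $\sum_j z_jA_j(\cdot)B_j^\dagger$ with unitary $A_j,B_j$ is sampled with weights $|z_j|$ and phases $\phi=\arg z_j$. **One time step of length $\tau$, truncation order $K$.** The following are executed in this order. 1. $\tilde{\mathcal F}(\tau)$: the first-order Trotter product $S(\tau)$ of $e^{-iH\tau}$ (one Pauli rotation for each Pauli term), then the compensation with truncation order $K$ of $V(\tau)=e^{-iH\tau}S(\tau)^\dagger$. In general, for a Hermitian $G$ write $V(x)=e^{-iGx}S(x)^\dagger=\sum_kx^kF_k$. Here $F_0=1$, $F_1=0$, and $F_2,F_3$ are anti-Hermitian. The terms of order $2,3$ (and at most the truncation order) are $\sum_\gamma i\eta_\gamma P_\gamma$ with real $\eta_\gamma$, and, with $\eta=\sum_\gamma|\eta_\gamma|$, $1+\sum_\gamma i\eta_\gamma P_\gamma=\sqrt{1+\eta^2}\sum_\gamma\frac{|\eta_\gamma|}{\eta}e^{i\,\mathrm{sgn}(\eta_\gamma)\arctan(\eta)P_\gamma}$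 (just $1$ if $\eta=0$). The terms of order $4$ up to the truncation order are expanded into Pauli operators with phases. This gives $V(x)\approx\sum_ic_iU_i$ with $c_i\ge0$ and $U_i$ unitary; the compensation is the LCS formula $\sum_{i,j}c_ic_j\,\frac12(U_i(\cdot)U_j^\dagger+U_j(\cdot)U_i^\dagger)$. 2. For $l=1,\dots,m$: * $\tilde{\mathcal J}_l(\tau)$: reset a second ancilla to $|0\rangle$, apply the first-order Trotter product for $J_l=|1\rangle\langle0|\otimes D_l+|0\rangle\langle1|\otimes D_l^\dagger$ with time $\sqrt\tau$ and its compensation as in 1 with $G=J_l$, $x=\sqrt\tau$ and truncation order $2K$, and discard that ancilla. * $\tilde{\mathcal N}_l(\tau)=\sum_{k\in\{0,2,3,\dots,K\}}\tau^k\mathcal N_{l,k}$. Here $\mathcal N_l(\tau)=\sum_k\tau^k\mathcal N_{l,k}$ is defined by $\mathcal N_l(\tau)\circ\mathcal J_l(\tau)=e^{\mathcal D_l\tau}$ with $\mathcal J_l(\tau)=\mathrm{Tr}_a[e^{-iJ_l\sqrt\tau}(|0\rangle\langle0|_a\otimes\cdot)e^{iJ_l\sqrt\tau}]$, all expanded as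 series of words in $D_l(\cdot)D_l^\dagger$, $D_l^\dagger D_l(\cdot)$, $(\cdot)D_l^\dagger D_l$. Each letter is then expanded as $\sum\chi_{\alpha\beta}P_\alpha(\cdot)P_\beta^\dagger$ and the words are sampled as unitary-conjugate operations. 3. $\tilde{\mathcal M}(\tau)=\sum_{k\in\{0,2,3,\dots,K\}}\tau^k\mathcal M_k$ with $\sum_k\tau^k\mathcal M_k=e^{\mathcal L\tau}e^{-\mathcal H\tau}e^{-\mathcal D_1\tau}\cdots e^{-\mathcal D_m\tau}$, where every exponential is expanded into words in $\mathcal H,\mathcal D_1,\dots,\mathcal D_m$ and each letter into $\sum\chi_{\alpha\beta}P_\alpha(\cdot)P_\beta^\dagger$; the words are sampled in the same way. **Algorithm.** A round starts from $\rho_0$, executes $T/\tau$ steps (assumed to be an integer), drawing all samples independently, measures the observable $O$ on the system, and returns the measured eigenvalue times the product of all recorded signs times the 1-norm $\mu$ of the concatenated formula (the product of the 1-norms of all formulas used, over all steps). The estimate $\widetilde{\langle O\rangle}$ is the average over $N$ independent rounds. Elementary operations are single-qubit gates, CNOT gates, and single-qubit resets and measurements on the ancillas (the final measurement of $O$ is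 not counted). **Theorem.** There are universal constants $c_2,A>0$ such that for every $0<c_1\le c_2$ there is a constant $B_1=B_1(c_1)>0$, and for all $B_2$ and $w$ a constant $C=C(c_1,B_2,w)$, with the following property. Let $n$, $q$, $m\ge1$, $H$, $(D_l)$ be as above, $\rho_0$ a density operator, $O$ a Hermitian observable with spectral norm $\|O\|$, $T>0$ with $\|\mathcal L\|_{\sf pauli}T>1$, $0<\varepsilon<1$, $0<\delta<1$, and let $$\frac{c_1}{\|\mathcal L\|_{\sf pauli}^2T}\le\tau\le\frac{c_2}{\|\mathcal L\|_{\sf pauli}^2T},\quad \frac T\tau\in\mathbb N,\qquad K\ge B_1\Big(1+\frac{\ln(1/\varepsilon)}{\ln(\|\mathcal L\|_{\sf pauli}T)}\Big),\qquad N\ge A\,\frac{\ln(2/\delta)}{\varepsilon^2},$$ with $K,N$ integers. Then with probability at least $1-\delta$ the estimate satisfies $$\big|\widetilde{\langle O\rangle}-\mathrm{Tr}\big(e^{\mathcal LT}(\rho_0)\,O\big)\big|\le\varepsilon\|O\| .$$ Every round runs on the $n$ system qubits and two ancilla qubits. If moreover $K\le B_2\big(1+\frac{\ln(1/\varepsilon)}{\ln(\|\mathcal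 L\|_{\sf pauli}T)}\big)$, then every circuit that a round can sample is realised on these $n+2$ qubits with at most $$C\,m\,\|\mathcal L\|_{\sf pauli}^2T^2\Big(q+\frac{\ln(1/\varepsilon)}{\ln(\|\mathcal L\|_{\sf pauli}T)}\Big)$$ elementary operations. -/

import Mathlib

open scoped Nat Matrix

noncomputable section

namespace LindbladSim

/-! ### Operators and Pauli strings on a finite set of qubits -/

/-- Operators on the qubits labelled by `Q`, as matrices in the computational basis. -/
abbrev Op (Q : Type) := Matrix (Q → Fin 2) (Q → Fin 2) ℂ

/-- Superoperators on `n` qubits. -/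
abbrev SuperOp (n : ℕ) := Module.End ℂ (Op (Fin n))

/-- A Pauli string: one of `I, X, Y, Z` (numbered `0, 1, 2, 3`) for each qubit. -/
abbrev PauliString (Q : Type) := Q → Fin 4

/-- The single-qubit Pauli matrices `I, X, Y, Z`. -/
def pauliMat : Fin 4 → Matrix (Fin 2) (Fin 2) ℂ :=
  ![1, !![0, 1; 1, 0], !![0, -Complex.I; Complex.I, 0], !![1, 0; 0, -1]]

/-- The number of qubits on which a Pauli string acts nontrivially. -/
def weight {Q : Type} [Fintype Q] (γ : PauliString Q) : ℕ :=
  (Finset.univ.filter fun i => γ i ≠ 0).card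

/-- The tensor product of Pauli matrices given by a Pauli string. -/
def pauliOp {Q : Type} [Fintype Q] (γ : PauliString Q) : Op Q :=
  Matrix.of fun x y => ∏ i, pauliMat (γ i) (x i) (y i)

/-- The coefficient `c_γ` in the Pauli decomposition `A = ∑ γ, c_γ P_γ`. -/
def pauliCoeff {Q : Type} [Fintype Q] [DecidableEq Q] (A : Op Q) (γ : PauliString Q) : ℂ :=
  ((2 : ℂ) ^ Fintype.card Q)⁻¹ * (pauliOp γ * A).trace

open Classical in
/-- The Pauli strings occurring in `A`. -/
def pauliSupport {Q : Type} [Fintype Q] [DecidableEq Q] (A : Op Q) : Finset (PauliString Q) :=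
  Finset.univ.filter fun γ => pauliCoeff A γ ≠ 0

/-- The Pauli `1`-norm `‖A‖₁ = ∑ γ, |c_γ|`. -/
def pauliNorm {Q : Type} [Fintype Q] [DecidableEq Q] (A : Op Q) : ℝ :=
  ∑ γ, ‖pauliCoeff A γ‖

/-- `A` is `q`-sparse: at most `q` nonzero Pauli coefficients. -/
def IsSparse {Q : Type} [Fintype Q] [DecidableEq Q] (q : ℕ) (A : Op Q) : Prop :=
  (pauliSupport A).card ≤ q

/-- `A` is `w`-local: every Pauli string occurring in `A` acts on at most `w` qubits. -/
def IsLocal {Q : Type} [Fintype Q] [DecidableEq Q] (w : ℕ) (A : Op Q) : Prop :=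
  ∀ γ ∈ pauliSupport A, weight γ ≤ w

/-- The rotation `exp(-i θ P_γ) = cos θ - i sin θ P_γ`. -/
def pauliRot {Q : Type} [Fintype Q] [DecidableEq Q] (θ : ℝ) (γ : PauliString Q) : Op Q :=
  (Real.cos θ : ℂ) • 1 - (Complex.I * (Real.sin θ : ℂ)) • pauliOp γ

/-- The single-qubit operator `M` acting on qubit `i`. -/
def onQubit {Q : Type} [Fintype Q] [DecidableEq Q] (i : Q) (M : Matrix (Fin 2) (Fin 2) ℂ) : Op Q :=
  Matrix.of fun x y => if ∀ j, j ≠ i → x j = y j then M (x i) (y i) else 0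

/-- The matrix unit `|u⟩⟨v|` of a single qubit. -/
def ketBra (u v : Fin 2) : Matrix (Fin 2) (Fin 2) ℂ := Matrix.single u v 1

/-- `U` applied if the control qubit `c` is in the state `v`, for `U` acting trivially on `c`. -/
def controlled {Q : Type} [Fintype Q] [DecidableEq Q] (c : Q) (v : Fin 2) (U : Op Q) : Op Q :=
  onQubit c (ketBra v v) * U + (1 - onQubit c (ketBra v v))

/-! ### Lindbladians -/

/-- `ρ ↦ -i[H, ρ]`. -/
def hamPart {n : ℕ} (H : Op (Fin n)) : SuperOp n :=
  (-Complex.I) • (LinearMap.mulLeft ℂ H - LinearMap.mulRight ℂ H)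

/-- The three parts `ρ ↦ D ρ D†`, `ρ ↦ D†D ρ`, `ρ ↦ ρ D†D` of a dissipator. -/
def jumpPart {n : ℕ} (D : Op (Fin n)) : Fin 3 → SuperOp n :=
  ![LinearMap.mulLeft ℂ D * LinearMap.mulRight ℂ Dᴴ,
    LinearMap.mulLeft ℂ (Dᴴ * D),
    LinearMap.mulRight ℂ (Dᴴ * D)]

/-- `ρ ↦ D ρ D† - (1/2) D†D ρ - (1/2) ρ D†D`. -/
def dissPart {n : ℕ} (D : Op (Fin n)) : SuperOp n :=
  jumpPart D 0 - (1 / 2 : ℂ) • jumpPart D 1 - (1 / 2 : ℂ) • jumpPart D 2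

/-- The Lindbladian with Hamiltonian `H` and jump operators `D l`. -/
def lindbladian {n m : ℕ} (H : Op (Fin n)) (D : Fin m → Op (Fin n)) : SuperOp n :=
  hamPart H + ∑ l, dissPart (D l)

/-- The Lindbladian norm `2 (‖H‖₁ + ∑ l, ‖D l‖₁²)`. -/
def lindbladNorm {n m : ℕ} (H : Op (Fin n)) (D : Fin m → Op (Fin n)) : ℝ :=
  2 * (pauliNorm H + ∑ l, pauliNorm (D l) ^ 2)

/-- `e^{𝓛 T} ρ`, by the exponential series. -/
def evolve {n : ℕ} (L : SuperOp n) (T : ℝ) (ρ : Op (Fin n)) : Op (Fin n) :=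
  ∑' k : ℕ, ((T : ℂ) ^ k / (k ! : ℂ)) • (L ^ k) ρ

/-- The spectral norm `‖O‖`. -/
def opNorm {n : ℕ} (O : Op (Fin n)) : ℝ := ‖Matrix.toEuclideanCLM (𝕜 := ℂ) O‖

open scoped ComplexOrder in
/-- Density operators. -/
def IsState {n : ℕ} (ρ : Op (Fin n)) : Prop := ρ.PosSemidef ∧ ρ.trace = 1

/-! ### Quantum circuits -/

/-- Elementary gates: arbitrary single-qubit gates and `CNOT`. -/
inductive Gate (Q : Type) : Type
  | single (i : Q) (U : Matrix.unitaryGroup (Fin 2) ℂ) : Gate Q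
  | cnot (c t : Q) (h : c ≠ t) : Gate Q

/-- The unitary of an elementary gate. -/
def Gate.toOp {Q : Type} [Fintype Q] [DecidableEq Q] : Gate Q → Op Q
  | .single i U => onQubit i U
  | .cnot c t _ => controlled c 1 (onQubit t (pauliMat 1))

/-- The least number of elementary gates, on the qubits in `Q` only, whose product is `U`
(and `⊤` if there is no such product). -/
def gateCount {Q : Type} [Fintype Q] [DecidableEq Q] (U : Op Q) : ℕ∞ :=
  ⨅ gs ∈ {gs : List (Gate Q) | (gs.map Gate.toOp).prod = U}, (gs.length : ℕ∞)

/-- Instructions of a circuit: apply a unitary; discard a qubit and prepare it in `|0⟩`;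
measure a qubit in the `X` basis and multiply the recorded sign by the outcome `±1`. -/
inductive Instr (Q : Type) : Type
  | unitary (U : Op Q) : Instr Q
  | reset (i : Q) : Instr Q
  | measureX (i : Q) : Instr Q

/-- A circuit: a list of instructions, the first one executed first. -/
abbrev Circuit (Q : Type) := List (Instr Q)

/-- The cost of an instruction in elementary operations. -/
def Instr.cost {Q : Type} [Fintype Q] [DecidableEq Q] : Instr Q → ℕ∞
  | .unitary U => gateCount U
  | .reset _ => 1
  | .measureX _ => 1

/-- The number of elementary operations of a circuit. -/
def circuitCost {Q : Type} [Fintype Q] [DecidableEq Q] (c : Circuit Q) : ℕ∞ :=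
  (c.map Instr.cost).sum

/-- The projector onto the eigenvector of `X` with eigenvalue `s`. -/
def projX (s : ℤˣ) : Matrix (Fin 2) (Fin 2) ℂ :=
  (1 / 2 : ℂ) • (1 + ((s : ℤ) : ℂ) • pauliMat 1)

/-- Joint states of the recorded sign and the qubits: for each value of the sign, an operator
whose trace is the probability of that value, and which, normalised, is the state given it. -/
abbrev SignedState (Q : Type) := ℤˣ → Op Q

/-- The effect of one instruction on a joint state of sign and qubits. -/
def Instr.apply {Q : Type} [Fintype Q] [DecidableEq Q] (σ : SignedState Q) :
    Instr Q → SignedState Q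
  | .unitary U => fun s => U * σ s * Uᴴ
  | .reset i => fun s =>
      ∑ b : Fin 2, onQubit i (ketBra 0 b) * σ s * (onQubit i (ketBra 0 b))ᴴ
  | .measureX i => fun s =>
      ∑ r : ℤˣ, onQubit i (projX r) * σ (r * s) * onQubit i (projX r)

/-- The effect of a circuit. -/
def run {Q : Type} [Fintype Q] [DecidableEq Q] (c : Circuit Q) (σ : SignedState Q) :
    SignedState Q :=
  c.foldl Instr.apply σ

/-! ### The register: `n` system qubits and `a` ancilla qubits -/

/-- `n` system qubits and `a` ancilla qubits. -/
abbrev Register (n a : ℕ) := Fin n ⊕ Fin a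

/-- The ancilla used for the dilation of the jump operators. -/
def dilAnc (n : ℕ) : Register n 2 := Sum.inr 0

/-- The ancilla used as control qubit for the unitary-conjugate operations. -/
def ctlAnc (n : ℕ) : Register n 2 := Sum.inr 1

/-- `A ⊗ 1`, for `A` acting on the system. -/
def onSystem {n a : ℕ} (A : Op (Fin n)) : Op (Register n a) :=
  Matrix.of fun x y =>
    if x ∘ Sum.inr = y ∘ Sum.inr then A (x ∘ Sum.inl) (y ∘ Sum.inl) else 0

/-- The state `ρ` of the system, all ancillas in `|0⟩`, and the sign `+1`. -/
def initState {n a : ℕ} (ρ : Op (Fin n)) : SignedState (Register n a) := fun s =>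
  if s = 1 then
    Matrix.of fun x y =>
      if x ∘ Sum.inr = 0 ∧ y ∘ Sum.inr = 0 then ρ (x ∘ Sum.inl) (y ∘ Sum.inl) else 0
  else 0

/-- The dilation `J = |1⟩⟨0| ⊗ D + |0⟩⟨1| ⊗ D†` of a jump operator. -/
def dilation {n : ℕ} (D : Op (Fin n)) : Op (Register n 2) :=
  onQubit (dilAnc n) (ketBra 1 0) * onSystem D + onQubit (dilAnc n) (ketBra 0 1) * onSystem Dᴴ

/-! ### Linear combinations of superoperators (LCS) -/

/-- An LCS formula: weights `c i ≥ 0`, each with a circuit that effectively implements the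
superoperator `𝓥 i`. Sampling from the formula means choosing `i` with probability `c i / μ`. -/
abbrev LCS (Q : Type) := List (ℝ × Circuit Q)

/-- The `1`-norm `μ = ∑ i, c i`. -/
def LCS.mu {Q : Type} (F : LCS Q) : ℝ := (F.map Prod.fst).sum

/-- Concatenation: independent sampling from `F` and from `G`, executing the circuit from `F`
first. -/
def LCS.andThen {Q : Type} (F G : LCS Q) : LCS Q :=
  F.flatMap fun f => G.map fun g => (f.1 * g.1, f.2 ++ g.2)

/-- Concatenation of a list of formulas, the first one executed first. -/
def LCS.concat {Q : Type} (Fs : List (LCS Q)) : LCS Q := Fs.foldr LCS.andThen [(1, [])]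

/-- The phase gate `diag(e^{-iθ/2}, e^{iθ/2})`. -/
def phaseGate (θ : ℝ) : Matrix (Fin 2) (Fin 2) ℂ :=
  Matrix.diagonal
    ![Complex.exp (-(Complex.I * (θ / 2 : ℝ))), Complex.exp (Complex.I * (θ / 2 : ℝ))]

/-- The Hadamard gate. -/
def hadamard : Matrix (Fin 2) (Fin 2) ℂ :=
  ((Real.sqrt 2)⁻¹ : ℂ) • !![1, 1; 1, -1]

/-- The circuit effectively implementing the unitary-conjugate operation
`ρ ↦ (1/2) (e^{iθ} U ρ W† + e^{-iθ} W ρ U†)`: prepare the control ancilla in `|+⟩`, apply `U`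
controlled on `1` and `W` controlled on `0`, then the phase, and measure the ancilla in the
`X` basis. -/
def conjCircuit {n : ℕ} (θ : ℝ) (U W : Op (Register n 2)) : Circuit (Register n 2) :=
  [.reset (ctlAnc n),
   .unitary (onQubit (ctlAnc n) hadamard),
   .unitary (controlled (ctlAnc n) 1 U),
   .unitary (controlled (ctlAnc n) 0 W),
   .unitary (onQubit (ctlAnc n) (phaseGate θ)),
   .measureX (ctlAnc n)]

/-! ### Pauli-conjugate formulas -/

/-- The entry `χ_{αβ}` of the Pauli process matrix, `𝓔 ρ = ∑ α β, χ_{αβ} P_α ρ P_β†`. -/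
def processMatrix {n : ℕ} (E : SuperOp n) (α β : PauliString (Fin n)) : ℂ :=
  ((4 : ℂ) ^ n)⁻¹ * ∑ x : Fin n → Fin 2, ∑ y : Fin n → Fin 2,
    ((pauliOp α * Matrix.single x y 1 * (pauliOp β)ᴴ)ᴴ * E (Matrix.single x y 1)).trace

/-- A formal sum of terms `(c, A, B)`, standing for `ρ ↦ ∑ c A ρ B†`; like terms are not
collected. -/
abbrev FormalSum (n : ℕ) := List (ℂ × Op (Fin n) × Op (Fin n))

/-- The identity, as a formal sum. -/
def FormalSum.one {n : ℕ} : FormalSum n := [(1, 1, 1)]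

/-- Multiplication of all coefficients by `z`. -/
def FormalSum.scale {n : ℕ} (z : ℂ) (F : FormalSum n) : FormalSum n :=
  F.map fun t => (z * t.1, t.2)

/-- The composition `F ∘ G`, expanded into words. -/
def FormalSum.comp {n : ℕ} (F G : FormalSum n) : FormalSum n :=
  F.flatMap fun f => G.map fun g => (f.1 * g.1, f.2.1 * g.2.1, f.2.2 * g.2.2)

/-- `F₁ ∘ F₂ ∘ ⋯`. -/
def FormalSum.compList {n : ℕ} (Fs : List (FormalSum n)) : FormalSum n :=
  Fs.foldr FormalSum.comp FormalSum.one

open Classical in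
/-- The Pauli decomposition of a superoperator through its process matrix. -/
def pauliSum {n : ℕ} (E : SuperOp n) : FormalSum n :=
  ((Finset.univ : Finset (PauliString (Fin n) × PauliString (Fin n))).filter
    fun p => processMatrix E p.1 p.2 ≠ 0).toList.map
      fun p => (processMatrix E p.1 p.2, pauliOp p.1, pauliOp p.2)

/-- Formal power series in the time `τ` with formal sums as coefficients. -/
abbrev FormalSeries (n : ℕ) := ℕ → FormalSum n

/-- The Cauchy product, for composition. -/
def FormalSeries.mul {n : ℕ} (f g : FormalSeries n) : FormalSeries n := fun k =>
  (List.range (k + 1)).flatMap fun i => (f i).comp (g (k - i))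

/-- The constant series `1`. -/
def FormalSeries.one {n : ℕ} : FormalSeries n := fun k => if k = 0 then FormalSum.one else []

/-- The series of `exp(z τ F)`. -/
def FormalSeries.exp {n : ℕ} (z : ℂ) (F : FormalSum n) : FormalSeries n := fun k =>
  (FormalSum.compList (List.replicate k F)).scale (z ^ k / (k ! : ℂ))

/-- The LCS formula of a series with vanishing first-order part, truncated at order `K`: the
terms of the orders `0, 2, 3, …, K`, the term `(c, A, B)` of order `k` having the weight
`|c| τ^k` and the unitary-conjugate operation of `A`, `B` and phase `arg c`. -/
def FormalSeries.toLCS {n : ℕ} (f : FormalSeries n) (τ : ℝ) (K : ℕ) : LCS (Register n 2) :=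
  (0 :: (List.range (K + 1)).filter fun k => 2 ≤ k).flatMap fun k =>
    (f k).map fun t =>
      (τ ^ k * ‖t.1‖, conjCircuit t.1.arg (onSystem t.2.1) (onSystem t.2.2))

/-! ### Compensation of the Lie-Trotter error -/

/-- The series `∑ k, 𝓜_k τ^k` of `e^{𝓛τ} e^{-𝓗τ} e^{-𝓓₁τ} ⋯ e^{-𝓓_mτ}`, the exponents being
expanded into Paulis. -/
def seriesM {n m : ℕ} (H : Op (Fin n)) (D : Fin m → Op (Fin n)) : FormalSeries n :=
  let h := pauliSum (hamPart H)
  let d := fun l => pauliSum (dissPart (D l))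
  (FormalSeries.exp 1 (h ++ (List.finRange m).flatMap d)).mul
    ((FormalSeries.exp (-1) h).mul
      (((List.finRange m).map fun l => FormalSeries.exp (-1) (d l)).foldr
        FormalSeries.mul FormalSeries.one))

/-- The truncated compensation `𝓜̃(τ)`. -/
def lcsM {n m : ℕ} (H : Op (Fin n)) (D : Fin m → Op (Fin n)) (τ : ℝ) (K : ℕ) :
    LCS (Register n 2) :=
  (seriesM H D).toLCS τ K

/-! ### Compensation of the dissipative steps

The superoperators `jumpPart D 0`, `jumpPart D 1`, `jumpPart D 2` are the letters of words; a word
stands for the composition of its letters, and the order in `τ` is the length of the word. -/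

/-- The coefficient of a word in `e^{𝓓τ}`. -/
def expWord (w : List (Fin 3)) : ℝ :=
  (w.length ! : ℝ)⁻¹ * (w.map fun j => if j = 0 then (1 : ℝ) else -1 / 2).prod

/-- The coefficient of a word in `𝓙(τ) = Tr_a [e^{-iJ√τ} (|0⟩⟨0| ⊗ ·) e^{iJ√τ}]`. -/
def dilWord (w : List (Fin 3)) : ℝ :=
  (∑ j ∈ Finset.range (w.length + 1),
    if w = List.replicate j 1 ++ List.replicate (w.length - j) 2 then
      (-1 : ℝ) ^ w.length / ((2 * j) ! * (2 * (w.length - j)) ! : ℝ) else 0) +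
  ∑ j ∈ Finset.range w.length,
    if w = 0 :: (List.replicate j 1 ++ List.replicate (w.length - 1 - j) 2) then
      (-1 : ℝ) ^ (w.length - 1) / ((2 * j + 1) ! * (2 * (w.length - 1 - j) + 1) ! : ℝ) else 0

/-- The coefficient of a word in the compensation `𝓝(τ)`, determined recursively by
`𝓝(τ) ∘ 𝓙(τ) = e^{𝓓τ}`. -/
def compWord (w : List (Fin 3)) : ℝ :=
  if w = [] then 1 else
    expWord w
      - (∑ i : Fin (w.length - 1), compWord (w.take (i + 1)) * dilWord (w.drop (i + 1)))
      - dilWord w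
termination_by w.length
decreasing_by
  have := i.isLt
  simp only [List.length_take]
  omega

/-- The series `∑ k, 𝓝_k τ^k`. -/
def seriesN {n : ℕ} (D : Op (Fin n)) : FormalSeries n := fun k =>
  (Finset.univ : Finset (Fin k → Fin 3)).toList.flatMap fun j =>
    (FormalSum.compList ((List.ofFn j).map fun i => pauliSum (jumpPart D i))).scale
      (compWord (List.ofFn j) : ℂ)

/-- The truncated compensation `𝓝̃(τ)`. -/
def lcsN {n : ℕ} (D : Op (Fin n)) (τ : ℝ) (K : ℕ) : LCS (Register n 2) :=
  (seriesN D).toLCS τ K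

/-! ### First-order Trotter formula and its compensation -/

/-- The first-order Trotter formula `S(x)` for `e^{-iGx}`: the rotations `e^{-i g_γ x P_γ}`, where
`G = ∑ γ, g_γ P_γ`, one after the other (in some fixed order). -/
def trotterCircuit {Q : Type} [Fintype Q] [DecidableEq Q] (G : Op Q) (x : ℝ) : Circuit Q :=
  (pauliSupport G).toList.map fun γ => .unitary (pauliRot ((pauliCoeff G γ).re * x) γ)

/-- The power series of `e^{Ax}` in `x`. -/
def expSeries {Q : Type} [Fintype Q] [DecidableEq Q] (A : Op Q) : PowerSeries (Op Q) :=
  PowerSeries.mk fun k => ((k ! : ℂ)⁻¹) • A ^ k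

/-- The coefficient of `x^k` in `V(x) = e^{-iGx} S(x)†`. -/
def trotterErr {Q : Type} [Fintype Q] [DecidableEq Q] (G : Op Q) (k : ℕ) : Op Q :=
  PowerSeries.coeff k
    (expSeries ((-Complex.I) • G) *
      ((pauliSupport G).toList.map fun γ =>
        expSeries ((Complex.I * ((pauliCoeff G γ).re : ℂ)) • pauliOp γ)).prod)

/-- The linear combination of Pauli rotations for `V(x)` truncated at order `K`. The parts of
order `2` and `3` are anti-Hermitian, `∑ γ, i η_γ P_γ`, and are combined with the identity into
`√(1 + η²) ∑ γ, (|η_γ| / η) exp(i sgn(η_γ) arctan(η) P_γ)`, where `η = ∑ γ, |η_γ|`. The parts of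
order at least `4` are expanded into Paulis with phases. -/
def trotterComp {Q : Type} [Fintype Q] [DecidableEq Q] (G : Op Q) (x : ℝ) (K : ℕ) :
    List (ℝ × Op Q) :=
  let E : Op Q := ∑ k ∈ Finset.Icc 2 (min 3 K), (x : ℂ) ^ k • trotterErr G k
  let η : ℝ := ∑ γ, |(pauliCoeff E γ).im|
  (if η = 0 then [(1, 1)] else
    (pauliSupport E).toList.map fun γ =>
      (Real.sqrt (1 + η ^ 2) * (|(pauliCoeff E γ).im| / η),
        pauliRot (-(Real.sign (pauliCoeff E γ).im * Real.arctan η)) γ)) ++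
  ((List.range (K + 1)).filter fun k => 4 ≤ k).flatMap fun k =>
    (pauliSupport (trotterErr G k)).toList.map fun γ =>
      (x ^ k * ‖pauliCoeff (trotterErr G k) γ‖,
        Complex.exp (Complex.I * ((pauliCoeff (trotterErr G k) γ).arg : ℂ)) • pauliOp γ)

/-- The LCS formula of `V(x) ρ V(x)†`: two independent samples `U`, `W` and the
unitary-conjugate operation `(1/2) (U ρ W† + W ρ U†)`. -/
def lcsV {n : ℕ} (G : Op (Register n 2)) (x : ℝ) (K : ℕ) : LCS (Register n 2) :=
  (trotterComp G x K).flatMap fun u => (trotterComp G x K).map fun v =>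
    (u.1 * v.1, conjCircuit 0 u.2 v.2)

/-- `𝓕̃(τ)`: the Trotter step for the Hamiltonian, followed by its compensation. -/
def lcsF {n : ℕ} (H : Op (Fin n)) (τ : ℝ) (K : ℕ) : LCS (Register n 2) :=
  LCS.andThen [(1, trotterCircuit (onSystem H) τ)] (lcsV (onSystem H) τ K)

/-- `𝓙̃(τ)`: prepare the dilation ancilla in `|0⟩`, apply the Trotter step of length `√τ` for the
dilation and its compensation, truncated at order `2K`; the ancilla is then no longer used. -/
def lcsJ {n : ℕ} (D : Op (Fin n)) (τ : ℝ) (K : ℕ) : LCS (Register n 2) :=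
  LCS.andThen [(1, .reset (dilAnc n) :: trotterCircuit (dilation D) (Real.sqrt τ))]
    (lcsV (dilation D) (Real.sqrt τ) (2 * K))

/-! ### The algorithm -/

/-- One time step: `𝓕̃(τ)`, then `𝓙̃_l(τ)` and `𝓝̃_l(τ)` for each jump operator, then `𝓜̃(τ)`. -/
def lcsStep {n m : ℕ} (H : Op (Fin n)) (D : Fin m → Op (Fin n)) (τ : ℝ) (K : ℕ) :
    LCS (Register n 2) :=
  LCS.concat
    (lcsF H τ K :: ((List.finRange m).flatMap fun l => [lcsJ (D l) τ K, lcsN (D l) τ K]) ++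
      [lcsM H D τ K])

/-- One round: `S` time steps. -/
def lcsRound {n m : ℕ} (H : Op (Fin n)) (D : Fin m → Op (Fin n)) (τ : ℝ) (K S : ℕ) :
    LCS (Register n 2) :=
  LCS.concat (List.replicate S (lcsStep H D τ K))

/-- The projector onto the `j`-th eigenvector of an observable. -/
def eigenProj {n : ℕ} {O : Op (Fin n)} (hO : O.IsHermitian) (j : Fin n → Fin 2) : Op (Fin n) :=
  Matrix.vecMulVec (hO.eigenvectorBasis j) (star (hO.eigenvectorBasis j : (Fin n → Fin 2) → ℂ))

/-- The law of the number returned by one round: sample a circuit from the formula, run it on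
`ρ`, measure the observable `O` on the system, and multiply the measured eigenvalue by the
recorded sign and by the `1`-norm `μ`. -/
def sampleLaw {n a : ℕ} (F : LCS (Register n a)) (ρ : Op (Fin n)) {O : Op (Fin n)}
    (hO : O.IsHermitian) : MeasureTheory.Measure ℝ :=
  (F.map fun t => ∑ s : ℤˣ, ∑ j : Fin n → Fin 2,
    ENNReal.ofReal (t.1 / F.mu *
      (onSystem (eigenProj hO j) * run t.2 (initState ρ) s).trace.re) •
    MeasureTheory.Measure.dirac (F.mu * ((s : ℤ) : ℝ) * hO.eigenvalues j)).sum

/-- The joint law of the numbers returned by `N` independent rounds of the algorithm. -/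
def roundsLaw {n m : ℕ} (H : Op (Fin n)) (D : Fin m → Op (Fin n)) (ρ : Op (Fin n))
    {O : Op (Fin n)} (hO : O.IsHermitian) (τ : ℝ) (K S N : ℕ) :
    MeasureTheory.Measure (Fin N → ℝ) :=
  MeasureTheory.Measure.pi fun _ => sampleLaw (lcsRound H D τ K S) ρ hO

end LindbladSim

end

open LindbladSim

/-!
The argument takes place in the Heisenberg picture. A circuit with its recorded sign, and hence an
LCS formula, acts linearly on observables (`circuitDual`, `LCS.dual`), and concatenation of formulas
becomes composition. The number returned by one round is bounded by `μ ‖O‖` and has mean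
`Tr(A(O) ρ₀)`, where the action of the whole formula takes `O ⊗ 1` to `A(O) ⊗ 1`
(`sampleLaw_mean`, `sampleLaw_ae_mem_Icc`). So three things have to be shown: `A` is close to the
adjoint of `e^{𝓛T}`, the `1`-norm `μ` stays bounded, and the circuits are short.

`IsFactor` records all three for a formula and the superoperator it is meant to implement, in such a
way that its constants add under concatenation. The untruncated step is exact. The formal series of
`𝓝_l` is constructed so that `𝓝_l ∘ 𝓙_l = e^{𝓓_l τ}`; that the series of words in `D(·)D†`,
`D†D(·)`, `(·)D†D` for `𝓙_l` sums to the dilated unitary evolution is seen from its two Kraus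
operators `cos (√τ |D|)` and `-i D sin (√τ |D|) / |D|` (`exactOp_dilation`, `absSum_dilWord`,
`seriesN_evalsTo`). The series of `𝓜` undoes the splitting, so that the product of all the factors
telescopes to `e^{𝓛τ}` (`seriesM_evalsTo`, `prod_exp_mul_dissBackward`).

Put `x = ‖𝓛‖τ`. The coefficients of each series are bounded by a geometric sequence in the share of
the corresponding generator in `x`, so truncation at order `K` costs at most `12 (14 x)^K` in a step
(`isFactor_lcsStep`). The `1`-norms multiply over `T/τ ≤ (‖𝓛‖T)² / c₁` steps, and it is essential
that the logarithm of the `1`-norm of one step is `O(x²)`: the total logarithm is then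
`O(x ‖𝓛‖T) = O(c₂)`. For `𝓝` and `𝓜` this holds because their first-order terms vanish
(`seriesN_starts`, `seriesM_starts`). For the Trotter compensations with `G = J_l` the series is in
powers of `√τ`, and its terms up to `τ^{3/2}` have to be harmless. The first-order term vanishes,
and those of order two and three are anti-Hermitian, since `V` is formally unitary
(`trotterErr_two_three`); combined with the identity into Pauli rotations they cost only
`√(1 + η²) = 1 + O(τ²)` (`lcuNorm_trotterComp_bounds`).

With `K` as in the theorem the accumulated bias is at most half the precision
(`truncation_error_le`), and Hoeffding's inequality bounds the statistical error by the other half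
(`hoeffding_average`, `estimate_bound`). For the circuit size, a Pauli rotation or a controlled Pauli
string costs a number of gates linear in its weight (`realizable_pauliRot`,
`realizable_select_pauliRot`), and the strings of order `k` have weight `O(k w)`. A step consists of
`O(m q)` rotations and `O(m)` unitary-conjugate operations of weight `O(K w)` (`total_cost_le`).
-/


open scoped Nat Matrix

noncomputable section

set_option linter.unusedSectionVars false
set_option linter.unusedSimpArgs false

namespace LindbladSim

section Pauli

variable {Q : Type} [Fintype Q] [DecidableEq Q]

/-! ### Tensor products of single-qubit matrices -/

/-- The tensor product of single-qubit matrices. -/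
def tensorOp (M : Q → Matrix (Fin 2) (Fin 2) ℂ) : Op Q :=
  Matrix.of fun x y => ∏ i, M i (x i) (y i)

lemma tensorOp_mul (M N : Q → Matrix (Fin 2) (Fin 2) ℂ) :
    tensorOp M * tensorOp N = tensorOp fun i => M i * N i := by
  ext x y
  simp only [Matrix.mul_apply, tensorOp, Matrix.of_apply, ← Finset.prod_mul_distrib]
  rw [Finset.prod_univ_sum]
  simp [Fintype.piFinset_univ]

lemma tensorOp_conjTranspose (M : Q → Matrix (Fin 2) (Fin 2) ℂ) :
    (tensorOp M)ᴴ = tensorOp fun i => (M i)ᴴ := by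
  ext x y
  simp [tensorOp, Matrix.conjTranspose_apply]

lemma tensorOp_trace (M : Q → Matrix (Fin 2) (Fin 2) ℂ) :
    (tensorOp M).trace = ∏ i, (M i).trace := by
  simp only [Matrix.trace, Matrix.diag, tensorOp, Matrix.of_apply]
  rw [Finset.prod_univ_sum]
  simp [Fintype.piFinset_univ]

lemma tensorOp_smul (z : Q → ℂ) (M : Q → Matrix (Fin 2) (Fin 2) ℂ) :
    tensorOp (fun i => z i • M i) = (∏ i, z i) • tensorOp M := by
  ext x y
  simp [tensorOp, Finset.prod_mul_distrib]

lemma tensorOp_one : tensorOp (fun _ : Q => (1 : Matrix (Fin 2) (Fin 2) ℂ)) = 1 := by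
  ext x y
  simp only [tensorOp, Matrix.of_apply, Matrix.one_apply]
  rw [Finset.prod_ite_zero]
  simp [funext_iff]

lemma onQubit_eq_tensorOp (i : Q) (M : Matrix (Fin 2) (Fin 2) ℂ) :
    onQubit i M = tensorOp (Function.update 1 i M) := by
  ext x y
  simp only [onQubit, tensorOp, Matrix.of_apply]
  rw [← Finset.mul_prod_erase _ _ (Finset.mem_univ i)]
  have : ∀ j ∈ Finset.univ.erase i, (Function.update 1 i M : Q → _) j (x j) (y j)
      = if x j = y j then (1 : ℂ) else 0 := by
    intro j hj
    rw [Function.update_of_ne (Finset.ne_of_mem_erase hj)]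
    simp [Matrix.one_apply]
  rw [Finset.prod_congr rfl this, Finset.prod_ite_zero]
  by_cases h : ∀ j, j ≠ i → x j = y j
  · rw [if_pos h, if_pos (fun j hj => h j (Finset.ne_of_mem_erase hj))]; simp
  · rw [if_neg h, if_neg (fun h' => h fun j hj => h' j (by simp [hj]))]; simp

lemma onQubit_mul (i : Q) (M N : Matrix (Fin 2) (Fin 2) ℂ) :
    onQubit i M * onQubit i N = onQubit i (M * N) := by
  simp only [onQubit_eq_tensorOp, tensorOp_mul]
  congr 1; ext1 j
  by_cases h : j = i
  · subst h; simp
  · simp [Function.update_of_ne h]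

lemma onQubit_commute {i j : Q} (h : i ≠ j) (M N : Matrix (Fin 2) (Fin 2) ℂ) :
    Commute (onQubit i M) (onQubit j N) := by
  simp only [Commute, SemiconjBy, onQubit_eq_tensorOp, tensorOp_mul]
  congr 1; ext1 k
  by_cases hi : k = i
  · subst hi; simp [Function.update_of_ne h]
  · by_cases hj : k = j
    · subst hj; simp [Function.update_of_ne hi]
    · simp [Function.update_of_ne hi, Function.update_of_ne hj]

lemma onQubit_conjTranspose (i : Q) (M : Matrix (Fin 2) (Fin 2) ℂ) :
    (onQubit i M)ᴴ = onQubit i Mᴴ := by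
  simp only [onQubit_eq_tensorOp, tensorOp_conjTranspose]
  congr 1; ext1 j
  by_cases h : j = i
  · subst h; simp
  · simp [Function.update_of_ne h]

lemma onQubit_one (i : Q) : onQubit i (1 : Matrix (Fin 2) (Fin 2) ℂ) = 1 := by
  rw [onQubit_eq_tensorOp, ← tensorOp_one]
  congr 1; ext1 j
  by_cases h : j = i
  · subst h; simp
  · simp [Function.update_of_ne h]

/-- `onQubit i` as a linear map. -/
def onQubitLin (i : Q) : Matrix (Fin 2) (Fin 2) ℂ →ₗ[ℂ] Op Q where
  toFun := onQubit i
  map_add' M N := by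
    ext x y; simp only [onQubit, Matrix.of_apply, Matrix.add_apply]; split_ifs <;> simp
  map_smul' z M := by
    ext x y; simp only [onQubit, Matrix.of_apply, Matrix.smul_apply]; split_ifs <;> simp

lemma onQubit_add (i : Q) (M N : Matrix (Fin 2) (Fin 2) ℂ) :
    onQubit i (M + N) = onQubit i M + onQubit i N := (onQubitLin i).map_add M N

lemma onQubit_sub (i : Q) (M N : Matrix (Fin 2) (Fin 2) ℂ) :
    onQubit i (M - N) = onQubit i M - onQubit i N := (onQubitLin i).map_sub M N

lemma onQubit_smul (i : Q) (z : ℂ) (M : Matrix (Fin 2) (Fin 2) ℂ) :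
    onQubit i (z • M) = z • onQubit i M := (onQubitLin i).map_smul z M

lemma onQubit_zero (i : Q) : onQubit i (0 : Matrix (Fin 2) (Fin 2) ℂ) = 0 := (onQubitLin i).map_zero

/-! ### Pauli matrices -/

/-- The product of two Pauli matrices up to a phase: exclusive or of the labels. -/
def pauliXor (a b : Fin 4) : Fin 4 :=
  ![![0, 1, 2, 3], ![1, 0, 3, 2], ![2, 3, 0, 1], ![3, 2, 1, 0]] a b

lemma pauliMat_mul (a b : Fin 4) :
    ∃ z : ℂ, ‖z‖ = 1 ∧ pauliMat a * pauliMat b = z • pauliMat (pauliXor a b) := by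
  refine ⟨(![![1, 1, 1, 1], ![1, 1, Complex.I, -Complex.I], ![1, -Complex.I, 1, Complex.I],
    ![1, Complex.I, -Complex.I, 1]] : Fin 4 → Fin 4 → ℂ) a b, ?_, ?_⟩
  · fin_cases a <;> fin_cases b <;> simp
  · fin_cases a <;> fin_cases b <;> ext i j <;> fin_cases i <;> fin_cases j <;>
      simp [pauliMat, pauliXor]

lemma pauliMat_zero : pauliMat 0 = 1 := rfl

lemma pauliMat_conjTranspose (a : Fin 4) : (pauliMat a)ᴴ = pauliMat a := by
  ext i j
  fin_cases a <;> fin_cases i <;> fin_cases j <;> simp [pauliMat, Matrix.conjTranspose_apply]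

lemma pauliMat_mul_self (a : Fin 4) : pauliMat a * pauliMat a = 1 := by
  ext i j
  fin_cases a <;> fin_cases i <;> fin_cases j <;> simp [pauliMat]

lemma pauliMat_trace_mul (a b : Fin 4) :
    (pauliMat a * pauliMat b).trace = if a = b then 2 else 0 := by
  fin_cases a <;> fin_cases b <;>
    simp [pauliMat, Matrix.trace_fin_two, Matrix.mul_apply, one_add_one_eq_two]

lemma pauliMat_completeness (x y u v : Fin 2) :
    ∑ a, pauliMat a x y * pauliMat a u v = if x = v ∧ y = u then 2 else 0 := by
  rw [Fin.sum_univ_four]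
  fin_cases x <;> fin_cases y <;> fin_cases u <;> fin_cases v <;>
    simp [pauliMat, one_add_one_eq_two]

lemma pauliOp_eq_tensorOp (γ : PauliString Q) : pauliOp γ = tensorOp fun i => pauliMat (γ i) := rfl

lemma pauliOp_mul (γ δ : PauliString Q) :
    ∃ z : ℂ, ‖z‖ = 1 ∧ pauliOp γ * pauliOp δ = z • pauliOp fun i => pauliXor (γ i) (δ i) := by
  choose z hz h using fun i => pauliMat_mul (γ i) (δ i)
  refine ⟨∏ i, z i, by simp [hz], ?_⟩
  simp only [pauliOp_eq_tensorOp, tensorOp_mul, h, tensorOp_smul]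

lemma pauliOp_conjTranspose (γ : PauliString Q) : (pauliOp γ)ᴴ = pauliOp γ := by
  simp [pauliOp_eq_tensorOp, tensorOp_conjTranspose, pauliMat_conjTranspose]

lemma pauliOp_mul_self (γ : PauliString Q) : pauliOp γ * pauliOp γ = 1 := by
  simp [pauliOp_eq_tensorOp, tensorOp_mul, pauliMat_mul_self, tensorOp_one]

lemma pauliOp_zero : pauliOp (0 : PauliString Q) = 1 := tensorOp_one

lemma pauliOp_trace_mul (γ δ : PauliString Q) :
    (pauliOp γ * pauliOp δ).trace = if γ = δ then (2 : ℂ) ^ Fintype.card Q else 0 := by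
  simp only [pauliOp_eq_tensorOp, tensorOp_mul, tensorOp_trace, pauliMat_trace_mul]
  rw [Finset.prod_ite_zero]
  simp [funext_iff]

/-- The Pauli strings form an orthogonal basis: `∑ γ, P_γ ⊗ P_γ` is a multiple of the swap operator. -/
lemma pauliOp_completeness (x y u v : Q → Fin 2) :
    ∑ γ : PauliString Q, pauliOp γ x y * pauliOp γ u v
      = if x = v ∧ y = u then (2 : ℂ) ^ Fintype.card Q else 0 := by
  have h := (Finset.prod_univ_sum (fun _ : Q => (Finset.univ : Finset (Fin 4)))
    (fun i a => pauliMat a (x i) (y i) * pauliMat a (u i) (v i)))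
  rw [Fintype.piFinset_univ] at h
  simp only [pauliOp, Matrix.of_apply, ← Finset.prod_mul_distrib]
  rw [← h]
  simp only [pauliMat_completeness]
  rw [Finset.prod_ite_zero]
  simp [funext_iff, forall_and]

/-- Pauli coefficients as a linear map. -/
def pauliCoeffLin (γ : PauliString Q) : Op Q →ₗ[ℂ] ℂ where
  toFun A := pauliCoeff A γ
  map_add' A B := by simp [pauliCoeff, mul_add]
  map_smul' z A := by simp [pauliCoeff]; ring

lemma pauliCoeff_add (A B : Op Q) (γ : PauliString Q) :
    pauliCoeff (A + B) γ = pauliCoeff A γ + pauliCoeff B γ := (pauliCoeffLin γ).map_add A B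

lemma pauliCoeff_smul (z : ℂ) (A : Op Q) (γ : PauliString Q) :
    pauliCoeff (z • A) γ = z * pauliCoeff A γ := (pauliCoeffLin γ).map_smul z A

lemma pauliCoeff_sum {ι : Type*} (s : Finset ι) (A : ι → Op Q) (γ : PauliString Q) :
    pauliCoeff (∑ i ∈ s, A i) γ = ∑ i ∈ s, pauliCoeff (A i) γ := map_sum (pauliCoeffLin γ) A s

lemma pauliCoeff_zero (γ : PauliString Q) : pauliCoeff (0 : Op Q) γ = 0 := (pauliCoeffLin γ).map_zero

lemma pauliCoeff_pauliOp (γ δ : PauliString Q) :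
    pauliCoeff (pauliOp δ) γ = if γ = δ then 1 else 0 := by
  rw [pauliCoeff, pauliOp_trace_mul]
  split_ifs <;> simp

lemma sum_pauliCoeff_smul (A : Op Q) : ∑ γ, pauliCoeff A γ • pauliOp γ = A := by
  ext u v
  have h2 : ((2 : ℂ) ^ Fintype.card Q) ≠ 0 := pow_ne_zero _ two_ne_zero
  simp only [Matrix.sum_apply, Matrix.smul_apply, smul_eq_mul, pauliCoeff, Matrix.trace,
    Matrix.diag, Matrix.mul_apply]
  have : ∀ γ : PauliString Q, ((2 : ℂ) ^ Fintype.card Q)⁻¹ *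
      (∑ x, ∑ y, pauliOp γ x y * A y x) * pauliOp γ u v =
      ∑ x, ∑ y, ((2 : ℂ) ^ Fintype.card Q)⁻¹ * A y x * (pauliOp γ x y * pauliOp γ u v) := by
    intro γ
    rw [mul_assoc, Finset.sum_mul, Finset.mul_sum]
    refine Finset.sum_congr rfl fun x _ => ?_
    rw [Finset.sum_mul, Finset.mul_sum]
    exact Finset.sum_congr rfl fun y _ => by ring
  simp only [this]
  rw [Finset.sum_comm]
  simp only [Finset.sum_comm (s := (Finset.univ : Finset (PauliString Q))), ← Finset.mul_sum,
    pauliOp_completeness]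
  simp only [mul_ite, mul_zero]
  rw [Finset.sum_eq_single v, Finset.sum_eq_single u]
  · simp; field_simp
  · intro y _ hy; simp [hy]
  · simp
  · intro x _ hx; simp [hx]
  · simp

lemma sum_pauliSupport {M : Type*} [AddCommMonoid M] (A : Op Q) (f : PauliString Q → M)
    (hf : ∀ γ, pauliCoeff A γ = 0 → f γ = 0) : ∑ γ ∈ pauliSupport A, f γ = ∑ γ, f γ := by
  classical
  rw [pauliSupport, Finset.sum_filter]
  refine Finset.sum_congr rfl fun γ _ => ?_
  split_ifs with h
  · rfl
  · exact (hf γ (not_not.mp h)).symm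

lemma mem_pauliSupport {A : Op Q} {γ : PauliString Q} :
    γ ∈ pauliSupport A ↔ pauliCoeff A γ ≠ 0 := by
  classical
  simp [pauliSupport]

/-! ### The Pauli norm -/

lemma pauliNorm_nonneg (A : Op Q) : 0 ≤ pauliNorm A := Finset.sum_nonneg fun _ _ => norm_nonneg _

lemma pauliNorm_add (A B : Op Q) : pauliNorm (A + B) ≤ pauliNorm A + pauliNorm B := by
  rw [pauliNorm, pauliNorm, pauliNorm, ← Finset.sum_add_distrib]
  exact Finset.sum_le_sum fun γ _ => by rw [pauliCoeff_add]; exact norm_add_le _ _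

lemma pauliNorm_smul (z : ℂ) (A : Op Q) : pauliNorm (z • A) = ‖z‖ * pauliNorm A := by
  simp [pauliNorm, pauliCoeff_smul, Finset.mul_sum]

lemma pauliNorm_zero : pauliNorm (0 : Op Q) = 0 := by simp [pauliNorm, pauliCoeff_zero]

lemma pauliNorm_sum {ι : Type*} (s : Finset ι) (A : ι → Op Q) :
    pauliNorm (∑ i ∈ s, A i) ≤ ∑ i ∈ s, pauliNorm (A i) := by
  classical
  induction s using Finset.induction_on with
  | empty => simp [pauliNorm_zero]
  | insert i s hi ih =>
    rw [Finset.sum_insert hi, Finset.sum_insert hi]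
    exact (pauliNorm_add _ _).trans (by gcongr)

lemma pauliNorm_pauliOp (γ : PauliString Q) : pauliNorm (pauliOp γ) = 1 := by
  simp [pauliNorm, pauliCoeff_pauliOp, apply_ite norm]

lemma pauliNorm_one : pauliNorm (1 : Op Q) = 1 := by rw [← pauliOp_zero, pauliNorm_pauliOp]

lemma mul_eq_sum_pauliOp (A B : Op Q) :
    A * B = ∑ γ, ∑ δ, (pauliCoeff A γ * pauliCoeff B δ) • (pauliOp γ * pauliOp δ) := by
  conv_lhs => rw [← sum_pauliCoeff_smul A, ← sum_pauliCoeff_smul B]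
  rw [Finset.sum_mul_sum]
  simp only [smul_mul_smul_comm]

lemma pauliNorm_mul (A B : Op Q) : pauliNorm (A * B) ≤ pauliNorm A * pauliNorm B := by
  rw [mul_eq_sum_pauliOp, pauliNorm.eq_def A, pauliNorm.eq_def B, Finset.sum_mul_sum]
  refine (pauliNorm_sum _ _).trans (Finset.sum_le_sum fun γ _ => ?_)
  refine (pauliNorm_sum _ _).trans (Finset.sum_le_sum fun δ _ => ?_)
  obtain ⟨z, hz, h⟩ := pauliOp_mul γ δ
  simp [h, pauliNorm_smul, pauliNorm_pauliOp, hz]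

lemma pauliCoeff_conjTranspose (A : Op Q) (γ : PauliString Q) :
    pauliCoeff Aᴴ γ = star (pauliCoeff A γ) := by
  rw [pauliCoeff, pauliCoeff, star_mul', ← Matrix.trace_conjTranspose, Matrix.conjTranspose_mul,
    pauliOp_conjTranspose, Matrix.trace_mul_comm]
  simp

lemma pauliNorm_conjTranspose (A : Op Q) : pauliNorm Aᴴ = pauliNorm A := by
  simp [pauliNorm, pauliCoeff_conjTranspose]

lemma pauliCoeff_im_of_isHermitian {A : Op Q} (hA : A.IsHermitian) (γ : PauliString Q) :
    ((pauliCoeff A γ).re : ℂ) = pauliCoeff A γ := by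
  have := pauliCoeff_conjTranspose A γ
  rw [hA.eq] at this
  exact Complex.conj_eq_iff_re.mp this.symm

open scoped Matrix.Norms.L2Operator

lemma norm_le_one_of_unitary {ι : Type*} [Fintype ι] [DecidableEq ι] {U : Matrix ι ι ℂ}
    (h : Uᴴ * U = 1) : ‖U‖ ≤ 1 := by
  have h1 : ‖U‖ * ‖U‖ ≤ 1 := by
    rw [← Matrix.l2_opNorm_conjTranspose_mul_self, h]
    have : ‖(1 : Matrix ι ι ℂ)‖ ≤ 1 := by
      rw [← Matrix.diagonal_one, Matrix.l2_opNorm_diagonal]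
      exact (pi_norm_le_iff_of_nonneg zero_le_one).mpr fun i => by simp
    exact this
  nlinarith [norm_nonneg U]

lemma norm_pauliOp_le (γ : PauliString Q) : ‖pauliOp γ‖ ≤ 1 :=
  norm_le_one_of_unitary (by rw [pauliOp_conjTranspose, pauliOp_mul_self])

lemma norm_le_pauliNorm (A : Op Q) : ‖A‖ ≤ pauliNorm A := by
  conv_lhs => rw [← sum_pauliCoeff_smul A]
  refine (norm_sum_le _ _).trans (Finset.sum_le_sum fun γ _ => ?_)
  rw [norm_smul]
  exact mul_le_of_le_one_right (norm_nonneg _) (norm_pauliOp_le γ)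

end Pauli

/-! ### Circuits in the Heisenberg picture -/

section Dual

variable {Q : Type} [Fintype Q] [DecidableEq Q]

/-- The superoperator `X ↦ A X B`. -/
def sandwich (A B : Op Q) : Module.End ℂ (Op Q) := LinearMap.mulLeft ℂ A * LinearMap.mulRight ℂ B

lemma sandwich_apply (A B X : Op Q) : sandwich A B X = A * X * B := by
  simp [sandwich, mul_assoc]

/-- The action of an instruction on observables, the recorded sign included: the adjoint of
`Instr.apply` for the pairing `(X, σ) ↦ ∑ s, s Tr(X σ_s)`. -/
def Instr.dual : Instr Q → Module.End ℂ (Op Q)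
  | .unitary U => sandwich Uᴴ U
  | .reset i => ∑ b : Fin 2, sandwich (onQubit i (ketBra 0 b))ᴴ (onQubit i (ketBra 0 b))
  | .measureX i => ∑ r : ℤˣ, ((r : ℤ) : ℂ) • sandwich (onQubit i (projX r)) (onQubit i (projX r))

/-- The action of a circuit on observables. -/
def circuitDual (c : Circuit Q) : Module.End ℂ (Op Q) := (c.map Instr.dual).prod

/-- The action of an LCS formula on observables. -/
def LCS.dual (F : LCS Q) : Module.End ℂ (Op Q) :=
  (F.map fun t => (t.1 : ℂ) • circuitDual t.2).sum

/-- The sign-weighted total operator of a joint state. -/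
def signedSum (σ : SignedState Q) : Op Q := ∑ s : ℤˣ, ((s : ℤ) : ℂ) • σ s

lemma circuitDual_append (c d : Circuit Q) : circuitDual (c ++ d) = circuitDual c * circuitDual d := by
  simp [circuitDual]

lemma sum_units {M : Type*} [AddCommMonoid M] (f : ℤˣ → M) : ∑ r : ℤˣ, f r = f 1 + f (-1) := by
  have : (Finset.univ : Finset ℤˣ) = {1, -1} := by decide
  rw [this, Finset.sum_pair (by decide)]

/-- Schrödinger and Heisenberg pictures agree on a single instruction. -/
lemma trace_instr_apply (i : Instr Q) (σ : SignedState Q) (X : Op Q) :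
    (X * signedSum (Instr.apply σ i)).trace = (i.dual X * signedSum σ).trace := by
  have cyc : ∀ A B C : Op Q, (X * (A * B * C)).trace = (C * X * A * B).trace := by
    intro A B C
    rw [← mul_assoc, Matrix.trace_mul_comm]
    simp only [mul_assoc]
  cases i with
  | unitary U =>
    simp only [signedSum, Instr.apply, Instr.dual, sandwich_apply, sum_units, mul_add,
      Matrix.trace_add, Matrix.mul_smul, Matrix.trace_smul, cyc]
  | reset i =>
    simp only [signedSum, Instr.apply, Instr.dual, sandwich_apply, sum_units, mul_add,
      Matrix.trace_add, Matrix.mul_smul, Matrix.trace_smul, Fin.sum_univ_two, cyc,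
      LinearMap.add_apply, add_mul, smul_add]
  | measureX i =>
    simp only [signedSum, Instr.apply, Instr.dual, sandwich_apply, sum_units, mul_add,
      Matrix.trace_add, Matrix.mul_smul, Matrix.trace_smul, cyc, LinearMap.smul_apply,
      LinearMap.add_apply, add_mul, smul_add, Matrix.smul_mul, one_mul, mul_one, mul_neg, neg_neg]
    simp
    ring

lemma trace_run (c : Circuit Q) (σ : SignedState Q) (X : Op Q) :
    (X * signedSum (run c σ)).trace = (circuitDual c X * signedSum σ).trace := by
  induction c generalizing σ with
  | nil => simp [run, circuitDual]
  | cons i c ih =>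
    have : run (i :: c) σ = run c (Instr.apply σ i) := rfl
    rw [this, ih, trace_instr_apply]
    simp [circuitDual]

lemma LCS.dual_andThen (F G : LCS Q) : (F.andThen G).dual = F.dual * G.dual := by
  unfold LCS.andThen LCS.dual
  induction F with
  | nil => simp
  | cons f F ih =>
    rw [List.flatMap_cons, List.map_append, List.sum_append, ih, List.map_cons, List.sum_cons,
      add_mul]
    congr 1
    simp only [List.map_map, Function.comp_def, circuitDual_append]
    clear ih
    induction G with
    | nil => simp
    | cons g G ih =>
      simp only [List.map_cons, List.sum_cons, ih, mul_add]
      congr 1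
      rw [smul_mul_smul_comm, Complex.ofReal_mul]

lemma LCS.mu_andThen (F G : LCS Q) : (F.andThen G).mu = F.mu * G.mu := by
  unfold LCS.andThen LCS.mu
  induction F with
  | nil => simp
  | cons f F ih =>
    rw [List.flatMap_cons, List.map_append, List.sum_append, ih, List.map_cons, List.sum_cons,
      add_mul]
    congr 1
    simp only [List.map_map, Function.comp_def]
    rw [← List.sum_map_mul_left]

lemma LCS.dual_concat (Fs : List (LCS Q)) : (LCS.concat Fs).dual = (Fs.map LCS.dual).prod := by
  induction Fs with
  | nil => simp [LCS.concat, LCS.dual, circuitDual]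
  | cons F Fs ih =>
    have : LCS.concat (F :: Fs) = F.andThen (LCS.concat Fs) := rfl
    simp [this, LCS.dual_andThen, ih]

lemma LCS.mu_concat (Fs : List (LCS Q)) : (LCS.concat Fs).mu = (Fs.map LCS.mu).prod := by
  induction Fs with
  | nil => simp [LCS.concat, LCS.mu]
  | cons F Fs ih =>
    have : LCS.concat (F :: Fs) = F.andThen (LCS.concat Fs) := rfl
    simp [this, LCS.mu_andThen, ih]

lemma LCS.mem_andThen {F G : LCS Q} {t : ℝ × Circuit Q} :
    t ∈ F.andThen G ↔ ∃ f ∈ F, ∃ g ∈ G, t = (f.1 * g.1, f.2 ++ g.2) := by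
  simp [LCS.andThen, eq_comm]

/-- The operator `A` acts trivially on the qubit `c`: it commutes with every operator on `c`. -/
def TrivialOn (c : Q) (A : Op Q) : Prop := ∀ M, Commute (onQubit c M) A

lemma TrivialOn.mul {c : Q} {A B : Op Q} (hA : TrivialOn c A) (hB : TrivialOn c B) :
    TrivialOn c (A * B) := fun M => (hA M).mul_right (hB M)

lemma TrivialOn.one {c : Q} : TrivialOn c (1 : Op Q) := fun _ => Commute.one_right _

lemma TrivialOn.add {c : Q} {A B : Op Q} (hA : TrivialOn c A) (hB : TrivialOn c B) :
    TrivialOn c (A + B) := fun M => (hA M).add_right (hB M)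

lemma TrivialOn.smul {c : Q} {A : Op Q} (z : ℂ) (hA : TrivialOn c A) :
    TrivialOn c (z • A) := fun M => (hA M).smul_right z

lemma TrivialOn.conjTranspose {c : Q} {A : Op Q} (hA : TrivialOn c A) : TrivialOn c Aᴴ := by
  intro M
  have := congrArg Matrix.conjTranspose (hA Mᴴ).eq
  rw [Matrix.conjTranspose_mul, Matrix.conjTranspose_mul, onQubit_conjTranspose,
    Matrix.conjTranspose_conjTranspose] at this
  exact this.symm

lemma TrivialOn.pauliOp {c : Q} {γ : PauliString Q} (h : γ c = 0) : TrivialOn c (pauliOp γ) := by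
  intro M
  simp only [Commute, SemiconjBy, onQubit_eq_tensorOp, pauliOp_eq_tensorOp, tensorOp_mul]
  congr 1; ext1 i
  by_cases hi : i = c
  · subst hi; simp [h, pauliMat_zero]
  · simp [Function.update_of_ne hi]

/-- Factors on the qubit `c` and factors trivial on it multiply separately. -/
lemma TrivialOn.sandwich_mul {c : Q} {V Y : Op Q} (hV : TrivialOn c V) (hY : TrivialOn c Y)
    (A N B : Matrix (Fin 2) (Fin 2) ℂ) (U : Op Q) :
    (onQubit c A * V) * (onQubit c N * Y) * (onQubit c B * U)
      = onQubit c (A * N * B) * (V * Y * U) := by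
  rw [← onQubit_mul, ← onQubit_mul]
  calc _ = onQubit c A * (V * onQubit c N) * (Y * onQubit c B) * U := by simp only [mul_assoc]
    _ = onQubit c A * onQubit c N * (V * onQubit c B) * Y * U := by
      rw [← (hV N).eq, ← (hY B).eq]; simp only [mul_assoc]
    _ = _ := by rw [← (hV B).eq]; simp only [mul_assoc]

lemma ketBra_mul (a b c d : Fin 2) :
    ketBra a b * ketBra c d = if b = c then ketBra a d else 0 := by
  unfold ketBra
  split_ifs with h
  · subst h; simp
  · simp [h]

lemma ketBra_conjTranspose (a b : Fin 2) : (ketBra a b)ᴴ = ketBra b a := by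
  simp [ketBra]

lemma ketBra_add : ketBra 0 0 + ketBra 1 1 = 1 := by
  ext i j; fin_cases i <;> fin_cases j <;> simp [ketBra]

lemma one_sub_ketBra_zero (c : Q) : 1 - onQubit c (ketBra 0 0) = onQubit c (ketBra 1 1) := by
  rw [← onQubit_one c, ← onQubit_sub, ← ketBra_add]; simp

lemma one_sub_ketBra_one (c : Q) : 1 - onQubit c (ketBra 1 1) = onQubit c (ketBra 0 0) := by
  rw [← onQubit_one c, ← onQubit_sub, ← ketBra_add]; simp

lemma controlled_zero_eq (c : Q) (U : Op Q) :
    controlled c 0 U = onQubit c (ketBra 0 0) * U + onQubit c (ketBra 1 1) * 1 := by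
  rw [controlled, one_sub_ketBra_zero, mul_one]

lemma controlled_one_eq (c : Q) (U : Op Q) :
    controlled c 1 U = onQubit c (ketBra 1 1) * U + onQubit c (ketBra 0 0) * 1 := by
  rw [controlled, one_sub_ketBra_one, mul_one]

lemma TrivialOn.conjTranspose_onQubit_mul {c : Q} {U : Op Q} (hU : TrivialOn c U)
    (M : Matrix (Fin 2) (Fin 2) ℂ) : (onQubit c M * U)ᴴ = onQubit c Mᴴ * Uᴴ := by
  rw [Matrix.conjTranspose_mul, onQubit_conjTranspose, (hU.conjTranspose Mᴴ).eq]

/-- A measurement of `X` with recorded sign acts on observables as multiplication by `X`. -/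
lemma dual_measureX {c : Q} {X : Op Q} (hX : TrivialOn c X) :
    (Instr.measureX c).dual X = onQubit c (pauliMat 1) * X := by
  have : ∀ r, onQubit c (projX r) * X * onQubit c (projX r) = onQubit c (projX r * projX r) * X := by
    intro r
    rw [mul_assoc, ← (hX _).eq, ← mul_assoc, onQubit_mul]
  simp only [Instr.dual, sum_units, LinearMap.add_apply, LinearMap.smul_apply, sandwich_apply, this,
    ← Matrix.smul_mul, ← add_mul, ← onQubit_smul, ← onQubit_add]
  congr 2
  ext i j
  fin_cases i <;> fin_cases j <;>
    simp [projX, pauliMat, Matrix.mul_apply, Fin.sum_univ_two] <;> norm_num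

lemma dual_unitary_onQubit {c : Q} {X : Op Q} (hX : TrivialOn c X)
    (N P : Matrix (Fin 2) (Fin 2) ℂ) :
    (Instr.unitary (onQubit c P)).dual (onQubit c N * X) = onQubit c (Pᴴ * N * P) * X := by
  have := TrivialOn.sandwich_mul (TrivialOn.one (c := c)) hX Pᴴ N P 1
  simp only [mul_one, one_mul] at this
  simp only [Instr.dual, sandwich_apply, onQubit_conjTranspose, this]

lemma dual_reset {c : Q} {X : Op Q} (hX : TrivialOn c X) (N : Matrix (Fin 2) (Fin 2) ℂ) :
    (Instr.reset c).dual (onQubit c N * X) = N 0 0 • X := by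
  have := fun A B => TrivialOn.sandwich_mul (TrivialOn.one (c := c)) hX A N B 1
  simp only [mul_one, one_mul] at this
  simp only [Instr.dual, LinearMap.add_apply, sandwich_apply, onQubit_conjTranspose, this,
    Fin.sum_univ_two, ← add_mul, ← onQubit_add, ketBra_conjTranspose]
  rw [← one_mul X, ← Matrix.smul_mul, one_mul, ← onQubit_one c, ← onQubit_smul]
  congr 2
  ext i j
  fin_cases i <;> fin_cases j <;>
    simp [ketBra, Matrix.mul_apply, Fin.sum_univ_two, Matrix.single]

/-- Off the diagonal of the control qubit, a controlled gate acts on one side of the observable only. -/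
lemma dual_controlled_zero {c : Q} {W X : Op Q} (hW : TrivialOn c W) (hX : TrivialOn c X)
    (z₀ z₁ : ℂ) :
    (Instr.unitary (controlled c 0 W)).dual
        (onQubit c (z₀ • ketBra 0 1 + z₁ • ketBra 1 0) * X)
      = onQubit c (ketBra 0 1) * (z₀ • (Wᴴ * X)) + onQubit c (ketBra 1 0) * (z₁ • (X * W)) := by
  have s := fun A N B V (hV : TrivialOn c V) U => TrivialOn.sandwich_mul hV hX A N B U
  simp only [Instr.dual, sandwich_apply, controlled_zero_eq, Matrix.conjTranspose_add,
    hW.conjTranspose_onQubit_mul, TrivialOn.one.conjTranspose_onQubit_mul, mul_add, add_mul,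
    Matrix.conjTranspose_one]
  simp only [s _ _ _ _ hW.conjTranspose, s _ _ _ _ TrivialOn.one, ketBra_conjTranspose]
  simp [mul_add, add_mul, ketBra_mul, onQubit_zero, onQubit_smul]
  exact add_comm _ _

lemma dual_controlled_one {c : Q} {U X Y : Op Q} (hU : TrivialOn c U) (hX : TrivialOn c X)
    (hY : TrivialOn c Y) :
    (Instr.unitary (controlled c 1 U)).dual
        (onQubit c (ketBra 0 1) * X + onQubit c (ketBra 1 0) * Y)
      = onQubit c (ketBra 0 1) * (X * U) + onQubit c (ketBra 1 0) * (Uᴴ * Y) := by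
  have sX := fun A N B V (hV : TrivialOn c V) U => TrivialOn.sandwich_mul hV hX A N B U
  have sY := fun A N B V (hV : TrivialOn c V) U => TrivialOn.sandwich_mul hV hY A N B U
  simp only [Instr.dual, sandwich_apply, controlled_one_eq, Matrix.conjTranspose_add,
    hU.conjTranspose_onQubit_mul, TrivialOn.one.conjTranspose_onQubit_mul, mul_add, add_mul,
    Matrix.conjTranspose_one]
  simp only [sX _ _ _ _ hU.conjTranspose, sX _ _ _ _ TrivialOn.one, sY _ _ _ _ hU.conjTranspose,
    sY _ _ _ _ TrivialOn.one, ketBra_conjTranspose]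
  simp [ketBra_mul, onQubit_zero]

end Dual

section Conj

variable {n : ℕ}

lemma phaseGate_conj (θ : ℝ) :
    (phaseGate θ)ᴴ * pauliMat 1 * phaseGate θ
      = Complex.exp (Complex.I * θ) • ketBra 0 1 + Complex.exp (-(Complex.I * θ)) • ketBra 1 0 := by
  have h : ∀ z : ℂ, Complex.exp (Complex.I * z) = Complex.exp (Complex.I * (z / 2)) * Complex.exp (Complex.I * (z / 2)) := by
    intro z; rw [← Complex.exp_add]; ring_nf
  ext i j
  fin_cases i <;> fin_cases j <;>
    simp [phaseGate, pauliMat, ketBra, Matrix.mul_apply, Fin.sum_univ_two, Matrix.single,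
      Matrix.diagonal, Matrix.conjTranspose_apply, ← Complex.exp_conj, map_ofNat]
  · rw [h θ]
  · rw [← Complex.exp_add]; ring_nf

/-- Both coherences contribute equally to the control qubit in the state `|+⟩`. -/
lemma hadamard_conj_entry (a b : Fin 2) (h : a ≠ b) :
    (hadamardᴴ * ketBra a b * hadamard) 0 0 = 1 / 2 := by
  have h2 : ((Real.sqrt 2 : ℝ) : ℂ)⁻¹ * ((Real.sqrt 2 : ℝ) : ℂ)⁻¹ = 2⁻¹ := by
    rw [← mul_inv, ← Complex.ofReal_mul, Real.mul_self_sqrt (by norm_num)]; simp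
  fin_cases a <;> fin_cases b <;> first | exact absurd rfl h | skip
  all_goals
    simp [hadamard, ketBra, Matrix.mul_apply, Fin.sum_univ_two, Matrix.single,
      Matrix.conjTranspose_apply, h2]

/-- The circuit `conjCircuit` implements the unitary-conjugate operation. -/
lemma dual_conjCircuit (θ : ℝ) {U W X : Op (Register n 2)} (hU : TrivialOn (ctlAnc n) U)
    (hW : TrivialOn (ctlAnc n) W) (hX : TrivialOn (ctlAnc n) X) :
    circuitDual (conjCircuit θ U W) X
      = (1 / 2 : ℂ) • (Complex.exp (Complex.I * θ) • (Wᴴ * X * U)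
          + Complex.exp (-(Complex.I * θ)) • (Uᴴ * X * W)) := by
  simp only [circuitDual, conjCircuit, List.map_cons, List.map_nil, List.prod_cons, List.prod_nil,
    mul_one, Module.End.mul_apply]
  rw [dual_measureX hX, dual_unitary_onQubit hX, phaseGate_conj, dual_controlled_zero hW hX,
    dual_controlled_one hU ((hW.conjTranspose.mul hX).smul _) ((hX.mul hW).smul _), map_add,
    dual_unitary_onQubit (((hW.conjTranspose.mul hX).smul _).mul hU),
    dual_unitary_onQubit (hU.conjTranspose.mul ((hX.mul hW).smul _)), map_add,
    dual_reset (((hW.conjTranspose.mul hX).smul _).mul hU),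
    dual_reset (hU.conjTranspose.mul ((hX.mul hW).smul _)), hadamard_conj_entry _ _ (by decide),
    hadamard_conj_entry _ _ (by decide), ← smul_add]
  simp [mul_assoc]

end Conj

/-! ### Operators on the system register -/

section System

variable {n a : ℕ}

open scoped Kronecker

/-- Basis states of the register as pairs of basis states of the system and of the ancillas. -/
def regEquiv (n a : ℕ) : (Register n a → Fin 2) ≃ (Fin n → Fin 2) × (Fin a → Fin 2) :=
  Equiv.sumArrowEquivProdArrow _ _ _

lemma onSystem_eq_kronecker (A : Op (Fin n)) :
    (onSystem A : Op (Register n a))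
      = (A ⊗ₖ (1 : Op (Fin a))).submatrix (regEquiv n a) (regEquiv n a) := by
  ext x y
  simp only [onSystem, Matrix.of_apply, Matrix.submatrix_apply, Matrix.kroneckerMap_apply,
    Matrix.one_apply, regEquiv, Equiv.sumArrowEquivProdArrow, Equiv.coe_fn_mk, mul_ite, mul_one,
    mul_zero]

lemma onSystem_mul (A B : Op (Fin n)) :
    (onSystem (A * B) : Op (Register n a)) = onSystem A * onSystem B := by
  rw [onSystem_eq_kronecker, onSystem_eq_kronecker, onSystem_eq_kronecker,
    Matrix.submatrix_mul_equiv, ← Matrix.mul_kronecker_mul, one_mul]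

lemma onSystem_one : (onSystem (1 : Op (Fin n)) : Op (Register n a)) = 1 := by
  rw [onSystem_eq_kronecker, Matrix.one_kronecker_one, Matrix.submatrix_one_equiv]

lemma onSystem_conjTranspose (A : Op (Fin n)) :
    (onSystem Aᴴ : Op (Register n a)) = (onSystem A)ᴴ := by
  rw [onSystem_eq_kronecker, onSystem_eq_kronecker, Matrix.conjTranspose_submatrix,
    Matrix.conjTranspose_kronecker, Matrix.conjTranspose_one]

/-- `onSystem` as a star-homomorphism. -/
def onSystemHom (n a : ℕ) : Op (Fin n) →⋆ₐ[ℂ] Op (Register n a) where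
  toFun := onSystem
  map_one' := onSystem_one
  map_mul' := onSystem_mul
  map_zero' := by ext x y; simp [onSystem]
  map_add' A B := by ext x y; simp only [onSystem, Matrix.of_apply, Matrix.add_apply]; split_ifs <;> simp
  commutes' z := by
    rw [Algebra.algebraMap_eq_smul_one, Algebra.algebraMap_eq_smul_one, ← onSystem_one]
    ext x y; simp only [onSystem, Matrix.of_apply, Matrix.smul_apply]; split_ifs <;> simp
  map_star' A := onSystem_conjTranspose A

lemma onSystemHom_apply (A : Op (Fin n)) : onSystemHom n a A = onSystem A := rfl

lemma onSystem_smul (z : ℂ) (A : Op (Fin n)) :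
    (onSystem (z • A) : Op (Register n a)) = z • onSystem A := map_smul (onSystemHom n a) z A

lemma onSystem_add (A B : Op (Fin n)) :
    (onSystem (A + B) : Op (Register n a)) = onSystem A + onSystem B := map_add (onSystemHom n a) A B

lemma onSystem_sum {ι : Type*} (s : Finset ι) (A : ι → Op (Fin n)) :
    (onSystem (∑ i ∈ s, A i) : Op (Register n a)) = ∑ i ∈ s, onSystem (A i) :=
  map_sum (onSystemHom n a) A s

lemma onQubit_inr_eq_kronecker (j : Fin a) (M : Matrix (Fin 2) (Fin 2) ℂ) :
    (onQubit (Sum.inr j) M : Op (Register n a))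
      = ((1 : Op (Fin n)) ⊗ₖ onQubit j M).submatrix (regEquiv n a) (regEquiv n a) := by
  ext x y
  simp only [onQubit, Matrix.of_apply, Matrix.submatrix_apply, Matrix.kroneckerMap_apply,
    Matrix.one_apply, regEquiv]
  simp only [Equiv.sumArrowEquivProdArrow, Equiv.coe_fn_mk]
  simp only [funext_iff, Sum.forall, ne_eq, reduceCtorEq, not_false_eq_true, Function.comp_apply,
    forall_true_left, Sum.inr.injEq, ite_mul, one_mul, zero_mul, ite_and]
  congr

lemma trivialOn_onSystem (j : Fin a) (A : Op (Fin n)) :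
    TrivialOn (Sum.inr j : Register n a) (onSystem A) := by
  intro M
  simp only [Commute, SemiconjBy, onQubit_inr_eq_kronecker, onSystem_eq_kronecker,
    Matrix.submatrix_mul_equiv, ← Matrix.mul_kronecker_mul, one_mul, mul_one]

open scoped Matrix.Norms.L2Operator

lemma norm_onSystem_le (A : Op (Fin n)) : ‖(onSystem A : Op (Register n a))‖ ≤ ‖A‖ :=
  NonUnitalStarAlgHom.norm_apply_le (onSystemHom n a) A

/-- The block `⟨0| Y |0⟩` of `Y` with all ancillas in the state `|0⟩`. -/
def compress (Y : Op (Register n a)) : Op (Fin n) :=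
  Matrix.of fun x y => Y (Sum.elim x 0) (Sum.elim y 0)

/-- The embedding of the system into the register with all ancillas in `|0⟩`. -/
def embed (n a : ℕ) : Matrix (Register n a → Fin 2) (Fin n → Fin 2) ℂ :=
  Matrix.of fun x y => if x = Sum.elim y 0 then 1 else 0

lemma compress_eq (Y : Op (Register n a)) : compress Y = (embed n a)ᴴ * Y * embed n a := by
  ext x y
  simp [compress, embed, Matrix.mul_apply, Matrix.conjTranspose_apply]

lemma embed_conjTranspose_mul : (embed n a)ᴴ * embed n a = 1 := by
  ext x y
  have h : ∀ x y : Fin n → Fin 2, (Sum.elim x 0 : Register n a → Fin 2) = Sum.elim y 0 ↔ x = y := by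
    intro x y
    constructor
    · intro h; ext1 i; exact congrFun h (Sum.inl i)
    · rintro rfl; rfl
  simp [embed, Matrix.mul_apply, Matrix.conjTranspose_apply, Matrix.one_apply, h, eq_comm]

lemma norm_compress_le (Y : Op (Register n a)) : ‖compress Y‖ ≤ ‖Y‖ := by
  have h : ‖embed n a‖ ≤ 1 := by
    have h1 : ‖embed n a‖ * ‖embed n a‖ ≤ 1 := by
      rw [← Matrix.l2_opNorm_conjTranspose_mul_self, embed_conjTranspose_mul]
      exact norm_le_one_of_unitary (by simp)
    nlinarith [norm_nonneg (embed n a)]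
  have h' : ‖(embed n a)ᴴ‖ ≤ 1 := by rwa [Matrix.l2_opNorm_conjTranspose]
  rw [compress_eq]
  calc _ ≤ ‖(embed n a)ᴴ * Y‖ * ‖embed n a‖ := Matrix.l2_opNorm_mul _ _
    _ ≤ ‖(embed n a)ᴴ‖ * ‖Y‖ * ‖embed n a‖ := by gcongr; exact Matrix.l2_opNorm_mul _ _
    _ ≤ 1 * ‖Y‖ * 1 := by gcongr
    _ = _ := by ring

lemma trace_onSystem_mul_initState (Y ρ : Op (Fin n)) :
    ((onSystem Y : Op (Register n a)) * signedSum (initState ρ)).trace = (Y * ρ).trace := by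
  have : signedSum (initState ρ : SignedState (Register n a))
      = (ρ ⊗ₖ (Matrix.single 0 0 1 : Op (Fin a))).submatrix (regEquiv n a) (regEquiv n a) := by
    ext x y
    simp only [signedSum, sum_units, initState]
    simp [regEquiv, Equiv.sumArrowEquivProdArrow, Matrix.single, eq_comm]
  rw [this, onSystem_eq_kronecker, Matrix.submatrix_mul_equiv, ← Matrix.mul_kronecker_mul, one_mul]
  have h2 : ∀ M : Matrix ((Fin n → Fin 2) × (Fin a → Fin 2)) ((Fin n → Fin 2) × (Fin a → Fin 2)) ℂ,
      (M.submatrix (regEquiv n a) (regEquiv n a)).trace = M.trace := by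
    intro M
    exact (regEquiv n a).sum_comp fun i => M i i
  rw [h2, Matrix.trace_kronecker]
  simp

end System

/-! ### The law of the number returned by one round -/

section Law

open MeasureTheory ProbabilityTheory
open scoped ComplexOrder

variable {Q : Type} [Fintype Q] [DecidableEq Q]

/-- The operators carried by the `unitary` instructions, which may be arbitrary, are unitary. -/
def ValidCircuit (c : Circuit Q) : Prop := ∀ U, Instr.unitary U ∈ c → Uᴴ * U = 1

lemma ValidCircuit.append {c d : Circuit Q} (hc : ValidCircuit c) (hd : ValidCircuit d) :
    ValidCircuit (c ++ d) := by
  intro U hU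
  rcases List.mem_append.mp hU with h | h
  · exact hc U h
  · exact hd U h

lemma projX_conjTranspose (r : ℤˣ) : (projX r)ᴴ = projX r := by
  rcases Int.units_eq_one_or r with rfl | rfl <;>
  · ext i j
    fin_cases i <;> fin_cases j <;> simp [projX, pauliMat, Matrix.conjTranspose_apply]

lemma projX_mul_self (r : ℤˣ) : projX r * projX r = projX r := by
  rcases Int.units_eq_one_or r with rfl | rfl <;>
  · ext i j
    fin_cases i <;> fin_cases j <;>
      simp [projX, pauliMat, Matrix.mul_apply, Fin.sum_univ_two] <;> norm_num

lemma projX_add : projX 1 + projX (-1) = 1 := by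
  ext i j
  fin_cases i <;> fin_cases j <;> simp [projX, pauliMat] <;> norm_num

lemma posSemidef_instr_apply {σ : SignedState Q} (h : ∀ s, (σ s).PosSemidef) (i : Instr Q)
    (s : ℤˣ) : (Instr.apply σ i s).PosSemidef := by
  cases i with
  | unitary U => exact (h s).mul_mul_conjTranspose_same U
  | reset i => exact Matrix.posSemidef_sum _ fun b _ => (h s).mul_mul_conjTranspose_same _
  | measureX i =>
    refine Matrix.posSemidef_sum _ fun r _ => ?_
    have := (h (r * s)).mul_mul_conjTranspose_same (onQubit i (projX r))
    rwa [onQubit_conjTranspose, projX_conjTranspose] at this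

lemma trace_total_instr_apply (σ : SignedState Q) {i : Instr Q}
    (hi : ∀ U, i = .unitary U → Uᴴ * U = 1) :
    ∑ s, (Instr.apply σ i s).trace = ∑ s, (σ s).trace := by
  have cyc : ∀ A B C : Op Q, (A * B * C).trace = (B * (C * A)).trace := by
    intro A B C
    rw [Matrix.trace_mul_comm, ← mul_assoc, Matrix.trace_mul_comm]
  cases i with
  | unitary U =>
    simp only [Instr.apply, cyc, hi U rfl, mul_one]
  | reset i =>
    simp only [Instr.apply, Matrix.trace_add, cyc, onQubit_conjTranspose, onQubit_mul,
      ketBra_conjTranspose, ketBra_mul, if_true, Fin.sum_univ_two]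
    simp only [← Matrix.trace_add, ← mul_add, ← onQubit_add, ketBra_add, onQubit_one, mul_one]
  | measureX i =>
    simp only [Instr.apply, Matrix.trace_add, cyc, onQubit_mul, projX_mul_self, sum_units,
      mul_one, mul_neg, neg_neg]
    have : ∀ A : Op Q, A.trace
        = (A * onQubit i (projX 1)).trace + (A * onQubit i (projX (-1))).trace := by
      intro A
      rw [← Matrix.trace_add, ← mul_add, ← onQubit_add, projX_add, onQubit_one, mul_one]
    rw [this (σ 1), this (σ (-1))]
    ring

lemma posSemidef_run {σ : SignedState Q} (h : ∀ s, (σ s).PosSemidef) (c : Circuit Q) (s : ℤˣ) :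
    (run c σ s).PosSemidef := by
  induction c generalizing σ with
  | nil => exact h s
  | cons i c ih => exact ih (σ := Instr.apply σ i) fun s => posSemidef_instr_apply h i s

lemma trace_total_run (σ : SignedState Q) {c : Circuit Q} (hc : ValidCircuit c) :
    ∑ s, (run c σ s).trace = ∑ s, (σ s).trace := by
  induction c generalizing σ with
  | nil => rfl
  | cons i c ih =>
    have : run (i :: c) σ = run c (Instr.apply σ i) := rfl
    rw [this, ih _ fun U hU => hc U (List.mem_cons_of_mem _ hU), trace_total_instr_apply]
    rintro U rfl
    exact hc U (by simp)

variable {n a : ℕ}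

lemma posSemidef_initState {ρ : Op (Fin n)} (hρ : ρ.PosSemidef) (s : ℤˣ) :
    (initState ρ s : Op (Register n a)).PosSemidef := by
  unfold initState
  split_ifs with h
  · have : (Matrix.of fun x y : Register n a → Fin 2 => if x ∘ Sum.inr = 0 ∧ y ∘ Sum.inr = 0 then
        ρ (x ∘ Sum.inl) (y ∘ Sum.inl) else 0) = embed n a * ρ * (embed n a)ᴴ := by
      have key : ∀ (x : Register n a → Fin 2) (u : Fin n → Fin 2),
          x = Sum.elim u 0 ↔ x ∘ Sum.inr = 0 ∧ u = x ∘ Sum.inl := by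
        intro x u
        constructor
        · rintro rfl; exact ⟨by ext; simp, by ext; simp⟩
        · rintro ⟨h1, rfl⟩
          ext i
          rcases i with i | i
          · simp
          · have := congrFun h1 i
            simp at this
            simp [this]
      ext x y
      simp only [Matrix.of_apply, Matrix.mul_apply, embed, Matrix.conjTranspose_apply, key]
      by_cases h1 : x ∘ Sum.inr = 0 <;> by_cases h2 : y ∘ Sum.inr = 0 <;> simp [h1, h2]
    rw [this]
    exact hρ.mul_mul_conjTranspose_same _
  · exact Matrix.PosSemidef.zero

lemma trace_total_initState (ρ : Op (Fin n)) :
    ∑ s, (initState ρ s : Op (Register n a)).trace = ρ.trace := by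
  have := trace_onSystem_mul_initState (a := a) 1 ρ
  rw [onSystem_one, one_mul, one_mul] at this
  rw [← this, signedSum, Matrix.trace_sum]
  simp [sum_units, initState]

variable {O : Op (Fin n)} (hO : O.IsHermitian)

lemma diagonal_eq_sum_single {ι : Type*} [Fintype ι] [DecidableEq ι] (d : ι → ℂ) :
    Matrix.diagonal d = ∑ i, Matrix.single i i (d i) := by
  ext x y
  simp only [Matrix.sum_apply, Matrix.single, Matrix.of_apply, Matrix.diagonal_apply]
  by_cases h : x = y
  · subst h; simp
  · rw [if_neg h, Finset.sum_eq_zero]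
    rintro i -
    rw [if_neg]
    rintro ⟨rfl, rfl⟩
    exact h rfl

lemma eigenProj_apply (j x y : Fin n → Fin 2) :
    eigenProj hO j x y = (hO.eigenvectorUnitary : Op (Fin n)) x j
      * star ((hO.eigenvectorUnitary : Op (Fin n)) y j) := by
  rw [Matrix.IsHermitian.eigenvectorUnitary_apply, Matrix.IsHermitian.eigenvectorUnitary_apply]
  rfl

lemma eigenProj_eq (j : Fin n → Fin 2) :
    eigenProj hO j = (hO.eigenvectorUnitary : Op (Fin n)) * Matrix.single j j 1
      * (hO.eigenvectorUnitary : Op (Fin n))ᴴ := by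
  ext x y
  rw [eigenProj_apply, Matrix.mul_apply, Finset.sum_eq_single j]
  · simp [Matrix.conjTranspose_apply]
  · intro k _ hk
    rw [Matrix.mul_single_apply_of_ne _ _ _ _ _ (by simpa using hk)]
    simp
  · simp

lemma sum_eigenProj : ∑ j, eigenProj hO j = 1 := by
  simp only [eigenProj_eq, ← Finset.sum_mul, ← Finset.mul_sum]
  have : ∑ j : Fin n → Fin 2, Matrix.single j j (1 : ℂ) = 1 := by
    rw [← Matrix.diagonal_one, diagonal_eq_sum_single]
  rw [this, mul_one]
  exact Unitary.coe_mul_star_self hO.eigenvectorUnitary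

lemma sum_eigenvalues_smul_eigenProj : ∑ j, (hO.eigenvalues j : ℂ) • eigenProj hO j = O := by
  conv_rhs => rw [hO.spectral_theorem]
  have : ∀ j, (hO.eigenvalues j : ℂ) • eigenProj hO j = (hO.eigenvectorUnitary : Op (Fin n))
      * Matrix.single j j (hO.eigenvalues j : ℂ) * (hO.eigenvectorUnitary : Op (Fin n))ᴴ := by
    intro j
    rw [eigenProj_eq, ← Matrix.smul_mul, ← Matrix.mul_smul, Matrix.smul_single, smul_eq_mul, mul_one]
  simp only [this, ← Finset.sum_mul, ← Finset.mul_sum]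
  rw [Unitary.conjStarAlgAut_apply, diagonal_eq_sum_single]
  rfl

lemma eigenProj_posSemidef (j : Fin n → Fin 2) : (eigenProj hO j).PosSemidef :=
  Matrix.posSemidef_vecMulVec_self_star _

lemma eigenProj_mul_self (j : Fin n → Fin 2) : eigenProj hO j * eigenProj hO j = eigenProj hO j := by
  have : (hO.eigenvectorUnitary : Op (Fin n))ᴴ * (hO.eigenvectorUnitary : Op (Fin n)) = 1 :=
    Unitary.coe_star_mul_self hO.eigenvectorUnitary
  simp only [eigenProj_eq]
  calc _ = (hO.eigenvectorUnitary : Op (Fin n)) * Matrix.single j j 1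
      * ((hO.eigenvectorUnitary : Op (Fin n))ᴴ * (hO.eigenvectorUnitary : Op (Fin n)))
      * Matrix.single j j 1 * (hO.eigenvectorUnitary : Op (Fin n))ᴴ := by simp only [mul_assoc]
    _ = (hO.eigenvectorUnitary : Op (Fin n)) * (Matrix.single j j 1 * Matrix.single j j 1)
      * (hO.eigenvectorUnitary : Op (Fin n))ᴴ := by rw [this]; simp only [mul_assoc, mul_one]
    _ = _ := by rw [Matrix.single_mul_single_same, one_mul]

open scoped Matrix.Norms.L2Operator in
lemma abs_eigenvalues_le_opNorm (j : Fin n → Fin 2) : |hO.eigenvalues j| ≤ opNorm O := by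
  have h := Matrix.l2_opNorm_mulVec O (hO.eigenvectorBasis j)
  rw [hO.mulVec_eigenvectorBasis] at h
  have h1 : ‖hO.eigenvectorBasis j‖ = 1 := hO.eigenvectorBasis.orthonormal.1 j
  have h2 : WithLp.toLp 2 (hO.eigenvalues j • (hO.eigenvectorBasis j : (Fin n → Fin 2) → ℂ))
      = hO.eigenvalues j • hO.eigenvectorBasis j := rfl
  have h3 : ‖WithLp.toLp 2 (hO.eigenvalues j • (hO.eigenvectorBasis j : (Fin n → Fin 2) → ℂ))‖
      = |hO.eigenvalues j| := by
    rw [h2, norm_smul, h1, mul_one, Real.norm_eq_abs]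
  rw [← h3]
  refine h.trans ?_
  rw [h1, mul_one]
  exact le_of_eq rfl

/-- Probabilities of the measurement outcomes are nonnegative reals. -/
lemma trace_eigenProj_mul_nonneg {σ : Op (Register n a)} (h : σ.PosSemidef) (j : Fin n → Fin 2) :
    0 ≤ (onSystem (eigenProj hO j) * σ).trace := by
  have h1 := (h.mul_mul_conjTranspose_same (onSystem (eigenProj hO j))).trace_nonneg
  rwa [← onSystem_conjTranspose, (eigenProj_posSemidef hO j).isHermitian.eq, Matrix.trace_mul_comm,
    ← mul_assoc, ← onSystem_mul, eigenProj_mul_self] at h1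

lemma sum_list_measure_apply {ι : Type*} (l : List ι) (ν : ι → Measure ℝ) (s : Set ℝ) :
    (l.map ν).sum s = (l.map fun t => ν t s).sum := by
  induction l with
  | nil => simp
  | cons t l ih => simp [ih]

lemma integral_list_sum {ι : Type*} (l : List ι) (ν : ι → Measure ℝ)
    (h : ∀ t ∈ l, Integrable (fun x : ℝ => x) (ν t)) :
    Integrable (fun x : ℝ => x) (l.map ν).sum ∧
      ∫ x, x ∂(l.map ν).sum = (l.map fun t => ∫ x, x ∂(ν t)).sum := by
  induction l with
  | nil => simp
  | cons t l ih =>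
    obtain ⟨h1, h2⟩ := ih fun t ht => h t (by simp [ht])
    have h3 := h t (by simp)
    simp only [List.map_cons, List.sum_cons]
    exact ⟨h3.add_measure h1, by rw [integral_add_measure h3 h1, h2]⟩

/-- The law of the outcome of a circuit sampled with probability `p`. -/
def circuitLaw (p μ : ℝ) (c : Circuit (Register n a)) (ρ : Op (Fin n)) : Measure ℝ :=
  ∑ s : ℤˣ, ∑ j : Fin n → Fin 2,
    ENNReal.ofReal (p * (onSystem (eigenProj hO j) * run c (initState ρ) s).trace.re) •
      Measure.dirac (μ * ((s : ℤ) : ℝ) * hO.eigenvalues j)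

lemma sampleLaw_eq (F : LCS (Register n a)) (ρ : Op (Fin n)) :
    sampleLaw F ρ hO = (F.map fun t => circuitLaw hO (t.1 / F.mu) F.mu t.2 ρ).sum := rfl

variable {ρ : Op (Fin n)} (hρ : IsState ρ)
include hρ

/-- A circuit sampled with probability `p` contributes the total mass `p`: its outcome probabilities
add up to one. -/
lemma circuitLaw_univ {p : ℝ} (hp : 0 ≤ p) (μ : ℝ) {c : Circuit (Register n a)}
    (hc : ValidCircuit c) : circuitLaw hO p μ c ρ Set.univ = ENNReal.ofReal p := by
  have hnn := fun s j => trace_eigenProj_mul_nonneg hO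
    (posSemidef_run (posSemidef_initState (a := a) hρ.1) c s) j
  have hre : ∀ s j, 0 ≤ p * (onSystem (eigenProj hO j) * run c (initState ρ) s).trace.re :=
    fun s j => mul_nonneg hp (Complex.nonneg_iff.mp (hnn s j)).1
  simp only [circuitLaw, Measure.coe_finsetSum, Finset.sum_apply, Measure.smul_apply,
    Measure.dirac_apply_of_mem (Set.mem_univ _), smul_eq_mul, mul_one]
  have h1 : ∀ s ∈ (Finset.univ : Finset ℤˣ), ∑ j : Fin n → Fin 2, ENNReal.ofReal (p * (onSystem (eigenProj hO j) * run c (initState ρ) s).trace.re) = ENNReal.ofReal (∑ j, p * (onSystem (eigenProj hO j) * run c (initState ρ) s).trace.re) :=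
    fun s _ => (ENNReal.ofReal_sum_of_nonneg fun j _ => hre s j).symm
  rw [Finset.sum_congr rfl h1,
    ← ENNReal.ofReal_sum_of_nonneg fun s _ => Finset.sum_nonneg fun j _ => hre s j]
  congr 1
  simp only [← Finset.mul_sum]
  have h2 : ∑ s : ℤˣ, ∑ j, (onSystem (eigenProj hO j) * run c (initState ρ) s).trace = 1 := by
    have : ∀ s, ∑ j, (onSystem (eigenProj hO j) * run c (initState ρ) s).trace
        = (run c (initState ρ) s : Op (Register n a)).trace := by
      intro s
      rw [← Matrix.trace_sum, ← Finset.sum_mul, ← onSystem_sum, sum_eigenProj, onSystem_one,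
        one_mul]
    simp only [this]
    rw [trace_total_run _ hc, trace_total_initState, hρ.2]
  have h3 := congrArg Complex.re h2
  simp only [Complex.re_sum, Complex.one_re] at h3
  rw [h3, mul_one]

/-- The mean of the signed outcome of a circuit, in the Heisenberg picture. -/
lemma circuitLaw_mean {p : ℝ} (hp : 0 ≤ p) (μ : ℝ) (c : Circuit (Register n a)) :
    Integrable (fun x : ℝ => x) (circuitLaw hO p μ c ρ) ∧
    ((∫ x, x ∂(circuitLaw hO p μ c ρ) : ℝ) : ℂ)
      = p * μ * (circuitDual c (onSystem O) * signedSum (initState ρ)).trace := by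
  have hnn := fun s j => trace_eigenProj_mul_nonneg hO
    (posSemidef_run (posSemidef_initState (a := a) hρ.1) c s) j
  have hint : ∀ (s : ℤˣ) j, Integrable (fun x : ℝ => x)
      (ENNReal.ofReal (p * (onSystem (eigenProj hO j) * run c (initState ρ) s).trace.re) •
      Measure.dirac (μ * ((s : ℤ) : ℝ) * hO.eigenvalues j)) :=
    fun s j => (integrable_dirac enorm_lt_top).smul_measure ENNReal.ofReal_ne_top
  have hint' : ∀ s : ℤˣ, Integrable (fun x : ℝ => x) (∑ j : Fin n → Fin 2,
      ENNReal.ofReal (p * (onSystem (eigenProj hO j) * run c (initState ρ) s).trace.re) •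
      Measure.dirac (μ * ((s : ℤ) : ℝ) * hO.eigenvalues j)) :=
    fun s => integrable_finsetSum_measure.mpr fun j _ => hint s j
  refine ⟨integrable_finsetSum_measure.mpr fun s _ => hint' s, ?_⟩
  unfold circuitLaw
  rw [integral_finsetSum_measure fun s _ => hint' s]
  simp only [integral_finsetSum_measure fun j _ => hint _ j, integral_smul_measure,
    integral_dirac, smul_eq_mul]
  have h1 : ∀ (s : ℤˣ) j, ((ENNReal.ofReal (p * (onSystem (eigenProj hO j) *
      run c (initState ρ) s).trace.re)).toReal : ℂ)
      = p * (onSystem (eigenProj hO j) * run c (initState ρ) s).trace := by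
    intro s j
    obtain ⟨h1, h2⟩ := Complex.nonneg_iff.mp (hnn s j)
    rw [ENNReal.toReal_ofReal (mul_nonneg hp h1), Complex.ofReal_mul]
    congr 1
    exact Complex.ext rfl (by simpa using h2)
  push_cast
  simp only [h1]
  rw [← trace_run, signedSum, Finset.mul_sum, Matrix.trace_sum, Finset.mul_sum]
  refine Finset.sum_congr rfl fun s _ => ?_
  conv_rhs => rw [← sum_eigenvalues_smul_eigenProj hO]
  rw [onSystem_sum, Finset.sum_mul, Matrix.trace_sum, Finset.mul_sum]
  refine Finset.sum_congr rfl fun j _ => ?_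
  simp only [onSystem_smul, Matrix.smul_mul, Matrix.mul_smul, Matrix.trace_smul, smul_eq_mul]
  ring

lemma sampleLaw_isProbabilityMeasure {F : LCS (Register n a)} (h0 : ∀ t ∈ F, 0 ≤ t.1)
    (hμ : 0 < F.mu) (hv : ∀ t ∈ F, ValidCircuit t.2) :
    IsProbabilityMeasure (sampleLaw F ρ hO) := by
  constructor
  rw [sampleLaw_eq, sum_list_measure_apply]
  have h1 : (F.map fun t => circuitLaw hO (t.1 / F.mu) F.mu t.2 ρ Set.univ)
      = F.map fun t => ENNReal.ofReal (t.1 / F.mu) :=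
    List.map_congr_left fun t ht =>
      circuitLaw_univ hO hρ (div_nonneg (h0 t ht) hμ.le) _ (hv t ht)
  rw [h1]
  have h2 : ∀ G : LCS (Register n a), (∀ t ∈ G, 0 ≤ t.1) →
      (G.map fun t => ENNReal.ofReal (t.1 / F.mu)).sum = ENNReal.ofReal (G.mu / F.mu) ∧
      0 ≤ G.mu := by
    intro G
    induction G with
    | nil => simp [LCS.mu]
    | cons t G ih =>
      intro h
      obtain ⟨i1, i2⟩ := ih fun t ht => h t (by simp [ht])
      have ht := h t (by simp)
      have e : LCS.mu (t :: G) = t.1 + LCS.mu G := by simp [LCS.mu]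
      rw [List.map_cons, List.sum_cons, i1, e, add_div,
        ENNReal.ofReal_add (div_nonneg ht hμ.le) (div_nonneg i2 hμ.le)]
      exact ⟨rfl, by positivity⟩
  rw [(h2 F h0).1, div_self hμ.ne', ENNReal.ofReal_one]

/-- The mean of one round is the expectation of the observable transformed by the formula: the
weight `μ` cancels the normalization of the sampling probabilities. -/
lemma sampleLaw_mean {F : LCS (Register n a)} (h0 : ∀ t ∈ F, 0 ≤ t.1) (hμ : 0 < F.mu) :
    ((∫ x, x ∂(sampleLaw F ρ hO) : ℝ) : ℂ)
      = (F.dual (onSystem O) * signedSum (initState ρ)).trace := by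
  have hm := fun t (ht : t ∈ F) =>
    circuitLaw_mean hO hρ (div_nonneg (h0 t ht) hμ.le) F.mu t.2
  rw [sampleLaw_eq, (integral_list_sum F _ fun t ht => (hm t ht).1).2]
  have h1 : (((F.map fun t => ∫ x, x ∂(circuitLaw hO (t.1 / F.mu) F.mu t.2 ρ)).sum : ℝ) : ℂ)
      = (F.map fun t => (t.1 : ℂ) * (circuitDual t.2 (onSystem O)
          * signedSum (initState ρ)).trace).sum := by
    rw [← Complex.ofRealHom_eq_coe, map_list_sum, List.map_map]
    congr 1
    refine List.map_congr_left fun t ht => ?_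
    simp only [Function.comp_apply, Complex.ofRealHom_eq_coe, (hm t ht).2]
    have : (F.mu : ℂ) ≠ 0 := by exact_mod_cast hμ.ne'
    push_cast
    rw [div_mul_cancel₀ _ this]
  rw [h1, LCS.dual]
  clear h1 hm h0 hμ
  induction F with
  | nil => simp
  | cons t F ih =>
    simp only [List.map_cons, List.sum_cons, ih, LinearMap.add_apply, LinearMap.smul_apply,
      add_mul, Matrix.trace_add, Matrix.smul_mul, Matrix.trace_smul, smul_eq_mul]

omit hρ in
lemma sampleLaw_ae_mem_Icc {F : LCS (Register n a)} (hμ : 0 < F.mu) :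
    ∀ᵐ x ∂(sampleLaw F ρ hO), x ∈ Set.Icc (-(F.mu * opNorm O)) (F.mu * opNorm O) := by
  have hval : ∀ (s : ℤˣ) j, F.mu * ((s : ℤ) : ℝ) * hO.eigenvalues j
      ∈ Set.Icc (-(F.mu * opNorm O)) (F.mu * opNorm O) := by
    intro s j
    rw [Set.mem_Icc, ← abs_le, abs_mul, abs_mul, abs_of_pos hμ]
    have : |((s : ℤ) : ℝ)| = 1 := by
      rcases Int.units_eq_one_or s with rfl | rfl <;> simp
    rw [this, mul_one]
    exact mul_le_mul_of_nonneg_left (abs_eigenvalues_le_opNorm hO j) hμ.le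
  rw [ae_iff, sampleLaw_eq, sum_list_measure_apply]
  refine List.sum_eq_zero fun x hx => ?_
  obtain ⟨t, _, rfl⟩ := List.mem_map.mp hx
  have hms : MeasurableSet {a : ℝ | ¬ a ∈ Set.Icc (-(F.mu * opNorm O)) (F.mu * opNorm O)} :=
    measurableSet_Icc.compl
  simp only [circuitLaw, Measure.coe_finsetSum, Finset.sum_apply, Measure.smul_apply]
  refine Finset.sum_eq_zero fun s _ => Finset.sum_eq_zero fun j _ => ?_
  rw [Measure.dirac_apply' _ hms, Set.indicator_of_notMem, smul_zero]
  rw [Set.mem_ofPred_eq, not_not]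
  exact hval s j

end Law

/-! ### Concentration of the average of independent rounds -/

section Hoeffding

open MeasureTheory ProbabilityTheory

lemma pi_ae_forall {N : ℕ} (ν : Measure ℝ) [IsProbabilityMeasure ν] {p : ℝ → Prop}
    (h : ∀ᵐ x ∂ν, p x) : ∀ᵐ y ∂(Measure.pi fun _ : Fin N => ν), ∀ i, p (y i) :=
  ae_all_iff.mpr fun i => (Measure.quasiMeasurePreserving_eval (fun _ : Fin N => ν) i).ae h

/-- Hoeffding's inequality for the average of `N` independent copies of a random variable with
values in `[-b, b]`. -/
lemma hoeffding_average {N : ℕ} (ν : Measure ℝ) [IsProbabilityMeasure ν] {b t δ : ℝ} (hb : 0 < b)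
    (ht : 0 < t) (hδ : 0 < δ) (hν : ∀ᵐ x ∂ν, x ∈ Set.Icc (-b) b) (hN : 0 < N)
    (h : 2 * b ^ 2 * Real.log (2 / δ) ≤ N * t ^ 2) :
    1 - δ ≤ (Measure.pi fun _ : Fin N => ν).real
      {y | |(∑ i, y i) / N - ∫ x, x ∂ν| ≤ t} := by
  set P := Measure.pi fun _ : Fin N => ν with hP
  set m := ∫ x, x ∂ν with hm
  have hN' : (0 : ℝ) < N := by exact_mod_cast hN
  have hsub : HasSubgaussianMGF (fun x : ℝ => x - m) ((‖b - -b‖₊ / 2) ^ 2) ν :=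
    hasSubgaussianMGF_of_mem_Icc aemeasurable_id hν
  have hc : (((‖b - -b‖₊ / 2) ^ 2 : NNReal) : ℝ) = b ^ 2 := by
    push_cast
    rw [Real.norm_eq_abs, abs_of_pos (by linarith)]
    ring
  have hX : ∀ i : Fin N, HasSubgaussianMGF (fun y : Fin N → ℝ => y i - m)
      ((‖b - -b‖₊ / 2) ^ 2) P := by
    intro i
    have hmap : Measure.map (fun y : Fin N → ℝ => y i) P = ν :=
      (measurePreserving_eval (fun _ : Fin N => ν) i).map_eq
    refine HasSubgaussianMGF.of_map (X := fun x : ℝ => x - m) (Y := fun y : Fin N → ℝ => y i)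
      (measurable_pi_apply i).aemeasurable ?_
    rw [hmap]; exact hsub
  have hindep : iIndepFun (fun (i : Fin N) (y : Fin N → ℝ) => y i - m) P :=
    iIndepFun_pi (X := fun _ x => x - m) fun _ => (measurable_id.sub_const m).aemeasurable
  have hindep' : iIndepFun (fun (i : Fin N) (y : Fin N → ℝ) => -(y i - m)) P :=
    iIndepFun_pi (X := fun _ x => -(x - m)) fun _ => (measurable_id.sub_const m).neg.aemeasurable
  have hbound : Real.exp (-(N * t) ^ 2 / (2 * (∑ _i ∈ (Finset.univ : Finset (Fin N)),
      ((‖b - -b‖₊ / 2) ^ 2 : NNReal) : NNReal))) ≤ δ / 2 := by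
    rw [NNReal.coe_sum, hc]
    simp only [Finset.sum_const, Finset.card_univ, Fintype.card_fin, nsmul_eq_mul]
    rw [← Real.le_log_iff_exp_le (by positivity)]
    have h1 : Real.log (δ / 2) = - Real.log (2 / δ) := by rw [← Real.log_inv, inv_div]
    rw [h1, div_le_iff₀ (by positivity)]
    nlinarith
  -- each of the two one-sided deviations has probability at most `δ / 2`
  have h1 : P.real {y | (N * t : ℝ) ≤ ∑ i, (y i - m)} ≤ δ / 2 :=
    (HasSubgaussianMGF.measure_sum_ge_le_of_iIndepFun hindep (s := Finset.univ)
      (fun i _ => hX i) (by positivity)).trans hbound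
  have h2 : P.real {y | (N * t : ℝ) ≤ ∑ i, -(y i - m)} ≤ δ / 2 :=
    (HasSubgaussianMGF.measure_sum_ge_le_of_iIndepFun hindep' (s := Finset.univ)
      (fun i _ => (hX i).neg) (by positivity)).trans hbound
  have hcompl : {y : Fin N → ℝ | |(∑ i, y i) / N - m| ≤ t}ᶜ
      ⊆ {y | (N * t : ℝ) ≤ ∑ i, (y i - m)} ∪ {y | (N * t : ℝ) ≤ ∑ i, -(y i - m)} := by
    intro y hy
    simp only [Set.mem_compl_iff, Set.mem_ofPred_eq, not_le] at hy
    have hs : ∑ i, (y i - m) = N * ((∑ i, y i) / N - m) := by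
      simp only [Finset.sum_sub_distrib, Finset.sum_const, Finset.card_univ, Fintype.card_fin,
        nsmul_eq_mul]
      field_simp
    simp only [Set.mem_union, Set.mem_ofPred_eq, Finset.sum_neg_distrib, hs, ← mul_neg]
    rcases lt_abs.mp hy with h | h
    · left; gcongr
    · right; gcongr
  have hmeas : MeasurableSet {y : Fin N → ℝ | |(∑ i, y i) / N - m| ≤ t} := by
    apply measurableSet_le _ measurable_const
    fun_prop
  have h3 : P.real {y : Fin N → ℝ | |(∑ i, y i) / N - m| ≤ t}ᶜ ≤ δ :=
    (measureReal_mono hcompl).trans ((measureReal_union_le _ _).trans (by linarith))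
  rw [probReal_compl_eq_one_sub hmeas] at h3
  linarith

end Hoeffding

/-! ### Gate counts -/

section Gates

variable {Q : Type} [Fintype Q] [DecidableEq Q]

/-- `U` is a product of at most `k` elementary gates. -/
def Realizable (U : Op Q) (k : ℕ) : Prop :=
  ∃ gs : List (Gate Q), (gs.map Gate.toOp).prod = U ∧ gs.length ≤ k

lemma Realizable.gateCount_le {U : Op Q} {k : ℕ} (h : Realizable U k) : gateCount U ≤ k := by
  obtain ⟨gs, h1, h2⟩ := h
  unfold gateCount
  refine (iInf₂_le gs h1).trans ?_
  exact_mod_cast h2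

lemma Realizable.mono {U : Op Q} {k l : ℕ} (h : Realizable U k) (hkl : k ≤ l) : Realizable U l :=
  let ⟨gs, h1, h2⟩ := h; ⟨gs, h1, h2.trans hkl⟩

lemma Realizable.mul {U V : Op Q} {k l : ℕ} (hU : Realizable U k) (hV : Realizable V l) :
    Realizable (U * V) (k + l) := by
  obtain ⟨gs, h1, h2⟩ := hU
  obtain ⟨hs, h3, h4⟩ := hV
  exact ⟨gs ++ hs, by simp [h1, h3], by simp; omega⟩

lemma Realizable.one : Realizable (1 : Op Q) 0 := ⟨[], by simp, by simp⟩

lemma realizable_onQubit (i : Q) {U : Matrix (Fin 2) (Fin 2) ℂ} (hU : Uᴴ * U = 1) :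
    Realizable (onQubit i U) 1 :=
  ⟨[Gate.single i ⟨U, Matrix.mem_unitaryGroup_iff'.mpr hU⟩], by simp [Gate.toOp], by simp⟩

/-- The operator acting as `V` if the qubit `c` is in the state `0`, and as `U` if it is in the
state `1`. -/
def select (c : Q) (V U : Op Q) : Op Q := onQubit c (ketBra 0 0) * V + onQubit c (ketBra 1 1) * U

lemma controlled_one_eq_select (c : Q) (U : Op Q) : controlled c 1 U = select c 1 U := by
  rw [controlled_one_eq, select, add_comm]

lemma controlled_zero_eq_select (c : Q) (U : Op Q) : controlled c 0 U = select c U 1 :=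
  controlled_zero_eq c U

lemma select_self (c : Q) (U : Op Q) : select c U U = U := by
  rw [select, ← add_mul, ← onQubit_add, ketBra_add, onQubit_one, one_mul]

lemma select_mul {c : Q} {V U : Op Q} (hV : TrivialOn c V) (hU : TrivialOn c U) (V' U' : Op Q) :
    select c V U * select c V' U' = select c (V * V') (U * U') := by
  have s := fun A B X (hX : TrivialOn c X) Y =>
    TrivialOn.sandwich_mul hX (TrivialOn.one (c := c)) A 1 B Y
  simp only [onQubit_one, mul_one] at s
  simp only [select, add_mul, mul_add, s _ _ _ hV, s _ _ _ hU, ketBra_mul]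
  simp [onQubit_zero]

lemma select_conjTranspose {c : Q} {V U : Op Q} (hV : TrivialOn c V) (hU : TrivialOn c U) :
    (select c V U)ᴴ = select c Vᴴ Uᴴ := by
  rw [select, Matrix.conjTranspose_add, hV.conjTranspose_onQubit_mul, hU.conjTranspose_onQubit_mul,
    ketBra_conjTranspose, ketBra_conjTranspose, select]

lemma select_unitary {c : Q} {V U : Op Q} (hV : TrivialOn c V) (hU : TrivialOn c U)
    (hV' : Vᴴ * V = 1) (hU' : Uᴴ * U = 1) : (select c V U)ᴴ * select c V U = 1 := by
  rw [select_conjTranspose hV hU, select_mul hV.conjTranspose hU.conjTranspose, hV', hU',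
    select_self]

lemma trivialOn_onQubit {c t : Q} (h : c ≠ t) (M : Matrix (Fin 2) (Fin 2) ℂ) :
    TrivialOn c (onQubit t M) := fun _ => onQubit_commute h _ _

/-- A gate conjugated by a single-qubit unitary is controlled by controlling the gate alone. -/
lemma realizable_select_conj {c t : Q} (h : c ≠ t) {v : Matrix (Fin 2) (Fin 2) ℂ}
    (hv : vᴴ * v = 1) (hv' : v * vᴴ = 1) (M : Matrix (Fin 2) (Fin 2) ℂ) {k : ℕ}
    (hk : Realizable (select c 1 (onQubit t M)) k) :
    Realizable (select c 1 (onQubit t (v * M * vᴴ))) (1 + k + 1) := by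
  have h1 : select c 1 (onQubit t (v * M * vᴴ))
      = onQubit t v * select c 1 (onQubit t M) * onQubit t vᴴ := by
    rw [← select_self c (onQubit t v), ← select_self c (onQubit t vᴴ),
      select_mul (trivialOn_onQubit h _) (trivialOn_onQubit h _),
      select_mul ((trivialOn_onQubit h _).mul TrivialOn.one)
        ((trivialOn_onQubit h _).mul (trivialOn_onQubit h _)),
      onQubit_mul, mul_one, onQubit_mul, onQubit_mul, hv', onQubit_one]
  rw [h1]
  exact ((realizable_onQubit t hv).mul hk).mul (realizable_onQubit t (by simpa using hv'))

lemma exists_conj_pauliX {a : Fin 4} (ha : a ≠ 0) :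
    ∃ v : Matrix (Fin 2) (Fin 2) ℂ, vᴴ * v = 1 ∧ v * pauliMat 1 * vᴴ = pauliMat a := by
  have h2 : ((Real.sqrt 2 : ℝ) : ℂ)⁻¹ * ((Real.sqrt 2 : ℝ) : ℂ)⁻¹ = 2⁻¹ := by
    rw [← mul_inv, ← Complex.ofReal_mul, Real.mul_self_sqrt (by norm_num)]; simp
  fin_cases a
  · exact absurd rfl ha
  · exact ⟨1, by simp, by simp⟩
  · refine ⟨!![1, 0; 0, Complex.I], ?_, ?_⟩ <;>
    · ext i j
      fin_cases i <;> fin_cases j <;>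
        simp [pauliMat, Matrix.mul_apply, Fin.sum_univ_two, Matrix.conjTranspose_apply]
  · refine ⟨hadamard, ?_, ?_⟩ <;>
    · ext i j
      fin_cases i <;> fin_cases j <;>
        simp [hadamard, pauliMat, Matrix.mul_apply, Fin.sum_univ_two, Matrix.conjTranspose_apply,
          h2] <;> norm_num

lemma realizable_select_pauliMat {c t : Q} (h : c ≠ t) (a : Fin 4) :
    Realizable (select c 1 (onQubit t (pauliMat a))) 3 := by
  by_cases ha : a = 0
  · subst ha
    rw [pauliMat_zero, onQubit_one, select_self]
    exact Realizable.one.mono (by norm_num)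
  · obtain ⟨v, hv, hva⟩ := exists_conj_pauliX ha
    rw [← hva]
    refine realizable_select_conj h hv (mul_eq_one_comm.mp hv) _ (k := 1) ?_
    refine ⟨[Gate.cnot c t h], ?_, by simp⟩
    simp [Gate.toOp, controlled_one_eq_select]

lemma pauliOp_eq_onQubit_mul {γ δ : PauliString Q} {i : Q} (hi : δ i = 0)
    (h : ∀ j, j ≠ i → γ j = δ j) : pauliOp γ = onQubit i (pauliMat (γ i)) * pauliOp δ := by
  rw [onQubit_eq_tensorOp, pauliOp_eq_tensorOp, pauliOp_eq_tensorOp, tensorOp_mul]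
  congr 1; ext1 j
  by_cases hj : j = i
  · subst hj; simp [hi, pauliMat_zero]
  · simp [Function.update_of_ne hj, h j hj]

/-- A controlled Pauli string is a product of controlled Pauli matrices, one for each qubit in its
support. -/
lemma realizable_select_pauliOp {c : Q} {γ : PauliString Q} (hc : γ c = 0) :
    Realizable (select c 1 (pauliOp γ)) (3 * weight γ) := by
  have key : ∀ s : Finset Q, c ∉ s →
      Realizable (select c 1 (pauliOp (s.piecewise γ 0))) (3 * s.card) := by
    intro s
    induction s using Finset.induction_on with
    | empty =>
      intro _
      rw [Finset.piecewise_empty, pauliOp_zero, select_self]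
      exact Realizable.one
    | insert i s hi ih =>
      intro hcs
      have hci : c ≠ i := fun h => hcs (by simp [h])
      have h1 := ih fun h => hcs (by simp [h])
      rw [pauliOp_eq_onQubit_mul (δ := s.piecewise γ 0) (i := i) (by simp [hi])
        (fun j hj => by simp [Finset.piecewise, hj]), ← one_mul (1 : Op Q),
        ← select_mul TrivialOn.one (trivialOn_onQubit hci _), Finset.card_insert_of_notMem hi]
      exact ((realizable_select_pauliMat hci _).mul h1).mono (by omega)
  have h1 := key (Finset.univ.filter fun i => γ i ≠ 0) (by simp [hc])
  have h2 : (Finset.univ.filter fun i => γ i ≠ 0).piecewise γ 0 = γ := by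
    ext1 i
    by_cases h : γ i = 0 <;> simp [Finset.piecewise, h]
  rwa [h2] at h1

lemma onQubit_unitary {i : Q} {U : Matrix (Fin 2) (Fin 2) ℂ} (hU : Uᴴ * U = 1) :
    (onQubit i U)ᴴ * onQubit i U = 1 := by
  rw [onQubit_conjTranspose, onQubit_mul, hU, onQubit_one]

lemma smul_one_unitary {ι : Type*} [Fintype ι] [DecidableEq ι] {z : ℂ} (hz : ‖z‖ = 1)
    {U : Matrix ι ι ℂ} (hU : Uᴴ * U = 1) : (z • U)ᴴ * (z • U) = 1 := by
  rw [Matrix.conjTranspose_smul, smul_mul_smul_comm, hU]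
  have : star z * z = 1 := by
    rw [Complex.star_def, ← Complex.normSq_eq_conj_mul_self, Complex.normSq_eq_norm_sq, hz]; simp
  rw [this, one_smul]

lemma pauliRot_mul (θ θ' : ℝ) (γ : PauliString Q) :
    pauliRot θ γ * pauliRot θ' γ = pauliRot (θ + θ') γ := by
  simp only [pauliRot, sub_mul, mul_sub, smul_mul_smul_comm, one_mul, mul_one, pauliOp_mul_self,
    Real.cos_add, Real.sin_add]
  push_cast
  have h : Complex.I * (Real.sin θ : ℂ) * (Complex.I * (Real.sin θ' : ℂ))
      = -((Real.sin θ : ℂ) * (Real.sin θ' : ℂ)) := by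
    linear_combination (Real.sin θ : ℂ) * (Real.sin θ' : ℂ) * Complex.I_mul_I
  push_cast at h
  rw [h]
  module

lemma pauliRot_zero_angle (γ : PauliString Q) : pauliRot 0 γ = 1 := by simp [pauliRot]

lemma pauliRot_conjTranspose (θ : ℝ) (γ : PauliString Q) :
    (pauliRot θ γ)ᴴ = pauliRot (-θ) γ := by
  simp only [pauliRot, Matrix.conjTranspose_sub, Matrix.conjTranspose_smul,
    Matrix.conjTranspose_one, pauliOp_conjTranspose, Real.cos_neg, Real.sin_neg, star_mul',
    Complex.star_def, Complex.conj_ofReal, Complex.conj_I, Complex.ofReal_neg, neg_mul, mul_neg]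

lemma pauliRot_unitary (θ : ℝ) (γ : PauliString Q) : (pauliRot θ γ)ᴴ * pauliRot θ γ = 1 := by
  rw [pauliRot_conjTranspose, pauliRot_mul, neg_add_cancel, pauliRot_zero_angle]

lemma pauliRot_trivialOn {c : Q} {γ : PauliString Q} (h : γ c = 0) (θ : ℝ) :
    TrivialOn c (pauliRot θ γ) := by
  have : pauliRot θ γ = (Real.cos θ : ℂ) • 1 + (-(Complex.I * (Real.sin θ : ℂ))) • pauliOp γ := by
    rw [pauliRot, neg_smul, sub_eq_add_neg]
  rw [this]
  exact (TrivialOn.one.smul _).add ((TrivialOn.pauliOp h).smul _)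

lemma pauliRot_zero (θ : ℝ) :
    pauliRot θ (0 : PauliString Q) = Complex.exp (-(Complex.I * θ)) • 1 := by
  rw [pauliRot, pauliOp_zero, ← sub_smul]
  congr 1
  have : -(Complex.I * (θ : ℂ)) = -(θ : ℂ) * Complex.I := by ring
  rw [this, Complex.exp_mul_I, Complex.cos_neg, Complex.sin_neg]
  push_cast
  ring

lemma norm_exp_neg_I_mul (θ : ℝ) : ‖Complex.exp (-(Complex.I * θ))‖ = 1 := by
  rw [neg_mul_eq_mul_neg, mul_comm, ← Complex.ofReal_neg, Complex.norm_exp_ofReal_mul_I]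

lemma pauliMat_one_eq : pauliMat 1 = ketBra 0 1 + ketBra 1 0 := by
  ext a b; fin_cases a <;> fin_cases b <;> simp [pauliMat, ketBra]

/-- Conjugation with the controlled involution `P` turns a rotation about `X` on the control qubit
into a rotation about `X ⊗ P`. -/
lemma select_conj_rot {i : Q} {P : Op Q} (hP : TrivialOn i P) (α β : ℂ) (hPP : P * P = 1) :
    select i 1 P * onQubit i (α • 1 + β • pauliMat 1) * select i 1 P
      = α • 1 + β • (onQubit i (pauliMat 1) * P) := by
  have s := fun A N B X (hX : TrivialOn i X) Y =>
    TrivialOn.sandwich_mul hX (TrivialOn.one (c := i)) A N B Y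
  simp only [mul_one] at s
  have hX := pauliMat_one_eq
  have h1 : onQubit i (ketBra 0 0) + onQubit i (ketBra 1 1) = 1 := by
    rw [← onQubit_add, ketBra_add, onQubit_one]
  simp only [select, add_mul, mul_add, s _ _ _ _ hP, s _ _ _ _ TrivialOn.one, hX]
  simp only [add_mul, mul_add, Matrix.mul_smul, Matrix.smul_mul, mul_one, one_mul, ketBra_mul,
    onQubit_add, onQubit_smul, hPP, smul_add]
  simp [onQubit_zero, ketBra_mul]
  rw [← h1, smul_add]
  abel

/-- A Pauli rotation is a single-qubit rotation, conjugated by a controlled Pauli string and a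
change of basis on a qubit in the support. -/
lemma realizable_pauliRot [Nonempty Q] (θ : ℝ) (γ : PauliString Q) :
    Realizable (pauliRot θ γ) (6 * weight γ + 3) := by
  by_cases hγ : γ = 0
  · subst hγ
    rw [pauliRot_zero, ← onQubit_one (Classical.arbitrary Q), ← onQubit_smul]
    exact (realizable_onQubit _ (smul_one_unitary (norm_exp_neg_I_mul θ) (by simp))).mono (by omega)
  · obtain ⟨i, hi⟩ := Function.ne_iff.mp hγ
    obtain ⟨v, hv, hva⟩ := exists_conj_pauliX hi
    have hv' := mul_eq_one_comm.mp hv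
    set δ : PauliString Q := Function.update γ i 0 with hδ
    have hδi : δ i = 0 := by simp [hδ]
    have hγδ : pauliOp γ = onQubit i (pauliMat (γ i)) * pauliOp δ :=
      pauliOp_eq_onQubit_mul hδi fun j hj => by simp [hδ, Function.update_of_ne hj]
    have hw : weight δ ≤ weight γ := by
      refine Finset.card_le_card fun j hj => ?_
      by_cases hji : j = i
      · subst hji; simp [hδi] at hj
      · simpa [hδ, Function.update_of_ne hji] using hj
    have hC := realizable_select_pauliOp hδi
    have hP := TrivialOn.pauliOp hδi
    have hr : ((Real.cos θ : ℂ) • (1 : Matrix (Fin 2) (Fin 2) ℂ)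
        + (-(Complex.I * (Real.sin θ : ℂ))) • pauliMat 1)ᴴ
        * ((Real.cos θ : ℂ) • (1 : Matrix (Fin 2) (Fin 2) ℂ)
        + (-(Complex.I * (Real.sin θ : ℂ))) • pauliMat 1) = 1 := by
      have hsc : (Complex.cos θ : ℂ) * Complex.cos θ + Complex.sin θ * Complex.sin θ = 1 := by
        rw [← pow_two, ← pow_two, Complex.cos_sq_add_sin_sq]
      simp only [Matrix.conjTranspose_add, Matrix.conjTranspose_smul, pauliMat_conjTranspose,
        Matrix.conjTranspose_one, add_mul, mul_add, smul_mul_smul_comm, mul_one, one_mul,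
        pauliMat_mul_self]
      simp only [star_neg, star_mul', Complex.star_def, Complex.conj_ofReal, Complex.conj_I]
      have e : ∀ c s : ℂ, c * c + s * s = 1 → (c * c) • (1 : Matrix (Fin 2) (Fin 2) ℂ)
        + (-(-Complex.I * s) * c) • pauliMat 1
        + ((c * -(Complex.I * s)) • pauliMat 1 + (-(-Complex.I * s) * -(Complex.I * s)) • 1)
        = 1 := by
        intro c s h
        have e1 : (-(-Complex.I * s) * -(Complex.I * s)) = s * s := by
          linear_combination - s * s * Complex.I_mul_I
        have e2 : c * -(Complex.I * s) = - (-(-Complex.I * s) * c) := by ring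
        rw [e1, e2, neg_smul]
        calc _ = (c * c + s * s) • (1 : Matrix (Fin 2) (Fin 2) ℂ) := by rw [add_smul]; abel
          _ = 1 := by rw [h, one_smul]
      exact e _ _ (by exact_mod_cast hsc)
    have h1 : pauliRot θ γ = onQubit i v * (select i 1 (pauliOp δ) *
        onQubit i ((Real.cos θ : ℂ) • 1 + (-(Complex.I * (Real.sin θ : ℂ))) • pauliMat 1) *
        select i 1 (pauliOp δ)) * onQubit i vᴴ := by
      rw [select_conj_rot hP _ _ (pauliOp_mul_self δ)]
      rw [mul_add, add_mul, Matrix.mul_smul, Matrix.mul_smul, Matrix.smul_mul, Matrix.smul_mul,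
        mul_one, onQubit_mul, hv', onQubit_one]
      have : onQubit i v * (onQubit i (pauliMat 1) * pauliOp δ) * onQubit i vᴴ = pauliOp γ := by
        rw [mul_assoc, mul_assoc, ← (hP vᴴ).eq, ← mul_assoc, ← mul_assoc, onQubit_mul, onQubit_mul,
          hva, hγδ]
      rw [this, pauliRot, neg_smul, sub_eq_add_neg]
    rw [h1]
    exact (((realizable_onQubit i hv).mul ((hC.mul (realizable_onQubit i hr)).mul hC)).mul
      (realizable_onQubit i (by simpa using hv'))).mono (by omega)

lemma exists_anticommute {a : Fin 4} (ha : a ≠ 0) :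
    ∃ b, pauliMat b * pauliMat a * pauliMat b = -pauliMat a := by
  fin_cases a
  · exact absurd rfl ha
  · refine ⟨3, ?_⟩
    ext i j; fin_cases i <;> fin_cases j <;> simp [pauliMat, Matrix.mul_apply, Fin.sum_univ_two]
  · refine ⟨1, ?_⟩
    ext i j; fin_cases i <;> fin_cases j <;> simp [pauliMat, Matrix.mul_apply, Fin.sum_univ_two]
  · refine ⟨1, ?_⟩
    ext i j; fin_cases i <;> fin_cases j <;> simp [pauliMat, Matrix.mul_apply, Fin.sum_univ_two]

lemma phaseOn_unitary {z : ℂ} (hz : ‖z‖ = 1) :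
    (ketBra 0 0 + z • ketBra 1 1)ᴴ * (ketBra 0 0 + z • ketBra 1 1) = 1 := by
  have hz' : (starRingEnd ℂ) z * z = 1 := by
    rw [← Complex.normSq_eq_conj_mul_self, Complex.normSq_eq_norm_sq, hz]; simp
  ext i j
  fin_cases i <;> fin_cases j <;>
    simp [ketBra, Matrix.mul_apply, Fin.sum_univ_two, Matrix.conjTranspose_apply, hz']

/-- A controlled phase is a single-qubit gate on the control qubit. -/
lemma select_smul (c : Q) {z : ℂ} (U : Op Q) :
    select c 1 (z • U) = onQubit c (ketBra 0 0 + z • ketBra 1 1) * select c 1 U := by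
  simp only [select, mul_add, ← mul_assoc, onQubit_mul, mul_one, add_mul, Matrix.smul_mul,
    ketBra_mul]
  simp [onQubit_smul]

/-- A controlled rotation is `R(θ/2) C R(-θ/2) C`, with `C` a controlled single-qubit Pauli matrix
that anticommutes with the string: if the control is in the state `0` the two rotations cancel, in
the state `1` their angles add. -/
lemma realizable_select_pauliRot [Nonempty Q] {c : Q} {γ : PauliString Q} (hc : γ c = 0) (θ : ℝ) :
    Realizable (select c 1 (pauliRot θ γ)) (12 * weight γ + 12) := by
  by_cases hγ : γ = 0
  · subst hγ
    rw [pauliRot_zero, select_smul, select_self, mul_one]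
    exact (realizable_onQubit c (phaseOn_unitary (norm_exp_neg_I_mul θ))).mono (by omega)
  · obtain ⟨i, hi⟩ := Function.ne_iff.mp hγ
    obtain ⟨b, hb⟩ := exists_anticommute hi
    have hci : c ≠ i := by rintro rfl; exact hi hc
    set A := onQubit i (pauliMat b) with hA
    have hAA : A * A = 1 := by rw [hA, onQubit_mul, pauliMat_mul_self, onQubit_one]
    have hδi : (Function.update γ i 0 : PauliString Q) i = 0 := by simp
    have hγδ : pauliOp γ = onQubit i (pauliMat (γ i)) * pauliOp (Function.update γ i 0) :=
      pauliOp_eq_onQubit_mul hδi fun j hj => by simp [Function.update_of_ne hj]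
    have hAP : A * pauliOp γ * A = -pauliOp γ := by
      rw [hγδ, hA, mul_assoc, mul_assoc, ← (TrivialOn.pauliOp hδi _).eq, ← mul_assoc, ← mul_assoc,
        onQubit_mul, onQubit_mul, hb, ← neg_one_smul ℂ, onQubit_smul, neg_one_smul, neg_mul]
    have hAR : A * pauliRot (-(θ / 2)) γ * A = pauliRot (θ / 2) γ := by
      simp only [pauliRot, mul_sub, sub_mul, Matrix.mul_smul, Matrix.smul_mul, mul_one, hAA, hAP,
        Real.cos_neg, Real.sin_neg]
      simp
    have hRA := trivialOn_onQubit hci (pauliMat b)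
    have h1 : select c 1 (pauliRot θ γ) = pauliRot (θ / 2) γ * (select c 1 A *
        pauliRot (-(θ / 2)) γ * select c 1 A) := by
      rw [← select_self c (pauliRot (θ / 2) γ), ← select_self c (pauliRot (-(θ / 2)) γ),
        select_mul TrivialOn.one hRA,
        select_mul (TrivialOn.one.mul (pauliRot_trivialOn hc _)) (hRA.mul (pauliRot_trivialOn hc _)),
        select_mul (pauliRot_trivialOn hc _) (pauliRot_trivialOn hc _), hAR, mul_one, one_mul,
        pauliRot_mul, pauliRot_mul, add_neg_cancel, pauliRot_zero_angle, add_halves]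
    rw [h1]
    exact ((realizable_pauliRot _ _).mul (((realizable_select_pauliMat hci b).mul
      (realizable_pauliRot _ _)).mul (realizable_select_pauliMat hci b))).mono (by omega)

/-- A Pauli string of weight at most `v` with a phase, or a Pauli rotation about such a string,
acting trivially on the qubit `c`. -/
def IsPauliLike (c : Q) (v : ℕ) (U : Op Q) : Prop :=
  ∃ γ : PauliString Q, γ c = 0 ∧ weight γ ≤ v ∧
    ((∃ z : ℂ, ‖z‖ = 1 ∧ U = z • pauliOp γ) ∨ ∃ θ : ℝ, U = pauliRot θ γ)

lemma IsPauliLike.trivialOn {c : Q} {v : ℕ} {U : Op Q} (h : IsPauliLike c v U) :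
    TrivialOn c U := by
  obtain ⟨γ, h1, _, ⟨z, _, rfl⟩ | ⟨θ, rfl⟩⟩ := h
  · exact (TrivialOn.pauliOp h1).smul z
  · exact pauliRot_trivialOn h1 θ

lemma IsPauliLike.unitary {c : Q} {v : ℕ} {U : Op Q} (h : IsPauliLike c v U) : Uᴴ * U = 1 := by
  obtain ⟨γ, h1, _, ⟨z, hz, rfl⟩ | ⟨θ, rfl⟩⟩ := h
  · exact smul_one_unitary hz (by rw [pauliOp_conjTranspose, pauliOp_mul_self])
  · exact pauliRot_unitary θ γ

lemma IsPauliLike.realizable_controlled_one [Nonempty Q] {c : Q} {v : ℕ} {U : Op Q}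
    (h : IsPauliLike c v U) : Realizable (controlled c 1 U) (12 * v + 12) := by
  rw [controlled_one_eq_select]
  obtain ⟨γ, h1, h2, ⟨z, hz, rfl⟩ | ⟨θ, rfl⟩⟩ := h
  · rw [select_smul]
    exact ((realizable_onQubit c (phaseOn_unitary hz)).mul (realizable_select_pauliOp h1)).mono
      (by omega)
  · exact (realizable_select_pauliRot h1 θ).mono (by omega)

lemma IsPauliLike.realizable_controlled_zero [Nonempty Q] {c : Q} {v : ℕ} {U : Op Q}
    (h : IsPauliLike c v U) : Realizable (controlled c 0 U) (12 * v + 14) := by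
  have h1 := h.realizable_controlled_one
  have hX : pauliMat 1 * ketBra 0 0 * pauliMat 1 = ketBra 1 1 ∧
      pauliMat 1 * ketBra 1 1 * pauliMat 1 = ketBra 0 0 := by
    rw [pauliMat_one_eq]
    constructor <;> simp [mul_add, add_mul, ketBra_mul]
  have h2 : controlled c 0 U = onQubit c (pauliMat 1) * controlled c 1 U * onQubit c (pauliMat 1) := by
    rw [controlled_zero_eq, controlled_one_eq, mul_add, add_mul, mul_one, mul_one, ← mul_assoc,
      mul_assoc, ← (h.trivialOn _).eq, ← mul_assoc, onQubit_mul, onQubit_mul, hX.2, onQubit_mul,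
      onQubit_mul, hX.1]
  have h3 : (pauliMat 1)ᴴ * pauliMat 1 = 1 := by rw [pauliMat_conjTranspose, pauliMat_mul_self]
  rw [h2]
  exact (((realizable_onQubit c h3).mul h1).mul (realizable_onQubit c h3)).mono (by omega)

/-- The circuit is valid and consists of at most `k` elementary operations. -/
def CircuitBound (k : ℕ) (c : Circuit Q) : Prop := ValidCircuit c ∧ circuitCost c ≤ k

lemma CircuitBound.nil : CircuitBound 0 ([] : Circuit Q) :=
  ⟨fun _ h => absurd h (by simp), by simp [circuitCost]⟩

lemma CircuitBound.mono {k l : ℕ} {c : Circuit Q} (h : CircuitBound k c) (hkl : k ≤ l) :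
    CircuitBound l c := ⟨h.1, h.2.trans (by exact_mod_cast hkl)⟩

lemma CircuitBound.append {k l : ℕ} {c d : Circuit Q} (hc : CircuitBound k c)
    (hd : CircuitBound l d) : CircuitBound (k + l) (c ++ d) := by
  refine ⟨hc.1.append hd.1, ?_⟩
  have : circuitCost (c ++ d) = circuitCost c + circuitCost d := by simp [circuitCost]
  rw [this]
  push_cast
  exact add_le_add hc.2 hd.2

lemma CircuitBound.unitary {k : ℕ} {U : Op Q} (hU : Uᴴ * U = 1) (h : Realizable U k) :
    CircuitBound k [Instr.unitary U] := by
  refine ⟨?_, ?_⟩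
  · intro V hV
    simp only [List.mem_singleton, Instr.unitary.injEq] at hV
    rw [hV, hU]
  · simpa [circuitCost, Instr.cost] using h.gateCount_le

lemma CircuitBound.reset (i : Q) : CircuitBound 1 [Instr.reset i] :=
  ⟨fun U hU => by simp at hU, by simp [circuitCost, Instr.cost]⟩

lemma CircuitBound.measureX (i : Q) : CircuitBound 1 [Instr.measureX i] :=
  ⟨fun U hU => by simp at hU, by simp [circuitCost, Instr.cost]⟩

lemma circuitBound_rotations [Nonempty Q] {ι : Type*} (l : List ι) (θ : ι → ℝ)
    (γ : ι → PauliString Q) {v : ℕ} (h : ∀ t ∈ l, weight (γ t) ≤ v) :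
    CircuitBound (l.length * (6 * v + 3)) (l.map fun t => Instr.unitary (pauliRot (θ t) (γ t))) := by
  induction l with
  | nil => simpa using CircuitBound.nil
  | cons t l ih =>
    have h1 : CircuitBound (6 * v + 3) [Instr.unitary (pauliRot (θ t) (γ t))] :=
      (CircuitBound.unitary (pauliRot_unitary _ _) (realizable_pauliRot _ _)).mono
        (by have := h t (by simp); omega)
    have h2 := h1.append (ih fun s hs => h s (by simp [hs]))
    refine CircuitBound.mono h2 ?_
    simp only [List.length_cons]
    linarith

end Gates

section ConjBound

variable {n : ℕ}

lemma hadamard_unitary : hadamardᴴ * hadamard = 1 := by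
  have h2 : ((Real.sqrt 2 : ℝ) : ℂ)⁻¹ * ((Real.sqrt 2 : ℝ) : ℂ)⁻¹ = 2⁻¹ := by
    rw [← mul_inv, ← Complex.ofReal_mul, Real.mul_self_sqrt (by norm_num)]; simp
  ext i j
  fin_cases i <;> fin_cases j <;>
    simp [hadamard, Matrix.mul_apply, Fin.sum_univ_two, Matrix.conjTranspose_apply, h2] <;>
    norm_num

lemma phaseGate_unitary (θ : ℝ) : (phaseGate θ)ᴴ * phaseGate θ = 1 := by
  ext i j
  fin_cases i <;> fin_cases j <;>
    simp [phaseGate, Matrix.mul_apply, Fin.sum_univ_two, Matrix.diagonal,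
      Matrix.conjTranspose_apply, ← Complex.exp_conj, ← Complex.exp_add, map_ofNat]

lemma circuitBound_conjCircuit {v : ℕ} (θ : ℝ) {U W : Op (Register n 2)}
    (hU : IsPauliLike (ctlAnc n) v U) (hW : IsPauliLike (ctlAnc n) v W) :
    CircuitBound (24 * v + 30) (conjCircuit θ U W) := by
  have : Nonempty (Register n 2) := ⟨ctlAnc n⟩
  have h1 : (controlled (ctlAnc n) 1 U)ᴴ * controlled (ctlAnc n) 1 U = 1 := by
    rw [controlled_one_eq_select]
    exact select_unitary TrivialOn.one hU.trivialOn (by simp) hU.unitary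
  have h0 : (controlled (ctlAnc n) 0 W)ᴴ * controlled (ctlAnc n) 0 W = 1 := by
    rw [controlled_zero_eq_select]
    exact select_unitary hW.trivialOn TrivialOn.one hW.unitary (by simp)
  have := (CircuitBound.reset (ctlAnc n)).append
    ((CircuitBound.unitary (onQubit_unitary hadamard_unitary)
      (realizable_onQubit (ctlAnc n) hadamard_unitary)).append
    ((CircuitBound.unitary h1 hU.realizable_controlled_one).append
    ((CircuitBound.unitary h0 hW.realizable_controlled_zero).append
    ((CircuitBound.unitary (onQubit_unitary (phaseGate_unitary θ))
      (realizable_onQubit (ctlAnc n) (phaseGate_unitary θ))).append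
      (CircuitBound.measureX (ctlAnc n))))))
  exact this.mono (by omega)

end ConjBound

/-! ### Pauli strings on the system -/

section SystemPauli

variable {n a : ℕ}

/-- A Pauli string on the system, extended by the identity on the ancillas. -/
def extendString (γ : PauliString (Fin n)) : PauliString (Register n a) := Sum.elim γ 0

lemma onSystem_pauliOp (γ : PauliString (Fin n)) :
    (onSystem (pauliOp γ) : Op (Register n a)) = pauliOp (extendString γ) := by
  ext x y
  simp only [onSystem, pauliOp, extendString, Matrix.of_apply, Fintype.prod_sum_type, Sum.elim_inl,
    Sum.elim_inr, Pi.zero_apply, pauliMat_zero, Matrix.one_apply]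
  rw [Finset.prod_ite_zero]
  simp only [funext_iff, Function.comp_apply, Finset.mem_univ, forall_true_left,
    Finset.prod_const_one, mul_ite, mul_one, mul_zero]

lemma weight_extendString (γ : PauliString (Fin n)) :
    weight (extendString γ : PauliString (Register n a)) = weight γ := by
  unfold weight
  rw [← Finset.card_map (s := Finset.univ.filter fun i => γ i ≠ 0)
    ⟨Sum.inl, Sum.inl_injective (β := Fin a)⟩]
  congr 1
  refine Finset.ext fun i => ?_
  rw [Finset.mem_filter, Finset.mem_map]
  rcases i with i | i <;> simp [extendString]

end SystemPauli

/-! ### Absolutely convergent series -/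

section AbsSum

open Finset.HasAntidiagonal (antidiagonal)

variable {R : Type*} [NormedRing R] [CompleteSpace R]

/-- The series `∑ a k` converges absolutely, with sum `s`. -/
def AbsSum (a : ℕ → R) (s : R) : Prop := (Summable fun k => ‖a k‖) ∧ HasSum a s

lemma AbsSum.mul {a b : ℕ → R} {s t : R} (ha : AbsSum a s) (hb : AbsSum b t) :
    AbsSum (fun n => ∑ p ∈ antidiagonal n, a p.1 * b p.2) (s * t) := by
  have h1 := summable_norm_sum_mul_antidiagonal_of_summable_norm ha.1 hb.1
  refine ⟨h1, ?_⟩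
  rw [← ha.2.tsum_eq, ← hb.2.tsum_eq,
    tsum_mul_tsum_eq_tsum_sum_antidiagonal_of_summable_norm ha.1 hb.1]
  exact h1.of_norm.hasSum

lemma AbsSum.one : AbsSum (fun n => if n = 0 then (1 : R) else 0) 1 := by
  constructor
  · refine summable_of_ne_finset_zero (s := {0}) fun n hn => ?_
    have : n ≠ 0 := by simpa using hn
    simp [this]
  · exact hasSum_ite_eq 0 1

lemma AbsSum.add {a b : ℕ → R} {s t : R} (ha : AbsSum a s) (hb : AbsSum b t) :
    AbsSum (fun n => a n + b n) (s + t) :=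
  ⟨Summable.of_nonneg_of_le (fun _ => norm_nonneg _) (fun _ => norm_add_le _ _) (ha.1.add hb.1),
    ha.2.add hb.2⟩

lemma AbsSum.unique {a : ℕ → R} {s t : R} (ha : AbsSum a s) (hb : AbsSum a t) : s = t :=
  ha.2.unique hb.2

lemma absSum_exp [NormedAlgebra ℂ R] (x : R) :
    AbsSum (fun k => ((k ! : ℂ)⁻¹) • x ^ k) (NormedSpace.exp x) :=
  ⟨NormedSpace.norm_expSeries_summable' x, NormedSpace.exp_series_hasSum_exp' x⟩

lemma summable_geometric_bound {a : ℕ → R} {y : ℝ} (hy : y ≤ 1 / 2) (h : ∀ k, ‖a k‖ ≤ y ^ k) :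
    Summable fun k => ‖a k‖ := by
  have hy0 : 0 ≤ y := by simpa using (norm_nonneg _).trans (h 1)
  exact Summable.of_nonneg_of_le (fun _ => norm_nonneg _) h
    (summable_geometric_of_lt_one hy0 (by linarith))

/-- The remainder of a series bounded by a geometric one. -/
lemma norm_sub_sum_range_le {a : ℕ → R} {s : R} {y : ℝ} (hy : y ≤ 1 / 2)
    (h : ∀ k, ‖a k‖ ≤ y ^ k) (hs : HasSum a s) (n : ℕ) :
    ‖∑ k ∈ Finset.range n, a k - s‖ ≤ 2 * y ^ n := by
  have hy0 : 0 ≤ y := by simpa using (norm_nonneg _).trans (h 1)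
  have h1 := norm_sub_le_of_geometric_bound_of_hasSum (C := 1) (r := y) (by linarith)
    (by simpa using h) hs n
  refine h1.trans ?_
  rw [div_le_iff₀ (by linarith), one_mul]
  have : 0 ≤ y ^ n := by positivity
  nlinarith

lemma sum_geometric_le {y : ℝ} (hy0 : 0 ≤ y) (hy : y ≤ 1 / 2) (j : ℕ) (s : Finset ℕ)
    (hs : ∀ k ∈ s, j ≤ k) : ∑ k ∈ s, y ^ k ≤ 2 * y ^ j := by
  have h1 : ∑ k ∈ s, y ^ k ≤ ∑ k ∈ Finset.Ico j (s.sup id + 1), y ^ k := by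
    refine Finset.sum_le_sum_of_subset_of_nonneg (fun k hk => ?_) fun _ _ _ => by positivity
    rw [Finset.mem_Ico]
    exact ⟨hs k hk, Nat.lt_succ_of_le (Finset.le_sup (f := id) hk)⟩
  refine h1.trans ?_
  rw [Finset.sum_Ico_eq_sum_range]
  simp only [pow_add, ← Finset.mul_sum]
  have h2 := Summable.sum_le_tsum (Finset.range (s.sup id + 1 - j)) (fun k _ => by positivity)
    (summable_geometric_of_lt_one hy0 (by linarith))
  rw [tsum_geometric_of_lt_one hy0 (by linarith)] at h2
  have h3 : (1 - y)⁻¹ ≤ 2 := by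
    rw [inv_le_comm₀ (by linarith) (by norm_num)]; linarith
  rw [mul_comm]
  gcongr
  exact h2.trans h3

/-- The binomial theorem for divided powers. -/
lemma sum_pow_div_factorial_mul {K : Type*} [Field K] [CharZero K] (a b : K) (n : ℕ) :
    ∑ p ∈ antidiagonal n, a ^ p.1 / (p.1 ! : K) * (b ^ p.2 / (p.2 ! : K))
      = (a + b) ^ n / (n ! : K) := by
  rw [(Commute.all a b).add_pow', Finset.sum_div]
  refine Finset.sum_congr rfl fun p hp => ?_
  obtain ⟨i, j⟩ := p
  have hij : i + j = n := by simpa using hp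
  subst hij
  have h1 : ((i + j).choose i * i ! * j ! : ℕ) = (i + j)! := by
    rw [Nat.choose_symm_add]; exact Nat.add_choose_mul_factorial_mul_factorial i j
  have h2 : ((i + j).choose i : K) * (i ! : K) * (j ! : K) = ((i + j)! : K) := by exact_mod_cast h1
  have hi : (i ! : K) ≠ 0 := by exact_mod_cast i.factorial_ne_zero
  have hj : (j ! : K) ≠ 0 := by exact_mod_cast j.factorial_ne_zero
  have hn : ((i + j)! : K) ≠ 0 := by exact_mod_cast (i + j).factorial_ne_zero
  simp only [nsmul_eq_mul]
  rw [div_mul_div_comm, div_eq_div_iff (mul_ne_zero hi hj) hn, ← h2]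
  ring

lemma pow_div_factorial_le {g : ℝ} (hg : 0 ≤ g) (k : ℕ) : g ^ k / (k ! : ℝ) ≤ g ^ k := by
  have : (1 : ℝ) ≤ k ! := by exact_mod_cast Nat.one_le_iff_ne_zero.mpr k.factorial_ne_zero
  exact div_le_self (by positivity) this

end AbsSum

/-! ### The Trotter error series -/

section Trotter

open Finset.HasAntidiagonal (antidiagonal)
open scoped Matrix.Norms.L2Operator

variable {Q : Type} [Fintype Q] [DecidableEq Q]

lemma pauliNorm_pow (A : Op Q) (k : ℕ) : pauliNorm (A ^ k) ≤ pauliNorm A ^ k := by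
  induction k with
  | zero => simp [pauliNorm_one]
  | succ k ih =>
    rw [pow_succ, pow_succ]
    exact (pauliNorm_mul _ _).trans (by gcongr; exact pauliNorm_nonneg _)

/-- The coefficients of `f` are bounded in Pauli norm by those of `exp (g x)`. -/
def SeriesBound (g : ℝ) (f : PowerSeries (Op Q)) : Prop :=
  ∀ k, pauliNorm (PowerSeries.coeff k f) ≤ g ^ k / (k ! : ℝ)

lemma SeriesBound.one : SeriesBound 0 (1 : PowerSeries (Op Q)) := by
  intro k
  rw [PowerSeries.coeff_one]
  split_ifs with h
  · subst h; simp [pauliNorm_one]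
  · simp [pauliNorm_zero, h]

lemma SeriesBound.mul {g h : ℝ} {f f' : PowerSeries (Op Q)} (hf : SeriesBound g f)
    (hf' : SeriesBound h f') : SeriesBound (g + h) (f * f') := by
  intro k
  rw [PowerSeries.coeff_mul, ← sum_pow_div_factorial_mul]
  refine (pauliNorm_sum _ _).trans (Finset.sum_le_sum fun p _ => (pauliNorm_mul _ _).trans ?_)
  exact mul_le_mul (hf _) (hf' _) (pauliNorm_nonneg _) ((pauliNorm_nonneg _).trans (hf _))

lemma SeriesBound.expSeries (A : Op Q) : SeriesBound (pauliNorm A) (expSeries A) := by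
  intro k
  rw [LindbladSim.expSeries, PowerSeries.coeff_mk, pauliNorm_smul, div_eq_inv_mul]
  simp only [norm_inv, Complex.norm_natCast]
  gcongr
  exact pauliNorm_pow A k

lemma SeriesBound.list_prod {ι : Type*} (l : List ι) (f : ι → PowerSeries (Op Q)) (g : ι → ℝ)
    (h : ∀ t, SeriesBound (g t) (f t)) : SeriesBound (l.map g).sum (l.map f).prod := by
  induction l with
  | nil => simpa using SeriesBound.one
  | cons t l ih => simpa using (h t).mul ih

/-- The series of `V(x) = e^{-iGx} S(x)†`. -/
def trotterSeries (G : Op Q) : PowerSeries (Op Q) :=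
  expSeries ((-Complex.I) • G) *
    ((pauliSupport G).toList.map fun γ =>
      expSeries ((Complex.I * ((pauliCoeff G γ).re : ℂ)) • pauliOp γ)).prod

lemma trotterErr_eq (G : Op Q) (k : ℕ) : trotterErr G k = PowerSeries.coeff k (trotterSeries G) := rfl

lemma SeriesBound.mono {g h : ℝ} {f : PowerSeries (Op Q)} (hf : SeriesBound g f) (hg : 0 ≤ g)
    (hgh : g ≤ h) : SeriesBound h f := fun k => (hf k).trans (by gcongr)

lemma seriesBound_trotterSeries (G : Op Q) : SeriesBound (2 * pauliNorm G) (trotterSeries G) := by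
  have h1 := (SeriesBound.expSeries ((-Complex.I) • G)).mul
    (SeriesBound.list_prod (pauliSupport G).toList
      (fun γ => LindbladSim.expSeries ((Complex.I * ((pauliCoeff G γ).re : ℂ)) • pauliOp γ)) _
      fun γ => SeriesBound.expSeries _)
  have h2 : pauliNorm ((-Complex.I) • G) = pauliNorm G := by rw [pauliNorm_smul]; simp
  have h3 : ∀ γ : PauliString Q,
      pauliNorm ((Complex.I * ((pauliCoeff G γ).re : ℂ)) • pauliOp γ) = |(pauliCoeff G γ).re| := by
    intro γ; simp [pauliNorm_smul, pauliNorm_pauliOp]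
  simp only [h2, h3, Finset.sum_map_toList] at h1
  refine SeriesBound.mono h1 (add_nonneg (pauliNorm_nonneg _)
    (Finset.sum_nonneg fun _ _ => abs_nonneg _)) ?_
  rw [two_mul]
  gcongr
  rw [sum_pauliSupport G (fun γ => |(pauliCoeff G γ).re|) fun γ h => by simp [h]]
  exact Finset.sum_le_sum fun γ _ => Complex.abs_re_le_norm _

/-! #### Evaluation of series -/

/-- The value at `x` of the series `f` is `a`. -/
def EvalsTo (f : PowerSeries (Op Q)) (x : ℝ) (a : Op Q) : Prop :=
  AbsSum (fun k => (x : ℂ) ^ k • PowerSeries.coeff k f) a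

lemma EvalsTo.mul {f f' : PowerSeries (Op Q)} {x : ℝ} {a b : Op Q} (hf : EvalsTo f x a)
    (hf' : EvalsTo f' x b) : EvalsTo (f * f') x (a * b) := by
  have := AbsSum.mul hf hf'
  unfold EvalsTo
  convert this using 2 with k
  rw [PowerSeries.coeff_mul, Finset.smul_sum]
  refine Finset.sum_congr rfl fun p hp => ?_
  rw [smul_mul_smul_comm, ← pow_add, Finset.HasAntidiagonal.mem_antidiagonal.mp hp]

lemma EvalsTo.one {x : ℝ} : EvalsTo (1 : PowerSeries (Op Q)) x 1 := by
  have := AbsSum.one (R := Op Q)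
  unfold EvalsTo
  convert this using 2 with k
  rw [PowerSeries.coeff_one]
  split_ifs with h
  · simp [h]
  · simp

lemma EvalsTo.expSeries (A : Op Q) (x : ℝ) :
    EvalsTo (expSeries A) x (NormedSpace.exp ((x : ℂ) • A)) := by
  have := absSum_exp ((x : ℂ) • A)
  unfold EvalsTo
  convert this using 2 with k
  rw [LindbladSim.expSeries, PowerSeries.coeff_mk, smul_pow, smul_comm]

lemma EvalsTo.list_prod {ι : Type*} (l : List ι) (f : ι → PowerSeries (Op Q)) (a : ι → Op Q)
    {x : ℝ} (h : ∀ t, EvalsTo (f t) x (a t)) : EvalsTo (l.map f).prod x (l.map a).prod := by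
  induction l with
  | nil => simpa using EvalsTo.one
  | cons t l ih => simpa using (h t).mul ih

lemma exp_smul_pauliOp (γ : PauliString Q) (θ : ℝ) :
    NormedSpace.exp ((Complex.I * (θ : ℂ)) • pauliOp γ) = pauliRot (-θ) γ := by
  set z : ℂ := Complex.I * (θ : ℂ) with hz
  have h1 := (absSum_exp (z • pauliOp γ)).2
  have e : ∀ w : ℂ, HasSum (fun k => (k ! : ℂ)⁻¹ * w ^ k) (Complex.exp w) := by
    intro w
    have := (absSum_exp w).2
    rwa [← Complex.exp_eq_exp_ℂ] at this
  have h2 : HasSum (fun k => ((k ! : ℂ)⁻¹) • (z • pauliOp γ) ^ k)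
      ((1 / 2 * (Complex.exp z + Complex.exp (-z))) • (1 : Op Q)
        + (1 / 2 * (Complex.exp z - Complex.exp (-z))) • pauliOp γ) := by
    have h3 := ((((e z).add (e (-z))).mul_left (1 / 2)).smul_const (1 : Op Q)).add
      ((((e z).sub (e (-z))).mul_left (1 / 2)).smul_const (pauliOp γ))
    convert h3 using 2 with k
    rw [smul_pow]
    rcases Nat.even_or_odd k with hk | hk
    · have hp : pauliOp γ ^ k = 1 := by
        obtain ⟨r, rfl⟩ := hk
        rw [← two_mul, pow_mul, pow_two, pauliOp_mul_self, one_pow]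
      rw [hp, hk.neg_pow, smul_smul, sub_self, mul_zero, zero_smul, add_zero]
      congr 1; ring
    · have hp : pauliOp γ ^ k = pauliOp γ := by
        obtain ⟨r, rfl⟩ := hk
        rw [pow_succ, pow_mul, pow_two, pauliOp_mul_self, one_pow, one_mul]
      rw [hp, hk.neg_pow, smul_smul, mul_neg, add_neg_cancel, mul_zero, zero_smul, zero_add]
      congr 1; ring
  rw [h1.unique h2, pauliRot, sub_eq_add_neg (_ • (1 : Op Q)), ← neg_smul]
  congr 2
  · rw [Real.cos_neg, Complex.ofReal_cos, Complex.cos, hz]; ring_nf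
  · rw [Real.sin_neg, Complex.ofReal_neg, Complex.ofReal_sin, Complex.sin, hz]
    rw [show -(θ : ℂ) * Complex.I = -(Complex.I * (θ : ℂ)) by ring, mul_comm (θ : ℂ)]
    linear_combination ((1 / 2) * (Complex.exp (Complex.I * θ)
      - Complex.exp (-(Complex.I * θ)))) * Complex.I_mul_I

/-- `S(x)†` for the first-order Trotter formula `S(x)`. -/
def trotterInv (G : Op Q) (x : ℝ) : Op Q :=
  ((pauliSupport G).toList.map fun γ => pauliRot (-((pauliCoeff G γ).re * x)) γ).prod

lemma evalsTo_trotterSeries (G : Op Q) (x : ℝ) :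
    EvalsTo (trotterSeries G) x
      (NormedSpace.exp ((-(Complex.I * (x : ℂ))) • G) * trotterInv G x) := by
  have h1 := EvalsTo.expSeries ((-Complex.I) • G) x
  rw [smul_smul, show (x : ℂ) * -Complex.I = -(Complex.I * (x : ℂ)) by ring] at h1
  refine h1.mul (EvalsTo.list_prod _ _ _ fun γ => ?_)
  have h2 := EvalsTo.expSeries ((Complex.I * ((pauliCoeff G γ).re : ℂ)) • pauliOp γ) x
  rwa [smul_smul, show (x : ℂ) * (Complex.I * ((pauliCoeff G γ).re : ℂ))
    = Complex.I * (((pauliCoeff G γ).re * x : ℝ) : ℂ) by push_cast; ring, exp_smul_pauliOp] at h2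

lemma circuitDual_trotterCircuit (G : Op Q) (x : ℝ) (X : Op Q) :
    circuitDual (trotterCircuit G x) X = trotterInv G x * X * (trotterInv G x)ᴴ := by
  unfold trotterCircuit trotterInv
  induction (pauliSupport G).toList generalizing X with
  | nil => simp [circuitDual]
  | cons γ l ih =>
    have : circuitDual (List.map (fun γ => Instr.unitary (pauliRot ((pauliCoeff G γ).re * x) γ)) (γ :: l)) X
        = (Instr.unitary (pauliRot ((pauliCoeff G γ).re * x) γ)).dual (circuitDual (List.map (fun γ => Instr.unitary (pauliRot ((pauliCoeff G γ).re * x) γ)) l) X) := by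
      simp [circuitDual]
    rw [this, ih]
    simp only [Instr.dual, sandwich_apply, List.map_cons, List.prod_cons, Matrix.conjTranspose_mul,
      pauliRot_conjTranspose, neg_neg, mul_assoc]

lemma trotterInv_mul_conjTranspose (G : Op Q) (x : ℝ) :
    trotterInv G x * (trotterInv G x)ᴴ = 1 := by
  unfold trotterInv
  induction (pauliSupport G).toList with
  | nil => simp
  | cons γ l ih =>
    rw [List.map_cons, List.prod_cons, Matrix.conjTranspose_mul, mul_assoc, ← mul_assoc _ _ (_)ᴴ,
      ih, one_mul]
    exact mul_eq_one_comm.mp (pauliRot_unitary _ _)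

/-! #### Low orders of the Trotter error -/

/-- The coefficientwise adjoint of a series. -/
def seriesStar (f : PowerSeries (Op Q)) : PowerSeries (Op Q) :=
  PowerSeries.mk fun k => (PowerSeries.coeff k f)ᴴ

lemma seriesStar_mul (f g : PowerSeries (Op Q)) :
    seriesStar (f * g) = seriesStar g * seriesStar f := by
  ext1 k
  simp only [seriesStar, PowerSeries.coeff_mk, PowerSeries.coeff_mul, Matrix.conjTranspose_sum,
    Matrix.conjTranspose_mul]
  rw [← Finset.Nat.sum_antidiagonal_swap]
  rfl

lemma seriesStar_one : seriesStar (1 : PowerSeries (Op Q)) = 1 := by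
  ext1 k
  simp only [seriesStar, PowerSeries.coeff_mk, PowerSeries.coeff_one]
  split_ifs <;> simp

lemma expSeries_mul_neg (A : Op Q) : expSeries A * expSeries (-A) = 1 := by
  ext1 k
  simp only [expSeries, PowerSeries.coeff_mul, PowerSeries.coeff_mk, PowerSeries.coeff_one]
  have h : ∀ p ∈ antidiagonal k, ((p.1 ! : ℂ)⁻¹ • A ^ p.1) * ((p.2 ! : ℂ)⁻¹ • (-A) ^ p.2)
      = ((1 : ℂ) ^ p.1 / (p.1 ! : ℂ) * ((-1) ^ p.2 / (p.2 ! : ℂ))) • A ^ k := by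
    intro p hp
    have hA : (-A) ^ p.2 = (-1 : ℂ) ^ p.2 • A ^ p.2 := by rw [← smul_pow, neg_one_smul]
    rw [hA, smul_smul, smul_mul_smul_comm, ← pow_add, Finset.HasAntidiagonal.mem_antidiagonal.mp hp]
    congr 1
    rw [one_pow]
    ring
  rw [Finset.sum_congr rfl h, ← Finset.sum_smul, sum_pow_div_factorial_mul, add_neg_cancel]
  split_ifs with hk
  · subst hk; simp
  · simp [zero_pow hk]

lemma seriesStar_expSeries (A : Op Q) : seriesStar (expSeries A) = expSeries Aᴴ := by
  ext1 k
  simp [seriesStar, expSeries, PowerSeries.coeff_mk, Matrix.conjTranspose_smul,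
    Matrix.conjTranspose_pow]

/-- The series is formally unitary. -/
def SeriesUnitary (f : PowerSeries (Op Q)) : Prop := f * seriesStar f = 1

lemma SeriesUnitary.mul {f g : PowerSeries (Op Q)} (hf : SeriesUnitary f) (hg : SeriesUnitary g) :
    SeriesUnitary (f * g) := by
  unfold SeriesUnitary at *
  rw [seriesStar_mul, mul_assoc, ← mul_assoc g, hg, one_mul, hf]

lemma SeriesUnitary.expSeries {A : Op Q} (hA : Aᴴ = -A) : SeriesUnitary (expSeries A) := by
  rw [SeriesUnitary, seriesStar_expSeries, hA, expSeries_mul_neg]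

lemma SeriesUnitary.list_prod {l : List (PowerSeries (Op Q))} (h : ∀ f ∈ l, SeriesUnitary f) :
    SeriesUnitary l.prod := by
  induction l with
  | nil => simp [SeriesUnitary, seriesStar_one]
  | cons f l ih =>
    rw [List.prod_cons]
    exact (h f (by simp)).mul (ih fun g hg => h g (by simp [hg]))

lemma seriesUnitary_trotterSeries {G : Op Q} (hG : G.IsHermitian) :
    SeriesUnitary (trotterSeries G) := by
  refine SeriesUnitary.mul (SeriesUnitary.expSeries ?_) (SeriesUnitary.list_prod ?_)
  · rw [Matrix.conjTranspose_smul, hG.eq, ← neg_smul]; simp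
  · intro f hf
    obtain ⟨γ, _, rfl⟩ := List.mem_map.mp hf
    refine SeriesUnitary.expSeries ?_
    rw [Matrix.conjTranspose_smul, pauliOp_conjTranspose, ← neg_smul]
    simp

lemma coeff_zero_expSeries (A : Op Q) : PowerSeries.coeff 0 (expSeries A) = 1 := by
  simp [expSeries, PowerSeries.coeff_mk]

lemma coeff_one_expSeries (A : Op Q) : PowerSeries.coeff 1 (expSeries A) = A := by
  simp [expSeries, PowerSeries.coeff_mk]

lemma coeff_one_mul' {f g : PowerSeries (Op Q)} (hf : PowerSeries.coeff 0 f = 1)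
    (hg : PowerSeries.coeff 0 g = 1) :
    PowerSeries.coeff 0 (f * g) = 1 ∧
      PowerSeries.coeff 1 (f * g) = PowerSeries.coeff 1 f + PowerSeries.coeff 1 g := by
  constructor
  · rw [PowerSeries.coeff_mul]; simp [hf, hg]
  · rw [PowerSeries.coeff_mul, Finset.Nat.antidiagonal_succ]
    simp [hf, hg, add_comm]

lemma coeff_list_prod_expSeries (l : List (Op Q)) :
    PowerSeries.coeff 0 (l.map expSeries).prod = 1 ∧
      PowerSeries.coeff 1 (l.map expSeries).prod = l.sum := by
  induction l with
  | nil => simp [PowerSeries.coeff_one]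
  | cons A l ih =>
    have := coeff_one_mul' (coeff_zero_expSeries A) ih.1
    rw [List.map_cons, List.prod_cons, List.sum_cons]
    exact ⟨this.1, by rw [this.2, coeff_one_expSeries, ih.2]⟩

/-- The first-order terms of `e^{-iGx}` and of `S(x)†` cancel. -/
lemma trotterErr_zero_one {G : Op Q} (hG : G.IsHermitian) :
    trotterErr G 0 = 1 ∧ trotterErr G 1 = 0 := by
  have h1 := coeff_list_prod_expSeries
    ((pauliSupport G).toList.map fun γ => (Complex.I * ((pauliCoeff G γ).re : ℂ)) • pauliOp γ)
  rw [List.map_map] at h1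
  have h2 := coeff_one_mul' (coeff_zero_expSeries ((-Complex.I) • G)) h1.1
  refine ⟨h2.1, h2.2.trans ?_⟩
  rw [h1.2, coeff_one_expSeries, Finset.sum_map_toList,
    sum_pauliSupport G _ fun γ h => by simp [h]]
  simp only [pauliCoeff_im_of_isHermitian hG, mul_smul, ← Finset.smul_sum, sum_pauliCoeff_smul]
  simp

/-- As the first-order term vanishes, orders two and three of `V V† = 1` read `F_k + F_k† = 0`. -/
lemma trotterErr_two_three {G : Op Q} (hG : G.IsHermitian) :
    (trotterErr G 2)ᴴ = -trotterErr G 2 ∧ (trotterErr G 3)ᴴ = -trotterErr G 3 := by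
  have hU := seriesUnitary_trotterSeries hG
  obtain ⟨h0, h1⟩ := trotterErr_zero_one hG
  have c := fun k => congrArg (PowerSeries.coeff k) hU
  have c2 := c 2
  have c3 := c 3
  rw [PowerSeries.coeff_mul, PowerSeries.coeff_one] at c2 c3
  simp only [seriesStar, PowerSeries.coeff_mk, ← trotterErr_eq, Finset.Nat.antidiagonal_succ,
    Finset.Nat.antidiagonal_zero, Finset.sum_cons, Finset.map_cons, Finset.map_singleton,
    Finset.sum_singleton] at c2 c3
  simp [h0, h1] at c2 c3
  exact ⟨eq_neg_of_add_eq_zero_left c2, eq_neg_of_add_eq_zero_left c3⟩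

end Trotter

/-! ### Supports of the Trotter error -/

section Support

open Finset.HasAntidiagonal (antidiagonal)

variable {Q : Type} [Fintype Q] [DecidableEq Q]

/-- The Pauli strings occurring in `A` are trivial on `c` and have weight at most `v`. -/
def SuppIn (c : Q) (v : ℕ) (A : Op Q) : Prop :=
  ∀ γ, pauliCoeff A γ ≠ 0 → γ c = 0 ∧ weight γ ≤ v

lemma SuppIn.mono {c : Q} {v v' : ℕ} {A : Op Q} (h : SuppIn c v A) (hv : v ≤ v') :
    SuppIn c v' A := fun γ hγ => ⟨(h γ hγ).1, (h γ hγ).2.trans hv⟩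

lemma SuppIn.smul {c : Q} {v : ℕ} {A : Op Q} (z : ℂ) (h : SuppIn c v A) : SuppIn c v (z • A) := by
  intro γ hγ
  rw [pauliCoeff_smul] at hγ
  exact h γ (right_ne_zero_of_mul hγ)

lemma SuppIn.sum {c : Q} {v : ℕ} {ι : Type*} {s : Finset ι} {A : ι → Op Q}
    (h : ∀ i ∈ s, SuppIn c v (A i)) : SuppIn c v (∑ i ∈ s, A i) := by
  intro γ hγ
  rw [pauliCoeff_sum] at hγ
  obtain ⟨i, hi, h'⟩ := Finset.exists_ne_zero_of_sum_ne_zero hγ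
  exact h i hi γ h'

lemma SuppIn.pauliOp {c : Q} {v : ℕ} {γ : PauliString Q} (h : γ c = 0) (hv : weight γ ≤ v) :
    SuppIn c v (pauliOp γ) := by
  intro δ hδ
  rw [pauliCoeff_pauliOp] at hδ
  have : δ = γ := by by_contra hne; simp [hne] at hδ
  exact this ▸ ⟨h, hv⟩

lemma weight_zero : weight (0 : PauliString Q) = 0 := by simp [weight]

lemma SuppIn.one {c : Q} {v : ℕ} : SuppIn c v (1 : Op Q) := by
  rw [← pauliOp_zero]
  exact SuppIn.pauliOp rfl (by simp [weight_zero])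

/-- The support of a product of Pauli strings lies in the union of their supports. -/
lemma weight_pauliXor_le (γ δ : PauliString Q) :
    weight (fun i => pauliXor (γ i) (δ i)) ≤ weight γ + weight δ := by
  refine (Finset.card_le_card fun i hi => ?_).trans (Finset.card_union_le _ _)
  simp only [Finset.mem_union, Finset.mem_filter, Finset.mem_univ, true_and] at hi ⊢
  by_contra h
  push Not at h
  rw [h.1, h.2] at hi
  exact hi rfl

lemma SuppIn.mul {c : Q} {v v' : ℕ} {A B : Op Q} (hA : SuppIn c v A) (hB : SuppIn c v' B) :
    SuppIn c (v + v') (A * B) := by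
  rw [mul_eq_sum_pauliOp]
  refine SuppIn.sum fun γ _ => SuppIn.sum fun δ _ => ?_
  by_cases h1 : pauliCoeff A γ = 0
  · intro ε hε; simp [h1, pauliCoeff_zero] at hε
  by_cases h2 : pauliCoeff B δ = 0
  · intro ε hε; simp [h2, pauliCoeff_zero] at hε
  obtain ⟨z, _, hz⟩ := pauliOp_mul γ δ
  rw [hz]
  obtain ⟨a1, a2⟩ := hA γ h1
  obtain ⟨b1, b2⟩ := hB δ h2
  refine ((SuppIn.pauliOp ?_ ((weight_pauliXor_le γ δ).trans (add_le_add a2 b2))).smul _).smul _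
  rw [a1, b1]; rfl

lemma SuppIn.pow {c : Q} {v : ℕ} {A : Op Q} (hA : SuppIn c v A) (k : ℕ) :
    SuppIn c (k * v) (A ^ k) := by
  induction k with
  | zero => rw [pow_zero]; exact SuppIn.one
  | succ k ih => rw [pow_succ, add_mul, one_mul]; exact ih.mul hA

/-- The coefficient of order `k` consists of Pauli strings of weight at most `k v`. -/
def SeriesSupp (c : Q) (v : ℕ) (f : PowerSeries (Op Q)) : Prop :=
  ∀ k, SuppIn c (k * v) (PowerSeries.coeff k f)

lemma SeriesSupp.mul {c : Q} {v : ℕ} {f g : PowerSeries (Op Q)} (hf : SeriesSupp c v f)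
    (hg : SeriesSupp c v g) : SeriesSupp c v (f * g) := by
  intro k
  rw [PowerSeries.coeff_mul]
  refine SuppIn.sum fun p hp => ?_
  rw [← Finset.HasAntidiagonal.mem_antidiagonal.mp hp, add_mul]
  exact (hf _).mul (hg _)

lemma SeriesSupp.expSeries {c : Q} {v : ℕ} {A : Op Q} (hA : SuppIn c v A) :
    SeriesSupp c v (expSeries A) := by
  intro k
  rw [LindbladSim.expSeries, PowerSeries.coeff_mk]
  exact (hA.pow k).smul _

lemma SeriesSupp.list_prod {c : Q} {v : ℕ} {l : List (PowerSeries (Op Q))}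
    (h : ∀ f ∈ l, SeriesSupp c v f) : SeriesSupp c v l.prod := by
  induction l with
  | nil =>
    intro k
    rw [List.prod_nil, PowerSeries.coeff_one]
    split_ifs
    · exact SuppIn.one
    · intro γ hγ; exact absurd (pauliCoeff_zero γ) hγ
  | cons f l ih =>
    rw [List.prod_cons]
    exact (h f (by simp)).mul (ih fun g hg => h g (by simp [hg]))

lemma suppIn_trotterErr {c : Q} {v : ℕ} {G : Op Q} (hG : SuppIn c v G) (k : ℕ) :
    SuppIn c (k * v) (trotterErr G k) := by
  refine (SeriesSupp.expSeries (hG.smul _)).mul (SeriesSupp.list_prod fun f hf => ?_) k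
  obtain ⟨γ, hγ, rfl⟩ := List.mem_map.mp hf
  obtain ⟨h1, h2⟩ := hG γ (mem_pauliSupport.mp (Finset.mem_toList.mp hγ))
  exact SeriesSupp.expSeries ((SuppIn.pauliOp h1 h2).smul _)

end Support

/-! ### The linear combination of unitaries for the Trotter error -/

section Compensation

open scoped Matrix.Norms.L2Operator

variable {Q : Type} [Fintype Q] [DecidableEq Q]

lemma sum_filter_range {M : Type*} [AddCommMonoid M] (f : ℕ → M) (j n : ℕ) :
    (((List.range n).filter fun k => j ≤ k).map f).sum
      = ∑ k ∈ (Finset.range n).filter fun k => j ≤ k, f k := by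
  rw [Finset.sum_filter]
  induction n with
  | zero => simp
  | succ n ih =>
    rw [List.range_succ, List.filter_append, List.map_append, List.sum_append, ih,
      Finset.sum_range_succ]
    congr 1
    by_cases h : j ≤ n <;> simp [h]

lemma sum_map_flatMap {α β M : Type*} [AddMonoid M] (l : List α) (f : α → List β) (g : β → M) :
    ((l.flatMap f).map g).sum = (l.map fun a => ((f a).map g).sum).sum := by
  induction l with
  | nil => simp
  | cons a l ih => simp [ih]

/-- The operator represented by a linear combination of unitaries. -/
def lcuOp (L : List (ℝ × Op Q)) : Op Q := (L.map fun t => (t.1 : ℂ) • t.2).sum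

/-- The `1`-norm of a linear combination of unitaries. -/
def lcuNorm (L : List (ℝ × Op Q)) : ℝ := (L.map Prod.fst).sum

lemma lcuOp_append (L L' : List (ℝ × Op Q)) : lcuOp (L ++ L') = lcuOp L + lcuOp L' := by
  simp [lcuOp]

lemma lcuNorm_append (L L' : List (ℝ × Op Q)) : lcuNorm (L ++ L') = lcuNorm L + lcuNorm L' := by
  simp [lcuNorm]

lemma norm_lcuOp_le {L : List (ℝ × Op Q)} (h : ∀ t ∈ L, 0 ≤ t.1 ∧ t.2ᴴ * t.2 = 1) :
    ‖lcuOp L‖ ≤ lcuNorm L := by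
  induction L with
  | nil => simp [lcuOp, lcuNorm]
  | cons t L ih =>
    have h1 := ih fun s hs => h s (by simp [hs])
    obtain ⟨h2, h3⟩ := h t (by simp)
    have e1 : lcuOp (t :: L) = (t.1 : ℂ) • t.2 + lcuOp L := by simp [lcuOp]
    have e2 : lcuNorm (t :: L) = t.1 + lcuNorm L := by simp [lcuNorm]
    rw [e1, e2]
    refine (norm_add_le _ _).trans (add_le_add ?_ h1)
    rw [norm_smul, Complex.norm_real, Real.norm_of_nonneg h2]
    exact mul_le_of_le_one_right h2 (norm_le_one_of_unitary h3)

/-- The rotations representing `1 + E`, for an anti-Hermitian `E`. -/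
def rotationPart (E : Op Q) : List (ℝ × Op Q) :=
  let η : ℝ := ∑ γ, |(pauliCoeff E γ).im|
  if η = 0 then [(1, 1)] else
    (pauliSupport E).toList.map fun γ =>
      (Real.sqrt (1 + η ^ 2) * (|(pauliCoeff E γ).im| / η),
        pauliRot (-(Real.sign (pauliCoeff E γ).im * Real.arctan η)) γ)

/-- The Pauli operators with phases representing `z A`. -/
def phasePart (z : ℝ) (A : Op Q) : List (ℝ × Op Q) :=
  (pauliSupport A).toList.map fun γ =>
    (z * ‖pauliCoeff A γ‖, Complex.exp (Complex.I * ((pauliCoeff A γ).arg : ℂ)) • pauliOp γ)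

lemma trotterComp_eq (G : Op Q) (x : ℝ) (K : ℕ) :
    trotterComp G x K = rotationPart (∑ k ∈ Finset.Icc 2 (min 3 K), (x : ℂ) ^ k • trotterErr G k) ++
      ((List.range (K + 1)).filter fun k => 4 ≤ k).flatMap fun k =>
        phasePart (x ^ k) (trotterErr G k) := rfl

lemma pauliCoeff_of_antiHermitian {E : Op Q} (hE : Eᴴ = -E) (γ : PauliString Q) :
    pauliCoeff E γ = Complex.I * ((pauliCoeff E γ).im : ℂ) := by
  have h := pauliCoeff_conjTranspose E γ
  rw [hE, ← neg_one_smul ℂ, pauliCoeff_smul] at h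
  have h1 := congrArg Complex.re h
  simp at h1
  apply Complex.ext
  · simp; linarith
  · simp

lemma sum_abs_im_eq_pauliNorm {E : Op Q} (hE : Eᴴ = -E) :
    ∑ γ, |(pauliCoeff E γ).im| = pauliNorm E := by
  refine Finset.sum_congr rfl fun γ _ => ?_
  conv_rhs => rw [pauliCoeff_of_antiHermitian hE γ]
  simp

/-- `√(1 + η²) e^{i sgn(a) arctan(η) P} = 1 + i sgn(a) η P`, multiplied by `|a| / η`. -/
lemma sqrt_smul_pauliRot {a η : ℝ} (ha : a ≠ 0) (hη : η ≠ 0) (γ : PauliString Q) :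
    ((Real.sqrt (1 + η ^ 2) * (|a| / η) : ℝ) : ℂ) • pauliRot (-(Real.sign a * Real.arctan η)) γ
      = ((|a| / η : ℝ) : ℂ) • (1 : Op Q) + (Complex.I * (a : ℂ)) • pauliOp γ := by
  have hs : Real.sqrt (1 + η ^ 2) ≠ 0 := (Real.sqrt_pos.mpr (by positivity)).ne'
  have h1 : Real.cos (-(Real.sign a * Real.arctan η)) = 1 / Real.sqrt (1 + η ^ 2) := by
    rw [Real.cos_neg]
    rcases Real.sign_apply_eq_of_ne_zero a ha with h | h <;> rw [h]
    · rw [neg_one_mul, Real.cos_neg, Real.cos_arctan]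
    · rw [one_mul, Real.cos_arctan]
  have h2 : Real.sin (-(Real.sign a * Real.arctan η))
      = -(Real.sign a * (η / Real.sqrt (1 + η ^ 2))) := by
    rw [Real.sin_neg]
    rcases Real.sign_apply_eq_of_ne_zero a ha with h | h <;> rw [h]
    · rw [neg_one_mul, Real.sin_neg, Real.sin_arctan]; ring
    · rw [one_mul, Real.sin_arctan, one_mul]
  have h3 : |a| * Real.sign a = a := by
    rcases lt_or_gt_of_ne ha with h | h
    · rw [Real.sign_of_neg h, abs_of_neg h]; ring
    · rw [Real.sign_of_pos h, abs_of_pos h]; ring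
  rw [pauliRot, h1, h2, smul_sub, smul_smul, smul_smul, sub_eq_add_neg, ← neg_smul]
  congr 2
  · rw [← Complex.ofReal_mul]
    congr 1
    field_simp
  · have : Real.sqrt (1 + η ^ 2) * (|a| / η) * (Real.sign a * (η / Real.sqrt (1 + η ^ 2))) = a := by
      field_simp
      exact h3
    calc _ = Complex.I * ((Real.sqrt (1 + η ^ 2) * (|a| / η)
          * (Real.sign a * (η / Real.sqrt (1 + η ^ 2))) : ℝ) : ℂ) := by push_cast; ring
      _ = _ := by rw [this]

lemma lcuOp_rotationPart {E : Op Q} (hE : Eᴴ = -E) : lcuOp (rotationPart E) = 1 + E := by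
  unfold rotationPart
  simp only []
  split_ifs with hη
  · have hE0 : E = 0 := by
      rw [← sum_pauliCoeff_smul E]
      refine Finset.sum_eq_zero fun γ _ => ?_
      have h0 := (Finset.sum_eq_zero_iff_of_nonneg (fun γ _ => abs_nonneg _)).mp hη γ
        (Finset.mem_univ _)
      rw [pauliCoeff_of_antiHermitian hE γ, abs_eq_zero.mp h0]
      simp
    simp [lcuOp, hE0]
  · set η : ℝ := ∑ γ, |(pauliCoeff E γ).im| with hη'
    have him : ∀ γ, (pauliCoeff E γ).im = 0 → pauliCoeff E γ = 0 := fun γ h => by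
      rw [pauliCoeff_of_antiHermitian hE γ, h]; simp
    rw [lcuOp, List.map_map, Finset.sum_map_toList]
    have h1 : ∀ γ ∈ pauliSupport E, ((fun t : ℝ × Op Q => (t.1 : ℂ) • t.2) ∘ fun γ =>
        (Real.sqrt (1 + η ^ 2) * (|(pauliCoeff E γ).im| / η),
        pauliRot (-(Real.sign (pauliCoeff E γ).im * Real.arctan η)) γ)) γ
        = ((|(pauliCoeff E γ).im| / η : ℝ) : ℂ) • (1 : Op Q) + pauliCoeff E γ • pauliOp γ := by
      intro γ hγ
      have hne : (pauliCoeff E γ).im ≠ 0 := fun h => mem_pauliSupport.mp hγ (him γ h)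
      simp only [Function.comp_apply]
      rw [sqrt_smul_pauliRot hne hη, ← pauliCoeff_of_antiHermitian hE γ]
    rw [Finset.sum_congr rfl h1, sum_pauliSupport E _ fun γ h => by simp [h],
      Finset.sum_add_distrib, sum_pauliCoeff_smul, ← Finset.sum_smul, ← Complex.ofReal_sum,
      ← Finset.sum_div, ← hη', div_self hη]
    simp

/-- The anti-Hermitian part enters the `1`-norm quadratically only. -/
lemma lcuNorm_rotationPart {E : Op Q} (hE : Eᴴ = -E) :
    lcuNorm (rotationPart E) = Real.sqrt (1 + pauliNorm E ^ 2) := by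
  rw [← sum_abs_im_eq_pauliNorm hE]
  unfold rotationPart
  simp only []
  split_ifs with hη
  · simp [lcuNorm, hη]
  · set η : ℝ := ∑ γ, |(pauliCoeff E γ).im| with hη'
    rw [lcuNorm, List.map_map, Finset.sum_map_toList]
    simp only [Function.comp_def]
    rw [← Finset.mul_sum, ← Finset.sum_div,
      sum_pauliSupport E (fun γ => |(pauliCoeff E γ).im|) (fun γ h => by simp [h]), ← hη',
      div_self hη, mul_one]

lemma lcuOp_phasePart (z : ℝ) (A : Op Q) : lcuOp (phasePart z A) = (z : ℂ) • A := by
  rw [lcuOp, phasePart, List.map_map, Finset.sum_map_toList]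
  have h1 : ∀ γ, ((fun t : ℝ × Op Q => (t.1 : ℂ) • t.2) ∘ fun γ =>
      (z * ‖pauliCoeff A γ‖, Complex.exp (Complex.I * ((pauliCoeff A γ).arg : ℂ)) • pauliOp γ)) γ
      = (z : ℂ) • pauliCoeff A γ • pauliOp γ := by
    intro γ
    simp only [Function.comp_apply]
    rw [smul_smul, smul_smul]
    congr 1
    conv_rhs => rw [← Complex.norm_mul_exp_arg_mul_I (pauliCoeff A γ)]
    push_cast
    rw [mul_comm Complex.I]
    ring
  simp only [h1]
  rw [sum_pauliSupport A (fun γ => (z : ℂ) • pauliCoeff A γ • pauliOp γ) fun γ h => by simp [h],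
    ← Finset.smul_sum, sum_pauliCoeff_smul]

lemma lcuNorm_phasePart (z : ℝ) (A : Op Q) : lcuNorm (phasePart z A) = z * pauliNorm A := by
  rw [lcuNorm, phasePart, List.map_map, Finset.sum_map_toList]
  simp only [Function.comp_def]
  rw [← Finset.mul_sum, sum_pauliSupport A (fun γ => ‖pauliCoeff A γ‖) fun γ h => by simp [h],
    pauliNorm]

lemma lcuOp_flatMap {ι : Type*} (l : List ι) (f : ι → List (ℝ × Op Q)) :
    lcuOp (l.flatMap f) = (l.map fun a => lcuOp (f a)).sum := sum_map_flatMap _ _ _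

lemma lcuNorm_flatMap {ι : Type*} (l : List ι) (f : ι → List (ℝ × Op Q)) :
    lcuNorm (l.flatMap f) = (l.map fun a => lcuNorm (f a)).sum := sum_map_flatMap _ _ _

lemma lowOrder_eq (G : Op Q) (x : ℝ) {K : ℕ} (hK : 3 ≤ K) :
    ∑ k ∈ Finset.Icc 2 (min 3 K), (x : ℂ) ^ k • trotterErr G k
      = (x : ℂ) ^ 2 • trotterErr G 2 + (x : ℂ) ^ 3 • trotterErr G 3 := by
  rw [min_eq_left hK]
  have : Finset.Icc 2 3 = ({2, 3} : Finset ℕ) := by decide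
  rw [this, Finset.sum_pair (by norm_num)]

lemma lowOrder_antiHermitian {G : Op Q} (hG : G.IsHermitian) (x : ℝ) :
    ((x : ℂ) ^ 2 • trotterErr G 2 + (x : ℂ) ^ 3 • trotterErr G 3)ᴴ
      = -((x : ℂ) ^ 2 • trotterErr G 2 + (x : ℂ) ^ 3 • trotterErr G 3) := by
  obtain ⟨h2, h3⟩ := trotterErr_two_three hG
  rw [Matrix.conjTranspose_add, Matrix.conjTranspose_smul, Matrix.conjTranspose_smul, h2, h3]
  simp
  abel

/-- The compensation represents the truncated series of `V(x)`. -/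
lemma lcuOp_trotterComp {G : Op Q} (hG : G.IsHermitian) (x : ℝ) {K : ℕ} (hK : 3 ≤ K) :
    lcuOp (trotterComp G x K) = ∑ k ∈ Finset.range (K + 1), (x : ℂ) ^ k • trotterErr G k := by
  rw [trotterComp_eq, lcuOp_append, lowOrder_eq G x hK,
    lcuOp_rotationPart (lowOrder_antiHermitian hG x), lcuOp_flatMap]
  simp only [lcuOp_phasePart]
  rw [sum_filter_range (fun k => ((x ^ k : ℝ) : ℂ) • trotterErr G k)]
  rw [← Finset.sum_filter_add_sum_filter_not (Finset.range (K + 1)) (fun k => 4 ≤ k)]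
  have hs : (Finset.range (K + 1)).filter (fun k => ¬ 4 ≤ k) = Finset.range 4 := by
    ext k; simp; omega
  obtain ⟨h0, h1⟩ := trotterErr_zero_one hG
  rw [hs, Finset.sum_range_succ, Finset.sum_range_succ, Finset.sum_range_succ,
    Finset.sum_range_one, h0, h1]
  push_cast
  simp
  abel

lemma mul_pow_trotterErr_le {G : Op Q} {x : ℝ} (hx : 0 ≤ x) (k : ℕ) :
    x ^ k * pauliNorm (trotterErr G k) ≤ (2 * pauliNorm G * x) ^ k := by
  have h0 := pauliNorm_nonneg G
  have h1 := (seriesBound_trotterSeries G k).trans (pow_div_factorial_le (by linarith) k)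
  rw [mul_pow (2 * pauliNorm G), mul_comm]
  exact mul_le_mul_of_nonneg_right h1 (by positivity)

/-- The `1`-norm deviates from one in order `y ^ 4` only: the rotations contribute `√(1 + η²)` with
`η = O(y ^ 2)`, the remaining terms are of order at least four. -/
lemma lcuNorm_trotterComp_bounds {G : Op Q} (hG : G.IsHermitian) {x : ℝ} (hx : 0 ≤ x) {K : ℕ}
    (hK : 3 ≤ K) {y : ℝ} (hy : y = 2 * pauliNorm G * x) (hy2 : y ≤ 1 / 2) :
    1 ≤ lcuNorm (trotterComp G x K) ∧ lcuNorm (trotterComp G x K) ≤ 1 + 4 * y ^ 4 := by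
  have hy0 : 0 ≤ y := by rw [hy]; have := pauliNorm_nonneg G; positivity
  rw [trotterComp_eq, lcuNorm_append, lowOrder_eq G x hK,
    lcuNorm_rotationPart (lowOrder_antiHermitian hG x), lcuNorm_flatMap]
  simp only [lcuNorm_phasePart]
  rw [sum_filter_range (fun k => x ^ k * pauliNorm (trotterErr G k))]
  set E := (x : ℂ) ^ 2 • trotterErr G 2 + (x : ℂ) ^ 3 • trotterErr G 3 with hE
  have hb : ∀ k, x ^ k * pauliNorm (trotterErr G k) ≤ y ^ k := by
    rw [hy]; exact mul_pow_trotterErr_le hx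
  have hEb : pauliNorm E ≤ y ^ 2 + y ^ 3 := by
    refine (pauliNorm_add _ _).trans ?_
    rw [pauliNorm_smul, pauliNorm_smul, norm_pow, norm_pow, Complex.norm_real,
      Real.norm_of_nonneg hx]
    exact add_le_add (hb 2) (hb 3)
  have hs0 : 0 ≤ ∑ k ∈ (Finset.range (K + 1)).filter fun k => 4 ≤ k,
      x ^ k * pauliNorm (trotterErr G k) :=
    Finset.sum_nonneg fun k _ => mul_nonneg (by positivity) (pauliNorm_nonneg _)
  have hs1 : ∑ k ∈ (Finset.range (K + 1)).filter fun k => 4 ≤ k,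
      x ^ k * pauliNorm (trotterErr G k) ≤ 2 * y ^ 4 :=
    (Finset.sum_le_sum fun k _ => hb k).trans
      (sum_geometric_le hy0 hy2 4 _ fun k hk => (Finset.mem_filter.mp hk).2)
  have hsq1 : 1 ≤ Real.sqrt (1 + pauliNorm E ^ 2) := by
    rw [Real.one_le_sqrt]; nlinarith [sq_nonneg (pauliNorm E)]
  have hsq2 : Real.sqrt (1 + pauliNorm E ^ 2) ≤ 1 + 2 * y ^ 4 := by
    have h1 : pauliNorm E ≤ 3 / 2 * y ^ 2 := by
      have : y ^ 3 ≤ 1 / 2 * y ^ 2 := by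
        have h2 : 0 ≤ y ^ 2 := by positivity
        calc y ^ 3 = y * y ^ 2 := by ring
          _ ≤ 1 / 2 * y ^ 2 := by gcongr
      linarith
    have h2 : pauliNorm E ^ 2 ≤ 9 / 4 * y ^ 4 := by
      have := pow_le_pow_left₀ (pauliNorm_nonneg E) h1 2
      calc _ ≤ _ := this
        _ = _ := by ring
    have h3 : 0 ≤ y ^ 4 := by positivity
    rw [Real.sqrt_le_left (by positivity)]
    nlinarith
  constructor <;> linarith

lemma isPauliLike_one (c : Q) (v : ℕ) : IsPauliLike c v (1 : Op Q) :=
  ⟨0, rfl, by simp [weight_zero], Or.inl ⟨1, by simp, by simp [pauliOp_zero]⟩⟩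

lemma mem_trotterComp {c : Q} {v : ℕ} {G : Op Q} (hG : SuppIn c v G) {x : ℝ} (hx : 0 ≤ x) {K : ℕ}
    (hK : 3 ≤ K) {t : ℝ × Op Q} (ht : t ∈ trotterComp G x K) :
    0 ≤ t.1 ∧ IsPauliLike c (K * v) t.2 := by
  rw [trotterComp_eq, List.mem_append, List.mem_flatMap] at ht
  rcases ht with ht | ⟨k, hk, ht⟩
  · unfold rotationPart at ht
    simp only [] at ht
    split_ifs at ht with hη
    · rw [List.mem_singleton] at ht
      subst ht
      exact ⟨zero_le_one, isPauliLike_one _ _⟩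
    · obtain ⟨γ, hγ, rfl⟩ := List.mem_map.mp ht
      have hγ' := mem_pauliSupport.mp (Finset.mem_toList.mp hγ)
      have hE : SuppIn c (K * v) (∑ k ∈ Finset.Icc 2 (min 3 K), (x : ℂ) ^ k • trotterErr G k) :=
        SuppIn.sum fun k hk => (SuppIn.smul _ (suppIn_trotterErr hG k)).mono
          (Nat.mul_le_mul_right _ (by rw [Finset.mem_Icc] at hk; omega))
      obtain ⟨h1, h2⟩ := hE γ hγ'
      refine ⟨?_, γ, h1, h2, Or.inr ⟨_, rfl⟩⟩
      have : 0 ≤ ∑ γ, |(pauliCoeff (∑ k ∈ Finset.Icc 2 (min 3 K),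
        (x : ℂ) ^ k • trotterErr G k) γ).im| := Finset.sum_nonneg fun _ _ => abs_nonneg _
      positivity
  · obtain ⟨γ, hγ, rfl⟩ := List.mem_map.mp ht
    have hγ' := mem_pauliSupport.mp (Finset.mem_toList.mp hγ)
    obtain ⟨h1, h2⟩ := suppIn_trotterErr hG k γ hγ'
    have hkK : k ≤ K := by
      have := List.mem_range.mp (List.mem_of_mem_filter hk)
      omega
    refine ⟨by positivity, γ, h1, h2.trans (Nat.mul_le_mul_right _ hkK), Or.inl ⟨_, ?_, rfl⟩⟩
    rw [mul_comm, Complex.norm_exp_ofReal_mul_I]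

lemma list_sum_mul_mul {ι κ : Type*} (L : List ι) (L' : List κ) (A : κ → Op Q) (B : ι → Op Q)
    (X : Op Q) :
    (L.map fun u => (L'.map fun v => A v * X * B u).sum).sum
      = (L'.map A).sum * X * (L.map B).sum := by
  have h1 : ∀ u, (L'.map fun v => A v * X * B u).sum = (L'.map A).sum * X * B u := by
    intro u
    rw [List.sum_map_mul_right, List.sum_map_mul_right]
  simp only [h1]
  rw [List.sum_map_mul_left]

lemma list_sum_apply {ι : Type*} (L : List ι) (A : ι → Module.End ℂ (Op Q)) (X : Op Q) :
    (L.map A).sum X = (L.map fun i => A i X).sum := by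
  induction L with
  | nil => simp
  | cons i L ih => simp [ih]

lemma lcuOp_conjTranspose (L : List (ℝ × Op Q)) :
    (lcuOp L)ᴴ = (L.map fun t => (t.1 : ℂ) • t.2ᴴ).sum := by
  unfold lcuOp
  induction L with
  | nil => simp
  | cons t L ih =>
    rw [List.map_cons, List.sum_cons, Matrix.conjTranspose_add, ih, Matrix.conjTranspose_smul]
    simp

variable {n : ℕ}

/-- The formula `lcsV` implements conjugation by the truncated `V(x)`. -/
lemma dual_lcsV {G : Op (Register n 2)} {v : ℕ} (hG : SuppIn (ctlAnc n) v G) {x : ℝ} (hx : 0 ≤ x)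
    {K : ℕ} (hK : 3 ≤ K) {X : Op (Register n 2)} (hX : TrivialOn (ctlAnc n) X) :
    (lcsV G x K).dual X = (lcuOp (trotterComp G x K))ᴴ * X * lcuOp (trotterComp G x K) := by
  set L := trotterComp G x K with hL
  have h0 : ∀ t ∈ L, TrivialOn (ctlAnc n) t.2 := fun t ht => (mem_trotterComp hG hx hK ht).2.trivialOn
  have h1 : (lcsV G x K).dual X = (L.map fun u => (L.map fun v =>
      (1 / 2 : ℂ) • (((v.1 : ℂ) • v.2ᴴ) * X * ((u.1 : ℂ) • u.2)
        + ((u.1 : ℂ) • u.2ᴴ) * X * ((v.1 : ℂ) • v.2))).sum).sum := by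
    unfold lcsV LCS.dual
    rw [sum_map_flatMap, list_sum_apply, ← hL]
    congr 1
    refine List.map_congr_left fun u hu => ?_
    rw [List.map_map, list_sum_apply]
    congr 1
    refine List.map_congr_left fun v hv => ?_
    simp only [Function.comp_apply, LinearMap.smul_apply]
    rw [dual_conjCircuit 0 (h0 u hu) (h0 v hv) hX]
    simp only [Complex.ofReal_zero, mul_zero, neg_zero, Complex.exp_zero, one_smul,
      Complex.ofReal_mul, Matrix.smul_mul, Matrix.mul_smul, smul_add, smul_smul]
    congr 2 <;> ring
  have h2 := list_sum_mul_mul L L (fun v => (v.1 : ℂ) • v.2ᴴ) (fun u => (u.1 : ℂ) • u.2) X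
  have h3 : (L.map fun u => (L.map fun v => ((u.1 : ℂ) • u.2ᴴ) * X * ((v.1 : ℂ) • v.2)).sum).sum
      = (L.map fun t => (t.1 : ℂ) • t.2ᴴ).sum * X * (L.map fun t => (t.1 : ℂ) • t.2).sum := by
    have : ∀ u : ℝ × Op (Register n 2), (L.map fun v => ((u.1 : ℂ) • u.2ᴴ) * X * ((v.1 : ℂ) • v.2)).sum
        = ((u.1 : ℂ) • u.2ᴴ) * X * (L.map fun t => (t.1 : ℂ) • t.2).sum := by
      intro u
      rw [List.sum_map_mul_left]
    simp only [this]
    rw [List.sum_map_mul_right, List.sum_map_mul_right]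
  rw [h1]
  simp only [List.sum_map_add, ← List.smul_sum, smul_add]
  have hsm : ∀ (z : ℂ) {ι : Type} (l : List ι) (f : ι → Op (Register n 2)),
      (l.map fun i => z • f i).sum = z • (l.map f).sum := by
    intro z ι l f
    induction l with
    | nil => simp
    | cons i l ih => simp [ih]
  simp only [hsm]
  rw [h2, h3, lcuOp_conjTranspose, lcuOp, ← smul_add, ← two_smul ℂ, smul_smul]
  norm_num

lemma mu_lcsV (G : Op (Register n 2)) (x : ℝ) (K : ℕ) :
    (lcsV G x K).mu = lcuNorm (trotterComp G x K) ^ 2 := by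
  unfold lcsV LCS.mu lcuNorm
  rw [sum_map_flatMap]
  simp only [List.map_map, Function.comp_def]
  simp only [List.sum_map_mul_left]
  rw [List.sum_map_mul_right, pow_two]

lemma mem_lcsV {G : Op (Register n 2)} {v : ℕ} (hG : SuppIn (ctlAnc n) v G) {x : ℝ} (hx : 0 ≤ x)
    {K : ℕ} (hK : 3 ≤ K) {t : ℝ × Circuit (Register n 2)} (ht : t ∈ lcsV G x K) :
    0 ≤ t.1 ∧ CircuitBound (24 * (K * v) + 30) t.2 := by
  unfold lcsV at ht
  obtain ⟨u, hu, ht⟩ := List.mem_flatMap.mp ht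
  obtain ⟨v, hv, rfl⟩ := List.mem_map.mp ht
  obtain ⟨u1, u2⟩ := mem_trotterComp hG hx hK hu
  obtain ⟨v1, v2⟩ := mem_trotterComp hG hx hK hv
  exact ⟨mul_nonneg u1 v1, circuitBound_conjCircuit 0 u2 v2⟩

/-- Trotter step and truncated compensation together approximate the exact evolution. -/
lemma norm_trotter_sub_exp_le {c : Q} {v : ℕ} {G : Op Q} (hG : G.IsHermitian)
    (hs : SuppIn c v G) {x : ℝ} (hx : 0 ≤ x)
    {K : ℕ} (hK : 3 ≤ K) {y : ℝ} (hy : y = 2 * pauliNorm G * x) (hy2 : y ≤ 1 / 2) (X : Op Q) :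
    ‖trotterInv G x * ((lcuOp (trotterComp G x K))ᴴ * X * lcuOp (trotterComp G x K))
        * (trotterInv G x)ᴴ
      - NormedSpace.exp ((Complex.I * (x : ℂ)) • G) * X
        * NormedSpace.exp ((-(Complex.I * (x : ℂ))) • G)‖ ≤ 8 * y ^ (K + 1) * ‖X‖ := by
  have hy0 : 0 ≤ y := by rw [hy]; have := pauliNorm_nonneg G; positivity
  set A := lcuOp (trotterComp G x K) with hA
  set S := trotterInv G x with hS
  set E := NormedSpace.exp ((-(Complex.I * (x : ℂ))) • G) with hE
  set V := E * S with hV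
  have hSS : S * Sᴴ = 1 := trotterInv_mul_conjTranspose G x
  have hEstar : Eᴴ = NormedSpace.exp ((Complex.I * (x : ℂ)) • G) := by
    rw [← Matrix.star_eq_conjTranspose, hE, NormedSpace.star_exp, star_smul,
      Matrix.star_eq_conjTranspose, hG.eq]
    congr 2
    simp
  have hVA : ‖A - V‖ ≤ 2 * y ^ (K + 1) := by
    rw [hA, lcuOp_trotterComp hG x hK]
    refine norm_sub_sum_range_le hy2 (fun k => ?_) (evalsTo_trotterSeries G x).2 (K + 1)
    rw [norm_smul, norm_pow, Complex.norm_real, Real.norm_of_nonneg hx, hy]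
    refine le_trans ?_ (mul_pow_trotterErr_le hx k)
    gcongr
    exact norm_le_pauliNorm _
  have hyK : y ^ (K + 1) ≤ 1 / 16 := by
    calc y ^ (K + 1) ≤ (1 / 2) ^ (K + 1) := by gcongr
      _ ≤ (1 / 2) ^ 4 := pow_le_pow_of_le_one (by norm_num) (by norm_num) (by omega)
      _ = 1 / 16 := by norm_num
  have hAn : ‖A‖ ≤ 5 / 4 := by
    refine (norm_lcuOp_le fun t ht => ?_).trans
      ((lcuNorm_trotterComp_bounds hG hx hK hy hy2).2.trans ?_)
    · obtain ⟨h1, h2⟩ := mem_trotterComp hs hx hK ht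
      exact ⟨h1, h2.unitary⟩
    · have : y ^ 4 ≤ (1 / 2) ^ 4 := by gcongr
      linarith
  have hVn : ‖V‖ ≤ 11 / 8 := by
    have : V = A - (A - V) := by abel
    rw [this]
    refine (norm_sub_le _ _).trans ?_
    linarith
  -- as `E = V Sᴴ`, both evolutions are conjugated by `S`, and `A` is compared with `V`
  have h1 : NormedSpace.exp ((Complex.I * (x : ℂ)) • G) * X * E = S * (Vᴴ * X * V) * Sᴴ := by
    rw [← hEstar, hV, Matrix.conjTranspose_mul]
    calc _ = (S * Sᴴ) * Eᴴ * X * E * (S * Sᴴ) := by rw [hSS]; simp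
      _ = _ := by simp only [mul_assoc]
  have h2 : Aᴴ * X * A - Vᴴ * X * V = (A - V)ᴴ * X * A + Vᴴ * X * (A - V) := by
    rw [Matrix.conjTranspose_sub]; noncomm_ring
  have hSn : ‖Sᴴ‖ ≤ 1 := norm_le_one_of_unitary (by simpa using hSS)
  have hSn' : ‖S‖ ≤ 1 := by rwa [Matrix.l2_opNorm_conjTranspose] at hSn
  rw [h1, ← sub_mul, ← mul_sub, h2]
  have h3 : ‖(A - V)ᴴ * X * A + Vᴴ * X * (A - V)‖ ≤ 8 * y ^ (K + 1) * ‖X‖ := by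
    refine (norm_add_le _ _).trans ?_
    have e1 : ‖(A - V)ᴴ * X * A‖ ≤ 2 * y ^ (K + 1) * ‖X‖ * (5 / 4) := by
      refine (norm_mul_le _ _).trans ?_
      gcongr
      refine (norm_mul_le _ _).trans ?_
      rw [Matrix.l2_opNorm_conjTranspose]
      gcongr
    have e2 : ‖Vᴴ * X * (A - V)‖ ≤ 11 / 8 * ‖X‖ * (2 * y ^ (K + 1)) := by
      refine (norm_mul_le _ _).trans ?_
      gcongr
      refine (norm_mul_le _ _).trans ?_
      rw [Matrix.l2_opNorm_conjTranspose]
      gcongr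
    have : 0 ≤ y ^ (K + 1) * ‖X‖ := by positivity
    linarith
  calc _ ≤ ‖S‖ * ‖(A - V)ᴴ * X * A + Vᴴ * X * (A - V)‖ * ‖Sᴴ‖ := by
        refine (norm_mul_le _ _).trans ?_
        gcongr
        exact norm_mul_le _ _
    _ ≤ 1 * (8 * y ^ (K + 1) * ‖X‖) * 1 := by gcongr
    _ = _ := by ring

end Compensation

/-! ### Formal sums in the Heisenberg picture -/

section Formal

open Finset.HasAntidiagonal (antidiagonal)
open scoped Matrix.Norms.L2Operator

variable {n : ℕ}

/-- Superoperators in the Heisenberg picture, with the operator norm induced by the spectral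
norm of observables. -/
def HOp (n : ℕ) : Type := Op (Fin n) →L[ℂ] Op (Fin n)

namespace HOp

instance : NormedRing (HOp n) := inferInstanceAs (NormedRing (Op (Fin n) →L[ℂ] Op (Fin n)))

instance : NormedAlgebra ℂ (HOp n) :=
  inferInstanceAs (NormedAlgebra ℂ (Op (Fin n) →L[ℂ] Op (Fin n)))

instance : CompleteSpace (HOp n) :=
  inferInstanceAs (CompleteSpace (Op (Fin n) →L[ℂ] Op (Fin n)))

instance : FunLike (HOp n) (Op (Fin n)) (Op (Fin n)) :=
  inferInstanceAs (FunLike (Op (Fin n) →L[ℂ] Op (Fin n)) (Op (Fin n)) (Op (Fin n)))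

lemma mul_apply (E F : HOp n) (X : Op (Fin n)) : (E * F) X = E (F X) := rfl

lemma one_apply (X : Op (Fin n)) : (1 : HOp n) X = X := rfl

lemma zero_apply (X : Op (Fin n)) : (0 : HOp n) X = 0 := rfl

lemma add_apply (E F : HOp n) (X : Op (Fin n)) : (E + F) X = E X + F X := rfl

lemma sub_apply (E F : HOp n) (X : Op (Fin n)) : (E - F) X = E X - F X := rfl

lemma smul_apply (z : ℂ) (E : HOp n) (X : Op (Fin n)) : (z • E) X = z • E X := rfl

/-- Evaluation at an observable. -/
def applyCLM (X : Op (Fin n)) : HOp n →L[ℂ] Op (Fin n) :=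
  (ContinuousLinearMap.apply ℂ (Op (Fin n)) X : (Op (Fin n) →L[ℂ] Op (Fin n)) →L[ℂ] Op (Fin n))

lemma applyCLM_apply (X : Op (Fin n)) (E : HOp n) : applyCLM X E = E X := rfl

lemma sum_apply {ι : Type*} (s : Finset ι) (E : ι → HOp n) (X : Op (Fin n)) :
    (∑ i ∈ s, E i) X = ∑ i ∈ s, E i X := map_sum (applyCLM X) E s

lemma norm_apply_le (E : HOp n) (X : Op (Fin n)) : ‖E X‖ ≤ ‖E‖ * ‖X‖ :=
  ContinuousLinearMap.le_opNorm (E : Op (Fin n) →L[ℂ] Op (Fin n)) X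

lemma norm_le_of {E : HOp n} {b : ℝ} (hb : 0 ≤ b) (h : ∀ X, ‖E X‖ ≤ b * ‖X‖) : ‖E‖ ≤ b :=
  ContinuousLinearMap.opNorm_le_bound (E : Op (Fin n) →L[ℂ] Op (Fin n)) hb h

lemma ext {E F : HOp n} (h : ∀ X, E X = F X) : E = F := DFunLike.ext E F h

end HOp

/-- The adjoint `X ↦ B† X A` of `ρ ↦ A ρ B†`. -/
def heis (A B : Op (Fin n)) : HOp n :=
  (ContinuousLinearMap.mulLeftRight ℂ (Op (Fin n)) Bᴴ A : Op (Fin n) →L[ℂ] Op (Fin n))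

lemma heis_apply (A B X : Op (Fin n)) : heis A B X = Bᴴ * X * A :=
  ContinuousLinearMap.mulLeftRight_apply ℂ (Op (Fin n)) Bᴴ A X

lemma heis_mul (A B A' B' : Op (Fin n)) : heis (A * A') (B * B') = heis A' B' * heis A B := by
  refine HOp.ext fun X => ?_
  simp only [HOp.mul_apply, heis_apply, Matrix.conjTranspose_mul, mul_assoc]

lemma heis_one : heis (1 : Op (Fin n)) 1 = 1 := by
  refine HOp.ext fun X => ?_
  simp [heis_apply, HOp.one_apply]

lemma norm_heis_le {A B : Op (Fin n)} (hA : Aᴴ * A = 1) (hB : Bᴴ * B = 1) : ‖heis A B‖ ≤ 1 := by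
  refine (ContinuousLinearMap.opNorm_mulLeftRight_apply_apply_le ℂ _ _ _).trans ?_
  rw [Matrix.l2_opNorm_conjTranspose]
  exact mul_le_one₀ (norm_le_one_of_unitary hB) (norm_nonneg _) (norm_le_one_of_unitary hA)

/-- The value of a formal sum in the Heisenberg picture. -/
def FormalSum.heisVal (F : FormalSum n) : HOp n := (F.map fun t => t.1 • heis t.2.1 t.2.2).sum

/-- The `1`-norm of a formal sum. -/
def FormalSum.norm1 (F : FormalSum n) : ℝ := (F.map fun t => ‖t.1‖).sum

lemma heisVal_nil : FormalSum.heisVal ([] : FormalSum n) = 0 := rfl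

lemma norm1_nil : FormalSum.norm1 ([] : FormalSum n) = 0 := rfl

lemma heisVal_append (F G : FormalSum n) :
    FormalSum.heisVal (F ++ G) = F.heisVal + G.heisVal := by
  simp [FormalSum.heisVal]

lemma norm1_append (F G : FormalSum n) : FormalSum.norm1 (F ++ G) = F.norm1 + G.norm1 := by
  simp [FormalSum.norm1]

lemma heisVal_flatMap {ι : Type*} (l : List ι) (f : ι → FormalSum n) :
    FormalSum.heisVal (l.flatMap f) = (l.map fun i => (f i).heisVal).sum := sum_map_flatMap _ _ _

lemma norm1_flatMap {ι : Type*} (l : List ι) (f : ι → FormalSum n) :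
    FormalSum.norm1 (l.flatMap f) = (l.map fun i => (f i).norm1).sum := sum_map_flatMap _ _ _

lemma norm1_nonneg (F : FormalSum n) : 0 ≤ F.norm1 :=
  List.sum_nonneg fun x hx => by
    obtain ⟨t, _, rfl⟩ := List.mem_map.mp hx
    exact norm_nonneg _

lemma heisVal_one : (FormalSum.one : FormalSum n).heisVal = 1 := by
  simp [FormalSum.heisVal, FormalSum.one, heis_one]

lemma norm1_one : (FormalSum.one : FormalSum n).norm1 = 1 := by
  simp [FormalSum.norm1, FormalSum.one]

lemma heisVal_scale (z : ℂ) (F : FormalSum n) : (F.scale z).heisVal = z • F.heisVal := by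
  unfold FormalSum.heisVal FormalSum.scale
  induction F with
  | nil => exact (smul_zero z).symm
  | cons t F ih =>
    rw [List.map_cons, List.map_cons, List.sum_cons, ih, List.map_cons, List.sum_cons, smul_add,
      smul_smul]

lemma norm1_scale (z : ℂ) (F : FormalSum n) : (F.scale z).norm1 = ‖z‖ * F.norm1 := by
  unfold FormalSum.norm1 FormalSum.scale
  rw [List.map_map, ← List.sum_map_mul_left]
  simp [Function.comp_def]

lemma heisVal_comp (F G : FormalSum n) : (F.comp G).heisVal = G.heisVal * F.heisVal := by
  unfold FormalSum.comp
  rw [heisVal_flatMap]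
  have h : ∀ f : ℂ × Op (Fin n) × Op (Fin n),
      FormalSum.heisVal (G.map fun g => (f.1 * g.1, f.2.1 * g.2.1, f.2.2 * g.2.2))
        = G.heisVal * (f.1 • heis f.2.1 f.2.2) := by
    intro f
    unfold FormalSum.heisVal
    rw [List.map_map, ← List.sum_map_mul_right]
    congr 1
    refine List.map_congr_left fun g _ => ?_
    simp only [Function.comp_apply]
    rw [heis_mul, smul_mul_smul_comm, mul_comm f.1]
  simp only [h]
  rw [List.sum_map_mul_left]
  rfl

lemma norm1_comp (F G : FormalSum n) : (F.comp G).norm1 = F.norm1 * G.norm1 := by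
  unfold FormalSum.comp
  rw [norm1_flatMap]
  have h : ∀ f : ℂ × Op (Fin n) × Op (Fin n),
      FormalSum.norm1 (G.map fun g => (f.1 * g.1, f.2.1 * g.2.1, f.2.2 * g.2.2))
        = ‖f.1‖ * G.norm1 := by
    intro f
    unfold FormalSum.norm1
    rw [List.map_map, ← List.sum_map_mul_left]
    simp [Function.comp_def]
  simp only [h]
  rw [List.sum_map_mul_right]
  rfl

lemma heisVal_compList_cons (F : FormalSum n) (Fs : List (FormalSum n)) :
    (FormalSum.compList (F :: Fs)).heisVal = (FormalSum.compList Fs).heisVal * F.heisVal :=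
  heisVal_comp F _

lemma heisVal_compList_append (Fs Gs : List (FormalSum n)) :
    (FormalSum.compList (Fs ++ Gs)).heisVal
      = (FormalSum.compList Gs).heisVal * (FormalSum.compList Fs).heisVal := by
  induction Fs with
  | nil =>
    have : (FormalSum.compList ([] : List (FormalSum n))).heisVal = 1 := heisVal_one
    rw [List.nil_append, this, mul_one]
  | cons F Fs ih => rw [List.cons_append, heisVal_compList_cons, ih, heisVal_compList_cons, mul_assoc]

lemma heisVal_compList_replicate (k : ℕ) (F : FormalSum n) :
    (FormalSum.compList (List.replicate k F)).heisVal = F.heisVal ^ k := by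
  induction k with
  | zero => exact heisVal_one
  | succ k ih => rw [List.replicate_succ, heisVal_compList_cons, ih, pow_succ]

lemma norm1_compList_le {Fs : List (FormalSum n)} {b : ℝ} (hb : 0 ≤ b)
    (h : ∀ F ∈ Fs, F.norm1 ≤ b) : (FormalSum.compList Fs).norm1 ≤ b ^ Fs.length := by
  induction Fs with
  | nil => exact norm1_one.le
  | cons F Fs ih =>
    have : (FormalSum.compList (F :: Fs)).norm1 = F.norm1 * (FormalSum.compList Fs).norm1 :=
      norm1_comp F _
    rw [this, List.length_cons, pow_succ, mul_comm]
    exact mul_le_mul (ih fun G hG => h G (by simp [hG])) (h F (by simp)) (norm1_nonneg _)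
      (by positivity)

/-- Pauli strings of weight at most `v`, with phases. -/
def IsPhasedPauli (v : ℕ) (A : Op (Fin n)) : Prop :=
  ∃ (γ : PauliString (Fin n)) (z : ℂ), weight γ ≤ v ∧ ‖z‖ = 1 ∧ A = z • pauliOp γ

/-- The operators of the formal sum are Pauli strings of weight at most `v`, with phases. -/
def FormalSum.IsPauli (v : ℕ) (F : FormalSum n) : Prop :=
  ∀ t ∈ F, IsPhasedPauli v t.2.1 ∧ IsPhasedPauli v t.2.2

lemma IsPhasedPauli.mono {v v' : ℕ} {A : Op (Fin n)} (h : IsPhasedPauli v A) (hv : v ≤ v') :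
    IsPhasedPauli v' A := let ⟨γ, z, h1, h2⟩ := h; ⟨γ, z, h1.trans hv, h2⟩

lemma IsPhasedPauli.unitary {v : ℕ} {A : Op (Fin n)} (h : IsPhasedPauli v A) : Aᴴ * A = 1 := by
  obtain ⟨γ, z, _, hz, rfl⟩ := h
  exact smul_one_unitary hz (by rw [pauliOp_conjTranspose, pauliOp_mul_self])

lemma IsPhasedPauli.mul {v v' : ℕ} {A B : Op (Fin n)} (hA : IsPhasedPauli v A)
    (hB : IsPhasedPauli v' B) : IsPhasedPauli (v + v') (A * B) := by
  obtain ⟨γ, z, h1, hz, rfl⟩ := hA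
  obtain ⟨δ, z', h1', hz', rfl⟩ := hB
  obtain ⟨u, hu, h⟩ := pauliOp_mul γ δ
  refine ⟨_, z * z' * u, (weight_pauliXor_le γ δ).trans (add_le_add h1 h1'), ?_, ?_⟩
  · rw [norm_mul, norm_mul, hz, hz', hu]; norm_num
  · rw [smul_mul_smul_comm, h, smul_smul]

lemma IsPhasedPauli.one (v : ℕ) : IsPhasedPauli v (1 : Op (Fin n)) :=
  ⟨0, 1, by simp [weight_zero], by simp, by simp [pauliOp_zero]⟩

lemma IsPhasedPauli.isPauliLike {v : ℕ} {A : Op (Fin n)} (h : IsPhasedPauli v A) :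
    IsPauliLike (ctlAnc n) v (onSystem A) := by
  obtain ⟨γ, z, h1, hz, rfl⟩ := h
  refine ⟨extendString γ, rfl, by rwa [weight_extendString], Or.inl ⟨z, hz, ?_⟩⟩
  rw [onSystem_smul, onSystem_pauliOp]

lemma FormalSum.IsPauli.mono {v v' : ℕ} {F : FormalSum n} (h : F.IsPauli v) (hv : v ≤ v') :
    F.IsPauli v' := fun t ht => ⟨(h t ht).1.mono hv, (h t ht).2.mono hv⟩

lemma FormalSum.IsPauli.comp {v v' : ℕ} {F G : FormalSum n} (hF : F.IsPauli v)
    (hG : G.IsPauli v') : (F.comp G).IsPauli (v + v') := by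
  intro t ht
  obtain ⟨f, hf, ht⟩ := List.mem_flatMap.mp ht
  obtain ⟨g, hg, rfl⟩ := List.mem_map.mp ht
  exact ⟨(hF f hf).1.mul (hG g hg).1, (hF f hf).2.mul (hG g hg).2⟩

lemma FormalSum.IsPauli.one (v : ℕ) : (FormalSum.one : FormalSum n).IsPauli v := by
  intro t ht
  have : t = (1, 1, 1) := by simpa [FormalSum.one] using ht
  subst this
  exact ⟨IsPhasedPauli.one v, IsPhasedPauli.one v⟩

lemma FormalSum.IsPauli.scale {v : ℕ} {F : FormalSum n} (z : ℂ) (hF : F.IsPauli v) :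
    (F.scale z).IsPauli v := by
  intro t ht
  obtain ⟨f, hf, rfl⟩ := List.mem_map.mp ht
  exact hF f hf

lemma FormalSum.IsPauli.compList {v : ℕ} {Fs : List (FormalSum n)} (h : ∀ F ∈ Fs, F.IsPauli v) :
    (FormalSum.compList Fs).IsPauli (Fs.length * v) := by
  induction Fs with
  | nil => exact FormalSum.IsPauli.one _
  | cons F Fs ih =>
    have : (Fs.length + 1) * v = v + Fs.length * v := by ring
    rw [List.length_cons, this]
    exact (h F (by simp)).comp (ih fun G hG => h G (by simp [hG]))

lemma norm_heisVal_le {v : ℕ} {F : FormalSum n} (hF : F.IsPauli v) : ‖F.heisVal‖ ≤ F.norm1 := by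
  unfold FormalSum.heisVal FormalSum.norm1
  induction F with
  | nil => simp
  | cons t F ih =>
    rw [List.map_cons, List.sum_cons, List.map_cons, List.sum_cons]
    refine (norm_add_le _ _).trans (add_le_add ?_ (ih fun s hs => hF s (by simp [hs])))
    obtain ⟨h1, h2⟩ := hF t (by simp)
    rw [norm_smul]
    exact mul_le_of_le_one_right (norm_nonneg _) (norm_heis_le h1.unitary h2.unitary)

/-! #### Formal series -/

lemma sum_map_range {M : Type*} [AddCommMonoid M] (f : ℕ → M) (k : ℕ) :
    ((List.range k).map f).sum = ∑ i ∈ Finset.range k, f i := by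
  induction k with
  | zero => simp
  | succ k ih => simp [List.range_succ, Finset.sum_range_succ, ih]

lemma sum_map_finRange {M : Type*} [AddCommMonoid M] {m : ℕ} (f : Fin m → M) :
    ((List.finRange m).map f).sum = ∑ l, f l := by
  rw [← List.ofFn_eq_map, List.sum_ofFn]

lemma heisVal_mul (f g : FormalSeries n) (k : ℕ) :
    (f.mul g k).heisVal = ∑ p ∈ antidiagonal k, (g p.1).heisVal * (f p.2).heisVal := by
  rw [← Finset.Nat.sum_antidiagonal_swap, Finset.Nat.sum_antidiagonal_eq_sum_range_succ_mk]
  unfold FormalSeries.mul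
  rw [heisVal_flatMap, sum_map_range]
  simp only [heisVal_comp, Prod.fst_swap, Prod.snd_swap]

lemma norm1_mul (f g : FormalSeries n) (k : ℕ) :
    (f.mul g k).norm1 = ∑ p ∈ antidiagonal k, (f p.1).norm1 * (g p.2).norm1 := by
  unfold FormalSeries.mul
  rw [norm1_flatMap, Finset.Nat.sum_antidiagonal_eq_sum_range_succ_mk, sum_map_range]
  simp only [norm1_comp]

/-- The series `f`, with terms acting on observables, converges at `τ` to `s`. -/
def FormalSeries.EvalsTo (f : FormalSeries n) (τ : ℝ) (s : HOp n) : Prop :=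
  AbsSum (fun k => (τ : ℂ) ^ k • (f k).heisVal) s

lemma FormalSeries.EvalsTo.mul {f g : FormalSeries n} {τ : ℝ} {s t : HOp n}
    (hf : f.EvalsTo τ s) (hg : g.EvalsTo τ t) : (f.mul g).EvalsTo τ (t * s) := by
  have := AbsSum.mul hg hf
  unfold FormalSeries.EvalsTo
  convert this using 2 with k
  rw [heisVal_mul, Finset.smul_sum]
  refine Finset.sum_congr rfl fun p hp => ?_
  rw [smul_mul_smul_comm, ← pow_add, Finset.HasAntidiagonal.mem_antidiagonal.mp hp]

lemma FormalSeries.EvalsTo.one {τ : ℝ} : (FormalSeries.one : FormalSeries n).EvalsTo τ 1 := by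
  have := AbsSum.one (R := HOp n)
  unfold FormalSeries.EvalsTo
  convert this using 2 with k
  unfold FormalSeries.one
  split_ifs with h
  · simp [h, heisVal_one]
  · simp [heisVal_nil]

lemma heisVal_exp (z : ℂ) (F : FormalSum n) (k : ℕ) :
    (FormalSeries.exp z F k).heisVal = (z ^ k / (k ! : ℂ)) • F.heisVal ^ k := by
  rw [FormalSeries.exp, heisVal_scale, heisVal_compList_replicate]

lemma FormalSeries.EvalsTo.exp (z : ℂ) (F : FormalSum n) (τ : ℝ) :
    (FormalSeries.exp z F).EvalsTo τ (NormedSpace.exp ((τ * z : ℂ) • F.heisVal)) := by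
  have := absSum_exp ((τ * z : ℂ) • F.heisVal)
  unfold FormalSeries.EvalsTo
  convert this using 2 with k
  rw [heisVal_exp, smul_pow, smul_smul, smul_smul]
  congr 1
  rw [mul_pow]; ring

/-- The `1`-norms of the coefficients are at most those of `exp (a τ)`. -/
def FormalSeries.ExpBound (a : ℝ) (f : FormalSeries n) : Prop :=
  ∀ k, (f k).norm1 ≤ a ^ k / (k ! : ℝ)

lemma FormalSeries.ExpBound.one : FormalSeries.ExpBound 0 (FormalSeries.one : FormalSeries n) := by
  intro k
  unfold FormalSeries.one
  split_ifs with h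
  · subst h; simp [norm1_one]
  · simp [norm1_nil, h]

lemma FormalSeries.ExpBound.mul {a b : ℝ} {f g : FormalSeries n} (hf : f.ExpBound a)
    (hg : g.ExpBound b) : (f.mul g).ExpBound (a + b) := by
  intro k
  rw [norm1_mul, ← sum_pow_div_factorial_mul]
  refine Finset.sum_le_sum fun p _ => ?_
  exact mul_le_mul (hf _) (hg _) (norm1_nonneg _) ((norm1_nonneg _).trans (hf _))

lemma FormalSeries.ExpBound.exp {z : ℂ} {F : FormalSum n} {a : ℝ} (hz : ‖z‖ ≤ 1)
    (hF : F.norm1 ≤ a) : (FormalSeries.exp z F).ExpBound a := by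
  intro k
  have ha : 0 ≤ a := (norm1_nonneg F).trans hF
  rw [FormalSeries.exp, norm1_scale, norm_div, norm_pow, Complex.norm_natCast, div_mul_eq_mul_div]
  have h1 := norm1_compList_le ha (Fs := List.replicate k F)
    fun G hG => (List.eq_of_mem_replicate hG) ▸ hF
  rw [List.length_replicate] at h1
  gcongr
  exact (mul_le_of_le_one_left (norm1_nonneg _) (pow_le_one₀ (norm_nonneg _) hz)).trans h1

/-- The series has constant term `1`, also as a formal sum of `1`-norm one, and first-order term
`A`. -/
def FormalSeries.Starts (f : FormalSeries n) (A : HOp n) : Prop :=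
  (f 0).norm1 = 1 ∧ (f 0).heisVal = 1 ∧ (f 1).heisVal = A

lemma FormalSeries.Starts.mul {f g : FormalSeries n} {A B : HOp n} (hf : f.Starts A)
    (hg : g.Starts B) : (f.mul g).Starts (A + B) := by
  refine ⟨?_, ?_, ?_⟩
  · rw [norm1_mul]; simp [hf.1, hg.1]
  · rw [heisVal_mul]; simp [hf.2.1, hg.2.1]
  · rw [heisVal_mul, Finset.Nat.antidiagonal_succ]
    simp [hf.2.1, hg.2.1, hf.2.2, hg.2.2]

lemma FormalSeries.Starts.one : (FormalSeries.one : FormalSeries n).Starts 0 :=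
  ⟨norm1_one, heisVal_one, rfl⟩

lemma FormalSeries.Starts.exp (z : ℂ) (F : FormalSum n) :
    (FormalSeries.exp z F).Starts (z • F.heisVal) := by
  refine ⟨?_, ?_, ?_⟩
  · rw [FormalSeries.exp, norm1_scale]
    simp [FormalSum.compList, norm1_one]
  · rw [heisVal_exp]; simp
  · rw [heisVal_exp]; simp

/-- Superoperators compatible with the adjoint, which therefore preserve Hermiticity.
Unitary-conjugate operations are of this kind. -/
def IsHermitianPreserving (E : HOp n) : Prop := ∀ X, E Xᴴ = (E X)ᴴ

lemma IsHermitianPreserving.mul {E F : HOp n} (hE : IsHermitianPreserving E)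
    (hF : IsHermitianPreserving F) : IsHermitianPreserving (E * F) := fun X => by
  rw [HOp.mul_apply, HOp.mul_apply, hF, hE]

lemma IsHermitianPreserving.one : IsHermitianPreserving (1 : HOp n) := fun _ => rfl

lemma IsHermitianPreserving.zero : IsHermitianPreserving (0 : HOp n) := fun _ => Matrix.conjTranspose_zero.symm

lemma IsHermitianPreserving.add {E F : HOp n} (hE : IsHermitianPreserving E)
    (hF : IsHermitianPreserving F) : IsHermitianPreserving (E + F) := fun X => by
  rw [HOp.add_apply, HOp.add_apply, hE, hF,
    Matrix.conjTranspose_add]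

lemma IsHermitianPreserving.smul {E : HOp n} (r : ℝ) (hE : IsHermitianPreserving E) :
    IsHermitianPreserving ((r : ℂ) • E) := fun X => by
  rw [HOp.smul_apply, HOp.smul_apply, hE,
    Matrix.conjTranspose_smul, Complex.star_def, Complex.conj_ofReal]

lemma IsHermitianPreserving.sub {E F : HOp n} (hE : IsHermitianPreserving E)
    (hF : IsHermitianPreserving F) : IsHermitianPreserving (E - F) := by
  have := hE.add (hF.smul (-1))
  rwa [Complex.ofReal_neg, Complex.ofReal_one, neg_one_smul, ← sub_eq_add_neg] at this

lemma IsHermitianPreserving.sum {ι : Type*} {s : Finset ι} {E : ι → HOp n}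
    (h : ∀ i ∈ s, IsHermitianPreserving (E i)) : IsHermitianPreserving (∑ i ∈ s, E i) := by
  induction s using Finset.cons_induction with
  | empty => exact IsHermitianPreserving.zero
  | cons a s ha ih =>
    rw [Finset.sum_cons]
    exact (h a (by simp)).add (ih fun i hi => h i (by simp [hi]))

lemma IsHermitianPreserving.list_sum {ι : Type*} {l : List ι} {E : ι → HOp n}
    (h : ∀ i ∈ l, IsHermitianPreserving (E i)) : IsHermitianPreserving (l.map E).sum := by
  induction l with
  | nil => exact IsHermitianPreserving.zero
  | cons a s ih =>
    rw [List.map_cons, List.sum_cons]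
    exact (h a (by simp)).add (ih fun i hi => h i (by simp [hi]))

lemma IsHermitianPreserving.pow {E : HOp n} (hE : IsHermitianPreserving E) (k : ℕ) :
    IsHermitianPreserving (E ^ k) := by
  induction k with
  | zero => exact IsHermitianPreserving.one
  | succ k ih => rw [pow_succ]; exact ih.mul hE

/-- All coefficients of the series preserve Hermiticity, and those of order `k` are built from
Pauli strings of weight at most `k v`. -/
def FormalSeries.IsPauli (v : ℕ) (f : FormalSeries n) : Prop :=
  ∀ k, IsHermitianPreserving (f k).heisVal ∧ (f k).IsPauli (k * v)

lemma FormalSeries.IsPauli.mul {v : ℕ} {f g : FormalSeries n} (hf : f.IsPauli v)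
    (hg : g.IsPauli v) : (f.mul g).IsPauli v := by
  intro k
  constructor
  · rw [heisVal_mul]
    exact IsHermitianPreserving.sum fun p _ => (hg _).1.mul (hf _).1
  · intro t ht
    obtain ⟨i, hi, ht⟩ := List.mem_flatMap.mp ht
    have hik : i ≤ k := Nat.lt_succ_iff.mp (List.mem_range.mp hi)
    have := ((hf i).2.comp (hg (k - i)).2) t ht
    rwa [← add_mul, Nat.add_sub_cancel' hik] at this

lemma FormalSeries.IsPauli.one {v : ℕ} : (FormalSeries.one : FormalSeries n).IsPauli v := by
  intro k
  unfold FormalSeries.one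
  split_ifs with h
  · exact ⟨heisVal_one (n := n) ▸ IsHermitianPreserving.one, FormalSum.IsPauli.one _⟩
  · exact ⟨IsHermitianPreserving.zero, fun t ht => by simp at ht⟩

lemma FormalSeries.IsPauli.exp {v : ℕ} {F : FormalSum n} (r : ℝ)
    (hF : IsHermitianPreserving F.heisVal) (hv : F.IsPauli v) :
    (FormalSeries.exp (r : ℂ) F).IsPauli v := by
  intro k
  constructor
  · rw [heisVal_exp]
    have := (hF.pow k).smul (r ^ k / (k ! : ℝ))
    push_cast at this
    exact this
  · have := FormalSum.IsPauli.compList (Fs := List.replicate k F) (v := v)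
      fun G hG => (List.eq_of_mem_replicate hG) ▸ hv
    rw [List.length_replicate] at this
    exact this.scale _

/-! ### Sampling a formal series -/

lemma sum_toLCS_orders {M : Type*} [AddCommMonoid M] (f : ℕ → M) (K : ℕ) (h1 : f 1 = 0) :
    ((0 :: (List.range (K + 1)).filter fun k => 2 ≤ k).map f).sum
      = ∑ k ∈ Finset.range (K + 1), f k := by
  rw [List.map_cons, List.sum_cons, sum_filter_range, Finset.sum_filter]
  rcases K with _ | K
  · simp
  · rw [Finset.sum_range_succ' _ (K + 1), Finset.sum_range_succ' _ K,
      Finset.sum_range_succ' _ (K + 1), Finset.sum_range_succ' _ K]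
    simp only [h1, Nat.le_add_left, if_true]
    simp [h1, add_comm]

/-- A unitary-conjugate operation averages a term with its conjugate; on a Hermiticity-preserving
formal sum the average is the sum itself. -/
lemma sum_conjCircuit {F : FormalSum n}
    (hH : IsHermitianPreserving F.heisVal) (r : ℝ) (X : Op (Fin n)) :
    (F.map fun t => ((r * ‖t.1‖ : ℝ) : ℂ) •
      circuitDual (conjCircuit t.1.arg (onSystem t.2.1) (onSystem t.2.2)) (onSystem X)).sum
      = onSystem ((r : ℂ) • F.heisVal X) := by
  have h1 : ∀ t ∈ F, ((r * ‖t.1‖ : ℝ) : ℂ) •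
      circuitDual (conjCircuit t.1.arg (onSystem t.2.1) (onSystem t.2.2)) (onSystem X)
      = onSystemHom n 2 (((r / 2 : ℝ) : ℂ) • ((t.1 • heis t.2.1 t.2.2) X
          + ((t.1 • heis t.2.1 t.2.2) Xᴴ)ᴴ)) := by
    intro t _
    rw [dual_conjCircuit _ (trivialOn_onSystem _ _) (trivialOn_onSystem _ _)
      (trivialOn_onSystem _ _)]
    simp only [← onSystem_conjTranspose, ← onSystem_mul, ← onSystem_smul, ← onSystem_add,
      onSystemHom_apply, HOp.smul_apply, heis_apply, Matrix.conjTranspose_smul,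
      Matrix.conjTranspose_mul, Matrix.conjTranspose_conjTranspose]
    congr 1
    have e1 : t.1 = ‖t.1‖ * Complex.exp (Complex.I * t.1.arg) := by
      conv_lhs => rw [← Complex.norm_mul_exp_arg_mul_I t.1]
      rw [mul_comm Complex.I]
    have e2 : star t.1 = ‖t.1‖ * Complex.exp (-(Complex.I * t.1.arg)) := by
      conv_lhs => rw [e1]
      rw [Complex.star_def, map_mul, Complex.conj_ofReal, ← Complex.exp_conj, map_mul,
        Complex.conj_I, Complex.conj_ofReal, neg_mul]
    rw [e2]
    generalize Complex.exp (-(Complex.I * t.1.arg)) = u' at *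
    generalize Complex.exp (Complex.I * t.1.arg) = u at *
    have e3 : ∀ A B : Op (Fin n), ((r / 2 : ℝ) : ℂ) • (t.1 • A + B)
        = ((r / 2 : ℝ) : ℂ) • ((‖t.1‖ * u : ℂ) • A + B) := fun A B => by rw [← e1]
    rw [e3, smul_add, smul_add, smul_add, smul_smul, smul_smul,
      smul_smul, smul_smul, smul_smul, smul_smul, ← mul_assoc t.2.1ᴴ]
    congr 2
    · push_cast; ring
    · push_cast; ring
  have h3 : ∀ (l : List (ℂ × Op (Fin n) × Op (Fin n))) (g : ℂ × Op (Fin n) × Op (Fin n) → Op (Fin n)),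
      (l.map fun t => onSystemHom n 2 (g t)).sum = onSystemHom n 2 (l.map g).sum := by
    intro l g
    rw [map_list_sum, List.map_map]
    rfl
  rw [List.map_congr_left h1, h3, onSystemHom_apply]
  congr 1
  have h2 : (F.map fun t : ℂ × Op (Fin n) × Op (Fin n) =>
      ((r / 2 : ℝ) : ℂ) • ((t.1 • heis t.2.1 t.2.2) X + ((t.1 • heis t.2.1 t.2.2) Xᴴ)ᴴ)).sum
      = ((r / 2 : ℝ) : ℂ) • (F.heisVal X + (F.heisVal Xᴴ)ᴴ) := by
    clear h1 hH
    unfold FormalSum.heisVal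
    induction F with
    | nil => simp [HOp.zero_apply]
    | cons t F ih =>
      rw [List.map_cons, List.sum_cons, ih, List.map_cons, List.sum_cons,
        HOp.add_apply, HOp.add_apply, Matrix.conjTranspose_add,
        ← smul_add]
      congr 1
      abel
  rw [h2, hH, Matrix.conjTranspose_conjTranspose, ← two_smul ℂ, smul_smul]
  congr 1
  push_cast; ring

/-- The value of the truncated series. -/
def FormalSeries.trunc (f : FormalSeries n) (τ : ℝ) (K : ℕ) : HOp n :=
  ∑ k ∈ Finset.range (K + 1), (τ : ℂ) ^ k • (f k).heisVal

lemma dual_toLCS {v : ℕ} {f : FormalSeries n} (hf : f.IsPauli v) (h1 : (f 1).heisVal = 0)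
    (τ : ℝ) (K : ℕ) (X : Op (Fin n)) :
    (f.toLCS τ K).dual (onSystem X) = onSystem (f.trunc τ K X) := by
  unfold FormalSeries.toLCS LCS.dual
  rw [sum_map_flatMap, list_sum_apply]
  have h2 : ∀ k, (((f k).map fun t => (τ ^ k * ‖t.1‖,
      conjCircuit t.1.arg (onSystem t.2.1) (onSystem t.2.2))).map
        fun t : ℝ × Circuit (Register n 2) => (t.1 : ℂ) • circuitDual t.2).sum (onSystem X)
      = onSystemHom n 2 ((τ : ℂ) ^ k • (f k).heisVal X) := by
    intro k
    rw [list_sum_apply, List.map_map]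
    have := sum_conjCircuit (hf k).1 (τ ^ k) X
    rw [Complex.ofReal_pow] at this
    exact this
  simp only [h2]
  rw [sum_toLCS_orders _ _ (by rw [h1, HOp.zero_apply, smul_zero, map_zero]), ← map_sum, onSystemHom_apply, FormalSeries.trunc,
    HOp.sum_apply]
  rfl

lemma mem_toLCS {v : ℕ} {f : FormalSeries n} (hf : f.IsPauli v) {τ : ℝ} (hτ : 0 ≤ τ) {K : ℕ}
    {t : ℝ × Circuit (Register n 2)} (ht : t ∈ f.toLCS τ K) :
    0 ≤ t.1 ∧ CircuitBound (24 * (K * v) + 30) t.2 := by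
  unfold FormalSeries.toLCS at ht
  obtain ⟨k, hk, ht⟩ := List.mem_flatMap.mp ht
  obtain ⟨s, hs, rfl⟩ := List.mem_map.mp ht
  have hkK : k ≤ K := by
    rcases List.mem_cons.mp hk with rfl | hk
    · exact Nat.zero_le _
    · have := (List.mem_filter.mp hk).1
      simpa [Nat.lt_succ_iff] using this
  obtain ⟨h1, h2⟩ := ((hf k).2.mono (Nat.mul_le_mul_right v hkK)) s hs
  exact ⟨by positivity, circuitBound_conjCircuit _ h1.isPauliLike h2.isPauliLike⟩

/-- With constant term one and no first-order term, the `1`-norm of the truncated series deviates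
from one in order `y ^ 2`. -/
lemma toLCS_bounds {v : ℕ} {f : FormalSeries n} (hf : f.IsPauli v) (hs : f.Starts 0) {τ : ℝ}
    (hτ : 0 ≤ τ) (K : ℕ) {y : ℝ} (hy0 : 0 ≤ y) (hy : y ≤ 1 / 2)
    (hb : ∀ k, τ ^ k * (f k).norm1 ≤ y ^ k) {s : HOp n} (he : f.EvalsTo τ s) :
    1 ≤ (f.toLCS τ K).mu ∧ (f.toLCS τ K).mu ≤ 1 + 2 * y ^ 2 ∧
      ‖f.trunc τ K‖ ≤ (f.toLCS τ K).mu ∧ ‖f.trunc τ K - s‖ ≤ 2 * y ^ (K + 1) := by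
  have hn : ∀ k, ‖(τ : ℂ) ^ k • (f k).heisVal‖ ≤ τ ^ k * (f k).norm1 := by
    intro k
    rw [norm_smul, norm_pow, Complex.norm_real, Real.norm_of_nonneg hτ]
    exact mul_le_mul_of_nonneg_left (norm_heisVal_le (hf k).2) (by positivity)
  have hmu : (f.toLCS τ K).mu
      = 1 + ∑ k ∈ (Finset.range (K + 1)).filter (fun k => 2 ≤ k), τ ^ k * (f k).norm1 := by
    unfold FormalSeries.toLCS LCS.mu
    rw [sum_map_flatMap]
    have : ∀ k, (((f k).map fun t => (τ ^ k * ‖t.1‖,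
        conjCircuit t.1.arg (onSystem t.2.1) (onSystem t.2.2))).map Prod.fst).sum
        = τ ^ k * (f k).norm1 := by
      intro k
      rw [List.map_map, FormalSum.norm1, ← List.sum_map_mul_left]
      rfl
    simp only [this]
    rw [List.map_cons, List.sum_cons, sum_filter_range, hs.1]
    simp
  have hpos : ∀ k, 0 ≤ τ ^ k * (f k).norm1 := fun k =>
    mul_nonneg (by positivity) (norm1_nonneg _)
  refine ⟨?_, ?_, ?_, ?_⟩
  · rw [hmu]
    exact le_add_of_nonneg_right (Finset.sum_nonneg fun k _ => hpos k)
  · rw [hmu]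
    have := sum_geometric_le hy0 hy 2 ((Finset.range (K + 1)).filter (fun k => 2 ≤ k))
      fun k hk => (Finset.mem_filter.mp hk).2
    exact add_le_add le_rfl ((Finset.sum_le_sum fun k _ => hb k).trans this)
  · rw [FormalSeries.trunc, ← sum_toLCS_orders _ _ (by rw [hs.2.2, smul_zero]), List.map_cons,
      List.sum_cons, sum_filter_range, hmu]
    refine (norm_add_le _ _).trans (add_le_add ?_ ((norm_sum_le _ _).trans
      (Finset.sum_le_sum fun k _ => hn k)))
    have := hn 0
    rwa [hs.1, pow_zero, mul_one] at this
  · exact norm_sub_sum_range_le hy (fun k => (hn k).trans (hb k)) he.2 (K + 1)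

/-! ### Pauli decompositions of superoperators -/

/-- `𝓔 ↦ χ_{αβ}` is linear. -/
def processLin (α β : PauliString (Fin n)) : SuperOp n →ₗ[ℂ] ℂ where
  toFun E := processMatrix E α β
  map_add' E F := by
    simp only [processMatrix, LinearMap.add_apply, mul_add, Matrix.trace_add, Finset.sum_add_distrib]
  map_smul' z E := by
    simp only [processMatrix, LinearMap.smul_apply, Matrix.mul_smul, Matrix.trace_smul, smul_eq_mul,
      RingHom.id_apply, ← Finset.mul_sum]
    ring

/-- The adjoint of a superoperator, through its process matrix. -/
def superDual : SuperOp n →ₗ[ℂ] HOp n :=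
  ∑ p : PauliString (Fin n) × PauliString (Fin n),
    (processLin p.1 p.2).smulRight (heis (pauliOp p.1) (pauliOp p.2))

lemma heisVal_pauliSum (E : SuperOp n) : (pauliSum E).heisVal = superDual E := by
  classical
  rw [FormalSum.heisVal, pauliSum, List.map_map, Finset.sum_map_toList, superDual,
    LinearMap.sum_apply]
  refine Finset.sum_subset (Finset.filter_subset _ _) fun p _ hp => ?_
  have : processMatrix E p.1 p.2 = 0 := by simpa using hp
  simp [this]

lemma norm1_pauliSum (E : SuperOp n) :
    (pauliSum E).norm1 = ∑ p : PauliString (Fin n) × PauliString (Fin n), ‖processLin p.1 p.2 E‖ := by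
  classical
  rw [FormalSum.norm1, pauliSum, List.map_map, Finset.sum_map_toList]
  refine Finset.sum_subset (Finset.filter_subset _ _) fun p _ hp => ?_
  have : processMatrix E p.1 p.2 = 0 := by simpa using hp
  simp [this]

lemma norm1_pauliSum_sub (E F : SuperOp n) :
    (pauliSum (E - F)).norm1 ≤ (pauliSum E).norm1 + (pauliSum F).norm1 := by
  simp only [norm1_pauliSum, map_sub, ← Finset.sum_add_distrib]
  exact Finset.sum_le_sum fun _ _ => norm_sub_le _ _

lemma norm1_pauliSum_smul (z : ℂ) (E : SuperOp n) :
    (pauliSum (z • E)).norm1 = ‖z‖ * (pauliSum E).norm1 := by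
  simp only [norm1_pauliSum, map_smul, norm_smul, Finset.mul_sum]

/-- Only Pauli strings of weight at most `v` occur in the process matrix. -/
def ProcLocal (v : ℕ) (E : SuperOp n) : Prop :=
  ∀ α β, processLin α β E ≠ 0 → weight α ≤ v ∧ weight β ≤ v

lemma ProcLocal.sub {v : ℕ} {E F : SuperOp n} (hE : ProcLocal v E) (hF : ProcLocal v F) :
    ProcLocal v (E - F) := by
  intro α β h
  rw [map_sub] at h
  by_cases h1 : processLin α β E = 0
  · exact hF α β fun h2 => h (by rw [h1, h2, sub_zero])
  · exact hE α β h1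

lemma ProcLocal.smul {v : ℕ} {E : SuperOp n} (z : ℂ) (hE : ProcLocal v E) :
    ProcLocal v (z • E) := by
  intro α β h
  rw [map_smul] at h
  exact hE α β (right_ne_zero_of_mul h)

lemma ProcLocal.isPauli {v : ℕ} {E : SuperOp n} (hE : ProcLocal v E) : (pauliSum E).IsPauli v := by
  intro t ht
  unfold pauliSum at ht
  obtain ⟨p, hp, rfl⟩ := List.mem_map.mp ht
  have hp' : processMatrix E p.1 p.2 ≠ 0 := by simpa using Finset.mem_toList.mp hp
  obtain ⟨h1, h2⟩ := hE p.1 p.2 hp'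
  exact ⟨⟨p.1, 1, h1, by simp, by simp⟩, ⟨p.2, 1, h2, by simp, by simp⟩⟩

/-- The process matrix of `X ↦ A X B` is the outer product of the Pauli coefficients. -/
lemma processLin_sandwich (A B : Op (Fin n)) (α β : PauliString (Fin n)) :
    processLin α β (sandwich A B) = pauliCoeff A α * pauliCoeff B β := by
  have h1 : ∀ x y : Fin n → Fin 2,
      ((pauliOp α * Matrix.single x y 1 * (pauliOp β)ᴴ)ᴴ * sandwich A B (Matrix.single x y 1)).trace
        = (pauliOp α * A) x x * (B * pauliOp β) y y := by
    intro x y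
    have h2 : (pauliOp α * Matrix.single x y 1 * (pauliOp β)ᴴ)ᴴ * sandwich A B (Matrix.single x y 1)
        = pauliOp β * ((Matrix.single y x 1 * (pauliOp α * A) * Matrix.single x y 1) * B) := by
      simp only [sandwich_apply, Matrix.conjTranspose_mul, pauliOp_conjTranspose,
        Matrix.conjTranspose_single, star_one, mul_assoc]
    rw [h2, Matrix.single_mul_mul_single, Matrix.trace_mul_comm, mul_assoc, Matrix.trace_single_mul,
      one_mul, mul_one, smul_eq_mul]
  show processMatrix _ α β = _
  unfold processMatrix
  simp only [h1]
  simp only [← Finset.mul_sum, ← Finset.sum_mul]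
  rw [pauliCoeff, pauliCoeff, Matrix.trace_mul_comm (pauliOp β) B, Fintype.card_fin]
  simp only [Matrix.trace, Matrix.diag]
  rw [show (4 : ℂ) = 2 * 2 by norm_num, mul_pow, mul_inv]
  ring

lemma superDual_sandwich (A B X : Op (Fin n)) : superDual (sandwich A B) X = B * X * A := by
  rw [superDual, LinearMap.sum_apply, HOp.sum_apply, Fintype.sum_prod_type]
  simp only [LinearMap.smulRight_apply, processLin_sandwich, HOp.smul_apply, heis_apply,
    pauliOp_conjTranspose]
  conv_rhs => rw [← sum_pauliCoeff_smul A, ← sum_pauliCoeff_smul B]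
  rw [Finset.mul_sum]
  refine Finset.sum_congr rfl fun α _ => ?_
  rw [Finset.sum_mul, Finset.sum_mul]
  refine Finset.sum_congr rfl fun β _ => ?_
  rw [smul_mul_assoc, smul_mul_assoc, mul_smul_comm, smul_smul, mul_comm]

lemma norm1_pauliSum_sandwich (A B : Op (Fin n)) :
    (pauliSum (sandwich A B)).norm1 = pauliNorm A * pauliNorm B := by
  rw [norm1_pauliSum, Fintype.sum_prod_type]
  simp only [processLin_sandwich, norm_mul, pauliNorm]
  rw [Finset.sum_mul_sum]

lemma IsLocal.mul {v v' : ℕ} {A B : Op (Fin n)} (hA : IsLocal v A) (hB : IsLocal v' B) :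
    IsLocal (v + v') (A * B) := by
  intro ε hε
  rw [mem_pauliSupport, mul_eq_sum_pauliOp, pauliCoeff_sum] at hε
  obtain ⟨γ, _, hγ⟩ := Finset.exists_ne_zero_of_sum_ne_zero hε
  rw [pauliCoeff_sum] at hγ
  obtain ⟨δ, _, hδ⟩ := Finset.exists_ne_zero_of_sum_ne_zero hγ
  obtain ⟨z, _, hz⟩ := pauliOp_mul γ δ
  rw [hz, pauliCoeff_smul, pauliCoeff_smul, pauliCoeff_pauliOp] at hδ
  have h1 := left_ne_zero_of_mul hδ
  have h2 : ε = fun i => pauliXor (γ i) (δ i) := by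
    by_contra hne
    simp [hne] at hδ
  rw [h2]
  exact (weight_pauliXor_le γ δ).trans (add_le_add
    (hA γ (mem_pauliSupport.mpr (left_ne_zero_of_mul h1)))
    (hB δ (mem_pauliSupport.mpr (right_ne_zero_of_mul h1))))

lemma IsLocal.one (v : ℕ) : IsLocal v (1 : Op (Fin n)) := by
  intro γ hγ
  rw [mem_pauliSupport, ← pauliOp_zero, pauliCoeff_pauliOp] at hγ
  have : γ = 0 := by
    by_contra hne
    simp [hne] at hγ
  simp [this, weight_zero]

lemma IsLocal.conjTranspose {v : ℕ} {A : Op (Fin n)} (hA : IsLocal v A) : IsLocal v Aᴴ := by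
  intro γ hγ
  rw [mem_pauliSupport, pauliCoeff_conjTranspose] at hγ
  exact hA γ (mem_pauliSupport.mpr fun h => hγ (by rw [h, star_zero]))

lemma ProcLocal.sandwich {v : ℕ} {A B : Op (Fin n)} (hA : IsLocal v A) (hB : IsLocal v B) :
    ProcLocal v (sandwich A B) := by
  intro α β h
  rw [processLin_sandwich] at h
  exact ⟨hA α (mem_pauliSupport.mpr (left_ne_zero_of_mul h)),
    hB β (mem_pauliSupport.mpr (right_ne_zero_of_mul h))⟩

lemma IsLocal.mono {v v' : ℕ} {A : Op (Fin n)} (hA : IsLocal v A) (h : v ≤ v') : IsLocal v' A :=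
  fun γ hγ => (hA γ hγ).trans h

/-- The adjoint of the Hamiltonian part, `X ↦ i[H, X]`. -/
def hamDual (H : Op (Fin n)) : HOp n := superDual (hamPart H)

/-- The adjoint of a dissipator. -/
def dissDual (D : Op (Fin n)) : HOp n := superDual (dissPart D)

lemma hamPart_eq (H : Op (Fin n)) :
    hamPart H = (-Complex.I) • (sandwich H 1 - sandwich 1 H) := by
  unfold hamPart sandwich
  congr 2 <;> ext1 X <;> simp

lemma jumpPart_eq (D : Op (Fin n)) :
    jumpPart D 0 = sandwich D Dᴴ ∧ jumpPart D 1 = sandwich (Dᴴ * D) 1 ∧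
      jumpPart D 2 = sandwich 1 (Dᴴ * D) := by
  refine ⟨rfl, ?_, ?_⟩
  · refine LinearMap.ext fun X => ?_
    simp [jumpPart, sandwich_apply, mul_assoc]
  · refine LinearMap.ext fun X => ?_
    simp [jumpPart, sandwich_apply, mul_assoc]

lemma dissPart_eq (D : Op (Fin n)) :
    dissPart D = sandwich D Dᴴ - (1 / 2 : ℂ) • sandwich (Dᴴ * D) 1
      - (1 / 2 : ℂ) • sandwich 1 (Dᴴ * D) := by
  obtain ⟨h0, h1, h2⟩ := jumpPart_eq D
  rw [dissPart, h0, h1, h2]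

lemma hamDual_apply (H X : Op (Fin n)) : hamDual H X = (-Complex.I) • (X * H - H * X) := by
  rw [hamDual, hamPart_eq, map_smul, map_sub, HOp.smul_apply, HOp.sub_apply, superDual_sandwich,
    superDual_sandwich, one_mul, mul_one]

lemma dissDual_apply (D X : Op (Fin n)) :
    dissDual D X = Dᴴ * X * D - (1 / 2 : ℂ) • (X * (Dᴴ * D)) - (1 / 2 : ℂ) • (Dᴴ * D * X) := by
  rw [dissDual, dissPart_eq, map_sub, map_sub, map_smul, map_smul, HOp.sub_apply, HOp.sub_apply,
    HOp.smul_apply, HOp.smul_apply, superDual_sandwich, superDual_sandwich, superDual_sandwich,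
    one_mul, mul_one]

lemma isHermitianPreserving_hamDual {H : Op (Fin n)} (hH : H.IsHermitian) :
    IsHermitianPreserving (hamDual H) := by
  intro X
  rw [hamDual_apply, hamDual_apply, Matrix.conjTranspose_smul, Matrix.conjTranspose_sub,
    Matrix.conjTranspose_mul, Matrix.conjTranspose_mul, hH.eq, star_neg, Complex.star_def,
    Complex.conj_I, neg_neg, neg_smul, ← smul_neg, neg_sub]

lemma isHermitianPreserving_dissDual (D : Op (Fin n)) : IsHermitianPreserving (dissDual D) := by
  intro X
  simp only [dissDual_apply, Matrix.conjTranspose_smul, Matrix.conjTranspose_sub,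
    Matrix.conjTranspose_mul, Matrix.conjTranspose_conjTranspose, mul_assoc]
  rw [show star (1 / 2 : ℂ) = 1 / 2 by simp, sub_right_comm]

lemma norm1_hamPart_le (H : Op (Fin n)) : (pauliSum (hamPart H)).norm1 ≤ 2 * pauliNorm H := by
  rw [hamPart_eq, norm1_pauliSum_smul, norm_neg, Complex.norm_I, one_mul]
  refine (norm1_pauliSum_sub _ _).trans (le_of_eq ?_)
  rw [norm1_pauliSum_sandwich, norm1_pauliSum_sandwich, pauliNorm_one]
  ring

lemma pauliNorm_conjTranspose_mul_self_le (D : Op (Fin n)) :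
    pauliNorm (Dᴴ * D) ≤ pauliNorm D ^ 2 := by
  refine (pauliNorm_mul _ _).trans (le_of_eq ?_)
  rw [pauliNorm_conjTranspose, pow_two]

lemma norm1_dissPart_le (D : Op (Fin n)) :
    (pauliSum (dissPart D)).norm1 ≤ 2 * pauliNorm D ^ 2 := by
  rw [dissPart_eq]
  have h1 := norm1_pauliSum_sub (sandwich D Dᴴ - (1 / 2 : ℂ) • sandwich (Dᴴ * D) 1)
    ((1 / 2 : ℂ) • sandwich 1 (Dᴴ * D))
  have h2 := norm1_pauliSum_sub (sandwich D Dᴴ) ((1 / 2 : ℂ) • sandwich (Dᴴ * D) 1)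
  have h3 := pauliNorm_conjTranspose_mul_self_le D
  rw [norm1_pauliSum_smul, norm1_pauliSum_sandwich, pauliNorm_one] at h1
  rw [norm1_pauliSum_smul, norm1_pauliSum_sandwich, norm1_pauliSum_sandwich, pauliNorm_one,
    pauliNorm_conjTranspose] at h2
  have h4 : ‖(1 / 2 : ℂ)‖ = 1 / 2 := by norm_num
  rw [h4] at h1 h2
  nlinarith

lemma norm1_jumpPart_le (D : Op (Fin n)) (i : Fin 3) :
    (pauliSum (jumpPart D i)).norm1 ≤ pauliNorm D ^ 2 := by
  obtain ⟨h0, h1, h2⟩ := jumpPart_eq D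
  have h3 := pauliNorm_conjTranspose_mul_self_le D
  fin_cases i
  · show (pauliSum (jumpPart D 0)).norm1 ≤ _
    rw [h0, norm1_pauliSum_sandwich, pauliNorm_conjTranspose, pow_two]
  · show (pauliSum (jumpPart D 1)).norm1 ≤ _
    rwa [h1, norm1_pauliSum_sandwich, pauliNorm_one, mul_one]
  · show (pauliSum (jumpPart D 2)).norm1 ≤ _
    rwa [h2, norm1_pauliSum_sandwich, pauliNorm_one, one_mul]

lemma IsLocal.conjTranspose_mul_self {w : ℕ} {D : Op (Fin n)} (hD : IsLocal w D) :
    IsLocal (2 * w) (Dᴴ * D) := by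
  rw [two_mul]
  exact hD.conjTranspose.mul hD

lemma procLocal_jumpPart {w : ℕ} {D : Op (Fin n)} (hD : IsLocal w D) (i : Fin 3) :
    ProcLocal (2 * w) (jumpPart D i) := by
  obtain ⟨h0, h1, h2⟩ := jumpPart_eq D
  have hw : w ≤ 2 * w := by omega
  fin_cases i
  · show ProcLocal _ (jumpPart D 0)
    rw [h0]; exact ProcLocal.sandwich (hD.mono hw) (hD.conjTranspose.mono hw)
  · show ProcLocal _ (jumpPart D 1)
    rw [h1]; exact ProcLocal.sandwich hD.conjTranspose_mul_self (IsLocal.one _)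
  · show ProcLocal _ (jumpPart D 2)
    rw [h2]; exact ProcLocal.sandwich (IsLocal.one _) hD.conjTranspose_mul_self

lemma procLocal_dissPart {w : ℕ} {D : Op (Fin n)} (hD : IsLocal w D) :
    ProcLocal (2 * w) (dissPart D) :=
  ((procLocal_jumpPart hD 0).sub ((procLocal_jumpPart hD 1).smul _)).sub
    ((procLocal_jumpPart hD 2).smul _)

lemma procLocal_hamPart {w : ℕ} {H : Op (Fin n)} (hH : IsLocal w H) :
    ProcLocal (2 * w) (hamPart H) := by
  have hw : w ≤ 2 * w := by omega
  rw [hamPart_eq]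
  exact ((ProcLocal.sandwich (hH.mono hw) (IsLocal.one _)).sub
    (ProcLocal.sandwich (IsLocal.one _) (hH.mono hw))).smul _

/-! ### The compensation of the splitting -/

variable {m : ℕ}

/-- The adjoint of the Lindbladian. -/
def lindDual (H : Op (Fin n)) (D : Fin m → Op (Fin n)) : HOp n :=
  hamDual H + ((List.finRange m).map fun l => dissDual (D l)).sum

lemma heisVal_lindblad (H : Op (Fin n)) (D : Fin m → Op (Fin n)) :
    FormalSum.heisVal (pauliSum (hamPart H) ++
      (List.finRange m).flatMap fun l => pauliSum (dissPart (D l))) = lindDual H D := by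
  rw [heisVal_append, heisVal_flatMap]
  simp only [heisVal_pauliSum]
  rfl

lemma isHermitianPreserving_lindDual {H : Op (Fin n)} (hH : H.IsHermitian)
    (D : Fin m → Op (Fin n)) : IsHermitianPreserving (lindDual H D) :=
  (isHermitianPreserving_hamDual hH).add
    (IsHermitianPreserving.list_sum fun l _ => isHermitianPreserving_dissDual (D l))

lemma norm1_lindblad_le (H : Op (Fin n)) (D : Fin m → Op (Fin n)) :
    FormalSum.norm1 (pauliSum (hamPart H) ++
      (List.finRange m).flatMap fun l => pauliSum (dissPart (D l))) ≤ lindbladNorm H D := by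
  rw [norm1_append, norm1_flatMap, lindbladNorm, mul_add, Finset.mul_sum]
  refine add_le_add (norm1_hamPart_le H) ?_
  rw [sum_map_finRange]
  exact Finset.sum_le_sum fun l _ => norm1_dissPart_le (D l)

lemma seriesM_isPauli {w : ℕ} {H : Op (Fin n)} {D : Fin m → Op (Fin n)} (hH : H.IsHermitian)
    (hw : IsLocal w H) (hD : ∀ l, IsLocal w (D l)) : (seriesM H D).IsPauli (2 * w) := by
  have h1 : ((1 : ℝ) : ℂ) = 1 := by simp
  have h2 : ((-1 : ℝ) : ℂ) = -1 := by simp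
  unfold seriesM
  simp only []
  rw [← h2, ← h1]
  refine FormalSeries.IsPauli.mul (FormalSeries.IsPauli.exp 1 ?_ ?_)
    (FormalSeries.IsPauli.mul (FormalSeries.IsPauli.exp (-1) ?_ ?_) ?_)
  · rw [heisVal_lindblad]
    exact isHermitianPreserving_lindDual hH D
  · intro t ht
    rcases List.mem_append.mp ht with ht | ht
    · exact (procLocal_hamPart hw).isPauli t ht
    · obtain ⟨l, _, ht⟩ := List.mem_flatMap.mp ht
      exact (procLocal_dissPart (hD l)).isPauli t ht
  · rw [heisVal_pauliSum]
    exact isHermitianPreserving_hamDual hH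
  · exact (procLocal_hamPart hw).isPauli
  · induction List.finRange m with
    | nil => exact FormalSeries.IsPauli.one
    | cons l L ih =>
      refine FormalSeries.IsPauli.mul (FormalSeries.IsPauli.exp (-1) ?_ ?_) ih
      · rw [heisVal_pauliSum]
        exact isHermitianPreserving_dissDual _
      · exact (procLocal_dissPart (hD l)).isPauli

/-- To first order the splitting of `𝓛` is exact. -/
lemma seriesM_starts (H : Op (Fin n)) (D : Fin m → Op (Fin n)) : (seriesM H D).Starts 0 := by
  unfold seriesM
  simp only []
  have h1 : ∀ L : List (Fin m), FormalSeries.Starts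
      ((L.map fun l => FormalSeries.exp (-1) (pauliSum (dissPart (D l)))).foldr
        FormalSeries.mul FormalSeries.one) (-(L.map fun l => dissDual (D l)).sum) := by
    intro L
    induction L with
    | nil => rw [List.map_nil, List.map_nil, List.sum_nil, neg_zero]; exact FormalSeries.Starts.one
    | cons l L ih =>
      have := (FormalSeries.Starts.exp (-1) (pauliSum (dissPart (D l)))).mul ih
      rw [heisVal_pauliSum, neg_one_smul, ← neg_add] at this
      exact this
  have h2 := (FormalSeries.Starts.exp 1 (pauliSum (hamPart H) ++
    (List.finRange m).flatMap fun l => pauliSum (dissPart (D l)))).mul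
    ((FormalSeries.Starts.exp (-1) (pauliSum (hamPart H))).mul (h1 (List.finRange m)))
  rw [heisVal_lindblad, heisVal_pauliSum, one_smul, neg_one_smul, ← neg_add] at h2
  have h3 : lindDual H D
      + -(superDual (hamPart H) + (List.map (fun l => dissDual (D l)) (List.finRange m)).sum) = 0 :=
    add_neg_cancel _
  rwa [h3] at h2

/-- `e^{-𝓓_m τ} ⋯ e^{-𝓓₁ τ}`, acting on observables. -/
def dissBackward (D : Fin m → Op (Fin n)) (τ : ℝ) (L : List (Fin m)) : HOp n :=
  (L.reverse.map fun l => NormedSpace.exp ((-τ : ℂ) • dissDual (D l))).prod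

/-- `𝓜` is the evolution `e^{𝓛τ}` with the exact Hamiltonian and dissipative factors undone. The
order of composition is reversed on observables. -/
lemma seriesM_evalsTo (H : Op (Fin n)) (D : Fin m → Op (Fin n)) (τ : ℝ) :
    (seriesM H D).EvalsTo τ (dissBackward D τ (List.finRange m) *
      NormedSpace.exp ((-τ : ℂ) • hamDual H) * NormedSpace.exp ((τ : ℂ) • lindDual H D)) := by
  unfold seriesM
  simp only []
  have h1 : ∀ L : List (Fin m), FormalSeries.EvalsTo
      ((L.map fun l => FormalSeries.exp (-1) (pauliSum (dissPart (D l)))).foldr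
        FormalSeries.mul FormalSeries.one) τ (dissBackward D τ L) := by
    intro L
    induction L with
    | nil => exact FormalSeries.EvalsTo.one
    | cons l L ih =>
      have := (FormalSeries.EvalsTo.exp (-1) (pauliSum (dissPart (D l))) τ).mul ih
      rw [heisVal_pauliSum, mul_neg_one] at this
      have h : dissBackward D τ (l :: L)
          = dissBackward D τ L * NormedSpace.exp ((-τ : ℂ) • dissDual (D l)) := by
        simp [dissBackward]
      rw [h]
      exact this
  have h2 := (FormalSeries.EvalsTo.exp 1 (pauliSum (hamPart H) ++
    (List.finRange m).flatMap fun l => pauliSum (dissPart (D l))) τ).mul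
    ((FormalSeries.EvalsTo.exp (-1) (pauliSum (hamPart H)) τ).mul (h1 (List.finRange m)))
  rw [heisVal_lindblad, heisVal_pauliSum, mul_one, mul_neg_one] at h2
  exact h2

lemma seriesM_expBound (H : Op (Fin n)) (D : Fin m → Op (Fin n)) :
    (seriesM H D).ExpBound (2 * lindbladNorm H D) := by
  unfold seriesM
  simp only []
  have h1 : ∀ L : List (Fin m), FormalSeries.ExpBound (L.map fun l => 2 * pauliNorm (D l) ^ 2).sum
      ((L.map fun l => FormalSeries.exp (-1) (pauliSum (dissPart (D l)))).foldr
        FormalSeries.mul FormalSeries.one) := by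
    intro L
    induction L with
    | nil => exact FormalSeries.ExpBound.one
    | cons l L ih =>
      rw [List.map_cons, List.sum_cons]
      exact (FormalSeries.ExpBound.exp (by simp) (norm1_dissPart_le _)).mul ih
  have h2 := (FormalSeries.ExpBound.exp (z := 1) (by simp) (norm1_lindblad_le H D)).mul
    ((FormalSeries.ExpBound.exp (z := -1) (by simp) (norm1_hamPart_le H)).mul
      (h1 (List.finRange m)))
  have h3 : lindbladNorm H D
      = 2 * pauliNorm H + (List.map (fun l => 2 * pauliNorm (D l) ^ 2) (List.finRange m)).sum := by
    rw [lindbladNorm, sum_map_finRange, mul_add, Finset.mul_sum]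
  rw [← h3, ← two_mul] at h2
  exact h2

end Formal

/-! ### Sums over words -/

section Words

open Finset.HasAntidiagonal (antidiagonal)
open scoped Matrix.Norms.L2Operator

variable {n : ℕ}

/-- The value of a word in the parts of a dissipator. -/
def wordVal (D : Op (Fin n)) (w : List (Fin 3)) : HOp n :=
  (FormalSum.compList (w.map fun i => pauliSum (jumpPart D i))).heisVal

lemma wordVal_append (D : Op (Fin n)) (u v : List (Fin 3)) :
    wordVal D (u ++ v) = wordVal D v * wordVal D u := by
  rw [wordVal, List.map_append, heisVal_compList_append]
  rfl

lemma wordVal_nil (D : Op (Fin n)) : wordVal D [] = 1 := heisVal_one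

lemma wordVal_cons (D : Op (Fin n)) (i : Fin 3) (w : List (Fin 3)) :
    wordVal D (i :: w) = wordVal D w * superDual (jumpPart D i) := by
  rw [wordVal, List.map_cons, heisVal_compList_cons, heisVal_pauliSum]
  rfl

lemma wordVal_replicate (D : Op (Fin n)) (i : Fin 3) (k : ℕ) :
    wordVal D (List.replicate k i) = superDual (jumpPart D i) ^ k := by
  induction k with
  | zero => exact wordVal_nil D
  | succ k ih => rw [List.replicate_succ, wordVal_cons, ih, pow_succ]

/-- The sum of the words of length `k` with coefficients `c`. -/
def wordSum (D : Op (Fin n)) (c : List (Fin 3) → ℝ) (k : ℕ) : HOp n :=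
  ∑ j : Fin k → Fin 3, (c (List.ofFn j) : ℂ) • wordVal D (List.ofFn j)

lemma heisVal_seriesN (D : Op (Fin n)) (k : ℕ) :
    (seriesN D k).heisVal = wordSum D compWord k := by
  rw [seriesN, heisVal_flatMap, Finset.sum_map_toList]
  simp only [heisVal_scale]
  rfl

lemma sum_words_add {M : Type*} [AddCommMonoid M] (F : List (Fin 3) → M) (k l : ℕ) :
    ∑ j : Fin (k + l) → Fin 3, F (List.ofFn j)
      = ∑ u : Fin k → Fin 3, ∑ v : Fin l → Fin 3, F (List.ofFn u ++ List.ofFn v) := by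
  rw [← Fintype.sum_prod_type', ← (Fin.appendEquiv k l).sum_comp]
  refine Finset.sum_congr rfl fun p _ => ?_
  rw [← List.ofFn_fin_append]
  rfl

lemma wordSum_mul (D : Op (Fin n)) (c d : List (Fin 3) → ℝ) (k l : ℕ) :
    wordSum D d l * wordSum D c k
      = ∑ j : Fin (k + l) → Fin 3, ((c ((List.ofFn j).take k) * d ((List.ofFn j).drop k) : ℝ) : ℂ) •
          wordVal D (List.ofFn j) := by
  rw [sum_words_add (fun w => ((c (w.take k) * d (w.drop k) : ℝ) : ℂ) • wordVal D w), wordSum,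
    wordSum, Finset.sum_mul_sum, Finset.sum_comm]
  refine Finset.sum_congr rfl fun u _ => Finset.sum_congr rfl fun v _ => ?_
  have h : (List.ofFn u).length = k := List.length_ofFn
  rw [smul_mul_smul_comm, wordVal_append, List.take_left' h, List.drop_left' h]
  congr 1
  push_cast; ring

/-- Concatenation of words corresponds to the convolution of their coefficients. -/
lemma sum_wordSum_mul (D : Op (Fin n)) (c d : List (Fin 3) → ℝ) (k : ℕ) :
    ∑ p ∈ antidiagonal k, wordSum D d p.2 * wordSum D c p.1
      = wordSum D (fun w => ∑ i ∈ Finset.range (w.length + 1), c (w.take i) * d (w.drop i)) k := by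
  rw [wordSum]
  have h1 : ∀ p ∈ antidiagonal k, wordSum D d p.2 * wordSum D c p.1
      = ∑ j : Fin k → Fin 3,
        ((c ((List.ofFn j).take p.1) * d ((List.ofFn j).drop p.1) : ℝ) : ℂ) •
          wordVal D (List.ofFn j) := by
    intro p hp
    have hk := Finset.HasAntidiagonal.mem_antidiagonal.mp hp
    subst hk
    exact wordSum_mul D c d p.1 p.2
  rw [Finset.sum_congr rfl h1, Finset.sum_comm]
  refine Finset.sum_congr rfl fun j _ => ?_
  rw [← Finset.sum_smul, List.length_ofFn, Finset.Nat.sum_antidiagonal_eq_sum_range_succ_mk]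
  push_cast
  rfl

lemma dilWord_nil : dilWord [] = 1 := by simp [dilWord]

lemma compWord_nil : compWord [] = 1 := by rw [compWord]; simp

/-- The recursion for the coefficients of `𝓝`, as a convolution. -/
lemma sum_compWord_mul_dilWord (w : List (Fin 3)) :
    ∑ i ∈ Finset.range (w.length + 1), compWord (w.take i) * dilWord (w.drop i) = expWord w := by
  by_cases hw : w = []
  · subst hw; simp [dilWord_nil, compWord_nil, expWord]
  obtain ⟨k, hk⟩ : ∃ k, w.length = k + 1 := Nat.exists_eq_succ_of_ne_zero (by simpa using hw)
  rw [Finset.sum_range_succ, hk, Finset.sum_range_succ', ← hk, List.take_length, List.drop_length,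
    dilWord_nil, mul_one, List.take_zero, List.drop_zero, compWord_nil, one_mul]
  conv_lhs => rw [compWord.eq_1 w]
  rw [if_neg hw, Finset.sum_range fun i => compWord (w.take (i + 1)) * dilWord (w.drop (i + 1))]
  have h : ∑ i : Fin (w.length - 1), compWord (w.take (i + 1)) * dilWord (w.drop (i + 1))
      = ∑ i : Fin k, compWord (w.take (i + 1)) * dilWord (w.drop (i + 1)) := by
    have : w.length - 1 = k := by omega
    rw [← Finset.sum_range fun i => compWord (w.take (i + 1)) * dilWord (w.drop (i + 1)),
      ← Finset.sum_range fun i => compWord (w.take (i + 1)) * dilWord (w.drop (i + 1)), this]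
  rw [h]
  ring

/-- `𝓝(τ) ∘ 𝓙(τ) = e^{𝓓τ}`, order by order. -/
lemma sum_comp_dil (D : Op (Fin n)) (k : ℕ) :
    ∑ p ∈ antidiagonal k, wordSum D dilWord p.2 * wordSum D compWord p.1 = wordSum D expWord k := by
  rw [sum_wordSum_mul]
  simp only [sum_compWord_mul_dilWord]

lemma wordSum_smul (D : Op (Fin n)) {c d : List (Fin 3) → ℝ} {k : ℕ} {r : ℝ}
    (h : ∀ w : List (Fin 3), w.length = k → c w = r * d w) :
    wordSum D c k = (r : ℂ) • wordSum D d k := by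
  rw [wordSum, wordSum, Finset.smul_sum]
  refine Finset.sum_congr rfl fun j _ => ?_
  rw [h _ List.length_ofFn, smul_smul]
  push_cast; rfl

lemma dissDual_eq_sum (D : Op (Fin n)) :
    dissDual D = ∑ i : Fin 3, ((if i = 0 then (1 : ℝ) else -1 / 2 : ℝ) : ℂ) • superDual (jumpPart D i) := by
  rw [dissDual, dissPart, map_sub, map_sub, map_smul, map_smul, Fin.sum_univ_three]
  simp only [if_true, Complex.ofReal_one, one_smul, show (1 : Fin 3) ≠ 0 by decide,
    show (2 : Fin 3) ≠ 0 by decide, if_false, sub_eq_add_neg, ← neg_smul]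
  push_cast
  norm_num

/-- The words of length `k` in the expansion of `𝓓 ^ k / k!`. -/
lemma wordSum_expWord (D : Op (Fin n)) (k : ℕ) :
    wordSum D expWord k = ((k ! : ℂ)⁻¹) • dissDual D ^ k := by
  have h1 : wordSum D expWord k = (((k ! : ℝ)⁻¹ : ℝ) : ℂ) • wordSum D
      (fun w => (w.map fun j => if j = 0 then (1 : ℝ) else -1 / 2).prod) k :=
    wordSum_smul D fun w hw => by rw [expWord, hw]
  rw [h1]
  push_cast
  congr 1
  clear h1
  induction k with
  | zero => simp [wordSum, wordVal_nil]
  | succ k ih =>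
    rw [pow_succ', ← ih, dissDual_eq_sum, Finset.sum_mul]
    rw [wordSum, sum_words_add (fun w => (((w.map fun j => if j = 0 then (1 : ℝ) else -1 / 2).prod : ℝ) : ℂ) •
      wordVal D w), Finset.sum_comm, ← (Equiv.funUnique (Fin 1) (Fin 3)).symm.sum_comp]
    refine Finset.sum_congr rfl fun i _ => ?_
    rw [wordSum, Finset.mul_sum]
    refine Finset.sum_congr rfl fun u _ => ?_
    have h2 : List.ofFn ((Equiv.funUnique (Fin 1) (Fin 3)).symm i) = [i] := by
      simp [List.ofFn_succ, Equiv.funUnique]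
    rw [h2, wordVal_append, wordVal_cons, wordVal_nil, one_mul, List.map_append, List.prod_append,
      smul_mul_smul_comm]
    congr 1
    rw [List.map_cons, List.map_nil, List.prod_singleton]
    push_cast; ring

lemma sum_words_single {M : Type*} [AddCommMonoid M] {k : ℕ} {W : List (Fin 3)} (hW : W.length = k)
    (F : List (Fin 3) → M) :
    ∑ j : Fin k → Fin 3, (if List.ofFn j = W then F (List.ofFn j) else 0) = F W := by
  subst hW
  rw [Finset.sum_eq_single W.get]
  · rw [List.ofFn_get, if_pos rfl]
  · intro j _ hj
    rw [if_neg fun h => hj (List.ofFn_injective (h.trans (List.ofFn_get W).symm))]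
  · simp

/-- The term of order `k` of `𝓙(τ)`, acting on observables. -/
lemma wordSum_dilWord_apply (D : Op (Fin n)) (k : ℕ) (X : Op (Fin n)) :
    wordSum D dilWord k X
      = (∑ j ∈ Finset.range (k + 1), (((-1 : ℝ) ^ k / ((2 * j) ! * (2 * (k - j)) ! : ℝ) : ℝ) : ℂ) •
          ((Dᴴ * D) ^ (k - j) * X * (Dᴴ * D) ^ j))
        + ∑ j ∈ Finset.range k,
          (((-1 : ℝ) ^ (k - 1) / ((2 * j + 1) ! * (2 * (k - 1 - j) + 1) ! : ℝ) : ℝ) : ℂ) •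
          ((Dᴴ * D) ^ (k - 1 - j) * (Dᴴ * X * D) * (Dᴴ * D) ^ j) := by
  obtain ⟨h0, h1, h2⟩ := jumpPart_eq D
  have p1 : ∀ (j : ℕ) (Y : Op (Fin n)), (superDual (jumpPart D 1) ^ j) Y = Y * (Dᴴ * D) ^ j := by
    intro j
    induction j with
    | zero => intro Y; rw [pow_zero, pow_zero, mul_one, HOp.one_apply]
    | succ j ih =>
      intro Y
      rw [pow_succ, HOp.mul_apply, ih, h1, superDual_sandwich, one_mul, pow_succ', mul_assoc]
  have p2 : ∀ (j : ℕ) (Y : Op (Fin n)), (superDual (jumpPart D 2) ^ j) Y = (Dᴴ * D) ^ j * Y := by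
    intro j
    induction j with
    | zero => intro Y; rw [pow_zero, pow_zero, one_mul, HOp.one_apply]
    | succ j ih =>
      intro Y
      rw [pow_succ, HOp.mul_apply, ih, h2, superDual_sandwich, mul_one, pow_succ, mul_assoc ((Dᴴ * D) ^ j)]
  have e : wordSum D dilWord k
      = (∑ j ∈ Finset.range (k + 1), (((-1 : ℝ) ^ k / ((2 * j) ! * (2 * (k - j)) ! : ℝ) : ℝ) : ℂ) •
          wordVal D (List.replicate j 1 ++ List.replicate (k - j) 2))
        + ∑ j ∈ Finset.range k,
          (((-1 : ℝ) ^ (k - 1) / ((2 * j + 1) ! * (2 * (k - 1 - j) + 1) ! : ℝ) : ℝ) : ℂ) •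
          wordVal D (0 :: (List.replicate j 1 ++ List.replicate (k - 1 - j) 2)) := by
    rw [wordSum]
    simp only [dilWord, List.length_ofFn, Complex.ofReal_add, Complex.ofReal_sum, add_smul,
      Finset.sum_smul, Finset.sum_add_distrib]
    congr 1
    · rw [Finset.sum_comm]
      refine Finset.sum_congr rfl fun j hj => ?_
      have hj' := Finset.mem_range.mp hj
      rw [← sum_words_single (k := k) (W := List.replicate j 1 ++ List.replicate (k - j) 2)
        (by simp; omega) fun w =>
          (((-1 : ℝ) ^ k / ((2 * j) ! * (2 * (k - j)) ! : ℝ) : ℝ) : ℂ) • wordVal D w]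
      refine Finset.sum_congr rfl fun u _ => ?_
      split_ifs <;> simp
    · rw [Finset.sum_comm]
      refine Finset.sum_congr rfl fun j hj => ?_
      have hj' := Finset.mem_range.mp hj
      rw [← sum_words_single (k := k) (W := 0 :: (List.replicate j 1 ++ List.replicate (k - 1 - j) 2))
        (by simp; omega) fun w =>
          (((-1 : ℝ) ^ (k - 1) / ((2 * j + 1) ! * (2 * (k - 1 - j) + 1) ! : ℝ) : ℝ) : ℂ) •
            wordVal D w]
      refine Finset.sum_congr rfl fun u _ => ?_
      split_ifs <;> simp
  rw [e, HOp.add_apply, HOp.sum_apply, HOp.sum_apply]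
  simp only [HOp.smul_apply, wordVal_cons, wordVal_append, wordVal_replicate, HOp.mul_apply, p1, p2,
    h0, superDual_sandwich, mul_assoc]

/-! ### The compensation of the dissipative steps -/

lemma abs_sum_ite_le (s : Finset ℕ) (p : ℕ → Prop) [DecidablePred p] (f : ℕ → ℝ)
    (hf : ∀ j ∈ s, |f j| ≤ 1) : |∑ j ∈ s, if p j then f j else 0| ≤ s.card := by
  refine (Finset.abs_sum_le_sum_abs _ _).trans ((Finset.sum_le_sum fun j hj => ?_).trans_eq
    (by simp : ∑ _j ∈ s, (1 : ℝ) = _))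
  split_ifs
  · exact hf j hj
  · simp

lemma abs_neg_one_pow_div_le (k a b : ℕ) : |(-1 : ℝ) ^ k / (a ! * b ! : ℝ)| ≤ 1 := by
  have h1 : (1 : ℝ) ≤ a ! := by exact_mod_cast Nat.one_le_iff_ne_zero.mpr a.factorial_ne_zero
  have h2 : (1 : ℝ) ≤ b ! := by exact_mod_cast Nat.one_le_iff_ne_zero.mpr b.factorial_ne_zero
  have h3 : (1 : ℝ) ≤ a ! * b ! := one_le_mul_of_one_le_of_one_le h1 h2
  rw [abs_div, abs_pow, abs_neg, abs_one, one_pow, abs_of_pos (by linarith)]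
  exact div_le_one_of_le₀ h3 (by linarith)

lemma abs_dilWord_le (w : List (Fin 3)) : |dilWord w| ≤ 3 ^ w.length := by
  have h1 : |dilWord w| ≤ (w.length + 1 : ℕ) + w.length := by
    unfold dilWord
    refine (abs_add_le _ _).trans (add_le_add ?_ ?_)
    · refine (abs_sum_ite_le _ _ _ fun j _ => ?_).trans_eq (by simp)
      exact abs_neg_one_pow_div_le _ _ _
    · refine (abs_sum_ite_le _ _ _ fun j _ => ?_).trans_eq (by simp)
      exact abs_neg_one_pow_div_le _ _ _
  refine h1.trans ?_
  have h2 : ∀ k : ℕ, (k + 1) + k ≤ 3 ^ k := by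
    intro k
    induction k with
    | zero => simp
    | succ k ih => rw [pow_succ]; omega
  exact_mod_cast h2 w.length

lemma abs_expWord_le (w : List (Fin 3)) : |expWord w| ≤ 1 := by
  unfold expWord
  rw [abs_mul]
  have h1 : (1 : ℝ) ≤ w.length ! := by
    exact_mod_cast Nat.one_le_iff_ne_zero.mpr w.length.factorial_ne_zero
  refine mul_le_one₀ ?_ (abs_nonneg _) ?_
  · rw [abs_inv, abs_of_pos (by linarith)]
    exact inv_le_one_of_one_le₀ h1
  · clear h1
    induction w with
    | nil => simp
    | cons i w ih =>
      rw [List.map_cons, List.prod_cons, abs_mul]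
      refine mul_le_one₀ ?_ (abs_nonneg _) ih
      split_ifs
      · simp
      · rw [abs_le]; norm_num

/-- A crude bound on the solution of the recursion; any geometric growth suffices. -/
lemma abs_compWord_le (w : List (Fin 3)) : |compWord w| ≤ 9 ^ w.length := by
  induction h : w.length using Nat.strong_induction_on generalizing w with
  | _ k ih =>
    by_cases hw : w = []
    · subst hw; simp [compWord_nil]; exact one_le_pow₀ (by norm_num)
    rw [compWord, if_neg hw]
    have hk : 1 ≤ k := by
      rw [← h]
      exact Nat.one_le_iff_ne_zero.mpr (by simpa using hw)
    have h1 : |∑ i : Fin (w.length - 1), compWord (w.take (i + 1)) * dilWord (w.drop (i + 1))|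
        ≤ ∑ i ∈ Finset.range (k - 1), 3 ^ k * 3 ^ (i + 1) := by
      rw [Finset.sum_range, ← h]
      refine (Finset.abs_sum_le_sum_abs _ _).trans (Finset.sum_le_sum fun i _ => ?_)
      have hi := i.isLt
      rw [abs_mul]
      have e1 : (w.take (i + 1)).length = i + 1 := by rw [List.length_take]; omega
      have e2 := ih (i + 1) (by omega) _ e1
      have e3 := abs_dilWord_le (w.drop (i + 1))
      rw [List.length_drop] at e3
      refine (mul_le_mul e2 e3 (abs_nonneg _) (by positivity)).trans_eq ?_
      rw [show (9 : ℝ) = 3 * 3 by norm_num, mul_pow, mul_assoc, ← pow_add,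
        show (i : ℕ) + 1 + (w.length - (i + 1)) = w.length by omega, mul_comm]
    have h2 := abs_dilWord_le w
    have h3 := abs_expWord_le w
    rw [h] at h2
    refine (abs_sub _ _).trans ((add_le_add (abs_sub _ _) le_rfl).trans ?_)
    refine (add_le_add (add_le_add h3 h1) h2).trans ?_
    -- `1 + 3ᵏ (1 + 3 + ⋯ + 3ᵏ⁻¹) ≤ 9ᵏ`
    obtain ⟨l, rfl⟩ := Nat.exists_eq_add_of_le' hk
    rw [Nat.add_sub_cancel, ← Finset.mul_sum]
    have e4 : ∑ i ∈ Finset.range l, (3 : ℝ) ^ (i + 1) = (3 ^ (l + 1) - 3) / 2 := by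
      induction l with
      | zero => norm_num
      | succ l ihl =>
        clear ih h1 h2 h3 ihl hk h
        induction l with
        | zero => norm_num
        | succ l ihl => rw [Finset.sum_range_succ, ihl]; ring
    rw [e4, show (9 : ℝ) = 3 * 3 by norm_num, mul_pow]
    have e5 : (3 : ℝ) ≤ 3 ^ (l + 1) := by
      simpa using pow_le_pow_right₀ (by norm_num : (1 : ℝ) ≤ 3) (Nat.le_add_left 1 l)
    nlinarith

lemma norm1_seriesN_le (D : Op (Fin n)) (k : ℕ) :
    (seriesN D k).norm1 ≤ (27 * pauliNorm D ^ 2) ^ k := by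
  rw [seriesN, norm1_flatMap, Finset.sum_map_toList]
  have h1 : ∀ j : Fin k → Fin 3, ((FormalSum.compList ((List.ofFn j).map fun i =>
      pauliSum (jumpPart D i))).scale (compWord (List.ofFn j) : ℂ)).norm1
      ≤ 9 ^ k * (pauliNorm D ^ 2) ^ k := by
    intro j
    rw [norm1_scale, Complex.norm_real, Real.norm_eq_abs]
    have e1 := abs_compWord_le (List.ofFn j)
    have e2 := norm1_compList_le (b := pauliNorm D ^ 2) (by positivity)
      (Fs := (List.ofFn j).map fun i => pauliSum (jumpPart D i)) fun F hF => by
        obtain ⟨i, _, rfl⟩ := List.mem_map.mp hF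
        exact norm1_jumpPart_le D i
    rw [List.length_ofFn] at e1
    rw [List.length_map, List.length_ofFn] at e2
    exact mul_le_mul e1 e2 (norm1_nonneg _) (by positivity)
  refine (Finset.sum_le_sum fun j _ => h1 j).trans_eq ?_
  rw [Finset.sum_const, Finset.card_univ, Fintype.card_fun, Fintype.card_fin, Fintype.card_fin,
    nsmul_eq_mul, ← mul_assoc]
  push_cast
  rw [← mul_pow, ← mul_pow]
  norm_num

lemma isHermitianPreserving_dil (D : Op (Fin n)) (k : ℕ) :
    IsHermitianPreserving (wordSum D dilWord k) := by
  intro X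
  have hP : (Dᴴ * D)ᴴ = Dᴴ * D := by simp
  rw [wordSum_dilWord_apply, wordSum_dilWord_apply, Matrix.conjTranspose_add,
    Matrix.conjTranspose_sum, Matrix.conjTranspose_sum]
  simp only [Matrix.conjTranspose_smul, Matrix.conjTranspose_mul, Matrix.conjTranspose_pow, hP,
    Complex.star_def, Complex.conj_ofReal, Matrix.conjTranspose_conjTranspose, mul_assoc]
  congr 1
  · rw [← Finset.sum_range_reflect]
    refine Finset.sum_congr rfl fun j hj => ?_
    have hj' := Finset.mem_range.mp hj
    rw [show k + 1 - 1 - j = k - j by omega, show k - (k - j) = j by omega,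
      mul_comm ((2 * j)! : ℝ)]
  · rw [← Finset.sum_range_reflect]
    refine Finset.sum_congr rfl fun j hj => ?_
    have hj' := Finset.mem_range.mp hj
    rw [show k - 1 - (k - 1 - j) = j by omega, mul_comm ((2 * j + 1)! : ℝ)]

/-- To first order `𝓙(τ)` agrees with `1 + 𝓓τ`. -/
lemma wordSum_zero_one (D : Op (Fin n)) :
    wordSum D dilWord 0 = 1 ∧ wordSum D dilWord 1 = dissDual D := by
  constructor
  · refine HOp.ext fun X => ?_
    rw [wordSum_dilWord_apply]
    simp [HOp.one_apply]
  · refine HOp.ext fun X => ?_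
    rw [wordSum_dilWord_apply, dissDual_apply]
    simp [Finset.sum_range_succ, Nat.factorial]
    module

lemma seriesN_starts (D : Op (Fin n)) : (seriesN D).Starts 0 := by
  have h0 : wordSum D compWord 0 = 1 := by simp [wordSum, compWord_nil, wordVal_nil]
  refine ⟨?_, ?_, ?_⟩
  · rw [seriesN, norm1_flatMap, Finset.sum_map_toList]
    simp only [norm1_scale]
    simp [compWord_nil, FormalSum.compList, norm1_one]
  · rw [heisVal_seriesN, h0]
  · have h := sum_comp_dil D 1
    rw [wordSum_expWord, Finset.Nat.antidiagonal_succ] at h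
    simp [h0, (wordSum_zero_one D).1, (wordSum_zero_one D).2] at h
    rw [heisVal_seriesN]
    exact h

/-- Hermiticity is inherited through the recursion
`𝓝_k = 𝓓 ^ k / k! - ∑_{i < k} 𝓝_i ∘ 𝓙_{k - i}`. -/
lemma seriesN_isPauli {w : ℕ} {D : Op (Fin n)} (hD : IsLocal w D) :
    (seriesN D).IsPauli (2 * w) := by
  intro k
  constructor
  · rw [heisVal_seriesN]
    induction k using Nat.strong_induction_on with
    | _ k ih =>
      have h := sum_comp_dil D k
      rw [Finset.Nat.sum_antidiagonal_eq_sum_range_succ_mk, Finset.sum_range_succ,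
        Nat.sub_self, (wordSum_zero_one D).1, one_mul, wordSum_expWord] at h
      rw [eq_sub_of_add_eq' h]
      refine IsHermitianPreserving.sub ?_ (IsHermitianPreserving.sum fun i hi => ?_)
      · have := ((isHermitianPreserving_dissDual D).pow k).smul ((k ! : ℝ)⁻¹)
        push_cast at this
        exact this
      · exact (isHermitianPreserving_dil D _).mul (ih i (Finset.mem_range.mp hi))
  · intro t ht
    obtain ⟨j, _, ht⟩ := List.mem_flatMap.mp ht
    have h := FormalSum.IsPauli.compList (v := 2 * w)
      (Fs := (List.ofFn j).map fun i => pauliSum (jumpPart D i)) fun F hF => by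
        obtain ⟨i, _, rfl⟩ := List.mem_map.mp hF
        exact (procLocal_jumpPart hD i).isPauli
    rw [List.length_map, List.length_ofFn] at h
    exact h.scale _ t ht

lemma seriesN_bound {D : Op (Fin n)} {τ : ℝ} (hτ : 0 ≤ τ) (k : ℕ) :
    τ ^ k * (seriesN D k).norm1 ≤ (27 * pauliNorm D ^ 2 * τ) ^ k := by
  rw [mul_pow _ τ, mul_comm]
  exact mul_le_mul_of_nonneg_right (norm1_seriesN_le D k) (by positivity)

/-- The series `𝓝(τ)` converges, and `𝓝(τ) ∘ 𝓙(τ) = e^{𝓓τ}`. -/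
lemma seriesN_evalsTo {w : ℕ} {D : Op (Fin n)} (hD : IsLocal w D) {τ : ℝ} (hτ : 0 ≤ τ)
    (hy : 27 * pauliNorm D ^ 2 * τ ≤ 1 / 2) {E : HOp n}
    (hE : AbsSum (fun k => (τ : ℂ) ^ k • wordSum D dilWord k) E) :
    ∃ s, (seriesN D).EvalsTo τ s ∧ E * s = NormedSpace.exp ((τ : ℂ) • dissDual D) := by
  have hs : Summable fun k => ‖(τ : ℂ) ^ k • (seriesN D k).heisVal‖ := by
    refine summable_geometric_bound hy fun k => ?_
    rw [norm_smul, norm_pow, Complex.norm_real, Real.norm_of_nonneg hτ]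
    exact (mul_le_mul_of_nonneg_left (norm_heisVal_le (seriesN_isPauli hD k).2)
      (by positivity)).trans (seriesN_bound hτ k)
  refine ⟨∑' k, (τ : ℂ) ^ k • (seriesN D k).heisVal, ⟨hs, hs.of_norm.hasSum⟩, ?_⟩
  have h1 := hE.mul ⟨hs, hs.of_norm.hasSum⟩
  have h2 := absSum_exp ((τ : ℂ) • dissDual D)
  refine h1.unique ?_
  convert h2 using 2 with k
  rw [smul_pow, smul_comm, ← wordSum_expWord, ← sum_comp_dil, ← Finset.Nat.sum_antidiagonal_swap,
    Finset.smul_sum]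
  refine Finset.sum_congr rfl fun p hp => ?_
  rw [heisVal_seriesN, smul_mul_smul_comm, ← pow_add, Prod.fst_swap, Prod.snd_swap, add_comm p.2,
    Finset.HasAntidiagonal.mem_antidiagonal.mp hp]

end Words

/-! ### Discarding and preparing ancillas -/

section Ancilla

open scoped Matrix.Norms.L2Operator

section Reset

variable {Q : Type} [Fintype Q] [DecidableEq Q]

lemma onQubit_mul_apply (c : Q) (M : Matrix (Fin 2) (Fin 2) ℂ) (Y : Op Q) (x y : Q → Fin 2) :
    (onQubit c M * Y) x y = ∑ b, M (x c) b * Y (Function.update x c b) y := by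
  have h1 : ∀ z : Q → Fin 2, onQubit c M x z * Y z y
      = ∑ b, if z = Function.update x c b then M (x c) b * Y (Function.update x c b) y else 0 := by
    intro z
    rw [onQubit, Matrix.of_apply]
    split_ifs with h
    · have hz : z = Function.update x c (z c) := by
        ext1 j
        by_cases hj : j = c
        · subst hj; simp
        · simp [hj, h j hj]
      rw [Finset.sum_eq_single (z c)]
      · rw [if_pos hz, ← hz]
      · intro b _ hb
        rw [if_neg]
        intro hzb
        exact hb (by rw [hzb]; simp)
      · simp
    · rw [zero_mul, Finset.sum_eq_zero]
      intro b _
      rw [if_neg]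
      rintro rfl
      exact h fun j hj => by simp [hj]
  rw [Matrix.mul_apply, Finset.sum_congr rfl fun z _ => h1 z, Finset.sum_comm]
  simp

lemma mul_onQubit_apply (c : Q) (M : Matrix (Fin 2) (Fin 2) ℂ) (Y : Op Q) (x y : Q → Fin 2) :
    (Y * onQubit c M) x y = ∑ b, Y x (Function.update y c b) * M b (y c) := by
  have h := onQubit_mul_apply c Mᴴ Yᴴ y x
  rw [← onQubit_conjTranspose, ← Matrix.conjTranspose_mul, Matrix.conjTranspose_apply] at h
  rw [← star_star ((Y * onQubit c M) x y), h, star_sum]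
  refine Finset.sum_congr rfl fun b _ => ?_
  simp [Matrix.conjTranspose_apply, mul_comm]

lemma reset_dual_apply (c : Q) (Y : Op Q) (x y : Q → Fin 2) :
    (Instr.reset c).dual Y x y
      = if x c = y c then Y (Function.update x c 0) (Function.update y c 0) else 0 := by
  have h : (Instr.reset c).dual Y
      = onQubit c (ketBra 0 0) * Y * onQubit c (ketBra 0 0)
        + onQubit c (ketBra 1 0) * Y * onQubit c (ketBra 0 1) := by
    show (∑ b : Fin 2, sandwich (onQubit c (ketBra 0 b))ᴴ (onQubit c (ketBra 0 b))) Y = _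
    rw [LinearMap.sum_apply, Fin.sum_univ_two]
    refine congrArg₂ (· + ·) ?_ ?_ <;>
    · refine (sandwich_apply _ _ _).trans ?_
      rw [onQubit_conjTranspose, ketBra_conjTranspose]
  rw [h]
  simp only [Fin.sum_univ_two, Matrix.add_apply, mul_onQubit_apply, onQubit_mul_apply, ketBra]
  generalize Y (Function.update x c 0) (Function.update y c 0) = r
  generalize x c = u
  generalize y c = v
  fin_cases u <;> fin_cases v <;> simp [Matrix.single]

lemma TrivialOn.reset_dual {c : Q} {Y : Op Q} (hY : TrivialOn c Y) : (Instr.reset c).dual Y = Y := by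
  have h := dual_reset hY 1
  rwa [onQubit_one, one_mul, Matrix.one_apply_eq, one_smul] at h

end Reset

variable {n : ℕ}

/-- On observables trivial on the control ancilla, resetting the other ancilla leaves the
compression to the system. -/
lemma reset_dilAnc_dual {Y : Op (Register n 2)} (hY : TrivialOn (ctlAnc n) Y) :
    (Instr.reset (dilAnc n)).dual Y = onSystem (compress Y) := by
  ext x y
  conv_lhs => rw [← hY.reset_dual]
  rw [reset_dual_apply, reset_dual_apply]
  have h0 : ∀ x : Register n 2 → Fin 2,
      Function.update (Function.update x (dilAnc n) 0) (ctlAnc n) 0 = Sum.elim (x ∘ Sum.inl) 0 := by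
    intro x
    ext1 i
    rcases i with i | i
    · simp [dilAnc, ctlAnc]
    · fin_cases i <;> simp [dilAnc, ctlAnc]
  have h1 : ∀ x : Register n 2 → Fin 2, Function.update x (dilAnc n) 0 (ctlAnc n) = x (ctlAnc n) :=
    fun x => Function.update_of_ne (by simp [dilAnc, ctlAnc]) _ _
  rw [h0, h0, h1, h1]
  simp only [onSystem, compress, Matrix.of_apply]
  have h2 : x ∘ Sum.inr = y ∘ Sum.inr
      ↔ x (dilAnc n) = y (dilAnc n) ∧ x (ctlAnc n) = y (ctlAnc n) := by
    simp [funext_iff, Fin.forall_fin_two, dilAnc, ctlAnc]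
  by_cases ha : x (dilAnc n) = y (dilAnc n) <;> by_cases hb : x (ctlAnc n) = y (ctlAnc n) <;>
    simp [h2, ha, hb]

/-- An operator acting on neither ancilla acts on the system only. -/
lemma eq_onSystem_compress {Y : Op (Register n 2)} (hd : TrivialOn (dilAnc n) Y)
    (hc : TrivialOn (ctlAnc n) Y) : Y = onSystem (compress Y) := by
  rw [← reset_dilAnc_dual hc, hd.reset_dual]

lemma compress_onSystem (X : Op (Fin n)) : compress (onSystem X : Op (Register n 2)) = X := by
  ext x y
  simp [compress, onSystem, Function.comp_def]

/-! ### Trotter steps on the register -/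

/-- `X ↦ ⟨0| P (X ⊗ 1) R |0⟩`. -/
def compressConj (P R : Op (Register n 2)) : HOp n :=
  (LinearMap.toContinuousLinearMap
    { toFun := fun X => compress (P * onSystem X * R)
      map_add' := fun X Y => by
        rw [onSystem_add, mul_add, add_mul]
        rfl
      map_smul' := fun z X => by
        rw [onSystem_smul, mul_smul_comm, smul_mul_assoc]
        rfl } : Op (Fin n) →L[ℂ] Op (Fin n))

lemma compressConj_apply (P R : Op (Register n 2)) (X : Op (Fin n)) :
    compressConj P R X = compress (P * onSystem X * R) := rfl

/-- The Trotter step for `G` with its truncated compensation, acting on observables. -/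
def trotterOp (G : Op (Register n 2)) (x : ℝ) (K : ℕ) : HOp n :=
  compressConj (trotterInv G x * (lcuOp (trotterComp G x K))ᴴ)
    (lcuOp (trotterComp G x K) * (trotterInv G x)ᴴ)

/-- The exact evolution `e^{-iGx}` of the register, acting on observables of the system. -/
def exactOp (G : Op (Register n 2)) (x : ℝ) : HOp n :=
  compressConj (NormedSpace.exp ((Complex.I * (x : ℂ)) • G))
    (NormedSpace.exp ((-(Complex.I * (x : ℂ))) • G))

section TrotterOp

variable {G : Op (Register n 2)} {v : ℕ} {x : ℝ} {K : ℕ}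

lemma SuppIn.trivialOn_trotterInv {c : Register n 2} (hs : SuppIn c v G) :
    TrivialOn c (trotterInv G x) := by
  have h : ∀ γ ∈ (pauliSupport G).toList, γ c = 0 := fun γ hγ =>
    (hs γ (mem_pauliSupport.mp (Finset.mem_toList.mp hγ))).1
  unfold trotterInv
  generalize (pauliSupport G).toList = l at h ⊢
  induction l with
  | nil => exact TrivialOn.one
  | cons γ l ih =>
    rw [List.map_cons, List.prod_cons]
    exact (pauliRot_trivialOn (h γ (by simp)) _).mul (ih fun δ hδ => h δ (by simp [hδ]))

lemma SuppIn.trivialOn_lcuOp {c : Register n 2} (hs : SuppIn c v G) (hx : 0 ≤ x) (hK : 3 ≤ K) :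
    TrivialOn c (lcuOp (trotterComp G x K)) := by
  have h : ∀ t ∈ trotterComp G x K, TrivialOn c t.2 := fun t ht =>
    (mem_trotterComp hs hx hK ht).2.trivialOn
  unfold lcuOp
  generalize trotterComp G x K = l at h ⊢
  induction l with
  | nil => exact fun M => Commute.zero_right _
  | cons t l ih =>
    rw [List.map_cons, List.sum_cons]
    exact (TrivialOn.smul _ (h t (by simp))).add (ih fun s hs => h s (by simp [hs]))

/-- The observable of the register before the ancilla is prepared. -/
lemma circuitDual_trotter_lcsV (hs : SuppIn (ctlAnc n) v G) (hx : 0 ≤ x) (hK : 3 ≤ K)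
    (X : Op (Fin n)) :
    circuitDual (trotterCircuit G x) ((lcsV G x K).dual (onSystem X))
      = trotterInv G x * (lcuOp (trotterComp G x K))ᴴ * onSystem X *
          (lcuOp (trotterComp G x K) * (trotterInv G x)ᴴ) := by
  rw [dual_lcsV hs hx hK (trivialOn_onSystem _ _), circuitDual_trotterCircuit]
  simp only [mul_assoc]

lemma trivialOn_trotter {c : Fin 2} (hs : SuppIn (Sum.inr c) v G) (hx : 0 ≤ x) (hK : 3 ≤ K)
    (X : Op (Fin n)) :
    TrivialOn (Sum.inr c : Register n 2) (trotterInv G x * (lcuOp (trotterComp G x K))ᴴ *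
      onSystem X * (lcuOp (trotterComp G x K) * (trotterInv G x)ᴴ)) :=
  ((hs.trivialOn_trotterInv.mul (hs.trivialOn_lcuOp hx hK).conjTranspose).mul
    (trivialOn_onSystem _ _)).mul
    ((hs.trivialOn_lcuOp hx hK).mul hs.trivialOn_trotterInv.conjTranspose)

lemma norm_trotterOp_le (hs : SuppIn (ctlAnc n) v G) (hx : 0 ≤ x) (hK : 3 ≤ K) :
    ‖trotterOp G x K‖ ≤ (lcsV G x K).mu := by
  rw [mu_lcsV]
  have hA : ‖lcuOp (trotterComp G x K)‖ ≤ lcuNorm (trotterComp G x K) := by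
    refine norm_lcuOp_le fun t ht => ?_
    obtain ⟨h1, h2⟩ := mem_trotterComp hs hx hK ht
    exact ⟨h1, h2.unitary⟩
  have hSn : ‖(trotterInv G x)ᴴ‖ ≤ 1 :=
    norm_le_one_of_unitary (by simpa using trotterInv_mul_conjTranspose G x)
  have hSn' : ‖trotterInv G x‖ ≤ 1 := by rwa [Matrix.l2_opNorm_conjTranspose] at hSn
  set L := lcuNorm (trotterComp G x K)
  have hL : 0 ≤ L := (norm_nonneg _).trans hA
  refine HOp.norm_le_of (by positivity) fun X => ?_
  rw [trotterOp, compressConj_apply]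
  refine (norm_compress_le _).trans ?_
  have e1 : ‖trotterInv G x * (lcuOp (trotterComp G x K))ᴴ‖ ≤ 1 * L := by
    refine (norm_mul_le _ _).trans ?_
    rw [Matrix.l2_opNorm_conjTranspose]
    gcongr
  have e2 : ‖lcuOp (trotterComp G x K) * (trotterInv G x)ᴴ‖ ≤ L * 1 := by
    refine (norm_mul_le _ _).trans ?_
    gcongr
  have e3 := norm_onSystem_le (a := 2) X
  calc _ ≤ ‖trotterInv G x * (lcuOp (trotterComp G x K))ᴴ‖ * ‖(onSystem X : Op (Register n 2))‖ *
        ‖lcuOp (trotterComp G x K) * (trotterInv G x)ᴴ‖ := by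
        refine (norm_mul_le _ _).trans ?_
        gcongr
        exact norm_mul_le _ _
    _ ≤ (1 * L) * ‖X‖ * (L * 1) := by gcongr
    _ = _ := by ring

lemma norm_trotterOp_sub_le (hG : G.IsHermitian) (hs : SuppIn (ctlAnc n) v G) (hx : 0 ≤ x)
    (hK : 3 ≤ K) {y : ℝ} (hy : 2 * pauliNorm G * x ≤ y) (hy2 : y ≤ 1 / 2) :
    ‖trotterOp G x K - exactOp G x‖ ≤ 8 * y ^ (K + 1) := by
  have hy0 : 0 ≤ 2 * pauliNorm G * x := by have := pauliNorm_nonneg G; positivity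
  have hy1 := hy0.trans hy
  refine HOp.norm_le_of (by positivity) fun X => ?_
  have h1 := norm_trotter_sub_exp_le hG hs hx hK rfl (hy.trans hy2) (onSystem X)
  rw [HOp.sub_apply, trotterOp, exactOp, compressConj_apply, compressConj_apply]
  have h2 : ∀ Y Z : Op (Register n 2), compress Y - compress Z = compress (Y - Z) := fun _ _ => rfl
  rw [h2]
  refine (norm_compress_le _).trans ?_
  have h3 : trotterInv G x * (lcuOp (trotterComp G x K))ᴴ * onSystem X *
      (lcuOp (trotterComp G x K) * (trotterInv G x)ᴴ)
      = trotterInv G x * ((lcuOp (trotterComp G x K))ᴴ * onSystem X * lcuOp (trotterComp G x K))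
        * (trotterInv G x)ᴴ := by simp only [mul_assoc]
  rw [h3]
  refine h1.trans ?_
  have := norm_onSystem_le (a := 2) X
  gcongr

lemma mu_lcsV_bounds (hG : G.IsHermitian) (hx : 0 ≤ x) (hK : 3 ≤ K) {y : ℝ}
    (hy : 2 * pauliNorm G * x ≤ y) (hy2 : y ≤ 1 / 2) :
    1 ≤ (lcsV G x K).mu ∧ (lcsV G x K).mu ≤ (1 + 4 * y ^ 4) ^ 2 := by
  have hy0 : 0 ≤ 2 * pauliNorm G * x := by have := pauliNorm_nonneg G; positivity
  obtain ⟨h1, h2⟩ := lcuNorm_trotterComp_bounds hG hx hK rfl (hy.trans hy2)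
  rw [mu_lcsV]
  refine ⟨one_le_pow₀ h1, ?_⟩
  have : lcuNorm (trotterComp G x K) ≤ 1 + 4 * y ^ 4 := h2.trans (by gcongr)
  gcongr

lemma circuitBound_trotterCircuit {c : Register n 2} (hs : SuppIn c v G) :
    CircuitBound ((pauliSupport G).card * (6 * v + 3)) (trotterCircuit G x) := by
  have : Nonempty (Register n 2) := ⟨ctlAnc n⟩
  rw [← Finset.length_toList]
  exact circuitBound_rotations _ _ _ fun γ hγ =>
    (hs γ (mem_pauliSupport.mp (Finset.mem_toList.mp hγ))).2

end TrotterOp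

/-! ### The Hamiltonian step -/

lemma suppIn_onSystem {w : ℕ} {H : Op (Fin n)} (hw : IsLocal w H) (c : Fin 2) :
    SuppIn (Sum.inr c : Register n 2) w (onSystem H) := by
  rw [← sum_pauliCoeff_smul H, onSystem_sum]
  refine SuppIn.sum fun γ _ => ?_
  rw [onSystem_smul, onSystem_pauliOp]
  by_cases h : pauliCoeff H γ = 0
  · intro δ hδ; simp [h, pauliCoeff_zero] at hδ
  · refine SuppIn.smul _ (SuppIn.pauliOp rfl ?_)
    rw [weight_extendString]
    exact hw γ (mem_pauliSupport.mpr h)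

lemma pauliNorm_onSystem_le (H : Op (Fin n)) :
    pauliNorm (onSystem H : Op (Register n 2)) ≤ pauliNorm H := by
  conv_lhs => rw [← sum_pauliCoeff_smul H, onSystem_sum]
  refine (pauliNorm_sum _ _).trans (Finset.sum_le_sum fun γ _ => ?_)
  rw [onSystem_smul, onSystem_pauliOp, pauliNorm_smul, pauliNorm_pauliOp, mul_one]

lemma card_pauliSupport_onSystem_le (H : Op (Fin n)) :
    (pauliSupport (onSystem H : Op (Register n 2))).card ≤ (pauliSupport H).card := by
  classical
  refine (Finset.card_le_card (t := (pauliSupport H).image extendString) fun δ hδ => ?_).trans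
    Finset.card_image_le
  rw [mem_pauliSupport, ← sum_pauliCoeff_smul H, onSystem_sum, pauliCoeff_sum] at hδ
  obtain ⟨γ, _, hγ⟩ := Finset.exists_ne_zero_of_sum_ne_zero hδ
  rw [onSystem_smul, onSystem_pauliOp, pauliCoeff_smul, pauliCoeff_pauliOp] at hγ
  refine Finset.mem_image.mpr ⟨γ, mem_pauliSupport.mpr (left_ne_zero_of_mul hγ), ?_⟩
  by_contra hne
  simp [Ne.symm hne] at hγ

lemma isHermitian_onSystem {H : Op (Fin n)} (hH : H.IsHermitian) :
    (onSystem H : Op (Register n 2)).IsHermitian := by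
  rw [Matrix.IsHermitian, ← onSystem_conjTranspose, hH.eq]

lemma dual_lcsF {w : ℕ} {H : Op (Fin n)} (hw : IsLocal w H) {τ : ℝ} (hτ : 0 ≤ τ) {K : ℕ}
    (hK : 3 ≤ K) (X : Op (Fin n)) :
    (lcsF H τ K).dual (onSystem X) = onSystem (trotterOp (onSystem H) τ K X) := by
  have h1 : LCS.dual [((1 : ℝ), trotterCircuit (onSystem H : Op (Register n 2)) τ)]
      = circuitDual (trotterCircuit (onSystem H) τ) := by simp [LCS.dual]
  rw [lcsF, LCS.dual_andThen, h1, Module.End.mul_apply,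
    circuitDual_trotter_lcsV (suppIn_onSystem hw 1) hτ hK]
  exact eq_onSystem_compress (trivialOn_trotter (suppIn_onSystem hw 0) hτ hK X)
    (trivialOn_trotter (suppIn_onSystem hw 1) hτ hK X)

lemma mu_lcsF (H : Op (Fin n)) (τ : ℝ) (K : ℕ) :
    (lcsF H τ K).mu = (lcsV (onSystem H) τ K).mu := by
  rw [lcsF, LCS.mu_andThen]; simp [LCS.mu]

instance : NormedAlgebra ℚ (HOp n) := NormedAlgebra.restrictScalars ℚ ℂ (HOp n)

lemma heis_pow_left (A : Op (Fin n)) (k : ℕ) : heis (A ^ k) 1 = heis A 1 ^ k := by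
  induction k with
  | zero => simp [heis_one]
  | succ k ih =>
    rw [pow_succ', pow_succ, ← ih, ← heis_mul, one_mul]

lemma heis_pow_right (B : Op (Fin n)) (k : ℕ) : heis 1 (B ^ k) = heis 1 B ^ k := by
  induction k with
  | zero => simp [heis_one]
  | succ k ih =>
    rw [pow_succ', pow_succ, ← ih, ← heis_mul, one_mul]

/-- `A ↦ (X ↦ X A)`, as a continuous linear map. -/
def rightMulCLM (n : ℕ) : Op (Fin n) →L[ℂ] HOp n :=
  LinearMap.toContinuousLinearMap
    { toFun := fun A => heis A 1
      map_add' := fun A B => HOp.ext fun X => by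
        simp [heis_apply, HOp.add_apply, mul_add]
      map_smul' := fun z A => HOp.ext fun X => by
        simp [heis_apply, HOp.smul_apply] }

/-- `A ↦ (X ↦ A X)`, as a continuous linear map. -/
def leftMulCLM (n : ℕ) : Op (Fin n) →L[ℂ] HOp n :=
  LinearMap.toContinuousLinearMap
    { toFun := fun A => heis 1 Aᴴ
      map_add' := fun A B => HOp.ext fun X => by
        simp [heis_apply, HOp.add_apply, add_mul]
      map_smul' := fun z A => HOp.ext fun X => by
        simp [heis_apply, HOp.smul_apply] }

lemma rightMulCLM_apply (A X : Op (Fin n)) : rightMulCLM n A X = X * A := by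
  show heis A 1 X = _
  simp [heis_apply]

lemma leftMulCLM_apply (A X : Op (Fin n)) : leftMulCLM n A X = A * X := by
  show heis 1 Aᴴ X = _
  simp [heis_apply]

lemma exp_rightMul (A : Op (Fin n)) :
    NormedSpace.exp (rightMulCLM n A) = rightMulCLM n (NormedSpace.exp A) := by
  have h1 := (rightMulCLM n).hasSum (absSum_exp A).2
  refine (absSum_exp (rightMulCLM n A)).2.unique ?_
  convert h1 using 2 with k
  rw [map_smul]
  congr 1
  exact (heis_pow_left A k).symm

lemma exp_leftMul (A : Op (Fin n)) :
    NormedSpace.exp (leftMulCLM n A) = leftMulCLM n (NormedSpace.exp A) := by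
  have h1 := (leftMulCLM n).hasSum (absSum_exp A).2
  refine (absSum_exp (leftMulCLM n A)).2.unique ?_
  convert h1 using 2 with k
  rw [map_smul]
  congr 1
  show heis 1 Aᴴ ^ k = heis 1 (A ^ k)ᴴ
  rw [Matrix.conjTranspose_pow, heis_pow_right]

/-- The Heisenberg evolution `e^{τ𝓗} X = e^{iHτ} X e^{-iHτ}`. -/
lemma exp_hamDual_apply (H X : Op (Fin n)) (τ : ℝ) :
    NormedSpace.exp ((τ : ℂ) • hamDual H) X
      = NormedSpace.exp ((Complex.I * (τ : ℂ)) • H) * X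
        * NormedSpace.exp ((-(Complex.I * (τ : ℂ))) • H) := by
  have h1 : (τ : ℂ) • hamDual H = leftMulCLM n ((Complex.I * (τ : ℂ)) • H)
      + rightMulCLM n ((-(Complex.I * (τ : ℂ))) • H) := by
    refine HOp.ext fun X => ?_
    rw [HOp.add_apply, leftMulCLM_apply, rightMulCLM_apply, HOp.smul_apply, hamDual_apply,
      smul_mul_assoc, mul_smul_comm]
    module
  have h2 : Commute (leftMulCLM n ((Complex.I * (τ : ℂ)) • H))
      (rightMulCLM n ((-(Complex.I * (τ : ℂ))) • H)) := by
    refine HOp.ext fun X => ?_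
    rw [HOp.mul_apply, HOp.mul_apply, leftMulCLM_apply, rightMulCLM_apply, leftMulCLM_apply,
      rightMulCLM_apply, mul_assoc]
  rw [h1, NormedSpace.exp_add_of_commute h2, exp_leftMul, exp_rightMul, HOp.mul_apply,
    leftMulCLM_apply, rightMulCLM_apply, mul_assoc]

lemma onSystem_exp (A : Op (Fin n)) :
    (onSystem (NormedSpace.exp A) : Op (Register n 2)) = NormedSpace.exp (onSystem A) := by
  have h0 : Continuous (onSystemHom n 2) :=
    (onSystemHom n 2).toLinearMap.continuous_of_finiteDimensional
  have h1 := (absSum_exp A).2.map (onSystemHom n 2) h0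
  have h2 : (onSystemHom n 2 ∘ fun k => ((k ! : ℂ)⁻¹) • A ^ k)
      = fun k => ((k ! : ℂ)⁻¹) • (onSystem A : Op (Register n 2)) ^ k := by
    ext1 k
    rw [Function.comp_apply, map_smul, map_pow, onSystemHom_apply]
  rw [h2] at h1
  exact h1.unique (absSum_exp (onSystem A : Op (Register n 2))).2

lemma exactOp_onSystem (H : Op (Fin n)) (τ : ℝ) :
    exactOp (onSystem H) τ = NormedSpace.exp ((τ : ℂ) • hamDual H) := by
  refine HOp.ext fun X => ?_
  rw [exp_hamDual_apply, exactOp, compressConj_apply, ← onSystem_smul, ← onSystem_smul,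
    ← onSystem_exp, ← onSystem_exp, ← onSystem_mul, ← onSystem_mul, compress_onSystem]

/-! ### The dilation of a jump operator -/

/-- The Pauli string `γ` on the system and `a` on the dilation ancilla. -/
def dilString (a : Fin 4) (γ : PauliString (Fin n)) : PauliString (Register n 2) :=
  Sum.elim γ ![a, 0]

lemma onQubit_mul_onSystem_pauliOp (a : Fin 4) (γ : PauliString (Fin n)) :
    onQubit (dilAnc n) (pauliMat a) * onSystem (pauliOp γ) = pauliOp (dilString a γ) := by
  rw [onSystem_pauliOp, pauliOp_eq_tensorOp, pauliOp_eq_tensorOp, onQubit_eq_tensorOp, tensorOp_mul]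
  congr 1
  ext1 i
  rcases i with i | i
  · simp [dilAnc, dilString, extendString]
  · fin_cases i <;> simp [dilAnc, dilString, extendString, pauliMat_zero]

lemma ketBra_one_zero_eq :
    ketBra 1 0 = (1 / 2 : ℂ) • pauliMat 1 + (-Complex.I / 2) • pauliMat 2 := by
  ext i j
  fin_cases i <;> fin_cases j <;>
    simp [ketBra, pauliMat, Matrix.single] <;> ring_nf <;> norm_num

lemma ketBra_zero_one_eq :
    ketBra 0 1 = (1 / 2 : ℂ) • pauliMat 1 + (Complex.I / 2) • pauliMat 2 := by
  ext i j
  fin_cases i <;> fin_cases j <;>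
    simp [ketBra, pauliMat, Matrix.single] <;> ring_nf <;> norm_num

/-- The Pauli decomposition of the dilation, with real coefficients. -/
lemma dilation_eq_sum (D : Op (Fin n)) :
    dilation D = ∑ γ, (((pauliCoeff D γ).re : ℂ) • pauliOp (dilString 1 γ)
      + ((pauliCoeff D γ).im : ℂ) • pauliOp (dilString 2 γ)) := by
  have h1 : Dᴴ = ∑ γ, star (pauliCoeff D γ) • pauliOp γ := by
    rw [← sum_pauliCoeff_smul Dᴴ]
    exact Finset.sum_congr rfl fun γ _ => by rw [pauliCoeff_conjTranspose]
  have h2 : (onSystem D : Op (Register n 2)) = ∑ γ, pauliCoeff D γ • onSystem (pauliOp γ) := by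
    conv_lhs => rw [← sum_pauliCoeff_smul D, onSystem_sum]
    simp only [onSystem_smul]
  rw [dilation, h1, h2, onSystem_sum, ketBra_one_zero_eq, ketBra_zero_one_eq, Finset.mul_sum,
    Finset.mul_sum, ← Finset.sum_add_distrib]
  refine Finset.sum_congr rfl fun γ _ => ?_
  rw [onSystem_smul, onQubit_add, onQubit_add, onQubit_smul, onQubit_smul, onQubit_smul, add_mul,
    add_mul, smul_mul_smul_comm, smul_mul_smul_comm, smul_mul_smul_comm, smul_mul_smul_comm,
    onQubit_mul_onSystem_pauliOp, onQubit_mul_onSystem_pauliOp]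
  have e1 : pauliCoeff D γ = (pauliCoeff D γ).re + (pauliCoeff D γ).im * Complex.I :=
    (Complex.re_add_im _).symm
  have e2 : star (pauliCoeff D γ) = (pauliCoeff D γ).re - (pauliCoeff D γ).im * Complex.I := by
    apply Complex.ext <;> simp
  have e3 : ((pauliCoeff D γ).re : ℂ)
      = 1 / 2 * pauliCoeff D γ + 1 / 2 * star (pauliCoeff D γ) := by
    rw [e2]; nth_rewrite 2 [e1]; ring
  have e4 : ((pauliCoeff D γ).im : ℂ)
      = -Complex.I / 2 * pauliCoeff D γ + Complex.I / 2 * star (pauliCoeff D γ) := by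
    rw [e2]; nth_rewrite 2 [e1]; linear_combination (pauliCoeff D γ).im * Complex.I_mul_I
  rw [e3, e4]
  module

lemma weight_dilString_le (a : Fin 4) (γ : PauliString (Fin n)) :
    weight (dilString a γ) ≤ weight γ + 1 := by
  classical
  unfold weight
  refine (Finset.card_le_card (t := (Finset.univ.filter fun i => γ i ≠ 0).image Sum.inl
    ∪ {dilAnc n}) fun i hi => ?_).trans ((Finset.card_union_le _ _).trans
      (add_le_add Finset.card_image_le (by simp)))
  have hi' := (Finset.mem_filter.mp hi).2
  rcases i with i | i
  · exact Finset.mem_union_left _ (Finset.mem_image.mpr ⟨i, by simpa [dilString] using hi', rfl⟩)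
  · fin_cases i
    · exact Finset.mem_union_right _ (by simp [dilAnc])
    · simp [dilString] at hi'

lemma mem_pauliSupport_dilation {D : Op (Fin n)} {δ : PauliString (Register n 2)}
    (h : pauliCoeff (dilation D) δ ≠ 0) :
    ∃ γ ∈ pauliSupport D, δ = dilString 1 γ ∨ δ = dilString 2 γ := by
  rw [dilation_eq_sum, pauliCoeff_sum] at h
  obtain ⟨γ, _, hγ⟩ := Finset.exists_ne_zero_of_sum_ne_zero h
  rw [pauliCoeff_add, pauliCoeff_smul, pauliCoeff_smul, pauliCoeff_pauliOp, pauliCoeff_pauliOp] at hγ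
  refine ⟨γ, mem_pauliSupport.mpr fun h0 => hγ (by simp [h0]), ?_⟩
  by_contra hne
  push Not at hne
  simp [hne.1, hne.2] at hγ

lemma suppIn_dilation {w : ℕ} {D : Op (Fin n)} (hD : IsLocal w D) :
    SuppIn (ctlAnc n) (w + 1) (dilation D) := by
  intro δ hδ
  obtain ⟨γ, hγ, rfl | rfl⟩ := mem_pauliSupport_dilation hδ
  · exact ⟨rfl, (weight_dilString_le _ _).trans (by have := hD γ hγ; omega)⟩
  · exact ⟨rfl, (weight_dilString_le _ _).trans (by have := hD γ hγ; omega)⟩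

lemma card_pauliSupport_dilation_le (D : Op (Fin n)) :
    (pauliSupport (dilation D)).card ≤ 2 * (pauliSupport D).card := by
  classical
  rw [two_mul]
  refine (Finset.card_le_card (t := (pauliSupport D).image (dilString 1)
    ∪ (pauliSupport D).image (dilString 2)) fun δ hδ => ?_).trans
      ((Finset.card_union_le _ _).trans (add_le_add Finset.card_image_le Finset.card_image_le))
  obtain ⟨γ, hγ, rfl | rfl⟩ := mem_pauliSupport_dilation (mem_pauliSupport.mp hδ)
  · exact Finset.mem_union_left _ (Finset.mem_image_of_mem _ hγ)
  · exact Finset.mem_union_right _ (Finset.mem_image_of_mem _ hγ)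

lemma pauliNorm_dilation_le (D : Op (Fin n)) : pauliNorm (dilation D) ≤ 2 * pauliNorm D := by
  rw [dilation_eq_sum, pauliNorm, pauliNorm, Finset.mul_sum]
  refine (pauliNorm_sum _ _).trans (Finset.sum_le_sum fun γ _ => ?_)
  refine (pauliNorm_add _ _).trans ?_
  rw [pauliNorm_smul, pauliNorm_smul, pauliNorm_pauliOp, pauliNorm_pauliOp, mul_one, mul_one,
    Complex.norm_real, Complex.norm_real, Real.norm_eq_abs, Real.norm_eq_abs, two_mul]
  exact add_le_add (Complex.abs_re_le_norm _) (Complex.abs_im_le_norm _)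

lemma isHermitian_dilation (D : Op (Fin n)) : (dilation D).IsHermitian := by
  rw [Matrix.IsHermitian, dilation_eq_sum, Matrix.conjTranspose_sum]
  refine Finset.sum_congr rfl fun γ _ => ?_
  simp [Matrix.conjTranspose_add, Matrix.conjTranspose_smul, pauliOp_conjTranspose]

lemma dual_lcsJ {w : ℕ} {D : Op (Fin n)} (hD : IsLocal w D) (τ : ℝ) {K : ℕ}
    (hK : 3 ≤ 2 * K) (X : Op (Fin n)) :
    (lcsJ D τ K).dual (onSystem X)
      = onSystem (trotterOp (dilation D) (Real.sqrt τ) (2 * K) X) := by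
  have h1 : LCS.dual [((1 : ℝ), Instr.reset (dilAnc n) :: trotterCircuit (dilation D) (Real.sqrt τ))]
      = (Instr.reset (dilAnc n)).dual * circuitDual (trotterCircuit (dilation D) (Real.sqrt τ)) := by
    simp [LCS.dual, circuitDual]
  rw [lcsJ, LCS.dual_andThen, h1, Module.End.mul_apply, Module.End.mul_apply,
    circuitDual_trotter_lcsV (suppIn_dilation hD) (Real.sqrt_nonneg _) hK,
    reset_dilAnc_dual (trivialOn_trotter (suppIn_dilation hD) (Real.sqrt_nonneg _) hK X)]
  rfl

lemma mu_lcsJ (D : Op (Fin n)) (τ : ℝ) (K : ℕ) :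
    (lcsJ D τ K).mu = (lcsV (dilation D) (Real.sqrt τ) (2 * K)).mu := by
  rw [lcsJ, LCS.mu_andThen]; simp [LCS.mu]

/-! ### The exact dilated evolution -/

/-- The embedding of the system with the dilation ancilla in `|1⟩`. -/
def embedOne (n : ℕ) : Matrix (Register n 2 → Fin 2) (Fin n → Fin 2) ℂ :=
  onQubit (dilAnc n) (pauliMat 1) * embed n 2

lemma onSystem_mul_embed (A : Op (Fin n)) :
    (onSystem A : Op (Register n 2)) * embed n 2 = embed n 2 * A := by
  ext x y
  have h1 : ∀ z : Fin n → Fin 2, x = Sum.elim z 0 ↔ x ∘ Sum.inr = 0 ∧ z = x ∘ Sum.inl := by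
    intro z
    constructor
    · rintro rfl; exact ⟨rfl, rfl⟩
    · rintro ⟨h, rfl⟩
      ext1 i
      rcases i with i | i
      · rfl
      · exact congrFun h i
  simp only [Matrix.mul_apply, embed, onSystem, Matrix.of_apply, h1, mul_ite, ite_mul, mul_one,
    mul_zero, one_mul, zero_mul, Finset.sum_ite_eq', Finset.mem_univ, if_true, Sum.elim_comp_inr,
    Sum.elim_comp_inl]
  by_cases hx : x ∘ Sum.inr = 0
  · simp [hx]
  · simp [hx]

lemma onQubit_ketBra_mul_embed :
    onQubit (dilAnc n) (ketBra 0 0) * embed n 2 = embed n 2 := by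
  ext x y
  simp only [Matrix.mul_apply, embed, onQubit, Matrix.of_apply, mul_ite, mul_one, mul_zero,
    Finset.sum_ite_eq', Finset.mem_univ, if_true]
  have h0 : (Sum.elim y 0 : Register n 2 → Fin 2) (dilAnc n) = 0 := rfl
  rw [h0]
  by_cases hx : x = Sum.elim y 0
  · subst hx
    simp [h0, ketBra, Matrix.single]
  · rw [if_neg hx]
    by_cases hj : ∀ j, j ≠ dilAnc n → x j = (Sum.elim y 0 : Register n 2 → Fin 2) j
    · rw [if_pos hj]
      have hd : x (dilAnc n) ≠ 0 := fun h => hx (by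
        ext1 j
        by_cases hjd : j = dilAnc n
        · rw [hjd, h, h0]
        · exact hj j hjd)
      simp [ketBra, Matrix.single, hd.symm]
    · rw [if_neg hj]

lemma onQubit_mul_embed (M : Matrix (Fin 2) (Fin 2) ℂ) :
    onQubit (dilAnc n) M * embed n 2 = onQubit (dilAnc n) (M * ketBra 0 0) * embed n 2 := by
  conv_lhs => rw [← onQubit_ketBra_mul_embed, ← Matrix.mul_assoc, onQubit_mul]

lemma onSystem_mul_embedOne (A : Op (Fin n)) :
    (onSystem A : Op (Register n 2)) * embedOne n = embedOne n * A := by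
  have h : onQubit (dilAnc n) (pauliMat 1) * onSystem A
      = onSystem A * onQubit (dilAnc n) (pauliMat 1) := trivialOn_onSystem 0 A (pauliMat 1)
  rw [embedOne, ← Matrix.mul_assoc, ← h, Matrix.mul_assoc,
    onSystem_mul_embed, Matrix.mul_assoc]

lemma pauliX_mul_ketBra : pauliMat 1 * ketBra 0 0 = ketBra 1 0 ∧ ketBra 0 1 * pauliMat 1 = ketBra 0 0
    ∧ ketBra 1 0 * pauliMat 1 = ketBra 1 1 := by
  refine ⟨?_, ?_, ?_⟩ <;> ext i j <;> fin_cases i <;> fin_cases j <;>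
    simp [ketBra, pauliMat, Matrix.single, Matrix.mul_apply, Fin.sum_univ_two]

lemma dilation_mul_embed (D : Op (Fin n)) : dilation D * embed n 2 = embedOne n * D := by
  rw [dilation, Matrix.add_mul, Matrix.mul_assoc, Matrix.mul_assoc, onSystem_mul_embed,
    onSystem_mul_embed, ← Matrix.mul_assoc, ← Matrix.mul_assoc, onQubit_mul_embed (ketBra 0 1),
    ketBra_mul, embedOne, onQubit_mul_embed (pauliMat 1), pauliX_mul_ketBra.1]
  simp [onQubit_zero]

lemma dilation_mul_embedOne (D : Op (Fin n)) : dilation D * embedOne n = embed n 2 * Dᴴ := by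
  rw [dilation, Matrix.add_mul, Matrix.mul_assoc, Matrix.mul_assoc, onSystem_mul_embedOne,
    onSystem_mul_embedOne, embedOne, ← Matrix.mul_assoc, ← Matrix.mul_assoc, ← Matrix.mul_assoc,
    ← Matrix.mul_assoc, onQubit_mul, onQubit_mul, pauliX_mul_ketBra.2.1, pauliX_mul_ketBra.2.2,
    onQubit_mul_embed (ketBra 1 1), ketBra_mul, onQubit_ketBra_mul_embed]
  simp [onQubit_zero]

lemma embed_orthogonal :
    (embedOne n)ᴴ * embedOne n = 1 ∧ (embed n 2)ᴴ * embedOne n = 0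
      ∧ (embedOne n)ᴴ * embed n 2 = 0 := by
  have h1 : (embed n 2)ᴴ * embedOne n = 0 := by
    have e : (embed n 2)ᴴ = (embed n 2)ᴴ * onQubit (dilAnc n) (ketBra 0 0) := by
      conv_lhs => rw [← onQubit_ketBra_mul_embed, Matrix.conjTranspose_mul, onQubit_conjTranspose,
        ketBra_conjTranspose]
    rw [e, embedOne, onQubit_mul_embed (pauliMat 1), pauliX_mul_ketBra.1, Matrix.mul_assoc,
      ← Matrix.mul_assoc (onQubit _ _), onQubit_mul, ketBra_mul]
    simp [onQubit_zero]
  refine ⟨?_, h1, ?_⟩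
  · rw [embedOne, Matrix.conjTranspose_mul, onQubit_conjTranspose, pauliMat_conjTranspose,
      Matrix.mul_assoc, ← Matrix.mul_assoc (onQubit _ _), onQubit_mul, pauliMat_mul_self,
      onQubit_one, Matrix.one_mul, embed_conjTranspose_mul]
  · have := congrArg Matrix.conjTranspose h1
    rwa [Matrix.conjTranspose_mul, Matrix.conjTranspose_conjTranspose,
      Matrix.conjTranspose_zero] at this

/-- The powers of `J` alternate between the two states of the dilation ancilla. -/
lemma dilation_pow_mul_embed (D : Op (Fin n)) (j : ℕ) :
    dilation D ^ (2 * j) * embed n 2 = embed n 2 * (Dᴴ * D) ^ j ∧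
      dilation D ^ (2 * j + 1) * embed n 2 = embedOne n * (D * (Dᴴ * D) ^ j) := by
  have h2 : dilation D ^ (2 * j) * embed n 2 = embed n 2 * (Dᴴ * D) ^ j := by
    induction j with
    | zero => simp
    | succ j ih =>
      rw [show 2 * (j + 1) = 1 + 1 + 2 * j by ring, pow_add, pow_add, pow_one, Matrix.mul_assoc, ih,
        Matrix.mul_assoc, ← Matrix.mul_assoc (dilation D) (embed n 2), dilation_mul_embed,
        ← Matrix.mul_assoc, ← Matrix.mul_assoc, dilation_mul_embedOne, pow_succ']
      simp only [Matrix.mul_assoc]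
  refine ⟨h2, ?_⟩
  rw [pow_succ', Matrix.mul_assoc, h2, ← Matrix.mul_assoc, dilation_mul_embed, Matrix.mul_assoc]

/-- The terms of `cos (√τ |D|)` as a power series in `τ`. -/
def cosTerm (D : Op (Fin n)) (τ : ℝ) (j : ℕ) : Op (Fin n) :=
  ((-(τ : ℂ)) ^ j / ((2 * j)! : ℂ)) • (Dᴴ * D) ^ j

/-- The terms of `D sin (√τ |D|) / (√τ |D|)` as a power series in `τ`. -/
def sinTerm (D : Op (Fin n)) (τ : ℝ) (j : ℕ) : Op (Fin n) :=
  ((-(τ : ℂ)) ^ j / ((2 * j + 1)! : ℂ)) • (D * (Dᴴ * D) ^ j)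

lemma summable_exp_bound (A B : Op (Fin n)) (τ : ℝ) {f : ℕ → ℕ} (hf : ∀ j, j ≤ f j) :
    Summable fun j => ‖((-(τ : ℂ)) ^ j / ((f j)! : ℂ)) • (B * A ^ j)‖ := by
  refine Summable.of_nonneg_of_le (fun _ => norm_nonneg _) (fun j => ?_)
    ((Real.summable_pow_div_factorial (|τ| * ‖A‖)).mul_left (‖B‖ * ‖(1 : Op (Fin n))‖))
  have h1 : ‖A ^ j‖ ≤ ‖(1 : Op (Fin n))‖ * ‖A‖ ^ j := by
    induction j with
    | zero => simp
    | succ j ih =>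
      rw [pow_succ, pow_succ, ← mul_assoc]
      exact (norm_mul_le _ _).trans (by gcongr)
  have h2 : (j ! : ℝ) ≤ (f j)! := by exact_mod_cast Nat.factorial_le (hf j)
  have h3 : (0 : ℝ) < j ! := by exact_mod_cast j.factorial_pos
  rw [norm_smul, norm_div, norm_pow, norm_neg, Complex.norm_real, Complex.norm_natCast,
    Real.norm_eq_abs]
  calc |τ| ^ j / (f j)! * ‖B * A ^ j‖ ≤ |τ| ^ j / j ! * (‖B‖ * (‖(1 : Op (Fin n))‖ * ‖A‖ ^ j)) := by
        gcongr
        exact (norm_mul_le _ _).trans (by gcongr)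
    _ = _ := by rw [mul_pow]; ring

lemma absSum_cosTerm (D : Op (Fin n)) (τ : ℝ) :
    AbsSum (cosTerm D τ) (∑' j, cosTerm D τ j) := by
  have h := summable_exp_bound (Dᴴ * D) 1 τ (f := fun j => 2 * j) fun j => by omega
  simp only [one_mul] at h
  exact ⟨h, h.of_norm.hasSum⟩

lemma absSum_sinTerm (D : Op (Fin n)) (τ : ℝ) :
    AbsSum (sinTerm D τ) (∑' j, sinTerm D τ j) := by
  have h := summable_exp_bound (Dᴴ * D) D τ (f := fun j => 2 * j + 1) fun j => by omega
  exact ⟨h, h.of_norm.hasSum⟩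

/-- The dilated evolution of the system with the ancilla in `|0⟩`. -/
lemma exp_dilation_mul_embed (D : Op (Fin n)) {z : ℂ} {τ : ℝ} (hz : z ^ 2 = -(τ : ℂ)) :
    NormedSpace.exp (z • dilation D) * embed n 2
      = embed n 2 * (∑' j, cosTerm D τ j) + z • (embedOne n * ∑' j, sinTerm D τ j) := by
  have h1 := (absSum_exp (z • dilation D)).2.map
    (AddMonoidHom.mk' (fun M : Op (Register n 2) => M * embed n 2) fun A B => Matrix.add_mul A B _)
    (continuous_id.matrix_mul continuous_const)
  have h2 := (absSum_cosTerm D τ).2.map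
    (AddMonoidHom.mk' (fun M : Op (Fin n) => embed n 2 * M) fun A B => Matrix.mul_add _ A B)
    (continuous_const.matrix_mul continuous_id)
  have h3 := (absSum_sinTerm D τ).2.map
    (AddMonoidHom.mk' (fun M : Op (Fin n) => z • (embedOne n * M)) fun A B => by
      rw [Matrix.mul_add, smul_add])
    ((continuous_const.matrix_mul continuous_id).const_smul z)
  have h2' : HasSum (fun j => embed n 2 * cosTerm D τ j) (embed n 2 * ∑' j, cosTerm D τ j) := h2
  have h3' : HasSum (fun j => z • (embedOne n * sinTerm D τ j))
      (z • (embedOne n * ∑' j, sinTerm D τ j)) := h3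
  refine h1.unique (HasSum.even_add_odd ?_ ?_)
  · convert h2' using 2 with j
    simp only [Function.comp_apply, AddMonoidHom.mk'_apply, cosTerm]
    rw [smul_pow, smul_smul, Matrix.smul_mul, (dilation_pow_mul_embed D j).1, Matrix.mul_smul,
      pow_mul, hz]
    congr 1
    ring
  · convert h3' using 2 with j
    simp only [Function.comp_apply, AddMonoidHom.mk'_apply, sinTerm]
    rw [smul_pow, smul_smul, Matrix.smul_mul, (dilation_pow_mul_embed D j).2, Matrix.mul_smul,
      smul_smul, pow_succ, pow_mul, hz]
    congr 1
    ring

/-- `𝓙(τ)` through its two Kraus operators. -/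
lemma exactOp_dilation (D : Op (Fin n)) {τ : ℝ} (hτ : 0 ≤ τ) :
    exactOp (dilation D) (Real.sqrt τ)
      = rightMulCLM n (∑' j, cosTerm D τ j) * leftMulCLM n (∑' j, cosTerm D τ j)ᴴ
        + (τ : ℂ) • (rightMulCLM n (∑' j, sinTerm D τ j) * leftMulCLM n (∑' j, sinTerm D τ j)ᴴ) := by
  refine HOp.ext fun X => ?_
  set z : ℂ := -(Complex.I * (Real.sqrt τ : ℂ)) with hz
  have hs : ((Real.sqrt τ : ℝ) : ℂ) * ((Real.sqrt τ : ℝ) : ℂ) = τ := by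
    rw [← Complex.ofReal_mul, Real.mul_self_sqrt hτ]
  have hz2 : z ^ 2 = -(τ : ℂ) := by
    rw [hz, neg_sq, mul_pow, Complex.I_sq, pow_two, hs, neg_one_mul]
  have hzz : star z * z = τ := by
    rw [hz, star_neg, star_mul', Complex.star_def, Complex.conj_I, Complex.conj_ofReal]
    calc _ = -(Complex.I * Complex.I) * ((Real.sqrt τ : ℂ) * (Real.sqrt τ : ℂ)) := by ring
      _ = τ := by rw [Complex.I_mul_I, hs]; ring
  have hstar : NormedSpace.exp ((Complex.I * (Real.sqrt τ : ℂ)) • dilation D)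
      = (NormedSpace.exp (z • dilation D))ᴴ := by
    rw [← Matrix.star_eq_conjTranspose, NormedSpace.star_exp, star_smul,
      Matrix.star_eq_conjTranspose, (isHermitian_dilation D).eq]
    congr 2
    simp [hz]
  obtain ⟨o1, o2, o3⟩ := embed_orthogonal (n := n)
  have h4 : ∀ Y : Op (Register n 2), (embed n 2)ᴴ * ((NormedSpace.exp (z • dilation D))ᴴ * Y *
      NormedSpace.exp (z • dilation D)) * embed n 2
      = (NormedSpace.exp (z • dilation D) * embed n 2)ᴴ * (Y *
        (NormedSpace.exp (z • dilation D) * embed n 2)) := by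
    intro Y
    rw [Matrix.conjTranspose_mul]
    simp only [Matrix.mul_assoc]
  rw [exactOp, compressConj_apply, hstar, compress_eq, h4, exp_dilation_mul_embed D hz2]
  set C := ∑' j, cosTerm D τ j
  set S := ∑' j, sinTerm D τ j
  have h5 : (onSystem X : Op (Register n 2)) * (embed n 2 * C + z • (embedOne n * S) : Matrix _ _ ℂ)
      = embed n 2 * (X * C) + z • (embedOne n * (X * S)) := by
    rw [Matrix.mul_add, Matrix.mul_smul, ← Matrix.mul_assoc, ← Matrix.mul_assoc, onSystem_mul_embed,
      onSystem_mul_embedOne, Matrix.mul_assoc, Matrix.mul_assoc]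
  rw [h5, Matrix.conjTranspose_add, Matrix.conjTranspose_smul, Matrix.conjTranspose_mul,
    Matrix.conjTranspose_mul, Matrix.add_mul, Matrix.mul_add, Matrix.mul_add]
  have e1 : Cᴴ * (embed n 2)ᴴ * (embed n 2 * (X * C)) = Cᴴ * (X * C) := by
    rw [Matrix.mul_assoc, ← Matrix.mul_assoc (embed n 2)ᴴ, embed_conjTranspose_mul, Matrix.one_mul]
  have e2 : Cᴴ * (embed n 2)ᴴ * (z • (embedOne n * (X * S))) = 0 := by
    rw [Matrix.mul_smul, Matrix.mul_assoc, ← Matrix.mul_assoc (embed n 2)ᴴ, o2, Matrix.zero_mul,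
      Matrix.mul_zero, smul_zero]
  have e3 : star z • (Sᴴ * (embedOne n)ᴴ) * (embed n 2 * (X * C)) = 0 := by
    rw [Matrix.smul_mul, Matrix.mul_assoc, ← Matrix.mul_assoc (embedOne n)ᴴ, o3, Matrix.zero_mul,
      Matrix.mul_zero, smul_zero]
  have e4 : star z • (Sᴴ * (embedOne n)ᴴ) * (z • (embedOne n * (X * S))) = (τ : ℂ) • (Sᴴ * (X * S)) := by
    rw [Matrix.smul_mul, Matrix.mul_smul, smul_smul, hzz, Matrix.mul_assoc,
      ← Matrix.mul_assoc (embedOne n)ᴴ, o1, Matrix.one_mul]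
  rw [e1, e2, e3, e4, add_zero, zero_add, HOp.add_apply, HOp.smul_apply, HOp.mul_apply,
    HOp.mul_apply, leftMulCLM_apply, leftMulCLM_apply, rightMulCLM_apply, rightMulCLM_apply,
    Matrix.mul_assoc, Matrix.mul_assoc]

lemma AbsSum.shift {R : Type*} [NormedRing R] {a : ℕ → R} {s : R} (ha : AbsSum a s) :
    AbsSum (fun k => if k = 0 then 0 else a (k - 1)) s := by
  constructor
  · rw [← summable_nat_add_iff 1]
    simpa using ha.1
  · rw [← hasSum_nat_add_iff' 1]
    simpa using ha.2

lemma AbsSum.map_clm {R R' : Type*} [NormedRing R] [NormedRing R'] [NormedAlgebra ℂ R]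
    [NormedAlgebra ℂ R'] {a : ℕ → R} {s : R} (ha : AbsSum a s) (Φ : R →L[ℂ] R') :
    AbsSum (fun k => Φ (a k)) (Φ s) :=
  ⟨Summable.of_nonneg_of_le (fun _ => norm_nonneg _) (fun _ => Φ.le_opNorm _) (ha.1.mul_left ‖Φ‖),
    Φ.hasSum ha.2⟩

lemma AbsSum.conjTranspose {a : ℕ → Op (Fin n)} {s : Op (Fin n)} (ha : AbsSum a s) :
    AbsSum (fun k => (a k)ᴴ) sᴴ := by
  refine ⟨?_, ha.2.matrix_conjTranspose⟩
  simp only [Matrix.l2_opNorm_conjTranspose]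
  exact ha.1

lemma AbsSum.smul {R : Type*} [NormedRing R] [NormedAlgebra ℂ R] {a : ℕ → R} {s : R}
    (ha : AbsSum a s) (z : ℂ) : AbsSum (fun k => z • a k) (z • s) :=
  ⟨by simp only [norm_smul]; exact ha.1.mul_left _, ha.2.const_smul z⟩

/-- `𝓙(τ)` is the sum of its series of words. -/
lemma absSum_dilWord (D : Op (Fin n)) {τ : ℝ} (hτ : 0 ≤ τ) :
    AbsSum (fun k => (τ : ℂ) ^ k • wordSum D dilWord k)
      (exactOp (dilation D) (Real.sqrt τ)) := by
  rw [exactOp_dilation D hτ]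
  have h1 := ((absSum_cosTerm D τ).map_clm (rightMulCLM n)).mul
    ((absSum_cosTerm D τ).conjTranspose.map_clm (leftMulCLM n))
  have h2 := ((((absSum_sinTerm D τ).map_clm (rightMulCLM n)).mul
    ((absSum_sinTerm D τ).conjTranspose.map_clm (leftMulCLM n))).smul (τ : ℂ)).shift
  convert h1.add h2 using 2 with k
  refine HOp.ext fun X => ?_
  have hP : (Dᴴ * D)ᴴ = Dᴴ * D := by simp
  rw [HOp.smul_apply, wordSum_dilWord_apply, HOp.add_apply, smul_add,
    Finset.Nat.sum_antidiagonal_eq_sum_range_succ_mk, HOp.sum_apply, Finset.smul_sum]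
  congr 1
  · refine Finset.sum_congr rfl fun j hj => ?_
    have hj' := Finset.mem_range.mp hj
    rw [HOp.mul_apply, leftMulCLM_apply, rightMulCLM_apply, cosTerm, cosTerm,
      Matrix.conjTranspose_smul, Matrix.conjTranspose_pow, hP, smul_mul_assoc, mul_smul_comm,
      smul_mul_assoc, smul_smul, smul_smul]
    congr 1
    have : star (((-(τ : ℂ)) ^ (k - j)) / ((2 * (k - j))! : ℂ))
        = (-(τ : ℂ)) ^ (k - j) / ((2 * (k - j))! : ℂ) := by simp
    rw [this]
    have hk : k = j + (k - j) := by omega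
    generalize k - j = l at *
    subst hk
    push_cast
    rw [neg_pow (τ : ℂ) j, neg_pow (τ : ℂ) l]
    ring
  · rcases k with _ | k
    · simp [HOp.zero_apply]
    rw [if_neg (Nat.succ_ne_zero k), HOp.smul_apply, Nat.add_sub_cancel,
      Finset.Nat.sum_antidiagonal_eq_sum_range_succ_mk, HOp.sum_apply, Finset.smul_sum,
      Finset.smul_sum]
    refine Finset.sum_congr rfl fun j hj => ?_
    have hj' := Finset.mem_range.mp hj
    rw [HOp.mul_apply, leftMulCLM_apply, rightMulCLM_apply, sinTerm, sinTerm,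
      Matrix.conjTranspose_smul, Matrix.conjTranspose_mul, Matrix.conjTranspose_pow, hP,
      smul_mul_assoc, mul_smul_comm, smul_mul_assoc, smul_smul, smul_smul, smul_smul]
    have : star (((-(τ : ℂ)) ^ (k - j)) / ((2 * (k - j) + 1)! : ℂ))
        = (-(τ : ℂ)) ^ (k - j) / ((2 * (k - j) + 1)! : ℂ) := by simp
    rw [this]
    simp only [mul_assoc]
    congr 1
    have hk : k = j + (k - j) := by omega
    generalize k - j = l at *
    subst hk
    push_cast
    rw [neg_pow (τ : ℂ) j, neg_pow (τ : ℂ) l]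
    ring

end Ancilla

/-! ### The exact evolution in the Heisenberg picture -/

section Evolution

open scoped Matrix.Norms.L2Operator ComplexOrder

variable {n m : ℕ}

lemma opNorm_eq_norm (O : Op (Fin n)) : opNorm O = ‖O‖ := rfl

lemma norm_trace_mul_eigenProj_le {A : Op (Fin n)} (hA : A.IsHermitian) (Y : Op (Fin n))
    (j : Fin n → Fin 2) : ‖(Y * eigenProj hA j).trace‖ ≤ ‖Y‖ := by
  have h : (Y * eigenProj hA j).trace
      = inner ℂ (hA.eigenvectorBasis j)
          (Matrix.toEuclideanCLM (𝕜 := ℂ) Y (hA.eigenvectorBasis j)) := by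
    unfold eigenProj
    rw [Matrix.mul_vecMulVec, Matrix.trace_vecMulVec, EuclideanSpace.inner_eq_star_dotProduct]
    rfl
  rw [h]
  refine (norm_inner_le_norm _ _).trans ?_
  rw [hA.eigenvectorBasis.orthonormal.1 j, one_mul]
  refine (ContinuousLinearMap.le_opNorm _ _).trans ?_
  rw [hA.eigenvectorBasis.orthonormal.1 j, mul_one]
  exact le_of_eq rfl

/-- A state is a convex combination of eigenprojectors, so expectations are bounded by the
spectral norm. -/
lemma norm_trace_mul_state_le {ρ : Op (Fin n)} (hρ : IsState ρ) (Y : Op (Fin n)) :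
    ‖(Y * ρ).trace‖ ≤ ‖Y‖ := by
  have hH := hρ.1.isHermitian
  have h1 : (Y * ρ).trace = ∑ j, (hH.eigenvalues j : ℂ) * (Y * eigenProj hH j).trace := by
    conv_lhs => rw [← sum_eigenvalues_smul_eigenProj hH]
    simp [Finset.mul_sum, Matrix.trace_sum, Matrix.trace_smul]
  have h2 : ∑ j, hH.eigenvalues j = 1 := by
    have := hH.trace_eq_sum_eigenvalues
    rw [hρ.2] at this
    have h3 : ((∑ j, hH.eigenvalues j : ℝ) : ℂ) = 1 := by
      rw [this]; simp
    exact_mod_cast h3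
  rw [h1]
  calc _ ≤ ∑ j, hH.eigenvalues j * ‖Y‖ := by
        refine (norm_sum_le _ _).trans (Finset.sum_le_sum fun j _ => ?_)
        have h0 := hρ.1.eigenvalues_nonneg j
        rw [norm_mul, Complex.norm_real, Real.norm_of_nonneg h0]
        exact mul_le_mul_of_nonneg_left (norm_trace_mul_eigenProj_le hH Y j) h0
    _ = ‖Y‖ := by rw [← Finset.sum_mul, h2, one_mul]

lemma trace_hamPart_mul (H X Y : Op (Fin n)) :
    (hamPart H X * Y).trace = (hamDual H Y * X).trace := by
  rw [hamDual_apply]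
  simp only [hamPart, LinearMap.smul_apply, LinearMap.sub_apply, LinearMap.mulLeft_apply,
    LinearMap.mulRight_apply, smul_mul_assoc, Matrix.trace_smul, sub_mul, Matrix.trace_sub]
  rw [Matrix.trace_mul_cycle H X Y, mul_assoc X H Y, Matrix.trace_mul_comm X (H * Y)]

lemma trace_dissPart_mul (D X Y : Op (Fin n)) :
    (dissPart D X * Y).trace = (dissDual D Y * X).trace := by
  rw [dissDual_apply]
  simp only [dissPart, jumpPart, LinearMap.smul_apply, LinearMap.sub_apply, Module.End.mul_apply,
    LinearMap.mulLeft_apply, LinearMap.mulRight_apply, smul_mul_assoc, Matrix.trace_smul, sub_mul,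
    Matrix.trace_sub, Matrix.cons_val_zero, Matrix.cons_val_one, Matrix.cons_val]
  have h1 : (D * (X * Dᴴ) * Y).trace = (Dᴴ * Y * D * X).trace := by
    rw [show D * (X * Dᴴ) * Y = D * X * (Dᴴ * Y) by simp only [mul_assoc],
      Matrix.trace_mul_comm, ← mul_assoc]
  have h2 : (Dᴴ * D * X * Y).trace = (Y * (Dᴴ * D) * X).trace := by
    rw [Matrix.trace_mul_comm, ← mul_assoc]
  have h3 : (X * (Dᴴ * D) * Y).trace = (Dᴴ * D * Y * X).trace := by
    rw [mul_assoc, Matrix.trace_mul_comm]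
  rw [h1, h2, h3]

lemma trace_lindbladian_mul (H : Op (Fin n)) (D : Fin m → Op (Fin n)) (X Y : Op (Fin n)) :
    (lindbladian H D X * Y).trace = (lindDual H D Y * X).trace := by
  unfold lindbladian lindDual
  rw [sum_map_finRange, HOp.add_apply, HOp.sum_apply]
  simp only [LinearMap.add_apply, LinearMap.sum_apply, add_mul, Finset.sum_mul, Matrix.trace_add,
    Matrix.trace_sum, trace_hamPart_mul, trace_dissPart_mul]

lemma trace_lindbladian_pow_mul (H : Op (Fin n)) (D : Fin m → Op (Fin n)) (k : ℕ) :
    ∀ X Y, (((lindbladian H D) ^ k) X * Y).trace = (((lindDual H D) ^ k) Y * X).trace := by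
  induction k with
  | zero => intro X Y; simp [HOp.one_apply, Matrix.trace_mul_comm X Y]
  | succ k ih =>
    intro X Y
    rw [pow_succ, Module.End.mul_apply, ih, pow_succ', HOp.mul_apply,
      Matrix.trace_mul_comm, trace_lindbladian_mul]

/-- Expectations of the evolved state, in the Heisenberg picture. -/
lemma trace_evolve_mul (H : Op (Fin n)) (D : Fin m → Op (Fin n)) (T : ℝ) (ρ O : Op (Fin n)) :
    (evolve (lindbladian H D) T ρ * O).trace
      = ((NormedSpace.exp ((T : ℂ) • lindDual H D)) O * ρ).trace := by
  have hs : HasSum (fun k : ℕ => ((T : ℂ) ^ k / (k ! : ℂ)) • ((lindbladian H D) ^ k) ρ)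
      (evolve (lindbladian H D) T ρ) := by
    refine Summable.hasSum ?_
    let L : HOp n := (LinearMap.toContinuousLinearMap (lindbladian H D) :
      Op (Fin n) →L[ℂ] Op (Fin n))
    have hL : ∀ X, L X = lindbladian H D X := fun _ => rfl
    have h := (NormedSpace.expSeries_summable' (𝕂 := ℂ) ((T : ℂ) • L)).mapL (HOp.applyCLM ρ)
    refine h.congr fun k => ?_
    have hk : ∀ k, (L ^ k) ρ = ((lindbladian H D) ^ k) ρ := by
      intro k
      induction k with
      | zero => rfl
      | succ k ih => rw [pow_succ', pow_succ', HOp.mul_apply, ih, Module.End.mul_apply, hL]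
    rw [HOp.applyCLM_apply, smul_pow, HOp.smul_apply, HOp.smul_apply, hk, smul_smul,
      div_eq_inv_mul]
  have h1 := hs.mapL (LinearMap.toContinuousLinearMap
    ((Matrix.traceLinearMap (Fin n → Fin 2) ℂ ℂ) ∘ₗ LinearMap.mulRight ℂ O))
  have h2 := ((NormedSpace.exp_series_hasSum_exp' (𝕂 := ℂ) ((T : ℂ) • lindDual H D)).mapL
    (HOp.applyCLM O)).mapL (LinearMap.toContinuousLinearMap
    ((Matrix.traceLinearMap (Fin n → Fin 2) ℂ ℂ) ∘ₗ LinearMap.mulRight ℂ ρ))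
  refine h1.unique ?_
  convert h2 using 2 with k
  swap; · rfl
  rw [HOp.applyCLM_apply, smul_pow, HOp.smul_apply, HOp.smul_apply, smul_smul]
  simp only [LinearMap.coe_toContinuousLinearMap', LinearMap.coe_comp, Function.comp_apply,
    LinearMap.mulRight_apply, Matrix.traceLinearMap_apply, smul_mul_assoc, Matrix.trace_smul,
    trace_lindbladian_pow_mul]
  rw [div_eq_inv_mul]

end Evolution

/-! ### Error propagation through concatenated formulas -/

section Factors

variable {n m : ℕ}

/-- In the Heisenberg picture the formula `F` implements the superoperator `E` up to an error
`e * exp b`, with `1`-norm and `‖E‖` at most `exp b` and circuits of at most `g` operations. The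
factor `exp b` in the error makes `b`, `e` and `g` additive under concatenation. -/
structure IsFactor (F : LCS (Register n 2)) (E : HOp n) (b e : ℝ) (g : ℕ) : Prop where
  dual : ∃ A : HOp n, (∀ X, F.dual (onSystem X) = onSystem (A X)) ∧ ‖A‖ ≤ F.mu ∧
    ‖A - E‖ ≤ e * Real.exp b
  one_le : 1 ≤ F.mu
  mu_le : F.mu ≤ Real.exp b
  norm_le : ‖E‖ ≤ Real.exp b
  nonneg : 0 ≤ e
  mem : ∀ t ∈ F, 0 ≤ t.1 ∧ CircuitBound g t.2

lemma IsFactor.mono {F : LCS (Register n 2)} {E : HOp n} {b e b' e' : ℝ} {g g' : ℕ}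
    (h : IsFactor F E b e g) (hb : b ≤ b') (he : e ≤ e') (hg : g ≤ g') :
    IsFactor F E b' e' g' := by
  have hexp := Real.exp_le_exp.mpr hb
  obtain ⟨A, hA, hA1, hA2⟩ := h.dual
  exact ⟨⟨A, hA, hA1, hA2.trans (mul_le_mul he hexp (Real.exp_nonneg _) (h.nonneg.trans he))⟩,
    h.one_le, h.mu_le.trans hexp, h.norm_le.trans hexp, h.nonneg.trans he,
    fun t ht => ⟨(h.mem t ht).1, (h.mem t ht).2.mono hg⟩⟩

lemma IsFactor.andThen {F F' : LCS (Register n 2)} {E E' : HOp n} {b e b' e' : ℝ} {g g' : ℕ}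
    (h : IsFactor F E b e g) (h' : IsFactor F' E' b' e' g') :
    IsFactor (F.andThen F') (E * E') (b + b') (e + e') (g + g') := by
  obtain ⟨A, hA, hA1, hA2⟩ := h.dual
  obtain ⟨A', hA', hA1', hA2'⟩ := h'.dual
  refine ⟨⟨A * A', fun X => ?_, ?_, ?_⟩, ?_, ?_, ?_, add_nonneg h.nonneg h'.nonneg, ?_⟩
  · rw [LCS.dual_andThen, Module.End.mul_apply, hA', hA, HOp.mul_apply]
  · rw [LCS.mu_andThen]
    exact (norm_mul_le _ _).trans
      (mul_le_mul hA1 hA1' (norm_nonneg _) (zero_le_one.trans h.one_le))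
  · calc ‖A * A' - E * E'‖ = ‖A * (A' - E') + (A - E) * E'‖ := by congr 1; noncomm_ring
      _ ≤ ‖A‖ * ‖A' - E'‖ + ‖A - E‖ * ‖E'‖ :=
        (norm_add_le _ _).trans (add_le_add (norm_mul_le _ _) (norm_mul_le _ _))
      _ ≤ Real.exp b * (e' * Real.exp b') + e * Real.exp b * Real.exp b' :=
        add_le_add
          (mul_le_mul (hA1.trans h.mu_le) hA2' (norm_nonneg _) (Real.exp_nonneg _))
          (mul_le_mul hA2 h'.norm_le (norm_nonneg _)
            (mul_nonneg h.nonneg (Real.exp_nonneg _)))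
      _ = _ := by rw [Real.exp_add]; ring
  · rw [LCS.mu_andThen]; exact one_le_mul_of_one_le_of_one_le h.one_le h'.one_le
  · rw [LCS.mu_andThen, Real.exp_add]
    exact mul_le_mul h.mu_le h'.mu_le (zero_le_one.trans h'.one_le) (Real.exp_nonneg _)
  · rw [Real.exp_add]
    exact (norm_mul_le _ _).trans
      (mul_le_mul h.norm_le h'.norm_le (norm_nonneg _) (Real.exp_nonneg _))
  · intro t ht
    obtain ⟨f, hf, k, hk, rfl⟩ := LCS.mem_andThen.mp ht
    exact ⟨mul_nonneg (h.mem f hf).1 (h'.mem k hk).1, (h.mem f hf).2.append (h'.mem k hk).2⟩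

lemma IsFactor.nil : IsFactor (LCS.concat []) (1 : HOp n) 0 0 0 := by
  have h1 : ‖(1 : HOp n)‖ ≤ 1 :=
    HOp.norm_le_of zero_le_one fun X => by rw [HOp.one_apply, one_mul]
  have hmu : LCS.mu (LCS.concat ([] : List (LCS (Register n 2)))) = 1 := by simp [LCS.mu_concat]
  refine ⟨⟨1, fun X => ?_, ?_, by simp⟩, hmu.ge, by simp [hmu], by simpa using h1, le_rfl, ?_⟩
  · rw [LCS.dual_concat]; rfl
  · rw [hmu]; exact h1
  · intro t ht
    simp only [LCS.concat, List.foldr_nil, List.mem_singleton] at ht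
    subst ht
    exact ⟨zero_le_one, CircuitBound.nil⟩

lemma IsFactor.concat_cons {F : LCS (Register n 2)} {Fs : List (LCS (Register n 2))} {E E' : HOp n}
    {b e b' e' : ℝ} {g g' : ℕ} (h : IsFactor F E b e g)
    (h' : IsFactor (LCS.concat Fs) E' b' e' g') :
    IsFactor (LCS.concat (F :: Fs)) (E * E') (b + b') (e + e') (g + g') := h.andThen h'

lemma IsFactor.concat_replicate {F : LCS (Register n 2)} {E : HOp n} {b e : ℝ} {g : ℕ}
    (h : IsFactor F E b e g) (S : ℕ) :
    IsFactor (LCS.concat (List.replicate S F)) (E ^ S) (S * b) (S * e) (S * g) := by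
  induction S with
  | zero => simpa using IsFactor.nil
  | succ S ih =>
    have := h.concat_cons ih
    rw [← pow_succ'] at this
    exact this.mono (by push_cast; linarith) (by push_cast; linarith) (by linarith)

/-! ### The factors of one time step -/

/-- A truncated Pauli series with coefficients bounded by powers of `y`. -/
lemma isFactor_toLCS {v : ℕ} {f : FormalSeries n} (hf : f.IsPauli v) (hs : f.Starts 0) {τ : ℝ}
    (hτ : 0 ≤ τ) {K : ℕ} (hK : 1 ≤ K) {y : ℝ} (hy0 : 0 ≤ y) (hy : y ≤ 1 / 2)
    (hb : ∀ k, τ ^ k * (f k).norm1 ≤ y ^ k) {s : HOp n} (he : f.EvalsTo τ s) :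
    IsFactor (f.toLCS τ K) s (4 * y ^ 2) (2 * y ^ K) (24 * (K * v) + 30) := by
  obtain ⟨h1, h2, h3, h4⟩ := toLCS_bounds hf hs hτ K hy0 hy hb he
  have hexp : 1 + 4 * y ^ 2 ≤ Real.exp (4 * y ^ 2) := by
    linarith [Real.add_one_le_exp (4 * y ^ 2)]
  have hy1 : y ≤ 1 := by linarith
  have hK1 : y ^ (K + 1) ≤ y ^ K := pow_le_pow_of_le_one hy0 hy1 (by omega)
  have hK2 : y ^ (K + 1) ≤ y ^ 2 := pow_le_pow_of_le_one hy0 hy1 (by omega)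
  have hone : 1 ≤ Real.exp (4 * y ^ 2) := Real.one_le_exp (by positivity)
  refine ⟨⟨_, fun X => dual_toLCS hf hs.2.2 τ K X, h3, ?_⟩, h1, ?_, ?_, by positivity,
    fun t ht => mem_toLCS hf hτ ht⟩
  · refine h4.trans ((mul_le_mul_of_nonneg_left hK1 zero_le_two).trans ?_)
    exact le_mul_of_one_le_right (by positivity) hone
  · nlinarith
  · calc ‖s‖ = ‖f.trunc τ K - (f.trunc τ K - s)‖ := by rw [sub_sub_cancel]
      _ ≤ _ := (norm_sub_le _ _).trans (by linarith)

/-- Trotter formula and compensation with the same generator; `y` bounds twice the generator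
times the duration. -/
lemma trotter_bounds {G : Op (Register n 2)} {v : ℕ} (hG : G.IsHermitian)
    (hs : SuppIn (ctlAnc n) v G) {x : ℝ} (hx : 0 ≤ x) {K : ℕ} (hK : 3 ≤ K) {y : ℝ}
    (hy : 2 * pauliNorm G * x ≤ y) (hy2 : y ≤ 1 / 2) :
    ‖trotterOp G x K - exactOp G x‖ ≤ 8 * y ^ (K + 1) * Real.exp (16 * y ^ 4) ∧
      (lcsV G x K).mu ≤ Real.exp (16 * y ^ 4) ∧ ‖exactOp G x‖ ≤ Real.exp (16 * y ^ 4) := by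
  have hG0 : 0 ≤ pauliNorm G := Finset.sum_nonneg fun _ _ => norm_nonneg _
  have hy0 : 0 ≤ y := le_trans (by positivity) hy
  have h1 := norm_trotterOp_sub_le hG hs hx hK hy hy2
  obtain ⟨-, h2⟩ := mu_lcsV_bounds hG hx hK hy hy2
  have h3 := norm_trotterOp_le hs hx hK
  have hK1 : y ^ (K + 1) ≤ y ^ 4 := pow_le_pow_of_le_one hy0 (by linarith) (by omega)
  have h4 : 0 ≤ y ^ 4 := by positivity
  have hexp : (1 + 8 * y ^ 4) ^ 2 ≤ Real.exp (16 * y ^ 4) := by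
    rw [show 16 * y ^ 4 = 8 * y ^ 4 + 8 * y ^ 4 by ring, Real.exp_add, ← sq]
    exact pow_le_pow_left₀ (by positivity) (by linarith [Real.add_one_le_exp (8 * y ^ 4)]) 2
  refine ⟨h1.trans (le_mul_of_one_le_right (by positivity) (Real.one_le_exp (by positivity))),
    h2.trans (le_trans (by nlinarith) hexp), ?_⟩
  calc ‖exactOp G x‖ = ‖trotterOp G x K - (trotterOp G x K - exactOp G x)‖ := by
        rw [sub_sub_cancel]
    _ ≤ (1 + 4 * y ^ 4) ^ 2 + 8 * y ^ 4 := (norm_sub_le _ _).trans (by linarith)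
    _ ≤ _ := le_trans (by nlinarith) hexp

lemma isFactor_lcsF {w q : ℕ} {H : Op (Fin n)} (hH : H.IsHermitian) (hw : IsLocal w H)
    (hq : IsSparse q H) {τ : ℝ} (hτ : 0 ≤ τ) {K : ℕ} (hK : 3 ≤ K) {z : ℝ}
    (hz : z = 2 * pauliNorm H * τ) (hz2 : z ≤ 1 / 2) :
    IsFactor (lcsF H τ K) (NormedSpace.exp ((τ : ℂ) • hamDual H)) (16 * z ^ 2) (8 * z ^ K)
      (q * (6 * w + 3) + (24 * (K * w) + 30)) := by
  have hs := suppIn_onSystem hw 1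
  have hG := isHermitian_onSystem hH
  have hy : 2 * pauliNorm (onSystem H : Op (Register n 2)) * τ ≤ z := by
    rw [hz]
    exact mul_le_mul_of_nonneg_right
      (mul_le_mul_of_nonneg_left (pauliNorm_onSystem_le H) zero_le_two) hτ
  have hH0 : 0 ≤ pauliNorm H := Finset.sum_nonneg fun _ _ => norm_nonneg _
  have hz0 : 0 ≤ z := by rw [hz]; positivity
  obtain ⟨h1, h2, h3⟩ := trotter_bounds hG hs hτ hK hy hz2
  have h4 : 16 * z ^ 4 ≤ 16 * z ^ 2 := mul_le_mul_of_nonneg_left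
    (pow_le_pow_of_le_one hz0 (by linarith) (by omega)) (by norm_num)
  rw [← exactOp_onSystem]
  refine IsFactor.mono (b := 16 * z ^ 4) (e := 8 * z ^ (K + 1)) ?_ h4
    (mul_le_mul_of_nonneg_left (pow_le_pow_of_le_one hz0 (by linarith) (by omega)) (by norm_num))
    le_rfl
  refine ⟨⟨_, fun X => dual_lcsF hw hτ hK X, ?_, h1⟩, ?_, ?_, h3, by positivity, ?_⟩
  · rw [mu_lcsF]; exact norm_trotterOp_le hs hτ hK
  · rw [mu_lcsF]; exact (mu_lcsV_bounds hG hτ hK hy hz2).1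
  · rw [mu_lcsF]; exact h2
  · intro t ht
    obtain ⟨f, hf, k, hk, rfl⟩ := LCS.mem_andThen.mp ht
    rw [List.mem_singleton] at hf
    subst hf
    obtain ⟨k1, k2⟩ := mem_lcsV hs hτ hK hk
    refine ⟨by simpa using k1, CircuitBound.append ((circuitBound_trotterCircuit hs).mono ?_) k2⟩
    exact Nat.mul_le_mul_right _ ((card_pauliSupport_onSystem_le H).trans hq)

lemma isFactor_lcsJ {w q : ℕ} {D : Op (Fin n)} (hD : IsLocal w D) (hq : IsSparse q D) {τ : ℝ}
    (hτ : 0 ≤ τ) {K : ℕ} (hK : 2 ≤ K) {z : ℝ} (hz : z = 2 * pauliNorm D ^ 2 * τ)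
    (hz2 : z ≤ 1 / 32) :
    IsFactor (lcsJ D τ K) (exactOp (dilation D) (Real.sqrt τ)) (1024 * z ^ 2) (8 * (8 * z) ^ K)
      (1 + 2 * q * (6 * (w + 1) + 3) + (24 * (2 * K * (w + 1)) + 30)) := by
  have hs := suppIn_dilation hD
  have hG := isHermitian_dilation D
  have hD0 : 0 ≤ pauliNorm D := Finset.sum_nonneg fun _ _ => norm_nonneg _
  have hK' : 3 ≤ 2 * K := by omega
  -- the generator has norm at most twice that of `D`, so twice it times `√τ` is at most `√(8 z)`
  set y : ℝ := 4 * pauliNorm D * Real.sqrt τ with hydef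
  have hy0 : 0 ≤ y := by positivity
  have hysq : y ^ 2 = 8 * z := by
    rw [hydef, mul_pow, Real.sq_sqrt hτ, hz]; ring
  have hy : 2 * pauliNorm (dilation D) * Real.sqrt τ ≤ y :=
    mul_le_mul_of_nonneg_right (by linarith [pauliNorm_dilation_le D]) (Real.sqrt_nonneg _)
  have hy2 : y ≤ 1 / 2 :=
    (pow_le_pow_iff_left₀ hy0 (by norm_num) two_ne_zero).mp (by rw [hysq]; linarith)
  have hx := Real.sqrt_nonneg τ
  obtain ⟨h1, h2, h3⟩ := trotter_bounds hG hs hx hK' hy hy2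
  have h4 : 16 * y ^ 4 = 1024 * z ^ 2 := by
    rw [show y ^ 4 = (y ^ 2) ^ 2 by ring, hysq]; ring
  have h5 : 8 * y ^ (2 * K + 1) ≤ 8 * (8 * z) ^ K := by
    rw [← hysq, ← pow_mul]
    exact mul_le_mul_of_nonneg_left (pow_le_pow_of_le_one hy0 (by linarith) (by omega))
      (by norm_num)
  refine IsFactor.mono (b := 16 * y ^ 4) (e := 8 * y ^ (2 * K + 1)) ?_ h4.le h5 le_rfl
  refine ⟨⟨_, fun X => dual_lcsJ hD τ hK' X, ?_, h1⟩, ?_, ?_, h3, by positivity, ?_⟩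
  · rw [mu_lcsJ]; exact norm_trotterOp_le hs hx hK'
  · rw [mu_lcsJ]; exact (mu_lcsV_bounds hG hx hK' hy hy2).1
  · rw [mu_lcsJ]; exact h2
  · intro t ht
    obtain ⟨f, hf, k, hk, rfl⟩ := LCS.mem_andThen.mp ht
    rw [List.mem_singleton] at hf
    subst hf
    obtain ⟨k1, k2⟩ := mem_lcsV hs hx hK' hk
    refine ⟨by simpa using k1, CircuitBound.append ?_ k2⟩
    refine CircuitBound.append (CircuitBound.reset (dilAnc n))
      ((circuitBound_trotterCircuit hs).mono ?_)
    exact Nat.mul_le_mul_right _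
      ((card_pauliSupport_dilation_le D).trans (Nat.mul_le_mul_left 2 hq))

/-- `𝓝̃` implements the compensation that turns the dilated step into the exact one. -/
lemma isFactor_lcsN {w : ℕ} {D : Op (Fin n)} (hD : IsLocal w D) {τ : ℝ} (hτ : 0 ≤ τ) {K : ℕ}
    (hK : 1 ≤ K) {z : ℝ} (hz : z = 2 * pauliNorm D ^ 2 * τ) (hz2 : z ≤ 1 / 32) :
    ∃ s : HOp n, IsFactor (lcsN D τ K) s (729 * z ^ 2) (2 * (14 * z) ^ K)
        (24 * (K * (2 * w)) + 30) ∧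
      exactOp (dilation D) (Real.sqrt τ) * s = NormedSpace.exp ((τ : ℂ) • dissDual D) := by
  have hy : 27 * pauliNorm D ^ 2 * τ = 27 / 2 * z := by rw [hz]; ring
  have hy0 : 0 ≤ 27 * pauliNorm D ^ 2 * τ := by positivity
  have hz0 : 0 ≤ z := by rw [hz]; positivity
  have hy2 : 27 * pauliNorm D ^ 2 * τ ≤ 1 / 2 := by rw [hy]; linarith
  obtain ⟨s, hs, hE⟩ := seriesN_evalsTo hD hτ hy2 (absSum_dilWord D hτ)
  refine ⟨s, IsFactor.mono (isFactor_toLCS (seriesN_isPauli hD) (seriesN_starts D) hτ hK hy0 hy2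
    (seriesN_bound hτ) hs) ?_ ?_ le_rfl, hE⟩
  · rw [hy]; exact le_of_eq (by ring)
  · rw [hy]
    exact mul_le_mul_of_nonneg_left
      (pow_le_pow_left₀ (by positivity) (by linarith) _) zero_le_two

lemma lindbladNorm_nonneg (H : Op (Fin n)) (D : Fin m → Op (Fin n)) : 0 ≤ lindbladNorm H D :=
  mul_nonneg zero_le_two (add_nonneg (Finset.sum_nonneg fun _ _ => norm_nonneg _)
    (Finset.sum_nonneg fun _ _ => sq_nonneg _))

lemma isFactor_lcsM {w : ℕ} {H : Op (Fin n)} {D : Fin m → Op (Fin n)} (hH : H.IsHermitian)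
    (hw : IsLocal w H) (hD : ∀ l, IsLocal w (D l)) {τ : ℝ} (hτ : 0 ≤ τ) {K : ℕ} (hK : 1 ≤ K)
    {x : ℝ} (hx : x = lindbladNorm H D * τ) (hx0 : 0 ≤ x) (hx2 : x ≤ 1 / 4) :
    IsFactor (lcsM H D τ K) (dissBackward D τ (List.finRange m) *
      NormedSpace.exp ((-τ : ℂ) • hamDual H) * NormedSpace.exp ((τ : ℂ) • lindDual H D))
      (16 * x ^ 2) (2 * (2 * x) ^ K) (24 * (K * (2 * w)) + 30) := by
  have hL := lindbladNorm_nonneg H D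
  have hb : ∀ k, τ ^ k * (seriesM H D k).norm1 ≤ (2 * x) ^ k := fun k => by
    have h1 := seriesM_expBound H D k
    have h2 : (2 * lindbladNorm H D) ^ k / (k ! : ℝ) ≤ (2 * lindbladNorm H D) ^ k :=
      pow_div_factorial_le (mul_nonneg zero_le_two hL) k
    have h3 : (2 * x) ^ k = τ ^ k * (2 * lindbladNorm H D) ^ k := by
      rw [hx, ← mul_pow]; congr 1; ring
    rw [h3]
    exact mul_le_mul_of_nonneg_left (h1.trans h2) (pow_nonneg hτ k)
  have h := isFactor_toLCS (seriesM_isPauli hH hw hD) (seriesM_starts H D) hτ hK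
    (mul_nonneg zero_le_two hx0) (by linarith) hb (seriesM_evalsTo H D τ)
  unfold lcsM
  exact h.mono (le_of_eq (by ring)) le_rfl le_rfl

lemma exp_mul_exp_neg (A : HOp n) (τ : ℝ) :
    NormedSpace.exp ((τ : ℂ) • A) * NormedSpace.exp ((-τ : ℂ) • A) = 1 := by
  rw [neg_smul, ← NormedSpace.exp_add_of_commute (Commute.refl _).neg_right, add_neg_cancel,
    NormedSpace.exp_zero]

lemma prod_exp_mul_dissBackward (D : Fin m → Op (Fin n)) (τ : ℝ) (L : List (Fin m)) :
    (L.map fun l => NormedSpace.exp ((τ : ℂ) • dissDual (D l))).prod * dissBackward D τ L = 1 := by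
  induction L with
  | nil => simp [dissBackward]
  | cons l L ih =>
    have : dissBackward D τ (l :: L)
        = dissBackward D τ L * NormedSpace.exp ((-τ : ℂ) • dissDual (D l)) := by
      simp [dissBackward]
    rw [this, List.map_cons, List.prod_cons,
      show ∀ a b c d : HOp n, a * b * (c * d) = a * (b * c) * d by intros; noncomm_ring,
      ih, mul_one, exp_mul_exp_neg]

/-- One time step implements `e^{𝓛τ}`: the error of every factor is of order `K`, and the logarithm
of its `1`-norm of order `2`, in its share of `x = ‖𝓛‖τ`. -/
lemma isFactor_lcsStep {w q : ℕ} {H : Op (Fin n)} {D : Fin m → Op (Fin n)} (hH : H.IsHermitian)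
    (hw : IsLocal w H) (hD : ∀ l, IsLocal w (D l)) (hq : IsSparse q H)
    (hqD : ∀ l, IsSparse q (D l)) {τ : ℝ} (hτ : 0 ≤ τ) {K : ℕ} (hK : 3 ≤ K)
    {x : ℝ} (hx : x = lindbladNorm H D * τ) (hx2 : x ≤ 1 / 32) :
    IsFactor (lcsStep H D τ K) (NormedSpace.exp ((τ : ℂ) • lindDual H D)) (1800 * x ^ 2)
      (12 * (14 * x) ^ K) ((m + 1) * (200 * ((w + 1) * (q + K + 1)))) := by
  obtain ⟨g, hg⟩ : ∃ g : ℕ, g = 200 * ((w + 1) * (q + K + 1)) := ⟨_, rfl⟩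
  rw [← hg]
  set z₀ : ℝ := 2 * pauliNorm H * τ with hz₀
  set z : Fin m → ℝ := fun l => 2 * pauliNorm (D l) ^ 2 * τ with hz
  have hH0 : 0 ≤ pauliNorm H := Finset.sum_nonneg fun _ _ => norm_nonneg _
  have hz₀0 : 0 ≤ z₀ := by positivity
  have hz0 : ∀ l, 0 ≤ z l := fun l => by simp only [hz]; positivity
  have hsum : z₀ + ∑ l, z l = x := by
    rw [hx, lindbladNorm, hz₀]
    simp only [hz]
    rw [← Finset.sum_mul, ← Finset.mul_sum]
    ring
  have hsum0 : 0 ≤ ∑ l, z l := Finset.sum_nonneg fun l _ => hz0 l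
  have hz₀x : z₀ ≤ x := by linarith
  have hzx : ∀ l, z l ≤ x := fun l =>
    le_trans (Finset.single_le_sum (fun l _ => hz0 l) (Finset.mem_univ l)) (by linarith)
  have hx0 : 0 ≤ x := by linarith
  -- powers of the shares are bounded linearly in the shares, which add up to `x`
  have hsq : ∀ {y : ℝ}, 0 ≤ y → y ≤ x → y ^ 2 ≤ x * y := fun h h' => by
    rw [sq]; exact mul_le_mul_of_nonneg_right h' h
  have hpow : ∀ {y : ℝ}, 0 ≤ y → y ≤ x → y ^ K ≤ x ^ (K - 1) * y := fun {y} h h' => by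
    obtain ⟨k, rfl⟩ : ∃ k, K = k + 1 := ⟨K - 1, by omega⟩
    rw [pow_succ, Nat.add_sub_cancel]
    exact mul_le_mul_of_nonneg_right (pow_le_pow_left₀ h h' k) h
  have hxK : x ^ (K - 1) * x = x ^ K := by rw [← pow_succ]; congr 1; omega
  set c : ℝ := 10 * (14 ^ K * x ^ (K - 1)) with hc
  -- the jump operators in the list `L`, followed by `𝓜̃`
  have hlist : ∀ L : List (Fin m), ∀ E : HOp n, ∀ b e : ℝ, ∀ k : ℕ,
      IsFactor (LCS.concat [lcsM H D τ K]) E b e k →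
      IsFactor (LCS.concat ((L.flatMap fun l => [lcsJ (D l) τ K, lcsN (D l) τ K]) ++
          [lcsM H D τ K]))
        ((L.map fun l => NormedSpace.exp ((τ : ℂ) • dissDual (D l))).prod * E)
        (1753 * x * (L.map z).sum + b) (c * (L.map z).sum + e) (L.length * g + k) := by
    intro L E b e k hM
    induction L with
    | nil => simpa using hM
    | cons l L ih =>
      obtain ⟨s, hN, hs⟩ := isFactor_lcsN (hD l) hτ (K := K) (by omega) (z := z l) rfl
        ((hzx l).trans hx2)
      have hJ := isFactor_lcsJ (hD l) (hqD l) hτ (K := K) (by omega) (z := z l) rfl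
        ((hzx l).trans hx2)
      have h := hJ.concat_cons (hN.concat_cons ih)
      rw [← mul_assoc, hs, ← mul_assoc] at h
      rw [List.map_cons, List.map_cons, List.prod_cons, List.sum_cons, List.length_cons]
      refine IsFactor.mono h ?_ ?_ ?_
      · nlinarith [hsq (hz0 l) (hzx l)]
      · have h1 := hpow (hz0 l) (hzx l)
        have h2 : (8 * z l) ^ K ≤ (14 * z l) ^ K :=
          pow_le_pow_left₀ (mul_nonneg (by norm_num) (hz0 l)) (by linarith [hz0 l]) K
        have h3 : (14 * z l) ^ K ≤ 14 ^ K * (x ^ (K - 1) * z l) := by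
          rw [mul_pow]; exact mul_le_mul_of_nonneg_left h1 (by positivity)
        have h4 : c * z l = 10 * (14 ^ K * (x ^ (K - 1) * z l)) := by rw [hc]; ring
        linarith
      · rw [hg]; nlinarith
  have hM := (isFactor_lcsM hH hw hD hτ (K := K) (by omega) hx hx0 (by linarith)).concat_cons
    IsFactor.nil
  have hF := isFactor_lcsF hH hw hq hτ hK hz₀ (by linarith)
  have h := hF.concat_cons (hlist (List.finRange m) _ _ _ _ hM)
  rw [mul_one, mul_assoc (dissBackward _ _ _), ← mul_assoc (List.prod _),
    prod_exp_mul_dissBackward, one_mul, ← mul_assoc, exp_mul_exp_neg, one_mul, sum_map_finRange,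
    List.length_finRange] at h
  refine IsFactor.mono h ?_ ?_ ?_
  · have h1 := hsq hz₀0 hz₀x
    have h2 : x * z₀ + x * ∑ l, z l = x ^ 2 := by rw [← mul_add, hsum, sq]
    nlinarith [mul_nonneg hx0 hz₀0, mul_nonneg hx0 hsum0]
  · have h1 := hpow hz₀0 hz₀x
    have h2 : c * ∑ l, z l = 10 * (14 ^ K * (x ^ (K - 1) * ∑ l, z l)) := by rw [hc]; ring
    have h3 : (14 * x) ^ K = 14 ^ K * (x ^ (K - 1) * z₀) + 14 ^ K * (x ^ (K - 1) * ∑ l, z l) := by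
      rw [mul_pow, ← hxK, ← hsum]; ring
    have h4 : (2 * x) ^ K ≤ (14 * x) ^ K := pow_le_pow_left₀ (by linarith) (by linarith) K
    have h5 : x ^ (K - 1) * z₀ ≤ 14 ^ K * (x ^ (K - 1) * z₀) :=
      le_mul_of_one_le_left (by positivity) (one_le_pow₀ (by norm_num))
    have h6 : 0 ≤ 14 ^ K * (x ^ (K - 1) * z₀) := by positivity
    linarith
  · rw [hg]; nlinarith

end Factors

/-! ### Statistical error, truncation order and circuit size -/

section Estimate

open MeasureTheory
open scoped Matrix.Norms.L2Operator

variable {n m : ℕ}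

/-- The average of independent rounds of a formula implementing `E`: a bias of at most half the
precision from the truncation, the other half from Hoeffding's inequality. -/
lemma estimate_bound {F : LCS (Register n 2)} {E : HOp n} {b e : ℝ} {g : ℕ}
    (hF : IsFactor F E b e g) {ρ O : Op (Fin n)} (hO : O.IsHermitian) (hρ : IsState ρ)
    {ε δ : ℝ} (hε : 0 < ε) (hδ : 0 < δ) (hδ1 : δ < 1) (hb : Real.exp b ≤ 2)
    (he : e * Real.exp b ≤ ε / 2) {N : ℕ} (hN : 32 * (Real.log (2 / δ) / ε ^ 2) ≤ N) :
    IsProbabilityMeasure (Measure.pi fun _ : Fin N => sampleLaw F ρ hO) ∧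
    1 - δ ≤ (Measure.pi fun _ : Fin N => sampleLaw F ρ hO).real
      {y | ‖(((∑ i, y i) / N : ℝ) : ℂ) - (E O * ρ).trace‖ ≤ ε * opNorm O} := by
  have hμ : 0 < F.mu := zero_lt_one.trans_le hF.one_le
  have h0 : ∀ t ∈ F, 0 ≤ t.1 := fun t ht => (hF.mem t ht).1
  have hprob := sampleLaw_isProbabilityMeasure hO hρ h0 hμ fun t ht => (hF.mem t ht).2.1
  refine ⟨inferInstance, ?_⟩
  have hae := sampleLaw_ae_mem_Icc (ρ := ρ) hO hμ
  obtain ⟨A, hA, -, hAE⟩ := hF.dual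
  rcases (norm_nonneg O).eq_or_lt with hO0 | hO0
  · -- every sample vanishes, and so does the exact expectation
    have hall : ∀ᵐ y ∂(Measure.pi fun _ : Fin N => sampleLaw F ρ hO), y ∈
        {y : Fin N → ℝ | ‖(((∑ i, y i) / N : ℝ) : ℂ) - (E O * ρ).trace‖ ≤ ε * opNorm O} := by
      filter_upwards [pi_ae_forall _ hae] with y hy
      have hy0 : ∀ i, y i = 0 := fun i => by
        have h := hy i
        rw [opNorm_eq_norm, ← hO0, mul_zero, neg_zero, Set.Icc_self] at h
        exact h
      have hE : E O = 0 := by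
        rw [← norm_eq_zero]
        exact le_antisymm ((HOp.norm_apply_le E O).trans (by rw [← hO0, mul_zero])) (norm_nonneg _)
      simp [hy0, hE, opNorm_eq_norm, ← hO0]
    have h1 := measure_mono_ae (μ := Measure.pi fun _ : Fin N => sampleLaw F ρ hO)
      (s := Set.univ) (t := {y : Fin N → ℝ |
        ‖(((∑ i, y i) / N : ℝ) : ℂ) - (E O * ρ).trace‖ ≤ ε * opNorm O})
      (hall.mono fun y hy _ => hy)
    have h2 : (1 : ℝ) ≤ (Measure.pi fun _ : Fin N => sampleLaw F ρ hO).real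
        {y | ‖(((∑ i, y i) / N : ℝ) : ℂ) - (E O * ρ).trace‖ ≤ ε * opNorm O} := by
      rw [← probReal_univ (μ := Measure.pi fun _ : Fin N => sampleLaw F ρ hO)]
      exact ENNReal.toReal_mono (measure_ne_top _ _) h1
    linarith
  · have hlog : 0 < Real.log (2 / δ) := Real.log_pos (by rw [lt_div_iff₀ hδ]; linarith)
    have hN0 : 0 < N := by
      have : (0 : ℝ) < N := lt_of_lt_of_le (by positivity) hN
      exact_mod_cast this
    have hmean := sampleLaw_mean hO hρ h0 hμ
    rw [hA, trace_onSystem_mul_initState] at hmean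
    have hbias : ‖(A O * ρ).trace - (E O * ρ).trace‖ ≤ ε / 2 * ‖O‖ := by
      rw [← Matrix.trace_sub, ← sub_mul, ← HOp.sub_apply]
      exact (norm_trace_mul_state_le hρ _).trans ((HOp.norm_apply_le _ _).trans
        (mul_le_mul_of_nonneg_right (hAE.trans he) (norm_nonneg _)))
    have hμ2 : F.mu ^ 2 ≤ 4 := by nlinarith [hF.mu_le.trans hb]
    have hN' : 32 * Real.log (2 / δ) ≤ N * ε ^ 2 := by
      rw [← mul_div_assoc, div_le_iff₀ (by positivity)] at hN
      exact hN
    have hhoeff : 2 * (F.mu * ‖O‖) ^ 2 * Real.log (2 / δ) ≤ N * (ε / 2 * ‖O‖) ^ 2 := by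
      have h1 : F.mu ^ 2 * (8 * Real.log (2 / δ)) ≤ 4 * (8 * Real.log (2 / δ)) :=
        mul_le_mul_of_nonneg_right hμ2 (by positivity)
      calc 2 * (F.mu * ‖O‖) ^ 2 * Real.log (2 / δ)
          = (F.mu ^ 2 * (8 * Real.log (2 / δ))) * (‖O‖ ^ 2 / 4) := by ring
        _ ≤ (N * ε ^ 2) * (‖O‖ ^ 2 / 4) :=
          mul_le_mul_of_nonneg_right (by linarith) (by positivity)
        _ = _ := by ring
    refine (hoeffding_average (sampleLaw F ρ hO) (b := F.mu * ‖O‖) (t := ε / 2 * ‖O‖)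
      (by positivity) (by positivity) hδ hae hN0 hhoeff).trans (measureReal_mono fun y hy => ?_)
    simp only [Set.mem_ofPred_eq] at hy ⊢
    have hy' : ‖(((∑ i, y i) / N : ℝ) : ℂ) - (A O * ρ).trace‖ ≤ ε / 2 * ‖O‖ := by
      rw [← hmean, ← Complex.ofReal_sub, Complex.norm_real]
      exact hy
    calc _ = ‖((((∑ i, y i) / N : ℝ) : ℂ) - (A O * ρ).trace)
          + ((A O * ρ).trace - (E O * ρ).trace)‖ := by rw [sub_add_sub_cancel]
      _ ≤ ε / 2 * ‖O‖ + ε / 2 * ‖O‖ := (norm_add_le _ _).trans (add_le_add hy' hbias)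
      _ = ε * opNorm O := by rw [opNorm_eq_norm]; ring

/-- The choice of the truncation order: `2^K` absorbs the constants, and `(‖𝓛‖T)^(K-2)` beats
`1/ε` as `K - 2 ≥ log (1/ε) / log (‖𝓛‖T)`. -/
lemma truncation_error_le {M x ε c₁ : ℝ} (hM : 1 < M) (hε : 0 < ε) (hε1 : ε < 1) (hc : 0 < c₁)
    {K S : ℕ} (hx0 : 0 ≤ x) (hx : x ≤ 1 / 3600 / M) (hS : (S : ℝ) ≤ M ^ 2 / c₁)
    (hK : (5 + 48 / c₁) * (1 + Real.log (1 / ε) / Real.log M) ≤ K) :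
    S * (12 * (14 * x) ^ K) * 2 ≤ ε / 2 := by
  have hM0 : 0 < M := by linarith
  have hlogM : 0 < Real.log M := Real.log_pos hM
  have hlogε : 0 ≤ Real.log (1 / ε) :=
    Real.log_nonneg (by rw [le_div_iff₀ hε]; linarith)
  set l := Real.log (1 / ε) / Real.log M with hl
  have hl0 : 0 ≤ l := by positivity
  have hc' : 0 ≤ 48 / c₁ := by positivity
  have hK1 : 2 + l ≤ K := by nlinarith
  have hK2 : 48 / c₁ ≤ K := by nlinarith
  have hKn : 2 ≤ K := by
    have : (2 : ℝ) ≤ K := by linarith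
    exact_mod_cast this
  have hpow2 : 48 / c₁ ≤ 2 ^ K := hK2.trans (by exact_mod_cast Nat.lt_two_pow_self.le)
  have hMK : 1 / ε ≤ M ^ (K - 2) := by
    rw [← Real.log_le_log_iff (by positivity) (by positivity), Real.log_pow,
      Nat.cast_sub hKn]
    calc Real.log (1 / ε) = l * Real.log M := by rw [hl]; field_simp
      _ ≤ _ := mul_le_mul_of_nonneg_right (by push_cast; linarith) hlogM.le
  have hxM : (14 * x) ^ K ≤ (1 / (2 * M)) ^ K := by
    refine pow_le_pow_left₀ (by positivity) ?_ K
    have : 14 * (1 / 3600 / M) ≤ 1 / (2 * M) := by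
      rw [div_div, mul_one_div, div_le_div_iff₀ (by positivity) (by positivity)]
      linarith
    linarith
  have hMsplit : M ^ K = M ^ 2 * M ^ (K - 2) := by rw [← pow_add]; congr 1; omega
  have hden : 48 / c₁ * (1 / ε) ≤ 2 ^ K * M ^ (K - 2) :=
    mul_le_mul hpow2 hMK (by positivity) (by positivity)
  calc S * (12 * (14 * x) ^ K) * 2 ≤ M ^ 2 / c₁ * (12 * (1 / (2 * M)) ^ K) * 2 := by gcongr
    _ = 24 / c₁ / (2 ^ K * M ^ (K - 2)) := by
      rw [one_div, inv_pow, mul_pow, hMsplit]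
      field_simp
      norm_num
    _ ≤ 24 / c₁ / (48 / c₁ * (1 / ε)) := by gcongr
    _ = ε / 2 := by field_simp; norm_num

lemma pauliNorm_eq_zero_of_isSparse_zero {A : Op (Fin n)} (h : IsSparse 0 A) :
    pauliNorm A = 0 := by
  refine Finset.sum_eq_zero fun γ _ => ?_
  by_contra hγ
  have h1 : γ ∈ pauliSupport A := by
    simpa [pauliSupport] using fun h' : pauliCoeff A γ = 0 => hγ (by rw [h', norm_zero])
  have h2 : pauliSupport A = ∅ := Finset.card_eq_zero.mp (Nat.le_zero.mp h)
  rw [h2] at h1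
  simp at h1

lemma one_le_sparsity {q : ℕ} {H : Op (Fin n)} {D : Fin m → Op (Fin n)} (hH : IsSparse q H)
    (hD : ∀ l, IsSparse q (D l)) (h : lindbladNorm H D ≠ 0) : 1 ≤ q := by
  by_contra hq
  obtain rfl : q = 0 := by omega
  refine h ?_
  simp [lindbladNorm, pauliNorm_eq_zero_of_isSparse_zero hH,
    fun l => pauliNorm_eq_zero_of_isSparse_zero (hD l)]

/-- The size of all circuits of a round. -/
lemma total_cost_le {M l B₂ c₁ : ℝ} (hl : 0 ≤ l) (hc : 0 < c₁) {S m q K w : ℕ} (hm : 1 ≤ m)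
    (hq : 1 ≤ q) (hS : (S : ℝ) ≤ M ^ 2 / c₁) (hK : (K : ℝ) ≤ B₂ * (1 + l)) :
    ((S * ((m + 1) * (200 * ((w + 1) * (q + K + 1)))) : ℕ) : ℝ)
      ≤ 400 * (w + 1) * (|B₂| + 2) / c₁ * (m * M ^ 2 * (q + l)) := by
  have hm' : (1 : ℝ) ≤ m := by exact_mod_cast hm
  have hq' : (1 : ℝ) ≤ q := by exact_mod_cast hq
  have h1 : (q + K + 1 : ℝ) ≤ (|B₂| + 2) * (q + l) := by
    have h2 : B₂ * (1 + l) ≤ |B₂| * (q + l) :=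
      mul_le_mul (le_abs_self _) (by linarith) (by linarith) (abs_nonneg _)
    linarith
  have h3 : (m + 1 : ℝ) ≤ 2 * m := by linarith
  push_cast
  calc (S : ℝ) * ((m + 1) * (200 * ((w + 1) * (q + K + 1))))
      ≤ M ^ 2 / c₁ * (2 * m * (200 * ((w + 1) * ((|B₂| + 2) * (q + l))))) := by gcongr
    _ = _ := by ring

end Estimate

end LindbladSim

end

open LindbladSim
theorem mainTheorem1 :
    ∃ c₂ A : ℝ, 0 < c₂ ∧ 0 < A ∧ ∀ c₁ : ℝ, 0 < c₁ → c₁ ≤ c₂ →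
    ∃ B₁ : ℝ, 0 < B₁ ∧ ∀ (B₂ : ℝ) (w : ℕ), ∃ C : ℝ, 0 < C ∧
    ∀ (n m q : ℕ) (H : Op (Fin n)) (D : Fin m → Op (Fin n)) (ρ₀ O : Op (Fin n))
      (hO : O.IsHermitian) (T τ ε δ : ℝ) (K S N : ℕ),
      1 ≤ m → H.IsHermitian → IsSparse q H → (∀ l, IsSparse q (D l)) →
      IsLocal w H → (∀ l, IsLocal w (D l)) → IsState ρ₀ →
      0 < T → 1 < lindbladNorm H D * T → 0 < ε → ε < 1 → 0 < δ → δ < 1 →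
      c₁ / (lindbladNorm H D ^ 2 * T) ≤ τ → τ ≤ c₂ / (lindbladNorm H D ^ 2 * T) →
      T = S * τ →
      B₁ * (1 + Real.log (1 / ε) / Real.log (lindbladNorm H D * T)) ≤ K →
      A * (Real.log (2 / δ) / ε ^ 2) ≤ N →
      MeasureTheory.IsProbabilityMeasure (roundsLaw H D ρ₀ hO τ K S N) ∧
      1 - δ ≤ (roundsLaw H D ρ₀ hO τ K S N).real
        {y | ‖(((∑ i, y i) / N : ℝ) : ℂ)
            - (evolve (lindbladian H D) T ρ₀ * O).trace‖ ≤ ε * opNorm O} ∧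
      ((K : ℝ) ≤ B₂ * (1 + Real.log (1 / ε) / Real.log (lindbladNorm H D * T)) →
        ∀ t ∈ lcsRound H D τ K S, ∃ g : ℕ, circuitCost t.2 = g ∧
          (g : ℝ) ≤ C * (m * lindbladNorm H D ^ 2 * T ^ 2 *
            (q + Real.log (1 / ε) / Real.log (lindbladNorm H D * T)))) := by
  -- `c₂` keeps the logarithm of the total `1`-norm, at most `1800 c₂`, below `1/2`
  refine ⟨1 / 3600, 32, by norm_num, by norm_num, fun c₁ hc₁ _ => ⟨5 + 48 / c₁, by positivity,
    fun B₂ w => ⟨400 * (w + 1) * (|B₂| + 2) / c₁, by positivity, ?_⟩⟩⟩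
  intro n m q H D ρ₀ O hO T τ ε δ K S N hm hH hqH hqD hwH hwD hρ hT hM hε hε1 hδ hδ1 hτ1 hτ2
    hTS hK hN
  have hLT := hM
  set Λ := lindbladNorm H D with hΛ
  set M := Λ * T with hMdef
  have hM0 : 0 < M := by linarith
  have hΛ0 : 0 < Λ := pos_of_mul_pos_left hM0 hT.le
  have hτ0 : 0 < τ := lt_of_lt_of_le (by positivity) hτ1
  have hlogM : 0 < Real.log M := Real.log_pos hM
  have hl0 : 0 ≤ Real.log (1 / ε) / Real.log M :=
    div_nonneg (Real.log_nonneg (by rw [le_div_iff₀ hε]; linarith)) hlogM.le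
  -- in the dimensionless step length `x = ‖𝓛‖τ` the hypotheses read `c₁ / M ≤ x ≤ c₂ / M`
  set x := Λ * τ with hx
  have hx0 : 0 < x := mul_pos hΛ0 hτ0
  have hSx : S * x = M := by rw [hx, hMdef, hTS]; ring
  have hxM1 : c₁ / M ≤ x := by
    have := mul_le_mul_of_nonneg_left hτ1 hΛ0.le
    refine le_trans (le_of_eq ?_) this
    rw [hMdef]; field_simp
  have hxM2 : x ≤ 1 / 3600 / M := by
    have := mul_le_mul_of_nonneg_left hτ2 hΛ0.le
    refine le_trans this (le_of_eq ?_)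
    rw [hMdef]; field_simp
  have hxle : x ≤ 1 / 3600 := hxM2.trans (div_le_self (by norm_num) hM.le)
  have hS : (S : ℝ) ≤ M ^ 2 / c₁ := by
    rw [le_div_iff₀ hc₁]
    rw [div_le_iff₀ hM0] at hxM1
    calc (S : ℝ) * c₁ ≤ S * (x * M) := mul_le_mul_of_nonneg_left hxM1 (Nat.cast_nonneg S)
      _ = M ^ 2 := by rw [← mul_assoc, hSx, sq]
  have hK3 : 3 ≤ K := by
    have h1 : 0 ≤ 48 / c₁ := by positivity
    have h2 : (3 : ℝ) ≤ K := by nlinarith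
    exact_mod_cast h2
  have hstep := isFactor_lcsStep hH hwH hwD hqH hqD hτ0.le hK3 hx (by linarith)
  have hround := hstep.concat_replicate S
  have hE : NormedSpace.exp ((τ : ℂ) • lindDual H D) ^ S
      = NormedSpace.exp ((T : ℂ) • lindDual H D) := by
    rw [← NormedSpace.exp_nsmul, ← Nat.cast_smul_eq_nsmul ℂ, smul_smul, hTS]
    push_cast
    rfl
  rw [hE] at hround
  have hb : S * (1800 * x ^ 2) ≤ 1 / 2 := by
    rw [le_div_iff₀ hM0] at hxM2
    calc S * (1800 * x ^ 2) = 1800 * ((S * x) * x) := by ring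
      _ ≤ 1 / 2 := by rw [hSx]; linarith
  have hexp : Real.exp (S * (1800 * x ^ 2)) ≤ 2 := by
    have h1 : Real.exp (1 / 2) ^ 2 = Real.exp 1 := by rw [← Real.exp_nat_mul]; norm_num
    have h2 := Real.exp_one_lt_three
    have h3 := Real.exp_le_exp.mpr hb
    nlinarith [Real.exp_pos (1 / 2 : ℝ)]
  have herr := truncation_error_le hM hε hε1 hc₁ hx0.le hxM2 hS hK
  have hest := estimate_bound hround hO hρ hε hδ hδ1 hexp
    ((mul_le_mul_of_nonneg_left hexp (by positivity)).trans herr) hN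
  rw [← trace_evolve_mul] at hest
  refine ⟨hest.1, hest.2, fun hK2 t ht => ?_⟩
  obtain ⟨g, hg, hgle⟩ := ENat.le_natCast_iff.mp (hround.mem t ht).2.2
  refine ⟨g, hg, ?_⟩
  have hcost := total_cost_le (w := w) hl0 hc₁ hm (one_le_sparsity hqH hqD hΛ0.ne') hS hK2
  refine le_trans (by exact_mod_cast hgle) (hcost.trans (le_of_eq ?_))
  rw [hMdef]; ring
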